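/- Let $\mathbb K$ be a field of characteristic zero. **Graphs.** For $n\ge 1$ consider directed graphs with $n$ external vertices labelled $1,\dots,n$, finitely many unlabelled internal vertices, a linear order on the edges, no double edges (edges $a\to b$ and $b\to a$ may both occur) and no simple loops, such that every internal vertex has at most one incoming and at most two outgoing edges and is connected to an external vertex by an undirected path. Let $\mathsf{dgr}(n)$ be the span of such graphs modulo $\Gamma^\sigma=(-1)^{|\sigma|}\Gamma$ for permutations $\sigma$ of the edge order, with $|\Gamma|=2\#\{\text{internal vertices}\}-\#\{\text{edges}\}$. Let $\mathsf{dgraphs}(n)$ be its quotient by the generalized IHX relations: for every graph in which all internal vertices are as above, except that one of them, $v$, may have up to three outgoing edges, the sum over all admissible graphs obtained by replacing $v$ by two vertices joined by a directed edge, placed last in the order, and reconnecting the edges formerly at $v$ to its endpoints is zero. Here $\mathsf{dgraphs}(n)$ is completed, i.e. it consists of the series whose part with $m$ internal vertices is a finite linear combination for every $m$. Let $\Gamma_1\circ_i\Gamma_2$ be the insertion of $\Gamma_2$ at the $i$-th external vertex of $\Gamma_1$, summed over all ways of reconnecting loose edges that give admissible graphs, the edges of $\Gamma_1$ before those of $\Gamma_2$.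 The space $\mathfrak g=\mathfrak g_{\mathsf{As},\mathsf{dgraphs}}=\prod_{n\ge1}\mathsf{dgraphs}(n)$, in which a graph in $\mathsf{dgraphs}(n)$ has degree $|\Gamma|+n-1$, carries the pre-Lie product $$\Gamma_1\star\Gamma_2=\sum_{i=1}^n(-1)^{|\Gamma_2|(1-n)+(i+1)(m-1)}\,\Gamma_1\circ_i\Gamma_2\qquad(\Gamma_1\in\mathsf{dgraphs}(n),\ \Gamma_2\in\mathsf{dgraphs}(m)).$$ Its Maurer–Cartan elements are the $\alpha$ of degree one with $\alpha\star\alpha=0$; they form the set $\mathsf{MC}(\mathfrak g)$. **Gauge equivalence.** Write $\mathfrak g^0=\mathbb K\cdot u\oplus\mathfrak g^0_+$, where $u\in\mathsf{dgraphs}(1)$ is the graph without edges and internal vertices (the operadic unit) and $\mathfrak g^0_+$ is the pro-nilpotent ideal of elements without $u$-component. The gauge group is $\mathbb K^\times\ltimes\exp(\mathfrak g^0_+)$, where $\xi\in\mathfrak g^0_+$ acts by $e^{\mathrm{ad}_\xi}$ and $c\in\mathbb K^\times$ multiplies $\mathsf{dgraphs}(n)$ by $c^{1-n}$. **Representation.**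 For a finite-dimensional Lie algebra $L$ with basis $x_1,\dots,x_d$ and structure constants $c_{ij}^k$ put $A_L=SL\otimes\bigwedge L^*=\mathbb K[x_1,\dots,x_d,p^1,\dots,p^d]$ (with $|x_i|=0$, $|p^i|=1$), $\pi=\sum c_{ij}^kx_kp^ip^j$ and $\tau=\sum_l\partial_{p^l}\otimes\partial_{x_l}$. For a graph $\Gamma$ with $m$ internal vertices and ordered edges $e_1<\dots<e_r$ let $$B_\Gamma(f_1\otimes\dots\otimes f_n)=\mu\big(\tau_{e_1}\tau_{e_2}\cdots\tau_{e_r}(\pi^{\otimes m}\otimes f_1\otimes\dots\otimes f_n)\big),$$ where $\tau_e$ acts on the tensor factors of the source and the target of $e$ and $\mu$ is the iterated product. For an infinite series in $\mathsf{dgraphs}(n)$ the sum is locally finite. A family of maps $f_L:A_L^{\otimes n}\to A_L$, one for each finite-dimensional $L$ with a basis, is *universal* if there is one $\Gamma\in\mathsf{dgraphs}(n)$ with $f_L=B_\Gamma$ for all $L$. A universal $A_\infty$-structure is a family, over all $L$, of $A_\infty$-structures on $A_L$ whose components are universal; a universal $A_\infty$-isomorphism between two of them is a family of $A_\infty$-morphisms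 $f=(f_n)_{n\ge1}$ whose components are universal and such that $f_1$ is bijective for every $L$. **Statement.** $B$ is well defined on $\mathsf{dgraphs}$, and $\alpha\mapsto B\circ\alpha$ respects the pre-Lie products of $\mathfrak g$ and of the convolution Lie algebras $\mathfrak g_{\mathsf{As},A_L}$ (where $f\star g=\sum_{i}(-1)^{|g|(1-n)+(i+1)(m-1)}f\circ_ig$ for $f,g$ of arities $n,m$). It maps Maurer–Cartan elements to universal $A_\infty$-structures and induces a bijection $$\mathsf{MC}(\mathfrak g)/\big(\mathbb K^\times\ltimes\exp(\mathfrak g^0_+)\big)\;\cong\;\{\text{universal }A_\infty\text{-structures}\}/\{\text{universal }A_\infty\text{-isomorphisms}\},$$ and likewise a bijection $$\mathsf{MC}(\mathfrak g)/\exp(\mathfrak g^0_+)\;\cong\;\{\text{universal }A_\infty\text{-structures}\}/\{\text{universal }A_\infty\text{-isomorphisms with }f_1(1)=1\}.$$ In particular all four relations are equivalence relations. -/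

import Mathlib

universe u

open scoped TensorProduct

noncomputable section

namespace DGraphs

section Graphs

/-- The vertices of a graph with `n + 1` external vertices (labelled by `Fin (n + 1)`) and `m`
internal ones. -/
abbrev Vert (n m : ℕ) : Type := Fin (n + 1) ⊕ Fin m

/-- The possible directed edges `(source, target)` on a vertex set, without simple loops. -/
abbrev Edge (V : Type) : Type := {p : V × V // p.1 ≠ p.2}

/-- The space spanned by directed graphs without double edges and simple loops on the vertex
set `V`, with a linear order of the edges, modulo `Γ^σ = (-1)^|σ| Γ`: the exterior algebra on the
set of possible edges. -/
abbrev Gra (K : Type u) [Field K] (V : Type) : Type u := ExteriorAlgebra K (Edge V → K)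

/-- The graph whose only edge is `e`. -/
def arrow (K : Type u) [Field K] {V : Type} [DecidableEq V] (e : Edge V) : Gra K V :=
  ExteriorAlgebra.ι K (Pi.single e 1)

/-- The graph with edges `l`, in this order. -/
def graph (K : Type u) [Field K] {V : Type} [DecidableEq V] (l : List (Edge V)) : Gra K V :=
  (l.map (arrow K)).prod

/-- The linear map underlying `pull`. -/
def pullEdge (K : Type u) [Field K] {V V' : Type} [DecidableEq V] (c : V' → Option V) :
    (Edge V → K) →ₗ[K] (Edge V' → K) where
  toFun f q :=
    match c q.1.1, c q.1.2 with
    | some a, some b => if h : a ≠ b then f ⟨(a, b), h⟩ else 0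
    | _, _ => 0
  map_add' f g := by
    funext q
    simp only [Pi.add_apply]
    split
    · split <;> simp
    · simp
  map_smul' r f := by
    funext q
    simp only [Pi.smul_apply, smul_eq_mul, RingHom.id_apply]
    split
    · split <;> simp
    · simp

/-- Replacing vertices. Here `c` is a partial map, and the vertex `a` is replaced by the vertices
`a'` with `c a' = some a`: every edge `a ⟶ b` becomes the sum of all edges `a' ⟶ b'` with
`c a' = some a` and `c b' = some b`, so that a graph becomes the sum over all ways of reconnecting
its edges; the order of the edges is kept. -/
def pull (K : Type u) [Field K] {V V' : Type} [DecidableEq V] (c : V' → Option V) :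
    Gra K V →ₐ[K] Gra K V' :=
  ExteriorAlgebra.map (pullEdge K c)

/-- Multiplication of a graph with `e` edges by `(-1) ^ (k * e)`. -/
def twist (K : Type u) [Field K] {V : Type} (k : ℕ) : Gra K V →ₐ[K] Gra K V :=
  ExteriorAlgebra.map ((-1 : K) ^ k • LinearMap.id)

/-- The relabelling of the internal vertices by `σ`. -/
def relabel {n m : ℕ} (σ : Equiv.Perm (Fin m)) (u : Vert n m) : Option (Vert n m) :=
  some (Sum.map id σ u)

/-- Contraction of the internal vertex `w` to `v`: replacing vertices along this map splits `v`
into `v` and `w`. -/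
def contract {n m : ℕ} (v w : Fin m) (u : Vert n m) : Option (Vert n m) :=
  some (if u = Sum.inr w then Sum.inr v else u)

/-- The elements that are set to zero: graphs with two edges into, or three edges out of, an
internal vertex; the difference of two graphs that differ by a relabelling of the internal
vertices; the generalized IHX relations. In the last case `a` stands for a graph on the vertices
other than `w` (edges adjacent to `w` are sent to zero by `pull K (contract v w)`), the internal
vertex `v` is split into `v` and `w`, the edges formerly adjacent to `v` are reconnected
in all ways, and the new edge `v ⟶ w` is placed last. -/
inductive Relator (K : Type u) [Field K] (n m : ℕ) : Gra K (Vert n m) → Prop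
  | twoIn (v : Fin m) (e e' : Edge (Vert n m)) (a b : Gra K (Vert n m))
      (h : e.1.2 = Sum.inr v) (h' : e'.1.2 = Sum.inr v) :
      Relator K n m (a * arrow K e * arrow K e' * b)
  | threeOut (v : Fin m) (e e' e'' : Edge (Vert n m)) (a b : Gra K (Vert n m))
      (h : e.1.1 = Sum.inr v) (h' : e'.1.1 = Sum.inr v) (h'' : e''.1.1 = Sum.inr v) :
      Relator K n m (a * arrow K e * arrow K e' * arrow K e'' * b)
  | symm (σ : Equiv.Perm (Fin m)) (a : Gra K (Vert n m)) :
      Relator K n m (pull K (relabel σ) a - a)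
  | ihx (v w : Fin m) (h : (Sum.inr v : Vert n m) ≠ Sum.inr w) (a : Gra K (Vert n m)) :
      Relator K n m (pull K (contract v w) a * arrow K ⟨(Sum.inr v, Sum.inr w), h⟩)

/-- The span of the elements that are set to zero. -/
def relations (K : Type u) [Field K] (n m : ℕ) : Submodule K (Gra K (Vert n m)) :=
  Submodule.span K {a | Relator K n m a}

/-- Graphs with `n + 1` external and `m` internal vertices modulo the relations. -/
abbrev QGra (K : Type u) [Field K] (n m : ℕ) : Type u :=
  Gra K (Vert n m) ⧸ relations K n m

/-- The class of a graph. -/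
abbrev cls (K : Type u) [Field K] (n m : ℕ) : Gra K (Vert n m) →ₗ[K] QGra K n m :=
  (relations K n m).mkQ

/-- `l` lists, in their linear order, the edges of an admissible directed graph. -/
structure IsAdmissible {n m : ℕ} (l : List (Edge (Vert n m))) : Prop where
  nodup : l.Nodup
  trivalent : ∀ v : Fin m,
    l.countP (fun e => decide (e.1.1 = Sum.inr v ∨ e.1.2 = Sum.inr v)) ≤ 3
  incoming : ∀ v : Fin m, l.countP (fun e => decide (e.1.2 = Sum.inr v)) ≤ 1
  outgoing : ∀ v : Fin m, l.countP (fun e => decide (e.1.1 = Sum.inr v)) ≤ 2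
  connected : ∀ v : Fin m, ∃ i : Fin (n + 1),
    Relation.EqvGen (fun a b => ∃ e ∈ l, e.1.1 = a ∧ e.1.2 = b) (Sum.inr v) (Sum.inl i)

/-- The part of `dgr(n + 1)` with `m` internal vertices. -/
def dgr (K : Type u) [Field K] (n m : ℕ) : Submodule K (Gra K (Vert n m)) :=
  Submodule.span K {a | ∃ l : List (Edge (Vert n m)), IsAdmissible l ∧ a = graph K l}

/-- The part of `dgraphs(n + 1)` with `m` internal vertices. -/
def dgraphs (K : Type u) [Field K] (n m : ℕ) : Submodule K (QGra K n m) :=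
  (dgr K n m).map (cls K n m)

/-- The part of `dgraphs(n + 1)` with `m` internal vertices that has degree `q` in the convolution
Lie algebra: the degree there is `|Γ| + n`, where `|Γ| = 2 m - #edges`. -/
def dgraphsDeg (K : Type u) [Field K] (q : ℤ) (n m : ℕ) : Submodule K (QGra K n m) :=
  Submodule.span K {x | ∃ l : List (Edge (Vert n m)), IsAdmissible l ∧
    2 * (m : ℤ) - l.length + n = q ∧ x = cls K n m (graph K l)}

end Graphs

section Insertion

variable {n₁ n₂ m₁ m₂ N M : ℕ}

/-- In the graph with an external vertex `j` of `Γ₁` replaced by `Γ₂`, contract `Γ₂` to `j`. -/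
def collapse (hN : n₁ + n₂ = N) (_hM : m₁ + m₂ = M) (j : Fin (n₁ + 1)) :
    Vert N M → Option (Vert n₁ m₁)
  | Sum.inl k =>
      if h : k.1 < j.1 then some (Sum.inl ⟨k.1, by omega⟩)
      else if h' : k.1 ≤ j.1 + n₂ then some (Sum.inl j)
      else some (Sum.inl ⟨k.1 - n₂, by omega⟩)
  | Sum.inr k =>
      if h : k.1 < m₁ then some (Sum.inr ⟨k.1, h⟩) else some (Sum.inl j)

/-- In the graph with an external vertex `j` of `Γ₁` replaced by `Γ₂`, the vertices of `Γ₂`. -/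
def restrict (_hN : n₁ + n₂ = N) (hM : m₁ + m₂ = M) (j : Fin (n₁ + 1)) :
    Vert N M → Option (Vert n₂ m₂)
  | Sum.inl k =>
      if h : j.1 ≤ k.1 ∧ k.1 ≤ j.1 + n₂ then some (Sum.inl ⟨k.1 - j.1, by omega⟩) else none
  | Sum.inr k =>
      if h : m₁ ≤ k.1 then some (Sum.inr ⟨k.1 - m₁, by omega⟩) else none

/-- The operadic composition `Γ₁ ∘ⱼ Γ₂`: replace `j` by `Γ₂`, reconnect the loose edges to vertices of
`Γ₂` in all ways, and put the edges of `Γ₁` before those of `Γ₂`. -/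
def compose (K : Type u) [Field K] (hN : n₁ + n₂ = N) (hM : m₁ + m₂ = M) (j : Fin (n₁ + 1)) :
    Gra K (Vert n₁ m₁) →ₗ[K] Gra K (Vert n₂ m₂) →ₗ[K] Gra K (Vert N M) :=
  (LinearMap.mul K (Gra K (Vert N M))).compl₁₂
    (pull K (collapse hN hM j)).toLinearMap (pull K (restrict hN hM j)).toLinearMap


theorem pull_pull (K : Type u) [Field K] {V V' V'' : Type} [DecidableEq V] [DecidableEq V']
    (c : V'' → Option V') (c' : V' → Option V) (a : Gra K V) :
    pull K c (pull K c' a) = pull K (fun x => (c x).bind c') a := by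
  have h : pullEdge K c ∘ₗ pullEdge K c' = pullEdge K (fun x => (c x).bind c') := by
    apply LinearMap.ext
    intro f
    funext q
    simp only [pullEdge, LinearMap.comp_apply, LinearMap.coe_mk, AddHom.coe_mk]
    cases h1 : c q.1.1 with
    | none => simp
    | some x =>
      cases h2 : c q.1.2 with
      | none => cases h3 : c' x <;> simp [h3]
      | some y =>
        by_cases hxy : x = y
        · subst hxy
          cases h3 : c' x <;> simp [h3]
        · cases h3 : c' x <;> cases h4 : c' y <;> simp [h3, h4, hxy]
  unfold pull
  rw [← AlgHom.comp_apply, ExteriorAlgebra.map_comp_map, h]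

theorem pull_congr (K : Type u) [Field K] {V V' : Type} [DecidableEq V]
    {c c' : V' → Option V} (h : ∀ x, c x = c' x) (a : Gra K V) : pull K c a = pull K c' a := by
  rw [funext h]

theorem pull_arrow (K : Type u) [Field K] {V V' : Type} [DecidableEq V] [DecidableEq V']
    [Fintype V'] (c : V' → Option V) (e : Edge V) :
    pull K c (arrow K e) = ∑ q : {q : Edge V' // c q.1.1 = some e.1.1 ∧ c q.1.2 = some e.1.2},
      arrow K q.1 := by
  unfold pull arrow
  rw [ExteriorAlgebra.map_apply_ι, ← map_sum]
  congr 1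
  funext q
  rw [Finset.sum_apply]
  have : ∀ f : Edge V' → K,
      ∑ q : {q : Edge V' // c q.1.1 = some e.1.1 ∧ c q.1.2 = some e.1.2}, f q.1
        = ∑ q : Edge V', if c q.1.1 = some e.1.1 ∧ c q.1.2 = some e.1.2 then f q else 0 := by
    intro f
    rw [← Finset.sum_filter]
    exact (Finset.sum_subtype _ (by simp) f).symm
  rw [this (fun x => (Pi.single x (1 : K) : Edge V' → K) q)]
  rw [Finset.sum_eq_single q]
  · simp only [pullEdge, LinearMap.coe_mk, AddHom.coe_mk, Pi.single_eq_same]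
    cases h1 : c q.1.1 with
    | none => simp
    | some x =>
      cases h2 : c q.1.2 with
      | none => simp
      | some y =>
        by_cases hxy : x = y
        · subst hxy
          have := e.2
          simp only [ne_eq, not_true_eq_false, dite_false, Option.some.injEq]
          rw [if_neg]
          rintro ⟨h3, h4⟩
          exact this (h3.symm.trans h4)
        · simp only [ne_eq, hxy, not_false_eq_true, dite_true, Option.some.injEq]
          rw [Pi.single_apply]
          congr 1
          rw [Subtype.ext_iff, Prod.ext_iff]
  · intro b _ hb
    simp [hb.symm]
  · simp

theorem twist_pull (K : Type u) [Field K] {V V' : Type} [DecidableEq V] (k : ℕ)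
    (c : V' → Option V) (a : Gra K V) : twist K k (pull K c a) = pull K c (twist K k a) := by
  unfold twist pull
  rw [← AlgHom.comp_apply, ← AlgHom.comp_apply, ExteriorAlgebra.map_comp_map,
    ExteriorAlgebra.map_comp_map]
  congr 2
  apply LinearMap.ext
  intro f
  simp

theorem twist_arrow (K : Type u) [Field K] {V : Type} [DecidableEq V] (k : ℕ) (e : Edge V) :
    twist K k (arrow K e) = (-1 : K) ^ k • arrow K e := by
  unfold twist arrow
  rw [ExteriorAlgebra.map_apply_ι]
  simp

theorem arrow_mul (K : Type u) [Field K] {V : Type} [DecidableEq V] (e : Edge V) (a : Gra K V) :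
    arrow K e * a = twist K 1 a * arrow K e := by
  induction a using ExteriorAlgebra.induction with
  | algebraMap r => rw [AlgHom.commutes, Algebra.commutes]
  | ι x =>
    unfold twist arrow
    rw [ExteriorAlgebra.map_apply_ι]
    have := ExteriorAlgebra.ι_add_mul_swap (R := K) (Pi.single e (1 : K)) x
    rw [eq_neg_of_add_eq_zero_left this]
    simp
  | mul a b ha hb =>
    rw [map_mul, ← mul_assoc, ha, mul_assoc, hb, mul_assoc]
  | add a b ha hb => rw [map_add, mul_add, add_mul, ha, hb]

theorem twist_mem (K : Type u) [Field K] {n m : ℕ} (k : ℕ) {a : Gra K (Vert n m)}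
    (ha : a ∈ relations K n m) : twist K k a ∈ relations K n m := by
  induction ha using Submodule.span_induction with
  | mem x hx =>
    cases hx with
    | twoIn v e e' a b h h' =>
      simp only [map_mul, twist_arrow, mul_smul_comm, smul_mul_assoc]
      exact Submodule.smul_mem _ _ (Submodule.smul_mem _ _
        (Submodule.subset_span (Relator.twoIn v e e' _ _ h h')))
    | threeOut v e e' e'' a b h h' h'' =>
      simp only [map_mul, twist_arrow, mul_smul_comm, smul_mul_assoc]
      exact Submodule.smul_mem _ _ (Submodule.smul_mem _ _ (Submodule.smul_mem _ _
        (Submodule.subset_span (Relator.threeOut v e e' e'' _ _ h h' h''))))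
    | symm σ a =>
      rw [map_sub, twist_pull]
      exact Submodule.subset_span (Relator.symm σ _)
    | ihx v w h a =>
      rw [map_mul, twist_pull, twist_arrow, mul_smul_comm]
      exact Submodule.smul_mem _ _ (Submodule.subset_span (Relator.ihx v w h _))
  | zero => rw [map_zero]; exact zero_mem _
  | add x y _ _ hx hy => rw [map_add]; exact add_mem hx hy
  | smul r x _ hx => rw [map_smul]; exact Submodule.smul_mem _ _ hx

theorem compose_left_mem (K : Type u) [Field K] (hN : n₁ + n₂ = N) (hM : m₁ + m₂ = M)
    (j : Fin (n₁ + 1)) {a : Gra K (Vert n₁ m₁)} (ha : a ∈ relations K n₁ m₁)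
    (b : Gra K (Vert n₂ m₂)) : compose K hN hM j a b ∈ relations K N M := by
  let up : Fin m₁ ↪ Fin M := Fin.castLEEmb (by omega)
  have hup : ∀ (v : Fin m₁) (x : Vert N M),
      collapse hN hM j x = some (Sum.inr v) ↔ x = Sum.inr (up v) := by
    intro v x
    rcases x with k | k
    · simp only [collapse]
      split_ifs <;> simp
    · simp only [collapse]
      split_ifs with h
      · simp only [Option.some.injEq, Sum.inr.injEq, Fin.ext_iff, up]
        rfl
      · simp only [Option.some.injEq, reduceCtorEq, Sum.inr.injEq, false_iff]
        rintro rfl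
        exact h (by simp [up])
  have hres : ∀ v : Fin m₁, restrict hN hM j (Sum.inr (up v)) = none := by
    intro v
    simp [restrict, up]
  change pull K (collapse hN hM j) a * pull K (restrict hN hM j) b ∈ relations K N M
  induction ha using Submodule.span_induction with
  | mem x hx =>
    cases hx with
    | twoIn v e e' a a' h h' =>
      simp only [map_mul, pull_arrow, Finset.mul_sum, Finset.sum_mul]
      refine Submodule.sum_mem _ fun p _ => Submodule.sum_mem _ fun q _ => ?_
      rw [mul_assoc]
      refine Submodule.subset_span (Relator.twoIn (up v) _ _ _ _ ?_ ?_)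
      all_goals rw [← hup]
      · exact h ▸ q.2.2
      · exact h' ▸ p.2.2
    | threeOut v e e' e'' a a' h h' h'' =>
      simp only [map_mul, pull_arrow, Finset.mul_sum, Finset.sum_mul]
      refine Submodule.sum_mem _ fun p _ => Submodule.sum_mem _ fun q _ =>
        Submodule.sum_mem _ fun r _ => ?_
      rw [mul_assoc]
      refine Submodule.subset_span (Relator.threeOut (up v) _ _ _ _ _ ?_ ?_ ?_)
      all_goals rw [← hup]
      · exact h ▸ r.2.1
      · exact h' ▸ q.2.1
      · exact h'' ▸ p.2.1
    | symm σ a =>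
      let σ' : Equiv.Perm (Fin M) := σ.viaFintypeEmbedding up
      have h1 : pull K (collapse hN hM j) (pull K (relabel σ) a)
          = pull K (relabel σ') (pull K (collapse hN hM j) a) := by
        rw [pull_pull, pull_pull]
        refine pull_congr K (fun x => ?_) a
        by_cases hx : ∃ v, x = Sum.inr (up v)
        · obtain ⟨v, rfl⟩ := hx
          have e1 := (hup v _).2 rfl
          have e2 := (hup (σ v) _).2 rfl
          simp only [relabel, Sum.map_inr, Option.bind_some, σ',
            Equiv.Perm.viaFintypeEmbedding_apply_image, e1, e2]
        · have e1 : relabel σ' x = some x := by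
            rcases x with k | k
            · rfl
            · simp only [relabel, Sum.map_inr, σ']
              rw [Equiv.Perm.viaFintypeEmbedding_apply_notMem_range]
              rintro ⟨v, rfl⟩
              exact hx ⟨v, rfl⟩
          rw [e1, Option.bind_some]
          rcases hc : collapse hN hM j x with _ | y
          · rfl
          · rcases y with k | k
            · rfl
            · exact absurd ⟨k, (hup k x).1 hc⟩ hx
      have h2 : pull K (restrict hN hM j) b
          = pull K (relabel σ') (pull K (restrict hN hM j) b) := by
        rw [pull_pull]
        refine pull_congr K (fun x => ?_) b
        by_cases hx : ∃ v, x = Sum.inr (up v)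
        · obtain ⟨v, rfl⟩ := hx
          simp only [relabel, Sum.map_inr, Option.bind_some, σ',
            Equiv.Perm.viaFintypeEmbedding_apply_image, hres]
        · have e1 : relabel σ' x = some x := by
            rcases x with k | k
            · rfl
            · simp only [relabel, Sum.map_inr, σ']
              rw [Equiv.Perm.viaFintypeEmbedding_apply_notMem_range]
              rintro ⟨v, rfl⟩
              exact hx ⟨v, rfl⟩
          rw [e1, Option.bind_some]
      rw [map_sub, sub_mul, h1]
      nth_rewrite 1 [h2]
      rw [← map_mul]
      exact Submodule.subset_span (Relator.symm σ' _)
    | ihx v w h a =>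
      have h' : (Sum.inr (up v) : Vert N M) ≠ Sum.inr (up w) := by
        intro h0
        exact h (by rw [up.injective (Sum.inr.inj h0)])
      have h1 : pull K (collapse hN hM j) (pull K (contract v w) a)
          = pull K (contract (up v) (up w)) (pull K (collapse hN hM j) a) := by
        rw [pull_pull, pull_pull]
        refine pull_congr K (fun x => ?_) a
        by_cases hx : x = Sum.inr (up w)
        · subst hx
          have e1 := (hup v _).2 rfl
          have e2 := (hup w _).2 rfl
          simp [contract, e1, e2]
        · have e0 := mt (hup w x).1 hx
          simp only [contract, hx, if_false, Option.bind_some]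
          rcases hc : collapse hN hM j x with _ | y
          · rfl
          · rw [hc] at e0
            simp only [Option.bind_some]
            unfold contract
            rw [if_neg (show ¬ y = Sum.inr w from fun h => e0 (by rw [h]))]
      have h2 : ∀ b, pull K (restrict hN hM j) b
          = pull K (contract (up v) (up w)) (pull K (restrict hN hM j) b) := by
        intro b
        rw [pull_pull]
        refine pull_congr K (fun x => ?_) b
        by_cases hx : x = Sum.inr (up w)
        · subst hx
          simp [contract, hres]
        · simp [contract, hx]
      have h3 : pull K (collapse hN hM j) (arrow K ⟨(Sum.inr v, Sum.inr w), h⟩)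
          = arrow K ⟨(Sum.inr (up v), Sum.inr (up w)), h'⟩ := by
        rw [pull_arrow]
        rw [Fintype.sum_eq_single
          ⟨⟨(Sum.inr (up v), Sum.inr (up w)), h'⟩, (hup v _).2 rfl, (hup w _).2 rfl⟩]
        rintro ⟨⟨⟨x, y⟩, hq⟩, hx, hy⟩ hne
        refine absurd ?_ hne
        have hx' := (hup v x).1 hx
        have hy' := (hup w y).1 hy
        subst hx' hy'
        rfl
      rw [map_mul, h1, h3, mul_assoc, arrow_mul, twist_pull, h2, ← mul_assoc, ← map_mul]
      exact Submodule.subset_span (Relator.ihx _ _ h' _)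
  | zero => rw [map_zero, zero_mul]; exact zero_mem _
  | add x y _ _ hx hy => rw [map_add, add_mul]; exact add_mem hx hy
  | smul r x _ hx => rw [map_smul, smul_mul_assoc]; exact Submodule.smul_mem _ _ hx

theorem compose_right_mem (K : Type u) [Field K] (hN : n₁ + n₂ = N) (hM : m₁ + m₂ = M)
    (j : Fin (n₁ + 1)) (a : Gra K (Vert n₁ m₁)) {b : Gra K (Vert n₂ m₂)}
    (hb : b ∈ relations K n₂ m₂) : compose K hN hM j a b ∈ relations K N M := by
  let up : Fin m₂ ↪ Fin M := ⟨fun v => ⟨m₁ + v.1, by omega⟩, fun v w h => by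
    simpa [Fin.ext_iff] using h⟩
  have hval : ∀ v : Fin m₂, (up v).1 = m₁ + v.1 := fun v => rfl
  have hup : ∀ (v : Fin m₂) (x : Vert N M),
      restrict hN hM j x = some (Sum.inr v) ↔ x = Sum.inr (up v) := by
    intro v x
    rcases x with k | k
    · simp only [restrict]
      split_ifs <;> simp
    · simp only [restrict]
      split_ifs with h
      · simp only [Option.some.injEq, Sum.inr.injEq, Fin.ext_iff, hval]
        omega
      · simp only [Sum.inr.injEq, false_iff]
        rintro rfl
        exact h (by simp [hval])
  have hcol : ∀ v : Fin m₂, collapse hN hM j (Sum.inr (up v)) = some (Sum.inl j) := by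
    intro v
    simp [collapse, hval]
  change pull K (collapse hN hM j) a * pull K (restrict hN hM j) b ∈ relations K N M
  induction hb using Submodule.span_induction with
  | mem x hx =>
    cases hx with
    | twoIn v e e' b b' h h' =>
      simp only [map_mul, pull_arrow, Finset.mul_sum, Finset.sum_mul]
      refine Submodule.sum_mem _ fun p _ => Submodule.sum_mem _ fun q _ => ?_
      simp only [← mul_assoc]
      refine Submodule.subset_span (Relator.twoIn (up v) _ _ _ _ ?_ ?_)
      all_goals rw [← hup]
      · exact h ▸ q.2.2
      · exact h' ▸ p.2.2
    | threeOut v e e' e'' b b' h h' h'' =>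
      simp only [map_mul, pull_arrow, Finset.mul_sum, Finset.sum_mul]
      refine Submodule.sum_mem _ fun p _ => Submodule.sum_mem _ fun q _ =>
        Submodule.sum_mem _ fun r _ => ?_
      simp only [← mul_assoc]
      refine Submodule.subset_span (Relator.threeOut (up v) _ _ _ _ _ ?_ ?_ ?_)
      all_goals rw [← hup]
      · exact h ▸ r.2.1
      · exact h' ▸ q.2.1
      · exact h'' ▸ p.2.1
    | symm σ b =>
      let σ' : Equiv.Perm (Fin M) := σ.viaFintypeEmbedding up
      have hfix : ∀ x : Vert N M, (¬ ∃ v, x = Sum.inr (up v)) → relabel σ' x = some x := by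
        intro x hx
        rcases x with k | k
        · rfl
        · simp only [relabel, Sum.map_inr, σ']
          rw [Equiv.Perm.viaFintypeEmbedding_apply_notMem_range]
          rintro ⟨v, rfl⟩
          exact hx ⟨v, rfl⟩
      have h1 : pull K (restrict hN hM j) (pull K (relabel σ) b)
          = pull K (relabel σ') (pull K (restrict hN hM j) b) := by
        rw [pull_pull, pull_pull]
        refine pull_congr K (fun x => ?_) b
        by_cases hx : ∃ v, x = Sum.inr (up v)
        · obtain ⟨v, rfl⟩ := hx
          have e1 := (hup v _).2 rfl
          have e2 := (hup (σ v) _).2 rfl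
          simp only [relabel, Sum.map_inr, Option.bind_some, σ',
            Equiv.Perm.viaFintypeEmbedding_apply_image, e1, e2]
        · rw [hfix x hx, Option.bind_some]
          rcases hc : restrict hN hM j x with _ | y
          · rfl
          · rcases y with k | k
            · rfl
            · exact absurd ⟨k, (hup k x).1 hc⟩ hx
      have h2 : pull K (collapse hN hM j) a
          = pull K (relabel σ') (pull K (collapse hN hM j) a) := by
        rw [pull_pull]
        refine pull_congr K (fun x => ?_) a
        by_cases hx : ∃ v, x = Sum.inr (up v)
        · obtain ⟨v, rfl⟩ := hx
          simp only [relabel, Sum.map_inr, Option.bind_some, σ',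
            Equiv.Perm.viaFintypeEmbedding_apply_image, hcol]
        · rw [hfix x hx, Option.bind_some]
      rw [map_sub, mul_sub, h1]
      nth_rewrite 1 [h2]
      rw [← map_mul]
      exact Submodule.subset_span (Relator.symm σ' _)
    | ihx v w h b =>
      have h' : (Sum.inr (up v) : Vert N M) ≠ Sum.inr (up w) := by
        intro h0
        exact h (by rw [up.injective (Sum.inr.inj h0)])
      have h1 : pull K (restrict hN hM j) (pull K (contract v w) b)
          = pull K (contract (up v) (up w)) (pull K (restrict hN hM j) b) := by
        rw [pull_pull, pull_pull]
        refine pull_congr K (fun x => ?_) b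
        by_cases hx : x = Sum.inr (up w)
        · subst hx
          have e1 := (hup v _).2 rfl
          have e2 := (hup w _).2 rfl
          simp [contract, e1, e2]
        · have e0 := mt (hup w x).1 hx
          simp only [contract, hx, if_false, Option.bind_some]
          rcases hc : restrict hN hM j x with _ | y
          · rfl
          · rw [hc] at e0
            simp only [Option.bind_some]
            unfold contract
            rw [if_neg (show ¬ y = Sum.inr w from fun h => e0 (by rw [h]))]
      have h2 : pull K (collapse hN hM j) a
          = pull K (contract (up v) (up w)) (pull K (collapse hN hM j) a) := by
        rw [pull_pull]
        refine pull_congr K (fun x => ?_) a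
        by_cases hx : x = Sum.inr (up w)
        · subst hx
          simp [contract, hcol]
        · simp [contract, hx]
      have h3 : pull K (restrict hN hM j) (arrow K ⟨(Sum.inr v, Sum.inr w), h⟩)
          = arrow K ⟨(Sum.inr (up v), Sum.inr (up w)), h'⟩ := by
        rw [pull_arrow]
        rw [Fintype.sum_eq_single
          ⟨⟨(Sum.inr (up v), Sum.inr (up w)), h'⟩, (hup v _).2 rfl, (hup w _).2 rfl⟩]
        rintro ⟨⟨⟨x, y⟩, hq⟩, hx, hy⟩ hne
        refine absurd ?_ hne
        have hx' := (hup v x).1 hx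
        have hy' := (hup w y).1 hy
        subst hx' hy'
        rfl
      rw [map_mul, h1, h3, h2, ← mul_assoc, ← map_mul]
      exact Submodule.subset_span (Relator.ihx _ _ h' _)
  | zero => rw [map_zero, mul_zero]; exact zero_mem _
  | add x y _ _ hx hy => rw [map_add, mul_add]; exact add_mem hx hy
  | smul r x _ hx => rw [map_smul, mul_smul_comm]; exact Submodule.smul_mem _ _ hx

/-- The composition `Γ₁ ∘ⱼ Γ₂` on classes, with the sign `(-1) ^ (|Γ₂| * k)`; the degree
`|Γ₂|` has the parity of the number of edges. -/
def compSign (K : Type u) [Field K] (hN : n₁ + n₂ = N) (hM : m₁ + m₂ = M) (j : Fin (n₁ + 1))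
    (k : ℕ) (x : QGra K n₁ m₁) (y : QGra K n₂ m₂) : QGra K N M :=
  Quotient.map₂ (fun a b => compose K hN hM j a (twist K k b))
    (by
      intro a a' ha b b' hb
      have ha' : a - a' ∈ relations K n₁ m₁ := (Submodule.quotientRel_def _).1 ha
      have hb' : b - b' ∈ relations K n₂ m₂ := (Submodule.quotientRel_def _).1 hb
      refine (Submodule.quotientRel_def _).2 ?_
      have h1 := compose_left_mem K hN hM j ha' (twist K k b)
      have h2 := compose_right_mem K hN hM j a' (twist_mem K k hb')
      rw [map_sub, LinearMap.sub_apply] at h1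
      rw [map_sub, map_sub] at h2
      simpa using add_mem h1 h2) x y

end Insertion

section Convolution

/-- The convolution algebra `∏ₙ Hom(As¡(n + 1), dgraphs(n + 1))`, completed by the number of internal
vertices: families of (classes of) graphs with `n + 1` external and `m` internal vertices.
The condition that all graphs are admissible is a separate one. -/
abbrev Conv (K : Type u) [Field K] : Type u := ∀ n m : ℕ, QGra K n m

/-- The pre-Lie product
`Γ₁ ⋆ Γ₂ = ∑ᵢ (-1) ^ (|Γ₂| (1 - n) + (i + 1) (m - 1)) Γ₁ ∘ᵢ Γ₂` for graphs with `n`, `m` external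
vertices; below, `n = n₁ + 1`, `m = N - n₁ + 1` and `i = j + 1`. -/
def preLie (K : Type u) [Field K] (x y : Conv K) : Conv K := fun N M =>
  ∑ n₁ : Fin (N + 1), ∑ m₁ : Fin (M + 1), ∑ j : Fin (n₁.1 + 1),
    (-1 : K) ^ (j.1 * (N - n₁.1)) •
      compSign K (Nat.add_sub_of_le (Nat.le_of_lt_succ n₁.2))
        (Nat.add_sub_of_le (Nat.le_of_lt_succ m₁.2)) j n₁.1
        (x n₁.1 m₁.1) (y (N - n₁.1) (M - m₁.1))

/-- The bracket `[x, y] = x ⋆ y - y ⋆ x` for `x` of degree zero. -/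
def ad (K : Type u) [Field K] (x y : Conv K) : Conv K := preLie K x y - preLie K y x

/-- `exp(ad x) y = ∑ₖ (ad x)ᵏ y / k!` for `x` of degree zero with vanishing component
`x 0 0` (one external and no internal vertex). As `ad x` then raises `n + m`, the terms with
`k > n + m` do not contribute to the component `(n, m)`. -/
def expAd (K : Type u) [Field K] (x y : Conv K) : Conv K := fun n m =>
  ∑ k ∈ Finset.range (n + m + 1), ((k.factorial : K)⁻¹) • ((ad K x)^[k] y) n m

/-- The convolution Lie algebra `𝔤_{As, dgraphs}`, completed by the number of internal vertices. -/
def IsConvElement (K : Type u) [Field K] (x : Conv K) : Prop := ∀ n m, x n m ∈ dgraphs K n m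

/-- The elements of degree `q` in `𝔤_{As, dgraphs}`. -/
def IsConvDegree (K : Type u) [Field K] (q : ℤ) (x : Conv K) : Prop :=
  ∀ n m, x n m ∈ dgraphsDeg K q n m

/-- The Maurer–Cartan elements of `𝔤_{As, dgraphs}`. -/
def MC (K : Type u) [Field K] : Type u := {x : Conv K // IsConvDegree K 1 x ∧ preLie K x x = 0}

/-- The ideal `𝔤⁰₊` of `𝔤⁰_{As, dgraphs}`: elements of degree zero without a multiple of the graph
with one (external) vertex and no edge. It is pro-nilpotent, and `𝔤⁰` is the direct sum of `𝔤⁰₊` and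
the line spanned by that graph, the operadic unit. -/
def IsPronilpotent (K : Type u) [Field K] (x : Conv K) : Prop := IsConvDegree K 0 x ∧ x 0 0 = 0

/-- Equivalence under the pro-unipotent group `exp(𝔤⁰₊)`. -/
def UnipotentGauge (K : Type u) [Field K] (a b : MC K) : Prop :=
  ∃ x : Conv K, IsPronilpotent K x ∧ b.1 = expAd K x a.1

/-- Equivalence under the gauge group of `𝔤⁰`, the semidirect product of `exp(𝔤⁰₊)` and the
multiplicative group `Kˣ` that integrates the line of the operadic unit `u`; since
`[u, Γ] = - n Γ` for a graph with `n + 1` external vertices, `c` acts as `c⁻ⁿ`. -/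
def Gauge (K : Type u) [Field K] (a b : MC K) : Prop :=
  ∃ c : Kˣ, ∃ x : Conv K, IsPronilpotent K x ∧
    ∀ n m, b.1 n m = ((c⁻¹ : Kˣ) : K) ^ n • expAd K x a.1 n m

end Convolution

section AInfinity

variable {K : Type u} [Field K] {A : Type u} [AddCommGroup A] [Module K A]

/-- Families of multilinear maps; the `n`-th one has arity `n + 1`. -/
abbrev EndFam (K : Type u) [Field K] (A : Type u) [AddCommGroup A] [Module K A] : Type u :=
  ∀ n : ℕ, MultilinearMap K (fun _ : Fin (n + 1) => A) A

/-- The value of a map of arity `n + 1` on the first `n + 1` terms of a sequence. -/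
def evalSeq {n : ℕ} (f : MultilinearMap K (fun _ : Fin (n + 1) => A) A) (a : ℕ → A) : A :=
  f fun i => a i

/-- The sequence `a₀, …, a_{r-1}, y, a_{r+s}, a_{r+s+1}, …`. -/
def plug (r s : ℕ) (y : A) (a : ℕ → A) : ℕ → A := fun k =>
  if k < r then a k else if k = r then y else a (k + s - 1)

/-- The value on `a₀, a₁, …` of `f (1^{⊗ r} ⊗ g ⊗ 1^{⊗ t})`, where `g` has degree `p` and arity
`s' + 1`, and `aᵢ` has degree `kᵢ`; the sign is that of the Koszul rule. -/
def partialComp {u' s' : ℕ} (f : MultilinearMap K (fun _ : Fin (u' + 1) => A) A)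
    (g : MultilinearMap K (fun _ : Fin (s' + 1) => A) A) (p : ℤ) (r : ℕ)
    (a : ℕ → A) (k : ℕ → ℤ) : A :=
  (((p * ∑ i ∈ Finset.range r, k i).negOnePow : ℤˣ) : ℤ) •
    evalSeq f (plug r (s' + 1) (evalSeq g fun i => a (r + i)) a)

/-- `f` is homogeneous of degree `p` with respect to the grading `𝒜`. -/
def HasDegree (𝒜 : ℤ → Submodule K A) {n : ℕ}
    (f : MultilinearMap K (fun _ : Fin (n + 1) => A) A) (p : ℤ) : Prop :=
  ∀ (a : Fin (n + 1) → A) (k : Fin (n + 1) → ℤ), (∀ i, a i ∈ 𝒜 (k i)) →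
    f a ∈ 𝒜 (∑ i, k i + p)

/-- The pre-Lie product
`f ⋆ g = ∑ᵢ (-1) ^ (|g| (1 - n) + (i + 1) (m - 1)) f ∘ᵢ g` of the convolution Lie algebra of `A`,
for `g` of degree `q` there (so that the map of arity `m` has degree `q + 1 - m`), in arity
`N + 1` and on homogeneous arguments `aᵢ` of degrees `kᵢ`.
Here `m = s + 1`, `n = N - s + 1`, and `i = r + 1`. -/
def preLieEnd (q : ℤ) (f g : EndFam K A) (N : ℕ) (a : ℕ → A) (k : ℕ → ℤ) : A :=
  ∑ s ∈ Finset.range (N + 1), ∑ r ∈ Finset.range (N - s + 1),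
    ((((q - s) * (1 - ((N - s : ℕ) + 1 : ℤ)) + ((r : ℤ) + 2) * s).negOnePow : ℤˣ) : ℤ) •
      partialComp (f (N - s)) (g s) (q - s) r a k

/-- `A∞`-structures on the graded vector space `(A, 𝒜)`: maps `mₙ` of degree `2 - n` with
`∑ (-1) ^ (r + s t) m_u (1^{⊗ r} ⊗ m_s ⊗ 1^{⊗ t}) = 0`. Below, the arities are
`n = N + 1` and `s = s' + 1`. -/
structure IsAInfinity (𝒜 : ℤ → Submodule K A) (μ : EndFam K A) : Prop where
  degree : ∀ n, HasDegree 𝒜 (μ n) (2 - ((n : ℤ) + 1))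
  relation : ∀ (N : ℕ) (a : ℕ → A) (k : ℕ → ℤ), (∀ i, a i ∈ 𝒜 (k i)) →
    ∑ s' ∈ Finset.range (N + 1), ∑ r ∈ Finset.range (N - s' + 1),
      (-1 : ℤ) ^ (r + (s' + 1) * (N - s' - r)) •
        partialComp (μ (N - s')) (μ s') (2 - ((s' : ℤ) + 1)) r a k = 0

/-- The size of the `j`-th block of a composition, counting from zero. -/
def blk {n : ℕ} (c : Composition n) (j : ℕ) : ℕ := c.blocks.getD j 0

/-- `A∞`-morphisms `(A, μ) → (A, ν)`: maps `fₙ` of degree `1 - n` with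
`∑ (-1) ^ (r + s t) f_u (1^{⊗ r} ⊗ μ_s ⊗ 1^{⊗ t})
  = ∑ (-1) ^ (∑ⱼ (r - j) (iⱼ - 1)) ν_r (f_{i₁} ⊗ ⋯ ⊗ f_{i_r})`.
The additional sign on the right is that of the Koszul rule. -/
structure IsAInfinityMorphism (𝒜 : ℤ → Submodule K A) (μ ν f : EndFam K A) : Prop where
  degree : ∀ n, HasDegree 𝒜 (f n) (1 - ((n : ℤ) + 1))
  relation : ∀ (N : ℕ) (a : ℕ → A) (k : ℕ → ℤ), (∀ i, a i ∈ 𝒜 (k i)) →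
    ∑ s' ∈ Finset.range (N + 1), ∑ r ∈ Finset.range (N - s' + 1),
      (-1 : ℤ) ^ (r + (s' + 1) * (N - s' - r)) •
        partialComp (f (N - s')) (μ s') (2 - ((s' : ℤ) + 1)) r a k =
    ∑ c : Composition (N + 1),
      ((-1 : ℤ) ^ (∑ j ∈ Finset.range c.length, (c.length - 1 - j) * (blk c j - 1)) *
        (((∑ j ∈ Finset.range c.length,
          (1 - (blk c j : ℤ)) * ∑ i ∈ Finset.range (c.sizeUpTo j), k i).negOnePow : ℤˣ) : ℤ)) •
        evalSeq (ν (c.length - 1))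
          fun j => evalSeq (f (blk c j - 1)) fun i => a (c.sizeUpTo j + i)

end AInfinity

section Representation

/-- A finite-dimensional Lie algebra with a basis `x₁, …, x_d`. -/
structure BasedLie (K : Type u) [Field K] where
  carrier : Type u
  [lieRing : LieRing carrier]
  [lieAlgebra : LieAlgebra K carrier]
  dim : ℕ
  basis : Module.Basis (Fin dim) K carrier

attribute [instance] BasedLie.lieRing BasedLie.lieAlgebra

/-- The structure constants `c_{ij}^k`. -/
def BasedLie.c {K : Type u} [Field K] (L : BasedLie K) (i j k : Fin L.dim) : K :=
  L.basis.repr ⁅L.basis i, L.basis j⁆ k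

/-- `K[x_i] ⊗ Λ(p^i)`, for even variables `x_i` and odd variables `p^i` indexed by `ι`. -/
abbrev SuperPoly (K : Type u) [Field K] (ι : Type) : Type u :=
  MvPolynomial ι K ⊗[K] ExteriorAlgebra K (ι → K)

/-- The graded algebra `A = S𝔤 ⊗ Λ𝔤* = K[x₁, …, x_d, p¹, …, p^d]`. -/
abbrev BasedLie.A {K : Type u} [Field K] (L : BasedLie K) : Type u := SuperPoly K (Fin L.dim)

/-- The grading of `A`: the `x_i` have degree `0`, the `p^i` have degree `1`. -/
def BasedLie.gr {K : Type u} [Field K] (L : BasedLie K) (k : ℤ) : Submodule K L.A :=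
  Submodule.span K {a | ∃ (P : MvPolynomial (Fin L.dim) K) (j : ℕ)
    (w : ExteriorAlgebra K (Fin L.dim → K)),
    w ∈ (⋀[K]^j (Fin L.dim → K) : Submodule K (ExteriorAlgebra K (Fin L.dim → K))) ∧
      (j : ℤ) = k ∧ a = P ⊗ₜ[K] w}

/-- `π = ∑ c_{ij}^k x_k p^i p^j`. -/
def BasedLie.pi {K : Type u} [Field K] (L : BasedLie K) : L.A :=
  ∑ i, ∑ j, ∑ k, L.c i j k • (MvPolynomial.X k ⊗ₜ[K]
    (ExteriorAlgebra.ι K (Pi.single i 1) * ExteriorAlgebra.ι K (Pi.single j 1)))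

/-- The derivative with respect to the even variable `x_i`. -/
def dx (K : Type u) [Field K] {ι : Type} (i : ι) : Module.End K (SuperPoly K ι) :=
  TensorProduct.map (MvPolynomial.pderiv i).toLinearMap LinearMap.id

/-- The left derivative with respect to the odd variable `p^i`. -/
def dp (K : Type u) [Field K] {ι : Type} (i : ι) : Module.End K (SuperPoly K ι) :=
  TensorProduct.map LinearMap.id (CliffordAlgebra.contractLeft (LinearMap.proj i))

/-- `A^{⊗ V}`, as the superpolynomials in variables `x_{v,i}`, `p_{v,i}` (`v ∈ V`). With the tensor
factors in a given order, `⊗ a_v` corresponds to the product of the `slot v a_v` in that order; the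
Koszul signs of operators on tensor factors become the signs of odd derivations. -/
abbrev BasedLie.Slots {K : Type u} [Field K] (L : BasedLie K) (V : Type) : Type u :=
  SuperPoly K (V × Fin L.dim)

/-- The inclusion of the tensor factor with index `v`. -/
def BasedLie.slot {K : Type u} [Field K] (L : BasedLie K) {V : Type} [DecidableEq V] (v : V) :
    L.A →ₐ[K] L.Slots V :=
  Algebra.TensorProduct.map (MvPolynomial.rename (Prod.mk v))
    (ExteriorAlgebra.map (LinearMap.pi fun q : V × Fin L.dim =>
      if q.1 = v then LinearMap.proj q.2 else 0))

/-- The iterated product `A^{⊗ V} → A`. -/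
def BasedLie.merge {K : Type u} [Field K] (L : BasedLie K) (V : Type) [Fintype V] :
    L.Slots V →ₐ[K] L.A :=
  Algebra.TensorProduct.map (MvPolynomial.rename Prod.snd)
    (ExteriorAlgebra.map (LinearMap.pi fun i => ∑ v : V, LinearMap.proj (v, i)))

/-- `τ_{uv} = ∑_l ∂/∂p^l ⊗ ∂/∂x_l` on the tensor factors `u` and `v`, for an edge `u ⟶ v`. -/
def BasedLie.tau {K : Type u} [Field K] (L : BasedLie K) {V : Type} (e : Edge V) :
    Module.End K (L.Slots V) :=
  ∑ l : Fin L.dim, dp K (e.1.1, l) * dx K (e.1.2, l)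

theorem dx_comm (K : Type u) [Field K] {ι : Type} (i j : ι) : dx K i * dx K j = dx K j * dx K i := by
  refine TensorProduct.ext' fun P w => ?_
  have h : ⁅(MvPolynomial.pderiv i : Derivation K (MvPolynomial ι K) (MvPolynomial ι K)),
      (MvPolynomial.pderiv j : Derivation K (MvPolynomial ι K) (MvPolynomial ι K))⁆ = 0 := by
    classical
    refine MvPolynomial.derivation_ext fun k => ?_
    simp [Derivation.commutator_apply, MvPolynomial.pderiv_X, Pi.single_apply, apply_ite]
  have h' := congrArg (fun D => D P) h
  simp only [Derivation.commutator_apply, Derivation.coe_zero, Pi.zero_apply] at h'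
  simp only [dx, Module.End.mul_apply, TensorProduct.map_tmul, LinearMap.id_apply]
  exact congrArg (· ⊗ₜ[K] w) (sub_eq_zero.1 h')

theorem dx_dp (K : Type u) [Field K] {ι : Type} (i j : ι) : dx K i * dp K j = dp K j * dx K i := by
  refine TensorProduct.ext' fun P w => ?_
  simp [dx, dp]

theorem dp_anticomm (K : Type u) [Field K] {ι : Type} (i j : ι) :
    dp K i * dp K j + dp K j * dp K i = 0 := by
  refine TensorProduct.ext' fun P w => ?_
  simp only [dp, Module.End.mul_apply, TensorProduct.map_tmul, LinearMap.id_apply,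
    LinearMap.add_apply, LinearMap.zero_apply]
  rw [← TensorProduct.tmul_add, CliffordAlgebra.contractLeft_comm, neg_add_cancel,
    TensorProduct.tmul_zero]

theorem BasedLie.tau_anticomm {K : Type u} [Field K] (L : BasedLie K) {V : Type} (e e' : Edge V) :
    L.tau e * L.tau e' + L.tau e' * L.tau e = 0 := by
  unfold BasedLie.tau
  simp only [Finset.sum_mul, Finset.mul_sum]
  rw [Finset.sum_comm, ← Finset.sum_add_distrib]
  refine Finset.sum_eq_zero fun l _ => ?_
  rw [← Finset.sum_add_distrib]
  refine Finset.sum_eq_zero fun l' _ => ?_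
  have h : ∀ i j i' j' : V × Fin L.dim,
      dp K i * dx K j * (dp K i' * dx K j') = dp K i * dp K i' * (dx K j * dx K j') := by
    intro i j i' j'
    calc _ = dp K i * (dx K j * dp K i') * dx K j' := by simp only [mul_assoc]
      _ = _ := by rw [dx_dp]; simp only [mul_assoc]
  rw [h, h, dx_comm K (e'.1.2, _), ← add_mul, dp_anticomm, zero_mul]

theorem BasedLie.tau_sq {K : Type u} [Field K] [CharZero K] (L : BasedLie K) {V : Type} [Fintype V]
    [DecidableEq V] (f : Edge V → K) :
    (∑ e, f e • L.tau e) * (∑ e, f e • L.tau e) = 0 := by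
  have h : (∑ e, f e • L.tau e) * (∑ e, f e • L.tau e)
      + (∑ e, f e • L.tau e) * (∑ e, f e • L.tau e) = 0 := by
    have h1 : (∑ e, f e • L.tau e) * (∑ e, f e • L.tau e)
        = ∑ e, ∑ e', (f e * f e') • (L.tau e * L.tau e') := by
      simp only [Finset.sum_mul_sum, smul_mul_smul_comm]
    have h2 : (∑ e, f e • L.tau e) * (∑ e, f e • L.tau e)
        = ∑ e, ∑ e', (f e * f e') • (L.tau e' * L.tau e) := by
      rw [h1, Finset.sum_comm]
      simp only [mul_comm]
    nth_rewrite 1 [h1]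
    rw [h2, ← Finset.sum_add_distrib]
    refine Finset.sum_eq_zero fun e _ => ?_
    rw [← Finset.sum_add_distrib]
    refine Finset.sum_eq_zero fun e' _ => ?_
    rw [← smul_add, L.tau_anticomm, smul_zero]
  have h2 : (2 : K) ≠ 0 := two_ne_zero
  rw [← two_smul K] at h
  simpa [smul_smul, h2] using congrArg (fun T => (2 : K)⁻¹ • T) h

/-- A graph with edges `e₁, …, e_r`, in this order, acts on `A^{⊗ V}` as the product
`τ_{e₁} ⋯ τ_{e_r}` of operators. -/
def BasedLie.act {K : Type u} [Field K] [CharZero K] (L : BasedLie K) (V : Type) [Fintype V]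
    [DecidableEq V] : Gra K V →ₐ[K] Module.End K (L.Slots V) :=
  ExteriorAlgebra.lift K ⟨∑ e : Edge V, (LinearMap.proj e : (Edge V → K) →ₗ[K] K).smulRight (L.tau e),
    fun f => by simpa using L.tau_sq f⟩

/-- Kontsevich's representation: `B_Γ(f₁, …, f_n)` is the product of the factors of
`τ_{e₁} ⋯ τ_{e_r} (π ⊗ ⋯ ⊗ π ⊗ f₁ ⊗ ⋯ ⊗ f_n)`, with a factor `π` for each internal vertex. -/
def BasedLie.B {K : Type u} [Field K] [CharZero K] (L : BasedLie K) {n m : ℕ}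
    (a : Gra K (Vert n m)) : MultilinearMap K (fun _ : Fin (n + 1) => L.A) L.A :=
  ((L.merge (Vert n m)).toLinearMap ∘ₗ L.act (Vert n m) a ∘ₗ
    LinearMap.mulLeft K (List.ofFn fun v : Fin m => L.slot (Sum.inr v : Vert n m) L.pi).prod).compMultilinearMap
    ((MultilinearMap.mkPiAlgebraFin K (n + 1) (L.Slots (Vert n m))).compLinearMap
      fun i => (L.slot (Sum.inl i : Vert n m)).toLinearMap)

/-- Families of maps `A^{⊗ (n + 1)} → A`, for all finite-dimensional Lie algebras at once. -/
abbrev UFam (K : Type u) [Field K] : Type (u + 1) := ∀ L : BasedLie K, EndFam K L.A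

/-- `F = B ∘ x`: for one, hence every, choice of representatives of the components of `x`, the maps `F`
are the sums over the number `m` of internal vertices of the maps that represent the components of `x`.
On given arguments all but finitely many terms vanish. -/
def Realizes {K : Type u} [Field K] [CharZero K] (x : Conv K) (F : UFam K) : Prop :=
  ∃ a : ∀ n m, Gra K (Vert n m), (∀ n m, cls K n m (a n m) = x n m) ∧
    ∀ (L : BasedLie K) (n : ℕ) (f : Fin (n + 1) → L.A),
      ∀ᶠ M in Filter.atTop, F L n f = ∑ m ∈ Finset.range M, L.B (a n m) f

/-- Families of maps that are represented by graphs, the same for all Lie algebras. -/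
def IsUniversal {K : Type u} [Field K] [CharZero K] (F : UFam K) : Prop :=
  ∃ x : Conv K, IsConvElement K x ∧ Realizes x F

/-- Universal `A∞`-structures. -/
def UAInfinity (K : Type u) [Field K] [CharZero K] : Type (u + 1) :=
  {F : UFam K // IsUniversal F ∧ ∀ L : BasedLie K, IsAInfinity L.gr (F L)}

/-- `f` is a universal `A∞`-isomorphism from `F` to `G`. -/
structure IsUIso {K : Type u} [Field K] [CharZero K] (F G : UAInfinity K) (f : UFam K) : Prop where
  universal : IsUniversal f
  morphism : ∀ L : BasedLie K, IsAInfinityMorphism L.gr (F.1 L) (G.1 L) (f L)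
  bijective : ∀ L : BasedLie K, Function.Bijective fun a : L.A => f L 0 fun _ => a

/-- There is a universal `A∞`-isomorphism from `F` to `G`. -/
def UIsomorphic {K : Type u} [Field K] [CharZero K] (F G : UAInfinity K) : Prop :=
  ∃ f : UFam K, IsUIso F G f

/-- There is a universal `A∞`-isomorphism from `F` to `G` with `f₁(1) = 1`. -/
def UnipotentUIsomorphic {K : Type u} [Field K] [CharZero K] (F G : UAInfinity K) : Prop :=
  ∃ f : UFam K, IsUIso F G f ∧ ∀ L : BasedLie K, f L 0 (fun _ => 1) = 1

end Representation

end DGraphs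

end

noncomputable section

namespace DGraphs

open AlgHom (commutes)
open Algebra.TensorProduct (map_tmul one_def tmul_mul_tmul)
open CliffordAlgebra (contractLeft_ι_mul left_induction)
open Equiv (apply_symm_apply arrowCongr funSplitAt prodCongr sumCongr sum_comp
  swap_apply_of_ne_of_ne symm_apply_apply symm_apply_eq trans_apply)
open ExteriorAlgebra (map_apply_ι ιMulti ιMulti_apply ι_add_mul_swap)
open Fin (sum_univ_succ tail)
open Finset (card_univ mem_erase mem_filter mem_image mem_map mem_range mem_univ mul_prod_erase
  mul_sum prod_congr prod_ite_zero prod_ne_zero_iff prod_range range range_mono smul_sum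
  sum_add_distrib sum_comm sum_congr sum_const sum_const_zero sum_eq_single sum_eq_single_of_mem
  sum_eq_zero sum_filter sum_ite_eq sum_ite_eq' sum_mul sum_neg_distrib sum_range sum_range_succ'
  sum_smul sum_sub_distrib sum_subset univ)
open Finset.HasAntidiagonal (antidiagonal mem_antidiagonal)
open Fintype (card card_bool card_congr card_fin card_sigma card_subtype card_sum sum_equiv
  sum_prod_type sum_prod_type' sum_sum_type)
open Function (comp_apply injective_id onFun update update_of_ne update_self)
open GradedAlgebra (proj_apply)
open LinearMap (coe_mk id_apply mem_ker mk₂ mulLeft pi_apply proj)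
open List (countP_cons finRange getD_eq_getElem length_cons length_drop length_map map_congr_left
  map_cons map_map map_nil map_ofFn mem_cons nodup_cons ofFn ofFn_eq_map ofFn_succ prod
  prod_append prod_cons prod_nil sum_cons)
open Matrix (single stdBasis)
open MultilinearMap (map_smul_univ map_update_add map_update_smul mkPiAlgebraFin_apply)
open MvPolynomial (isHomogeneous_one)
open Nat (add_sub_of_le cast_mul cast_sub le_of_lt_succ)
open Pi (single_apply)
open Prod (ext_iff fst_add mk_add_mk snd snd_add)
open Set (mem_setOf_eq singleton_add_singleton)
open Subalgebra (center)
open Submodule (iSup_induction' mem_bot mem_iSup_of_mem mem_top mkQ_surjective mul_mem_mul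
  smul_mem span span_le span_mono subset_span)
open Submodule.Quotient (mk_eq_zero mk_surjective)
open Subtype (val)
open Sum (elim inl inr map_inl map_inr)
open TensorProduct (add_tmul sum_tmul tmul_add tmul_smul tmul_zero zero_tmul)
variable {K : Type u} [Field K]

set_option linter.unusedSectionVars false

section Nets

/-- The outgoing half-edges of a trivalent graph with `m` internal vertices, each of which has two of
them, and roots `R`. -/
abbrev Port (m : ℕ) (R : Type) : Type := Fin m × Bool ⊕ R

/-- Trivalent graphs with internal vertices `Fin m`, roots `R` and leaves `Lf`: every outgoing
half-edge is sent to the vertex or leaf at which its edge ends. -/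
abbrev Net (m : ℕ) (R Lf : Type) : Type := Port m R ≃ Fin m ⊕ Lf

variable {m : ℕ} {R Lf : Type}

/-- No edge is a loop. -/
def Net.Loopless (g : Net m R Lf) : Prop := ∀ v b, g (inl (v, b)) ≠ inl v

/-- Renaming of the internal vertices. -/
def Net.rename (τ : Equiv.Perm (Fin m)) (g : Net m R Lf) : Net m R Lf :=
  (sumCongr (prodCongr τ (Equiv.refl Bool)) (Equiv.refl R)).symm.trans
    (g.trans (sumCongr τ (Equiv.refl Lf)))

/-- The cyclic permutation `a ↦ b ↦ c ↦ a`. -/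
def cycle3 {P : Type} [DecidableEq P] (a b c : P) : Equiv.Perm P := Equiv.swap a b * Equiv.swap b c

lemma cycle3_left {P : Type} [DecidableEq P] {a b c : P} (hab : a ≠ b) (hac : a ≠ c) :
    cycle3 a b c a = b := by
  simp [cycle3, swap_apply_of_ne_of_ne hab hac]

lemma cycle3_mid {P : Type} [DecidableEq P] {a b c : P} (hac : a ≠ c) (hbc : b ≠ c) :
    cycle3 a b c b = c := by
  simp [cycle3, swap_apply_of_ne_of_ne hac.symm hbc.symm]

lemma cycle3_right {P : Type} [DecidableEq P] {a b c : P} : cycle3 a b c c = a := by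
  simp [cycle3]

lemma cycle3_of_ne {P : Type} [DecidableEq P] {a b c x : P} (ha : x ≠ a) (hb : x ≠ b)
    (hc : x ≠ c) : cycle3 a b c x = x := by
  simp [cycle3, swap_apply_of_ne_of_ne hb hc, swap_apply_of_ne_of_ne ha hb]

/-- Functions of trivalent graphs that satisfy the antisymmetry and IHX relations. -/
structure IsWeight (K : Type u) [Field K] [DecidableEq R] {X : Type u} [AddCommGroup X] [Module K X]
    (θ : Net m R Lf → X) : Prop where
  swap : ∀ g v, θ ((Equiv.swap (inl (v, false)) (inl (v, true))).trans g) = -θ g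
  rename : ∀ g τ, θ (Net.rename τ g) = θ g
  ihx : ∀ (g : Net m R Lf) (v w : Fin m) (b : Bool), g.Loopless → v ≠ w →
    g (inl (v, b)) = inl w → (∀ b', g (inl (w, b')) ≠ inl v) →
    θ g + θ ((cycle3 (inl (v, !b)) (inl (w, false)) (inl (w, true))).trans g) +
      θ ((cycle3 (inl (v, !b)) (inl (w, false)) (inl (w, true))).symm.trans g) = 0

/-- The vertices and leaves such that no special leaf `inr (inr r)` lies below them, and the part
below them is a finite tree. -/
inductive PlainAt (g : Net m R (Fin m ⊕ R)) : Fin m ⊕ (Fin m ⊕ R) → Prop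
  | leaf (l : Fin m) : PlainAt g (inr (inl l))
  | vertex (v : Fin m) (h : ∀ b, PlainAt g (g (inl (v, b)))) : PlainAt g (inl v)

/-- The tree at any root contains a special leaf. -/
def Net.Rooted (g : Net m R (Fin m ⊕ R)) : Prop := ∀ r, ¬ PlainAt g (g (inr r))

lemma not_plainAt_special (g : Net m R (Fin m ⊕ R)) (r : R) :
    ¬ PlainAt g (inr (inr r)) := by
  intro h; cases h

lemma plainAt_vertex_iff (g : Net m R (Fin m ⊕ R)) (v : Fin m) :
    PlainAt g (inl v) ↔ ∀ b, PlainAt g (g (inl (v, b))) :=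
  ⟨fun h => by cases h; assumption, PlainAt.vertex v⟩

/-- The ports, grouped into the first ports of vertices, the second ports of vertices, and roots. -/
def portEquiv (m : ℕ) (R : Type) : Port m R ≃ Fin m ⊕ (Fin m ⊕ R) where
  toFun
    | inl (v, false) => inl v
    | inl (v, true) => inr (inl v)
    | inr r => inr (inr r)
  invFun
    | inl v => inl (v, false)
    | inr (inl v) => inl (v, true)
    | inr (inr r) => inr r
  left_inv := by rintro (⟨v, _ | _⟩ | r) <;> rfl
  right_inv := by rintro (v | v | r) <;> rfl

/-- The exchange of the first two summands. -/
def exch (m : ℕ) (R : Type) : Fin m ⊕ (Fin m ⊕ R) ≃ Fin m ⊕ (Fin m ⊕ R) where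
  toFun
    | inl v => inr (inl v)
    | inr (inl v) => inl v
    | inr (inr r) => inr (inr r)
  invFun
    | inl v => inr (inl v)
    | inr (inl v) => inl v
    | inr (inr r) => inr (inr r)
  left_inv := by rintro (v | v | r) <;> rfl
  right_inv := by rintro (v | v | r) <;> rfl

/-- The graph in which every vertex `v` carries the leaf `v`, and the other edges are given by a
permutation. -/
def comb (σ : Equiv.Perm (Fin m ⊕ R)) : Net m R (Fin m ⊕ R) :=
  ((portEquiv m R).trans (sumCongr (Equiv.refl (Fin m)) σ)).trans (exch m R)

/-- The relation of being the end of an edge from `v`. -/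
def Net.Child (g : Net m R Lf) (u v : Fin m) : Prop := ∃ b, g (inl (v, b)) = inl u

lemma PlainAt.acc {g : Net m R (Fin m ⊕ R)} {y : Fin m ⊕ (Fin m ⊕ R)} (h : PlainAt g y) :
    ∀ v, y = inl v → Acc g.Child v := by
  induction h with
  | leaf l => intro v hv; cases hv
  | vertex w _ ih =>
    rintro v ⟨⟩
    exact Acc.intro _ fun u ⟨b, hb⟩ => ih b u hb

lemma exists_plain_child (g : Net m R (Fin m ⊕ R)) (hg : g.Rooted) {w₀ : Fin m}
    (hw₀ : PlainAt g (inl w₀)) :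
    ∃ v b w, g (inl (v, b)) = inl w ∧ PlainAt g (inl w) ∧ ¬ PlainAt g (inl v) := by
  let P := {v : Fin m // PlainAt g (inl v)}
  let rel : P → P → Prop := fun a b => Relation.TransGen g.Child b.1 a.1
  have : IsTrans P rel := ⟨fun a b c h1 h2 => h2.trans h1⟩
  have : Std.Irrefl rel := ⟨fun a h => by
    have h1 : Acc (Relation.TransGen g.Child) a.1 := (PlainAt.acc a.2 a.1 rfl).transGen
    exact (h1.rec (motive := fun x _ => ¬ Relation.TransGen g.Child x x)
      (fun x _ ih hx => ih x hx hx)) h⟩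
  have hwf : WellFounded rel := Finite.wellFounded_of_trans_of_irrefl rel
  obtain ⟨w, -, hw⟩ := hwf.has_min Set.univ ⟨⟨w₀, hw₀⟩, trivial⟩
  rcases hp : g.symm (inl w.1) with ⟨v, b⟩ | r
  · have hvb : g (inl (v, b)) = inl w.1 := by rw [← hp]; simp
    refine ⟨v, b, w.1, hvb, w.2, fun hv => ?_⟩
    exact hw ⟨v, hv⟩ trivial (Relation.TransGen.single ⟨b, hvb⟩)
  · have : g (inr r) = inl w.1 := by rw [← hp]; simp
    exact absurd (this ▸ w.2) (hg r)

lemma PlainAt.of_move {g : Net m R (Fin m ⊕ R)} {v w : Fin m} {b : Bool}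
    (hvw : g (inl (v, b)) = inl w)
    (hA : ¬ PlainAt g (g (inl (v, !b)))) {d : Equiv.Perm (Port m R)}
    (hvb : d (inl (v, b)) = inl (v, b))
    (hd : ∀ u b', u ≠ v → u ≠ w → d (inl (u, b')) = inl (u, b'))
    (hk : ∃ k, d (inl (w, k)) = inl (v, !b)) {y : Fin m ⊕ (Fin m ⊕ R)}
    (h : PlainAt (d.trans g) y) : PlainAt g y ∧ y ≠ inl w := by
  induction h with
  | leaf l => exact ⟨PlainAt.leaf l, by simp⟩
  | vertex u _ ih =>
    simp only [trans_apply] at ih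
    by_cases huw : u = w
    · subst huw
      obtain ⟨k, hk⟩ := hk
      exact absurd (hk ▸ (ih k).1) hA
    · by_cases huv : u = v
      · subst huv
        exact absurd (by rw [hvb, hvw]) (ih b).2
      · refine ⟨PlainAt.vertex u fun b' => ?_, by simpa using huw⟩
        rw [← hd u b' huv huw]
        exact (ih b').1

variable [DecidableEq R]

lemma exists_comb_of_leaf (K : Type u) [Field K] [Finite R] (g : Net m R (Fin m ⊕ R))
    (h : ∀ v, ∃ l, g (inl (v, false)) = inr (inl l)) :
    ∃ σ : Equiv.Perm (Fin m ⊕ R), ∀ (X : Type u) [AddCommGroup X] [Module K X]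
      (θ : Net m R (Fin m ⊕ R) → X), IsWeight K θ → θ g = θ (comb σ) := by
  choose l hl using h
  have hinj : Function.Injective l := by
    intro v w hvw
    have : g (inl (v, false)) = g (inl (w, false)) := by rw [hl, hl, hvw]
    simpa using g.injective this
  let τ : Equiv.Perm (Fin m) := Equiv.ofBijective l (Finite.injective_iff_bijective.1 hinj)
  let E : Equiv.Perm (Fin m ⊕ (Fin m ⊕ R)) :=
    (portEquiv m R).symm.trans ((g.rename τ).trans (exch m R).symm)
  have hE v : E (inl v) = inl v := by
    obtain ⟨v, rfl⟩ := τ.surjective v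
    simp [E, portEquiv, Net.rename, hl, exch, τ]
  have hE' : Set.MapsTo E (Set.range inl) (Set.range inl) := by
    rintro _ ⟨v, rfl⟩
    exact ⟨v, (hE v).symm⟩
  obtain ⟨⟨σ₁, σ⟩, hσ⟩ := Equiv.Perm.mem_sumCongrHom_range_of_perm_mapsTo_inl hE'
  have hσ₁ : σ₁ = Equiv.refl _ := by
    ext v
    have := hE v
    rw [← hσ] at this
    simp only [Equiv.Perm.sumCongrHom_apply, Equiv.sumCongr_apply, map_inl, inl.injEq] at this
    simp [this]
  refine ⟨σ, fun X _ _ θ hθ => ?_⟩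
  rw [← hθ.rename g τ]
  congr 1
  have : comb σ = ((portEquiv m R).trans E).trans (exch m R) := by
    rw [← hσ, hσ₁]; rfl
  rw [this]
  ext x
  simp [E]

lemma exists_comb_of_exists_leaf (K : Type u) [Field K] [Finite R] (N : ℕ) (g : Net m R (Fin m ⊕ R))
    (h : ∀ v, ∃ b l, g (inl (v, b)) = inr (inl l))
    (hN : {v | ∀ l, g (inl (v, false)) ≠ inr (inl l)}.ncard ≤ N) :
    ∃ (ε : K) (σ : Equiv.Perm (Fin m ⊕ R)), ∀ (X : Type u) [AddCommGroup X] [Module K X]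
      (θ : Net m R (Fin m ⊕ R) → X), IsWeight K θ → θ g = ε • θ (comb σ) := by
  induction N generalizing g with
  | zero =>
    have h0 : {v | ∀ l, g (inl (v, false)) ≠ inr (inl l)} = ∅ :=
      (Set.ncard_eq_zero).1 (by omega)
    obtain ⟨σ, hσ⟩ := exists_comb_of_leaf K g (fun v => by
      by_contra hc
      push Not at hc
      exact (h0 ▸ (show v ∈ {v | ∀ l, g (inl (v, false)) ≠ inr (inl l)} from hc) :
        v ∈ (∅ : Set (Fin m))))
    exact ⟨1, σ, fun X _ _ θ hθ => by rw [hσ X θ hθ, one_smul]⟩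
  | succ N ih =>
    by_cases hv : ∃ v, ∀ l, g (inl (v, false)) ≠ inr (inl l)
    · obtain ⟨v, hv⟩ := hv
      let g' : Net m R (Fin m ⊕ R) := (Equiv.swap (inl (v, false)) (inl (v, true))).trans g
      have hg' w b : w ≠ v → g' (inl (w, b)) = g (inl (w, b)) := by
        intro hw
        simp only [g', trans_apply]
        rw [swap_apply_of_ne_of_ne] <;> simp [hw]
      have hf : g' (inl (v, false)) = g (inl (v, true)) := by simp [g']
      have ht : g' (inl (v, true)) = g (inl (v, false)) := by simp [g']
      have hvt : ∃ l, g (inl (v, true)) = inr (inl l) := by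
        obtain ⟨b, l, hbl⟩ := h v
        cases b
        · exact absurd hbl (hv l)
        · exact ⟨l, hbl⟩
      obtain ⟨ε, σ, hσ⟩ := ih g' (by
        intro w
        by_cases hw : w = v
        · subst hw
          exact ⟨false, by rw [hf]; exact hvt⟩
        · obtain ⟨b, l, hbl⟩ := h w
          exact ⟨b, l, by rw [hg' w b hw, hbl]⟩) (by
        have : {w | ∀ l, g' (inl (w, false)) ≠ inr (inl l)} ⊂
            {w | ∀ l, g (inl (w, false)) ≠ inr (inl l)} := by
          refine ⟨fun w hw => ?_, fun hc => ?_⟩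
          · by_cases hwv : w = v
            · subst hwv; exact hv
            · simpa [hg' w false hwv] using hw
          · obtain ⟨l, hl⟩ := hvt
            exact hc (show v ∈ {w | ∀ l, g (inl (w, false)) ≠ inr (inl l)} from hv) l
              (hf.trans hl)
        have := Set.ncard_lt_ncard this
        omega)
      refine ⟨-ε, σ, fun X _ _ θ hθ => ?_⟩
      rw [neg_smul, ← hσ X θ hθ, hθ.swap, neg_neg]
    · push Not at hv
      obtain ⟨σ, hσ⟩ := exists_comb_of_leaf K g hv
      exact ⟨1, σ, fun X _ _ θ hθ => by rw [hσ X θ hθ, one_smul]⟩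

lemma exists_coeff (K : Type u) [Field K] [Fintype R] (N : ℕ) (g : Net m R (Fin m ⊕ R))
    (hl : g.Loopless) (hg : g.Rooted) (hN : {v | PlainAt g (inl v)}.ncard ≤ N) :
    ∃ c : Equiv.Perm (Fin m ⊕ R) → K, ∀ (X : Type u) [AddCommGroup X] [Module K X]
      (θ : Net m R (Fin m ⊕ R) → X), IsWeight K θ → θ g = ∑ σ, c σ • θ (comb σ) := by
  induction N generalizing g with
  | zero =>
    have h0 : {v | PlainAt g (inl v)} = ∅ := (Set.ncard_eq_zero).1 (by omega)
    have h1 : ∀ v, ¬ PlainAt g (inl v) := fun v hv =>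
      (h0 ▸ (show v ∈ {v | PlainAt g (inl v)} from hv) : v ∈ (∅ : Set (Fin m)))
    have h2 (l : Fin m) : ∃ v b, g (inl (v, b)) = inr (inl l) := by
      rcases hp : g.symm (inr (inl l)) with ⟨v, b⟩ | r
      · exact ⟨v, b, by rw [← hp]; simp⟩
      · have : g (inr r) = inr (inl l) := by rw [← hp]; simp
        exact absurd (this ▸ PlainAt.leaf l) (hg r)
    choose V b hV using h2
    have hinj : Function.Injective V := by
      intro l l' hll
      by_contra hne
      refine h1 (V l) (PlainAt.vertex _ fun b' => ?_)
      have hb : b l ≠ b l' := by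
        intro hb
        have h3 := hV l
        rw [hll, hb, hV l'] at h3
        simp at h3
        exact hne h3.symm
      have : b' = b l ∨ b' = b l' := by
        revert hb; generalize b l = x; generalize b l' = y
        cases b' <;> cases x <;> cases y <;> simp
      rcases this with rfl | rfl
      · rw [hV]; exact PlainAt.leaf l
      · rw [hll, hV]; exact PlainAt.leaf l'
    have hsurj := Finite.injective_iff_surjective.1 hinj
    obtain ⟨ε, σ, hσ⟩ := exists_comb_of_exists_leaf K _ g (fun v => by
      obtain ⟨l, rfl⟩ := hsurj v
      exact ⟨b l, l, hV l⟩) le_rfl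
    refine ⟨Pi.single σ ε, fun X _ _ θ hθ => ?_⟩
    rw [hσ X θ hθ, sum_eq_single σ]
    · simp
    · intro σ' _ hne
      simp [hne]
    · simp
  | succ N ih =>
    by_cases hw₀ : ∃ w₀, PlainAt g (inl w₀)
    · obtain ⟨w₀, hw₀⟩ := hw₀
      obtain ⟨v, b, w, hvw, hw, hv⟩ := exists_plain_child g hg hw₀
      have hne : v ≠ w := by rintro rfl; exact hv hw
      have hA : ¬ PlainAt g (g (inl (v, !b))) := by
        intro hA
        refine hv (PlainAt.vertex v fun b' => ?_)
        by_cases hb : b' = b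
        · rw [hb, hvw]; exact hw
        · rw [show b' = !b by revert hb; cases b' <;> cases b <;> simp]; exact hA
      have hkid : ∀ b', PlainAt g (g (inl (w, b'))) := (plainAt_vertex_iff g w).1 hw
      have hwv : ∀ b', g (inl (w, b')) ≠ inl v := fun b' h => hv (h ▸ hkid b')
      let d := cycle3 (inl (v, !b) : Port m R) (inl (w, false)) (inl (w, true))
      have n1 : (inl (v, !b) : Port m R) ≠ inl (w, false) := by simp [hne]
      have n2 : (inl (v, !b) : Port m R) ≠ inl (w, true) := by simp [hne]
      have n3 : (inl (w, false) : Port m R) ≠ inl (w, true) := by simp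
      have d1 : d (inl (v, !b)) = inl (w, false) := cycle3_left n1 n2
      have d2 : d (inl (w, false)) = inl (w, true) := cycle3_mid n2 n3
      have d3 : d (inl (w, true)) = inl (v, !b) := cycle3_right
      have key : ∀ e : Equiv.Perm (Port m R), (∀ x, x ≠ inl (v, !b) →
            x ≠ inl (w, false) → x ≠ inl (w, true) → e x = x) →
          (∃ k, e (inl (w, k)) = inl (v, !b)) → (∃ k, e (inl (v, !b)) = inl (w, k)) →
          (∀ k, e (inl (w, k)) = inl (v, !b) ∨ ∃ k', e (inl (w, k)) = inl (w, k')) →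
          ∃ c : Equiv.Perm (Fin m ⊕ R) → K, ∀ (X : Type u) [AddCommGroup X] [Module K X]
            (θ : Net m R (Fin m ⊕ R) → X), IsWeight K θ → θ (e.trans g) = ∑ σ, c σ • θ (comb σ) := by
        intro e he hk hk' hk''
        have evb : e (inl (v, b)) = inl (v, b) := he _ (by simp) (by simp [hne]) (by simp [hne])
        have eu : ∀ u b', u ≠ v → u ≠ w → e (inl (u, b')) = inl (u, b') := fun u b' h h' =>
          he _ (by simp [h]) (by simp [h']) (by simp [h'])
        have hpl : ∀ y, PlainAt (e.trans g) y → PlainAt g y ∧ y ≠ inl w := fun y hy =>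
          PlainAt.of_move hvw hA evb eu hk hy
        refine ih _ ?_ ?_ ?_
        · intro u b'
          simp only [trans_apply]
          by_cases huv : u = v
          · subst huv
            by_cases hb : b' = b
            · subst hb
              rw [evb, hvw]; simpa using hne.symm
            · rw [show b' = !b by revert hb; cases b' <;> cases b <;> simp]
              obtain ⟨k, hk⟩ := hk'
              rw [hk]; exact hwv k
          · by_cases huw : u = w
            · subst huw
              rcases hk'' b' with h | ⟨k', h⟩
              · rw [h]; intro hc; exact hA (hc ▸ hw)
              · rw [h]; exact hl _ _
            · rw [eu u b' huv huw]; exact hl _ _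
        · intro r hr
          have := (hpl _ hr).1
          simp only [trans_apply] at this
          rw [he _ (by simp) (by simp) (by simp)] at this
          exact hg r this
        · have : {u | PlainAt (e.trans g) (inl u)} ⊂ {u | PlainAt g (inl u)} := by
            refine ⟨fun u hu => (hpl _ hu).1, fun hc => ?_⟩
            exact (hpl _ (hc (show w ∈ {u | PlainAt g (inl u)} from hw))).2 rfl
          have := Set.ncard_lt_ncard this
          omega
      obtain ⟨c₁, hc₁⟩ := key d (fun x h1 h2 h3 => cycle3_of_ne h1 h2 h3) ⟨true, d3⟩ ⟨false, d1⟩ (by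
        rintro (_ | _)
        · exact Or.inr ⟨true, d2⟩
        · exact Or.inl d3)
      obtain ⟨c₂, hc₂⟩ := key d.symm (fun x h1 h2 h3 => by
          rw [symm_apply_eq]; exact (cycle3_of_ne h1 h2 h3).symm)
        ⟨false, by rw [symm_apply_eq, d1]⟩ ⟨true, by rw [symm_apply_eq, d3]⟩ (by
        rintro (_ | _)
        · exact Or.inl (by rw [symm_apply_eq, d1])
        · exact Or.inr ⟨false, by rw [symm_apply_eq, d2]⟩)
      refine ⟨-c₁ - c₂, fun X _ _ θ hθ => ?_⟩
      have h := hθ.ihx g v w b hl hne hvw hwv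
      rw [hc₁ X θ hθ, hc₂ X θ hθ, add_assoc] at h
      rw [eq_neg_of_add_eq_zero_left h, ← sum_add_distrib, ← sum_neg_distrib]
      refine sum_congr rfl fun σ _ => ?_
      simp only [Pi.sub_apply, Pi.neg_apply, sub_smul, neg_smul]
      abel
    · push Not at hw₀
      refine ih g hl hg ?_
      have : {v | PlainAt g (inl v)} = ∅ := by
        ext v; simpa using hw₀ v
      rw [this]; simp

end Nets

section NetValue

lemma sum_eq_zero_of_update {ι : Type} [Fintype ι] {P : Type} [Fintype P] [DecidableEq P] (p : P) (F : (P → ι) → K)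
    (h : ∀ γ, ∑ s, F (update γ p s) = 0) : ∑ γ, F γ = 0 := by
  rw [← sum_comp (funSplitAt p ι).symm, sum_prod_type, sum_comm]
  refine sum_eq_zero fun f _ => ?_
  rcases isEmpty_or_nonempty ι with _ | ⟨⟨s₀⟩⟩
  · simp
  · rw [← h ((funSplitAt p ι).symm (s₀, f))]
    refine sum_congr rfl fun s _ => congrArg F ?_
    funext q
    by_cases hq : q = p
    · subst hq; simp [funSplitAt]
    · simp [funSplitAt, hq]

variable {m : ℕ} {R Lf ι : Type} [Fintype R] [Fintype Lf] [Fintype ι]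
  [DecidableEq R] [DecidableEq ι]

/-- The contraction of structure constants `c` along a trivalent graph, with given basis elements at
the leaves and dual basis elements at the roots. -/
def netVal (c : ι → ι → ι → K) (lc : Lf → ι) (rc : R → ι) (g : Net m R Lf) : K :=
  ∑ γ : Port m R → ι,
    (∏ v, c (γ (inl (v, false))) (γ (inl (v, true))) (γ (g.symm (inl v)))) *
      ((∏ r, if γ (inr r) = rc r then 1 else 0) *
        ∏ l, if γ (g.symm (inr l)) = lc l then 1 else 0)

lemma netVal_trans (c : ι → ι → ι → K) (lc : Lf → ι) (rc : R → ι) (g : Net m R Lf)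
    (d : Equiv.Perm (Port m R)) (hd : ∀ r, d (inr r) = inr r) :
    netVal c lc rc (d.trans g) = ∑ γ : Port m R → ι,
    (∏ v, c (γ (d (inl (v, false)))) (γ (d (inl (v, true)))) (γ (g.symm (inl v)))) *
      ((∏ r, if γ (inr r) = rc r then 1 else 0) *
        ∏ l, if γ (g.symm (inr l)) = lc l then 1 else 0) := by
  unfold netVal
  rw [← sum_comp (arrowCongr d.symm (Equiv.refl ι))]
  refine sum_congr rfl fun γ _ => ?_
  simp [arrowCongr, hd]

lemma isWeight_netVal (c : ι → ι → ι → K) (hc : ∀ i j k, c i j k = -c j i k)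
    (hJ : ∀ i j k l, ∑ s, (c i s l * c j k s + c j s l * c k i s + c k s l * c i j s) = 0)
    (lc : Lf → ι) (rc : R → ι) : IsWeight (m := m) K (netVal c lc rc) where
  swap g v := by
    rw [netVal_trans _ _ _ _ _ (fun r => swap_apply_of_ne_of_ne (by simp) (by simp)), netVal,
      ← sum_neg_distrib]
    refine sum_congr rfl fun γ _ => ?_
    rw [← neg_mul]
    congr 1
    rw [← mul_prod_erase _ _ (mem_univ v),
      ← mul_prod_erase univ _ (mem_univ v), ← neg_mul]
    congr 1
    · simp only [Equiv.swap_apply_left, Equiv.swap_apply_right]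
      exact hc _ _ _
    · refine prod_congr rfl fun w hw => ?_
      have hw : w ≠ v := (mem_erase.1 hw).1
      rw [swap_apply_of_ne_of_ne, swap_apply_of_ne_of_ne] <;> simp [hw]
  rename g τ := by
    unfold netVal
    rw [← sum_comp (arrowCongr
      (sumCongr (prodCongr τ (Equiv.refl Bool)) (Equiv.refl R)) (Equiv.refl ι))]
    have hid : ∀ x : Port m R, Sum.map (Prod.map τ.symm (id : Bool → Bool) ∘ Prod.map τ id) id x = x := by
      rintro (⟨v, b⟩ | r) <;> simp
    refine sum_congr rfl fun γ _ => ?_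
    congr 1
    · rw [← Equiv.prod_comp τ]
      simp [arrowCongr, Net.rename, hid]
    · simp [arrowCongr, Net.rename, hid]
  ihx g v w b hg hvw hb hw := by
    have n1 : (inl (v, !b) : Port m R) ≠ inl (w, false) := by simp [hvw]
    have n2 : (inl (v, !b) : Port m R) ≠ inl (w, true) := by simp [hvw]
    have n3 : (inl (w, false) : Port m R) ≠ inl (w, true) := by simp
    set d := cycle3 (inl (v, !b) : Port m R) (inl (w, false)) (inl (w, true)) with hd
    have d0 : ∀ x, x ≠ inl (v, !b) → x ≠ inl (w, false) → x ≠ inl (w, true) →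
      d x = x := fun x h1 h2 h3 => cycle3_of_ne h1 h2 h3
    have d1 : d (inl (v, !b)) = inl (w, false) := cycle3_left n1 n2
    have d2 : d (inl (w, false)) = inl (w, true) := cycle3_mid n2 n3
    have d3 : d (inl (w, true)) = inl (v, !b) := cycle3_right
    have e0 : ∀ x, x ≠ inl (v, !b) → x ≠ inl (w, false) → x ≠ inl (w, true) →
      d.symm x = x := fun x h1 h2 h3 => by rw [symm_apply_eq, d0 x h1 h2 h3]
    have e1 : d.symm (inl (v, !b)) = inl (w, true) := by rw [symm_apply_eq, d3]
    have e2 : d.symm (inl (w, false)) = inl (v, !b) := by rw [symm_apply_eq, d1]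
    have e3 : d.symm (inl (w, true)) = inl (w, false) := by rw [symm_apply_eq, d2]
    have hgw : g.symm (inl w) = inl (v, b) := by rw [symm_apply_eq, hb]
    have dvb : d (inl (v, b)) = inl (v, b) := d0 _ (by simp) (by simp [hvw]) (by simp [hvw])
    have evb : d.symm (inl (v, b)) = inl (v, b) :=
      e0 _ (by simp) (by simp [hvw]) (by simp [hvw])
    rw [netVal_trans c lc rc g d (fun r => d0 _ (by simp) (by simp) (by simp)),
      netVal_trans c lc rc g d.symm (fun r => e0 _ (by simp) (by simp) (by simp)), netVal,
      ← sum_add_distrib, ← sum_add_distrib]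
    refine sum_eq_zero_of_update (inl (v, b)) _ fun γ => ?_
    -- the factors at the other vertices
    set rest : K := (∏ u ∈ (univ.erase v).erase w,
      c (γ (inl (u, false))) (γ (inl (u, true))) (γ (g.symm (inl u)))) *
        ((∏ r, if γ (inr r) = rc r then 1 else 0) *
        ∏ l, if γ (g.symm (inr l)) = lc l then 1 else 0) with hrest
    have upd : ∀ s y, y ≠ inl (v, b) → update γ (inl (v, b)) s y = γ y :=
      fun s y hy => update_of_ne hy _ _
    have term : ∀ (e : Equiv.Perm (Port m R)), (∀ u b', u ≠ v → u ≠ w →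
        e (inl (u, b')) = inl (u, b')) → ∀ s,
        (∏ u, c (update γ (inl (v, b)) s (e (inl (u, false))))
          (update γ (inl (v, b)) s (e (inl (u, true))))
          (update γ (inl (v, b)) s (g.symm (inl u)))) *
        ((∏ r, if update γ (inl (v, b)) s (inr r) = rc r then 1 else 0) *
        ∏ l, if update γ (inl (v, b)) s (g.symm (inr l)) = lc l then 1 else 0)
        = c (update γ (inl (v, b)) s (e (inl (v, false))))
          (update γ (inl (v, b)) s (e (inl (v, true)))) (γ (g.symm (inl v))) *
          c (update γ (inl (v, b)) s (e (inl (w, false))))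
          (update γ (inl (v, b)) s (e (inl (w, true)))) s * rest := by
      intro e he s
      have hgv : g.symm (inl v) ≠ inl (v, b) := by
        intro h; exact hg v b ((symm_apply_eq _).1 h).symm
      have hl l : g.symm (inr l) ≠ inl (v, b) := by
        intro h
        have := ((symm_apply_eq _).1 h).symm
        rw [hb] at this; simp at this
      rw [← mul_prod_erase _ _ (mem_univ v),
        ← mul_prod_erase (univ.erase v) _
          (mem_erase.2 ⟨hvw.symm, mem_univ w⟩), hrest]
      simp only [upd s _ hgv, upd s _ (hl _), hgw, update_self, upd s (inr _) (by simp)]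
      have : ∏ u ∈ (univ.erase v).erase w,
          c (update γ (inl (v, b)) s (e (inl (u, false))))
          (update γ (inl (v, b)) s (e (inl (u, true))))
          (update γ (inl (v, b)) s (g.symm (inl u))) =
          ∏ u ∈ (univ.erase v).erase w, c (γ (inl (u, false))) (γ (inl (u, true)))
            (γ (g.symm (inl u))) := by
        refine prod_congr rfl fun u hu => ?_
        simp only [mem_erase, mem_univ, and_true] at hu
        rw [he u _ hu.2 hu.1, he u _ hu.2 hu.1, upd, upd, upd]
        · intro h
          have := ((symm_apply_eq _).1 h).symm
          rw [hb] at this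
          exact hu.1 (by simpa using this.symm)
        · simp [hu.2]
        · simp [hu.2]
      rw [this]
      ring
    have hT s : _ := term (Equiv.refl _) (fun _ _ _ _ => rfl) s
    simp only [Equiv.refl_apply] at hT
    simp only [hT, term d (fun u b' h h' => d0 _ (by simp [h]) (by simp [h']) (by simp [h'])),
      term d.symm (fun u b' h h' => e0 _ (by simp [h]) (by simp [h']) (by simp [h'])), ← add_mul]
    rw [← sum_mul]
    refine mul_eq_zero_of_left ?_ _
    have a1 : (inl (v, !b) : Port m R) ≠ inl (v, b) := by simp
    have a2 : ∀ b', (inl (w, b') : Port m R) ≠ inl (v, b) := by simp [hvw.symm]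
    have hJ' := hJ (γ (inl (v, !b))) (γ (inl (w, false))) (γ (inl (w, true)))
      (γ (g.symm (inl v)))
    cases b
    · simp only [Bool.not_false] at *
      simp only [d1, d2, d3, e1, e2, e3, dvb, evb, update_self, upd _ _ a1, upd _ _ (a2 _)]
      rw [← neg_eq_zero, ← sum_neg_distrib, ← hJ']
      refine sum_congr rfl fun s _ => ?_
      rw [hc s (γ (inl (v, true))), hc s (γ (inl (w, false))), hc s (γ (inl (w, true)))]
      ring
    · simp only [Bool.not_true] at *
      simp only [d1, d2, d3, e1, e2, e3, dvb, evb, update_self, upd _ _ a1, upd _ _ (a2 _)]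
      exact hJ'

end NetValue

section Detection

variable {m : ℕ} {R : Type} [Fintype R] [DecidableEq R]

lemma netVal_comb {ι : Type} [Fintype ι] [DecidableEq ι] (c : ι → ι → ι → K)
    (lc : Fin m ⊕ R → ι) (rc : R → ι) (σ : Equiv.Perm (Fin m ⊕ R)) :
    netVal c lc rc (comb σ) = ∑ γ : Fin m ⊕ R → ι,
      (∏ v, c (lc (inl v)) (γ (inl v)) (γ (σ.symm (inl v)))) *
        ((∏ r, if γ (inr r) = rc r then 1 else 0) *
          ∏ r, if γ (σ.symm (inr r)) = lc (inr r) then 1 else 0) := by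
  unfold netVal
  rw [← sum_comp (((portEquiv m R).symm.arrowCongr (Equiv.refl ι))),
    ← sum_comp (Equiv.sumArrowEquivProdArrow _ _ _).symm, sum_prod_type,
    sum_comm]
  refine sum_congr rfl fun γ _ => ?_
  rw [sum_eq_single fun v => lc (inl v)]
  · have h1 x : (portEquiv m R) ((comb σ).symm (inl x)) = inr (σ.symm (inl x)) := by simp [comb, exch]
    have h2 x : (portEquiv m R) ((comb σ).symm (inr (inr x)))
        = inr (σ.symm (inr x)) := by simp [comb, exch]
    have h3 x : (portEquiv m R) ((comb σ).symm (inr (inl x))) = inl x := by simp [comb, exch]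
    have p1 v : portEquiv m R (inl (v, false)) = inl v := rfl
    have p2 v : portEquiv m R (inl (v, true)) = inr (inl v) := rfl
    have p3 : ∀ r, portEquiv m R (inr r) = inr (inr r) := fun v => rfl
    simp [arrowCongr, h1, h2, h3, Equiv.sumArrowEquivProdArrow, p1, p2, p3,
      Fintype.prod_sum_type]
  · intro γ₁ _ hne
    obtain ⟨v, hv⟩ := Function.ne_iff.1 hne
    refine mul_eq_zero_of_right _ (mul_eq_zero_of_right _
      (Finset.prod_eq_zero (mem_univ (inl v)) ?_))
    have h3 x : (portEquiv m R) ((comb σ).symm (inr (inl x))) = inl x := by simp [comb, exch]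
    simp [arrowCongr, h3, Equiv.sumArrowEquivProdArrow, hv]
  · simp

/-- The structure constants of the Lie algebra of matrices with rows `X` and columns `X ⊕ T`. -/
def unitConst (K : Type u) [Field K] (X T : Type) [DecidableEq X] [DecidableEq T]
    (i j k : X × (X ⊕ T)) : K :=
  (if i.2 = inl j.1 ∧ k = (i.1, j.2) then 1 else 0) -
    (if j.2 = inl i.1 ∧ k = (j.1, i.2) then 1 else 0)

/-- The rows of the leaves and the columns of their test matrices. -/
abbrev leafCol {t : ℕ} (σ₀ : Equiv.Perm (Fin m ⊕ R)) :
    Fin m ⊕ R → (Fin m ⊕ R) × ((Fin m ⊕ R) ⊕ Fin (t + 1)) :=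
  elim (fun v => (inl v, inl (σ₀ (inl v)))) fun r => (inr r, inr 0)

/-- The rows of the roots and the columns of their test matrices. -/
abbrev rootCol {t : ℕ} (σ₀ : Equiv.Perm (Fin m ⊕ R)) (r : R) :
    (Fin m ⊕ R) × ((Fin m ⊕ R) ⊕ Fin (t + 1)) := (σ₀ (inr r), inr 0)

/-- The kind of a column. -/
def kind {X T : Type} : X ⊕ T → Option X := elim some fun _ => none

/-- The factor of a vertex, up to the choice of columns of the second kind. -/
def kindFactor (K : Type u) [Field K] {X : Type} [DecidableEq X] (x y : X)
    (p q : X × Option X) : K :=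
  (if p.1 = y ∧ q = (x, p.2) then 1 else 0) - (if p.2 = some x ∧ q = (p.1, some y) then 1 else 0)

lemma unitConst_eq {X T : Type} [DecidableEq X] [DecidableEq T] (x y : X)
    (p q : X × (X ⊕ T)) [Decidable (∀ j, p.2 = inr j → q.2 = inr j)] :
    unitConst K X T (x, inl y) p q = if ∀ j, p.2 = inr j → q.2 = inr j then
      kindFactor K x y (p.1, kind p.2) (q.1, kind q.2) else 0 := by
  obtain ⟨a, b⟩ := p
  obtain ⟨c, d⟩ := q
  rcases b with b | b <;> rcases d with d | d <;>
    simp [unitConst, kindFactor, kind, ext_iff, eq_comm]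
  split_ifs <;> simp_all

variable (σ₀ σ : Equiv.Perm (Fin m ⊕ R))

/-- The contribution of a choice of kinds. -/
def kindWeight (K : Type u) [Field K] (s : Fin m ⊕ R → (Fin m ⊕ R) × Option (Fin m ⊕ R)) : K :=
  (∏ v, kindFactor K (inl v) (σ₀ (inl v)) (s (inl v)) (s (σ.symm (inl v)))) *
    ((∏ r, if s (inr r) = (σ₀ (inr r), none) then 1 else 0) *
      ∏ r, if s (σ.symm (inr r)) = (inr r, none) then 1 else 0)

lemma kindWeight_self : kindWeight σ₀ σ₀ K (fun x => (σ₀ x, none)) = 1 := by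
  simp [kindWeight, kindFactor]

lemma kindWeight_ne_zero {s : Fin m ⊕ R → (Fin m ⊕ R) × Option (Fin m ⊕ R)}
    (h : kindWeight σ₀ σ K s ≠ 0) :
    (∀ x, (s x).2 = none → (s (σ x)).2 = none ∧ (s x).1 = σ₀ x ∧ σ x = σ₀ x) ∧
      (∀ r, (s (inr r)).2 = none) ∧ ∀ x, (s (σ x)).2 = none → (s x).2 = none := by
  simp only [kindWeight, mul_ne_zero_iff, prod_ne_zero_iff, mem_univ, true_imp_iff, ne_eq,
    ite_eq_right_iff, one_ne_zero, imp_false, not_not] at h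
  obtain ⟨h1, g2, g3⟩ := h
  have g1 x (hx : (s x).2 = none) : (s x).1 = σ₀ x ∧ s (σ.symm x) = (x, none) := by
    rcases x with v | r
    · simpa [kindFactor, hx] using h1 v
    · exact ⟨by rw [g2], g3 r⟩
  have g4 x (hx : (s (σ.symm x)).2 = none) : (s x).2 = none := by
    rcases x with v | r
    · by_contra hne
      refine h1 v ?_
      rw [kindFactor, if_neg, if_neg, sub_zero]
      · rintro ⟨-, h⟩; simp [h] at hx
      · rintro ⟨-, h⟩; exact hne (by rw [h] at hx; exact hx)
    · rw [g2]
  refine ⟨fun x hx => ?_, fun r => by rw [g2], fun x hx => ?_⟩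
  · have hy : (s (σ x)).2 = none := g4 _ (by simpa using hx)
    have := (g1 _ hy).2
    simp only [symm_apply_apply] at this
    exact ⟨hy, (g1 x hx).1, by rw [← (g1 x hx).1, this]⟩
  · have := (g1 _ hx).2
    simp only [symm_apply_apply] at this
    rw [this]

/-- The cycles without roots on which all columns are of the second kind. -/
abbrev FreeCycle (s : Fin m ⊕ R → (Fin m ⊕ R) × Option (Fin m ⊕ R)) : Type :=
  {ω : Quotient (Equiv.Perm.SameCycle.setoid σ₀) // ∃ x, Quotient.mk _ x = ω ∧ (s x).2 = none ∧
    ∀ r, ¬ σ₀.SameCycle (inr r) x}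

/-- The choices of columns that contribute. -/
def Compatible {t : ℕ} (γ : Fin m ⊕ R → (Fin m ⊕ R) × ((Fin m ⊕ R) ⊕ Fin (t + 1))) : Prop :=
  (∀ v j, (γ (inl v)).2 = inr j → (γ (σ.symm (inl v))).2 = inr j) ∧
    (∀ r, (γ (inr r)).2 = inr 0) ∧ ∀ r, (γ (σ.symm (inr r))).2 = inr 0

lemma sameCycle_closed {α : Type} [Finite α] (τ : Equiv.Perm α) (P : α → Prop)
    (hP : ∀ x, P x → P (τ x)) {x y : α} (h : τ.SameCycle x y) (hx : P x) : P y := by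
  obtain ⟨i, -, rfl⟩ := h.exists_pow_eq'
  clear h
  induction i with
  | zero => simpa using hx
  | succ i ih => rw [pow_succ', Equiv.Perm.mul_apply]; exact hP _ ih

open Classical in
lemma card_compatible {t : ℕ} (s : Fin m ⊕ R → (Fin m ⊕ R) × Option (Fin m ⊕ R))
    (h : kindWeight σ₀ σ K s ≠ 0) :
    Nat.card {γ : Fin m ⊕ R → (Fin m ⊕ R) × ((Fin m ⊕ R) ⊕ Fin (t + 1)) //
      (∀ x, ((γ x).1, kind (γ x).2) = s x) ∧ Compatible σ γ} = (t + 1) ^ Nat.card (FreeCycle σ₀ s) := by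
  obtain ⟨h1, h2, h3⟩ := kindWeight_ne_zero σ₀ σ h
  have hcard : (t + 1) ^ Nat.card (FreeCycle σ₀ s) = Nat.card (FreeCycle σ₀ s → Fin (t + 1)) := by
    rw [Nat.card_fun, Nat.card_fin]
  rw [hcard]
  let Ψ : (FreeCycle σ₀ s → Fin (t + 1)) →
      Fin m ⊕ R → (Fin m ⊕ R) × ((Fin m ⊕ R) ⊕ Fin (t + 1)) := fun f x =>
    ((s x).1, match (s x).2 with
      | some d => inl d
      | none => inr (if hx : ∃ y, (Quotient.mk (Equiv.Perm.SameCycle.setoid σ₀) y) =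
          Quotient.mk _ x ∧ (s y).2 = none ∧ ∀ r, ¬ σ₀.SameCycle (inr r) y
            then f ⟨Quotient.mk _ x, hx⟩ else 0))
  have Ψn : ∀ f x, (s x).2 = none → (Ψ f x).2 = inr (if hx : ∃ y,
      (Quotient.mk (Equiv.Perm.SameCycle.setoid σ₀) y) = Quotient.mk _ x ∧ (s y).2 = none ∧
        ∀ r, ¬ σ₀.SameCycle (inr r) y then f ⟨Quotient.mk _ x, hx⟩ else 0) := by
    intro f x hx; simp only [Ψ, hx]
  have Ψs : ∀ f x d, (s x).2 = some d → (Ψ f x).2 = inl d := by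
    intro f x d hx; simp only [Ψ, hx]
  have hroot : ∀ r, ¬ ∃ y, (Quotient.mk (Equiv.Perm.SameCycle.setoid σ₀) y) =
      Quotient.mk _ (inr r) ∧ (s y).2 = none ∧ ∀ r, ¬ σ₀.SameCycle (inr r) y := by
    rintro r ⟨y, hy, -, hr⟩
    exact hr r (Quotient.exact hy).symm
  have hcyc x : σ₀.SameCycle x (σ₀ x) := ⟨1, by simp⟩
  have hmk x : (s x).2 = none → (Quotient.mk (Equiv.Perm.SameCycle.setoid σ₀) x) =
      Quotient.mk _ (σ x) := by
    intro hx
    rw [(h1 x hx).2.2]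
    exact Quotient.sound (hcyc x)
  symm
  refine Nat.card_congr (Equiv.ofBijective (fun f => ⟨Ψ f, ?_, ?_, ?_, ?_⟩) ⟨?_, ?_⟩)
  · intro x
    rcases hx : (s x).2 with _ | d
    · rw [Ψn f x hx]; exact Prod.ext rfl hx.symm
    · rw [Ψs f x d hx]; exact Prod.ext rfl hx.symm
  · intro v j hj
    have hv : (s (inl v)).2 = none := by
      rcases hx : (s (inl v)).2 with _ | d
      · rfl
      · rw [Ψs f _ d hx] at hj; simp at hj
    have hv' : (s (σ.symm (inl v))).2 = none := h3 _ (by simpa using hv)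
    have hm := hmk _ hv'
    rw [apply_symm_apply] at hm
    rw [Ψn f _ hv']
    rw [Ψn f _ hv] at hj
    rw [← hj]
    simp only [hm]
  · intro r
    rw [Ψn f _ (h2 r), dif_neg (hroot r)]
  · intro r
    have hv' : (s (σ.symm (inr r))).2 = none := h3 _ (by simpa using h2 r)
    have hm := hmk _ hv'
    rw [apply_symm_apply] at hm
    rw [Ψn f _ hv', dif_neg]
    rw [hm]
    exact hroot r
  · intro f f' hff
    have hff : Ψ f = Ψ f' := congrArg val hff
    funext ⟨ω, x, hx, hs, hr⟩
    subst hx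
    have := congrArg snd (congrFun hff x)
    rw [Ψn f x hs, Ψn f' x hs, dif_pos ⟨x, rfl, hs, hr⟩, dif_pos ⟨x, rfl, hs, hr⟩] at this
    exact inr.inj this
  · rintro ⟨γ, hγ, hc1, hc2, hc3⟩
    have hj x : (s x).2 = none → ∃ j, (γ x).2 = inr j := by
      intro hx
      have := congrArg snd (hγ x)
      rw [hx] at this
      rcases hg : (γ x).2 with d | j
      · simp [hg, kind] at this
      · exact ⟨j, rfl⟩
    have hstep x j : (s x).2 = none → (γ x).2 = inr j → (γ (σ x)).2 = inr j := by
      intro hx hxj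
      obtain ⟨j', hj'⟩ := hj _ (h1 x hx).1
      rcases hy : σ x with v | r
      · rw [hy] at hj'
        have := hc1 v j' hj'
        rw [← hy, symm_apply_apply, hxj] at this
        rw [hj', this]
      · have := hc3 r
        rw [← hy, symm_apply_apply, hxj] at this
        rw [hc2 r, this]
    have hclass x y j : (s x).2 = none → (γ x).2 = inr j → σ₀.SameCycle x y →
        (s y).2 = none ∧ (γ y).2 = inr j := by
      intro hx hxj hxy
      refine sameCycle_closed σ₀ (fun y => (s y).2 = none ∧ (γ y).2 = inr j) ?_ hxy ⟨hx, hxj⟩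
      rintro y ⟨hy, hyj⟩
      rw [← (h1 y hy).2.2]
      exact ⟨(h1 y hy).1, hstep y j hy hyj⟩
    choose! J hJ using hj
    let f₀ : FreeCycle σ₀ s → Fin (t + 1) := fun ω => J ω.2.choose
    have hΨ : Ψ f₀ = γ := by
      funext x
      have hx1 := hγ x
      have hx2 : (s x).1 = (γ x).1 := by rw [← hx1]
      rcases hx : (s x).2 with _ | d
      · refine Prod.ext hx2 ?_
        refine (Ψn f₀ x hx).trans ?_
        split_ifs with hy
        · have hy' := hy.choose_spec
          exact ((hclass _ x _ hy'.2.1 (hJ _ hy'.2.1) (Quotient.exact hy'.1)).2).symm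
        · push Not at hy
          obtain ⟨r, hr⟩ := hy x rfl hx
          exact ((hclass _ x 0 (h2 r) (hc2 r) hr).2).symm
      · refine Prod.ext hx2 ?_
        refine (Ψs f₀ x d hx).trans ?_
        rw [← hx1] at hx
        rcases hg : (γ x).2 with d' | j
        · simp [hg, kind] at hx; rw [hx]
        · simp [hg, kind] at hx
    exact ⟨f₀, Subtype.ext hΨ⟩

open Classical in
lemma netVal_comb_unitConst {t : ℕ} :
    netVal (unitConst K (Fin m ⊕ R) (Fin (t + 1))) (leafCol σ₀) (rootCol σ₀) (comb σ) = ∑ s, kindWeight σ₀ σ K s * ((t + 1 : ℕ) : K) ^ Nat.card (FreeCycle σ₀ s) := by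
  rw [netVal_comb]
  have hterm : ∀ γ : Fin m ⊕ R → (Fin m ⊕ R) × ((Fin m ⊕ R) ⊕ Fin (t + 1)),
      (∏ v, unitConst K (Fin m ⊕ R) (Fin (t + 1)) (leafCol σ₀ (inl v)) (γ (inl v)) (γ (σ.symm (inl v)))) *
        ((∏ r, if γ (inr r) = rootCol σ₀ r then 1 else 0) *
          ∏ r, if γ (σ.symm (inr r)) = leafCol σ₀ (inr r) then 1 else 0) =
      if Compatible σ γ then kindWeight σ₀ σ K (fun x => ((γ x).1, kind (γ x).2)) else 0 := by
    intro γ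
    have hr : ∀ (p : (Fin m ⊕ R) × ((Fin m ⊕ R) ⊕ Fin (t + 1))) x,
        (if p = (x, inr 0) then (1 : K) else 0) =
          if p.2 = inr 0 then (if (p.1, kind p.2) = (x, none) then 1 else 0) else 0 := by
      rintro ⟨a, b | b⟩ x <;> simp [kind, ext_iff]
      split_ifs <;> simp_all
    change (∏ v, unitConst K (Fin m ⊕ R) (Fin (t + 1)) (inl v, inl (σ₀ (inl v)))
      (γ (inl v)) (γ (σ.symm (inl v)))) *
        ((∏ r, if γ (inr r) = (σ₀ (inr r), inr 0) then 1 else 0) *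
          ∏ r, if γ (σ.symm (inr r)) = (inr r, inr 0) then 1 else 0) = _
    simp only [unitConst_eq, hr]
    rw [prod_ite_zero, prod_ite_zero (p := fun r => (γ (inr r)).2 = inr 0),
      prod_ite_zero (p := fun r => (γ (σ.symm (inr r))).2 = inr 0), ite_zero_mul_ite_zero,
      ite_zero_mul_ite_zero]
    simp only [mem_univ, true_imp_iff]
    exact if_congr Iff.rfl rfl rfl
  simp only [hterm]
  rw [← Finset.sum_fiberwise (g := fun γ x => ((γ x).1, kind (γ x).2))]
  refine sum_congr rfl fun s _ => ?_
  have h1 : ∀ γ ∈ univ.filter (fun γ : Fin m ⊕ R → (Fin m ⊕ R) × ((Fin m ⊕ R) ⊕ Fin (t + 1)) =>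
      (fun x => ((γ x).1, kind (γ x).2)) = s),
      (if Compatible σ γ then kindWeight σ₀ σ K (fun x => ((γ x).1, kind (γ x).2)) else 0) =
        kindWeight σ₀ σ K s * if Compatible σ γ then 1 else 0 := by
    intro γ hγ
    rw [(mem_filter.1 hγ).2, mul_ite, mul_one, mul_zero]
  rw [sum_congr rfl h1, ← mul_sum]
  by_cases h0 : kindWeight σ₀ σ K s = 0
  · rw [h0, zero_mul, zero_mul]
  · rw [← Nat.cast_pow, ← card_compatible σ₀ σ s h0, Finset.sum_boole, Finset.filter_filter,
      Nat.card_eq_fintype_card, card_subtype]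
    simp only [funext_iff]

lemma freeCycle_full {s : Fin m ⊕ R → (Fin m ⊕ R) × Option (Fin m ⊕ R)}
    (h : kindWeight σ₀ σ K s ≠ 0)
    (hk : Nat.card (FreeCycle σ₀ s) = Nat.card (FreeCycle σ₀ fun x => (σ₀ x, none))) :
    σ = σ₀ ∧ s = fun x => (σ₀ x, none) := by
  obtain ⟨h1, h2, -⟩ := kindWeight_ne_zero σ₀ σ h
  have hcl : ∀ {x y}, σ₀.SameCycle x y → (s x).2 = none → (s y).2 = none := by
    intro x y hxy hx
    refine sameCycle_closed σ₀ (fun y => (s y).2 = none) (fun y hy => ?_) hxy hx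
    rw [← (h1 y hy).2.2]; exact (h1 y hy).1
  let f : FreeCycle σ₀ s → FreeCycle σ₀ fun x => (σ₀ x, (none : Option (Fin m ⊕ R))) := fun ω =>
    ⟨ω.1, ω.2.imp fun x hx => ⟨hx.1, rfl, hx.2.2⟩⟩
  have hf : Function.Injective f := fun a b hab => by
    have := congrArg val hab
    exact Subtype.ext this
  have hsurj := ((Nat.bijective_iff_injective_and_card f).2 ⟨hf, hk⟩).2
  have hall x : (s x).2 = none := by
    by_cases hx : ∃ r, σ₀.SameCycle (inr r) x
    · obtain ⟨r, hr⟩ := hx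
      exact hcl hr (h2 r)
    · push Not at hx
      obtain ⟨ω, hω⟩ := hsurj ⟨Quotient.mk _ x, x, rfl, rfl, hx⟩
      obtain ⟨y, hy, hs, -⟩ := ω.2
      have : ω.1 = Quotient.mk _ x := congrArg val hω
      rw [this] at hy
      exact hcl (Quotient.exact hy) hs
  exact ⟨Equiv.ext fun x => (h1 x (hall x)).2.2,
    funext fun x => Prod.ext (h1 x (hall x)).2.1 (hall x)⟩

lemma coeff_eq_zero_of_netVal_comb [CharZero K] (U : Equiv.Perm (Fin m ⊕ R) → K)
    (hU : ∀ t : ℕ, ∑ σ, U σ * netVal (unitConst K (Fin m ⊕ R) (Fin (t + 1))) (leafCol σ₀)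
      (rootCol σ₀) (comb σ) = 0) : U σ₀ = 0 := by
  classical
  let P : Polynomial K := ∑ σ, ∑ s, Polynomial.C (U σ * kindWeight σ₀ σ K s) *
    Polynomial.X ^ Nat.card (FreeCycle σ₀ s)
  have hP : P = 0 := by
    refine Polynomial.eq_zero_of_infinite_isRoot P (Set.infinite_of_injective_forall_mem
      (f := fun t : ℕ => ((t + 1 : ℕ) : K)) (fun a b hab => by simpa using hab) fun t => ?_)
    change P.eval _ = 0
    rw [← hU t]
    simp only [P, Polynomial.eval_finsetSum, Polynomial.eval_mul, Polynomial.eval_C,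
      Polynomial.eval_pow, Polynomial.eval_X, netVal_comb_unitConst, mul_sum, mul_assoc]
  have hc := congrArg (fun Q => Q.coeff (Nat.card (FreeCycle σ₀ fun x => (σ₀ x, none)))) hP
  simp only [P, Polynomial.finsetSum_coeff, Polynomial.coeff_C_mul, Polynomial.coeff_X_pow,
    Polynomial.coeff_zero] at hc
  rw [sum_eq_single σ₀, sum_eq_single fun x => (σ₀ x, none)] at hc
  · simpa [kindWeight_self] using hc
  · intro s _ hs
    by_cases hw : kindWeight σ₀ σ₀ K s = 0
    · simp [hw]
    · rw [if_neg, mul_zero]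
      intro hk
      exact hs (freeCycle_full σ₀ σ₀ hw hk.symm).2
  · simp
  · intro σ _ hσ
    refine sum_eq_zero fun s _ => ?_
    by_cases hw : kindWeight σ₀ σ K s = 0
    · simp [hw]
    · rw [if_neg, mul_zero]
      intro hk
      exact hσ (freeCycle_full σ₀ σ hw hk.symm).1
  · simp

end Detection

section MatrixLie

variable (K) (X T : Type) [Fintype X] [Fintype T] [DecidableEq X] [DecidableEq T]

/-- Matrices with rows `X` and columns `X ⊕ T`, as the Lie algebra of the square matrices in which
the rows in `T` vanish. -/
def UnitLie : Type u := Matrix X (X ⊕ T) K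

namespace UnitLie

variable {K X T}

/-- The underlying matrix. -/
def mat (A : UnitLie K X T) : Matrix X (X ⊕ T) K := A

instance : AddCommGroup (UnitLie K X T) := inferInstanceAs (AddCommGroup (Matrix X (X ⊕ T) K))
instance : Module K (UnitLie K X T) := inferInstanceAs (Module K (Matrix X (X ⊕ T) K))

/-- The square part of a matrix. -/
def square (A : UnitLie K X T) : Matrix X X K := Matrix.submatrix A.mat id inl

instance : Bracket (UnitLie K X T) (UnitLie K X T) :=
  ⟨fun A B => (A.square * B.mat - B.square * A.mat : Matrix X (X ⊕ T) K)⟩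

lemma mat_injective : Function.Injective (mat : UnitLie K X T → _) := fun _ _ h => h

lemma mat_bracket (A B : UnitLie K X T) :
    (⁅A, B⁆ : UnitLie K X T).mat = A.square * B.mat - B.square * A.mat := rfl

lemma mat_add (A B : UnitLie K X T) : (A + B).mat = A.mat + B.mat := rfl

lemma mat_smul (r : K) (A : UnitLie K X T) : (r • A).mat = r • A.mat := rfl

lemma mat_zero : (0 : UnitLie K X T).mat = 0 := rfl

lemma square_add (A B : UnitLie K X T) : (A + B).square = A.square + B.square := rfl

lemma square_smul (r : K) (A : UnitLie K X T) : (r • A).square = r • A.square := rfl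

lemma square_bracket (A B : UnitLie K X T) :
    (⁅A, B⁆ : UnitLie K X T).square = A.square * B.square - B.square * A.square := by
  ext i j
  simp [square, mat_bracket, Matrix.mul_apply, Matrix.sub_apply]

instance : LieRing (UnitLie K X T) where
  add_lie A B C := mat_injective (by
    simp only [mat_bracket, mat_add, square_add, Matrix.add_mul, Matrix.mul_add]; abel)
  lie_add A B C := mat_injective (by
    simp only [mat_bracket, mat_add, square_add, Matrix.add_mul, Matrix.mul_add]; abel)
  lie_self A := mat_injective (by rw [mat_bracket, mat_zero, sub_self])
  leibniz_lie A B C := mat_injective (by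
    simp only [mat_bracket, mat_add, square_bracket, Matrix.mul_sub, Matrix.sub_mul,
      ← Matrix.mul_assoc]
    abel)

instance : LieAlgebra K (UnitLie K X T) where
  lie_smul r A B := mat_injective (by
    simp only [mat_bracket, mat_smul, square_smul, Matrix.mul_smul, Matrix.smul_mul, smul_sub])

end UnitLie

/-- The numbering of the matrix units. -/
def unitIndex : X × (X ⊕ T) ≃ Fin (card (X × (X ⊕ T))) := Fintype.equivFin _

/-- `UnitLie` with the basis of matrix units. -/
def unitLie : BasedLie K where
  carrier := UnitLie K X T
  dim := card (X × (X ⊕ T))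
  basis := ((stdBasis K X (X ⊕ T)).reindex (unitIndex X T) :
    Module.Basis _ K (Matrix X (X ⊕ T) K))

lemma unitLie_c (i j k : X × (X ⊕ T)) :
    (unitLie K X T).c (unitIndex X T i) (unitIndex X T j) (unitIndex X T k) =
      unitConst K X T i j k := by
  have hb i : (unitLie K X T).basis (unitIndex X T i) = (single i.1 i.2 1 : Matrix X (X ⊕ T) K) := by
    change ((stdBasis K X (X ⊕ T)).reindex (unitIndex X T)) (unitIndex X T i) = _
    rw [Module.Basis.reindex_apply, symm_apply_apply, ← Matrix.stdBasis_eq_single]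
  have hr (M : Matrix X (X ⊕ T) K) : (unitLie K X T).basis.repr M (unitIndex X T k) = M k.1 k.2 := by
    change ((stdBasis K X (X ⊕ T)).reindex (unitIndex X T)).repr M (unitIndex X T k) = _
    rw [Module.Basis.repr_reindex_apply, symm_apply_apply]
    rfl
  unfold BasedLie.c
  rw [hb, hb]
  refine (hr _).trans ?_
  change (UnitLie.square (single i.1 i.2 1 : Matrix X (X ⊕ T) K) *
    (single j.1 j.2 1 : Matrix X (X ⊕ T) K) -
    UnitLie.square (single j.1 j.2 1 : Matrix X (X ⊕ T) K) *
    (single i.1 i.2 1 : Matrix X (X ⊕ T) K) : Matrix X (X ⊕ T) K) k.1 k.2 = _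
  rw [Matrix.sub_apply]
  obtain ⟨a, b⟩ := i
  obtain ⟨c, d⟩ := j
  obtain ⟨e, f⟩ := k
  have hs (a : X) (b : X ⊕ T) (c : X) (d : X ⊕ T) :
      (UnitLie.square (single a b 1 : Matrix X (X ⊕ T) K) *
        (single c d 1 : Matrix X (X ⊕ T) K)) e f =
          if b = inl c ∧ (e, f) = (a, d) then (1 : K) else 0 := by
    have hq : ∀ x, UnitLie.square (single a b 1 : Matrix X (X ⊕ T) K) e x =
      (single a b 1 : Matrix X (X ⊕ T) K) e (inl x) := fun _ => rfl
    rw [Matrix.mul_apply, sum_eq_single c]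
    · rw [hq]
      simp only [Matrix.single_apply, Prod.mk.injEq]
      rcases eq_or_ne a e with rfl | h2 <;> rcases eq_or_ne d f with rfl | h3 <;>
        by_cases h1 : b = inl c <;> simp_all [Ne.symm]
    · intro x _ hx
      rw [Matrix.single_apply, if_neg (fun h => hx h.1.symm), mul_zero]
    · simp
  exact congrArg₂ _ (hs a b c d) (hs c d a b)

end MatrixLie

section StructureConstants

variable (L : BasedLie K)

lemma BasedLie.bracket_basis (i j : Fin L.dim) :
    ⁅L.basis i, L.basis j⁆ = ∑ k, L.c i j k • L.basis k :=
  (L.basis.sum_repr _).symm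

lemma BasedLie.c_antisymm (i j k : Fin L.dim) : L.c i j k = -L.c j i k := by
  unfold BasedLie.c
  rw [← lie_skew, map_neg, Finsupp.neg_apply]

lemma BasedLie.c_jacobi (i j k l : Fin L.dim) :
    ∑ s, (L.c i s l * L.c j k s + L.c j s l * L.c k i s + L.c k s l * L.c i j s) = 0 := by
  have h i j k : ∑ s, L.c i s l * L.c j k s =
      L.basis.repr ⁅L.basis i, ⁅L.basis j, L.basis k⁆⁆ l := by
    rw [L.bracket_basis j k, lie_sum, map_sum, Finsupp.finsetSum_apply]
    refine sum_congr rfl fun s _ => ?_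
    rw [lie_smul, map_smul, Finsupp.smul_apply, smul_eq_mul, mul_comm]
    rfl
  rw [sum_add_distrib, sum_add_distrib, h, h, h, ← Finsupp.add_apply, ← map_add,
    ← Finsupp.add_apply, ← map_add, lie_jacobi, map_zero, Finsupp.zero_apply]

end StructureConstants

section Under

variable {m : ℕ} {R Lf : Type}

/-- The vertices and leaves below a root. -/
inductive Net.Under (g : Net m R Lf) (r : R) : Fin m ⊕ Lf → Prop
  | root : Under g r (g (inr r))
  | step (v : Fin m) (b : Bool) (h : Under g r (inl v)) : Under g r (g (inl (v, b)))

lemma Net.Under.inv {g : Net m R Lf} {r : R} {y : Fin m ⊕ Lf} (h : g.Under r y) :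
    g.symm y = inr r ∨ ∃ v b, g.symm y = inl (v, b) ∧ g.Under r (inl v) := by
  cases h with
  | root => exact Or.inl (by simp)
  | step v b h => exact Or.inr ⟨v, b, by simp, h⟩

lemma Net.Under.unique {g : Net m R Lf} {r r' : R} {y : Fin m ⊕ Lf} (h : g.Under r y)
    (h' : g.Under r' y) : r = r' := by
  induction h with
  | root =>
    rcases h'.inv with h | ⟨v, b, h, -⟩
    · simpa using h
    · simp at h
  | step v b _ ih =>
    rcases h'.inv with h | ⟨w, b', h, hw⟩
    · simp at h
    · simp only [symm_apply_apply, inl.injEq, Prod.mk.injEq] at h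
      exact ih (h.1 ▸ hw)

lemma Net.exists_under_leaf (g : Net m R Lf) (r : R) : ∃ l, g.Under r (inr l) := by
  by_contra hc
  push Not at hc
  let S := {v : Fin m // g.Under r (inl v)}
  have hv : ∀ y, g.Under r y → ∃ v : S, y = inl v.1 := by
    rintro (v | l) h
    · exact ⟨⟨v, h⟩, rfl⟩
    · exact absurd h (hc l)
  let p : Option (S × Bool) → Port m R := fun o => o.elim (inr r) fun q => inl (q.1.1, q.2)
  have hp : Function.Injective p := by
    rintro (_ | ⟨⟨v, hv⟩, b⟩) (_ | ⟨⟨w, hw⟩, b'⟩) h <;> simp [p] at h ⊢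
    exact ⟨Subtype.ext h.1, h.2⟩
  have hu : ∀ o, g.Under r (g (p o)) := by
    rintro (_ | ⟨⟨v, hv⟩, b⟩)
    · exact Net.Under.root
    · exact Net.Under.step v b hv
  choose f hf using fun o => hv _ (hu o)
  have hfi : Function.Injective f := fun a b hab =>
    hp (g.injective (by rw [hf, hf, hab]))
  have := Nat.card_le_card_of_injective f hfi
  rw [Finite.card_option, Nat.card_prod] at this
  simp at this
  omega

lemma Net.Under.of_trans {g : Net m R Lf} {d : Equiv.Perm (Port m R)}
    (hr : ∀ r, d (inr r) = inr r) {r : R}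
    (h : ∀ u b, ∃ u' b', d (inl (u, b)) = inl (u', b') ∧
      (g.Under r (inl u) → g.Under r (inl u'))) {y : Fin m ⊕ Lf}
    (hy : Net.Under (d.trans g) r y) : g.Under r y := by
  induction hy with
  | root => rw [trans_apply, hr]; exact Net.Under.root
  | step v b _ ih =>
    obtain ⟨u', b', h1, h2⟩ := h v b
    rw [trans_apply, h1]
    exact Net.Under.step u' b' (h2 ih)

lemma Net.under_swap [DecidableEq R] (g : Net m R Lf) (v : Fin m) (r : R) (y : Fin m ⊕ Lf) :
    Net.Under ((Equiv.swap (inl (v, false)) (inl (v, true))).trans g) r y ↔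
      g.Under r y := by
  have key (g : Net m R Lf) y :
      Net.Under ((Equiv.swap (inl (v, false)) (inl (v, true))).trans g) r y →
        g.Under r y := by
    refine Net.Under.of_trans (fun r => swap_apply_of_ne_of_ne (a := inl (v, false))
      (b := inl (v, true)) (by simp) (by simp)) fun u b => ?_
    by_cases hu : u = v
    · subst hu
      refine ⟨u, !b, ?_, id⟩
      cases b <;> simp
    · exact ⟨u, b, swap_apply_of_ne_of_ne (by simp [hu]) (by simp [hu]), id⟩
  refine ⟨key g y, fun h => key _ y ?_⟩
  have h2 : (Equiv.swap (inl (v, false)) (inl (v, true))).trans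
      ((Equiv.swap (inl (v, false)) (inl (v, true))).trans g) = g := by
    ext x
    simp
  rw [h2]
  exact h

lemma Net.under_move {g : Net m R Lf} {v w : Fin m} {b : Bool}
    (hg : g (inl (v, b)) = inl w) {d : Equiv.Perm (Port m R)}
    (hd : ∀ x, (∀ b', x ≠ inl (v, b')) → (∀ b', x ≠ inl (w, b')) → d x = x) {r : R} {y : Fin m ⊕ Lf}
    (h : Net.Under (d.trans g) r y) : g.Under r y := by
  refine Net.Under.of_trans (fun r => hd _ (by simp) (by simp)) (fun u b' => ?_) h
  have e1 (h : g.Under r (inl v)) : g.Under r (inl w) := hg ▸ Net.Under.step v b h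
  have e2 (h : g.Under r (inl w)) : g.Under r (inl v) := by
    have hs : g.symm (inl w) = inl (v, b) := by rw [symm_apply_eq, hg]
    rcases h.inv with h | ⟨u, b', h, hu⟩ <;> simp_all
  by_cases hu : u = v ∨ u = w
  · obtain ⟨u', b'', h1, h2⟩ : ∃ u' b'', d (inl (u, b')) = inl (u', b'') ∧ (u' = v ∨ u' = w) := by
      by_contra! hc
      have h := hd (d (inl (u, b'))) (fun c h => (hc _ _ h).1 rfl) fun c h => (hc _ _ h).2 rfl
      have := hc u b' (d.injective h)
      tauto
    refine ⟨u', b'', h1, ?_⟩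
    rcases hu with rfl | rfl <;> rcases h2 with rfl | rfl
    exacts [id, e1, e2, id]
  · push Not at hu
    exact ⟨u, b', hd _ (by simp [hu.1]) (by simp [hu.2]), id⟩

lemma Net.Under.rename {g : Net m R Lf} (τ : Equiv.Perm (Fin m)) {r : R} {y : Fin m ⊕ Lf}
    (h : g.Under r y) : (g.rename τ).Under r (Sum.map τ id y) := by
  induction h with
  | root =>
    have : (g.rename τ) (inr r) = Sum.map τ id (g (inr r)) := by simp [Net.rename]
    rw [← this]; exact Net.Under.root
  | step v b _ ih =>
    have : (g.rename τ) (inl (τ v, b)) = Sum.map τ id (g (inl (v, b))) := by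
      simp [Net.rename]
    rw [← this]; exact Net.Under.step _ b ih

/-- The leaves below the roots. -/
def Net.leaves (g : Net m R Lf) : R → Lf → Prop := fun r l => g.Under r (inr l)

lemma Net.leaves_move {g : Net m R Lf} {v w : Fin m} {b : Bool} (hg : g (inl (v, b)) = inl w)
    {d : Equiv.Perm (Port m R)} (hb : d (inl (v, b)) = inl (v, b))
    (hd : ∀ x, (∀ b', x ≠ inl (v, b')) → (∀ b', x ≠ inl (w, b')) → d x = x) :
    Net.leaves (d.trans g) = Net.leaves g := by
  funext r l
  refine propext ⟨Net.under_move hg hd, fun h => ?_⟩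
  refine Net.under_move (g := d.trans g) (d := d.symm) (b := b) (v := v) (w := w)
    (by rw [trans_apply, hb, hg]) (fun x h1 h2 => by rw [symm_apply_eq, hd x h1 h2]) ?_
  rwa [show d.symm.trans (d.trans g) = g by ext x; simp]

variable [DecidableEq R] {X : Type u} [AddCommGroup X] [Module K X]

open Classical in
lemma IsWeight.restrict_leaves {θ : Net m R Lf → X} (hθ : IsWeight K θ) (ρ : R → Lf → Prop) :
    IsWeight K fun g => if Net.leaves g = ρ then θ g else 0 where
  swap g v := by
    have : Net.leaves ((Equiv.swap (inl (v, false)) (inl (v, true))).trans g)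
        = Net.leaves g := by
      funext r l; exact propext (Net.under_swap g v r _)
    simp only [this, hθ.swap]
    split_ifs <;> simp
  rename g τ := by
    have : (g.rename τ).leaves = Net.leaves g := by
      funext r l
      refine propext ⟨fun h => ?_, fun h => h.rename τ⟩
      have h2 := Net.Under.rename τ.symm h
      have h3 : Net.rename τ.symm (Net.rename τ g) = g := by
        ext x
        rcases x with ⟨v, b⟩ | r <;> simp [Net.rename]
      rw [h3] at h2
      exact h2
    simp only [this, hθ.rename]
  ihx g v w b hl hvw hb hw := by
    have h := hθ.ihx g v w b hl hvw hb hw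
    set d := cycle3 (inl (v, !b) : Port m R) (inl (w, false)) (inl (w, true)) with hd
    have d0 x (h1 : ∀ b', x ≠ inl (v, b')) (h2 : ∀ b', x ≠ inl (w, b')) : d x = x :=
      cycle3_of_ne (h1 _) (h2 _) (h2 _)
    have d1 : d (inl (v, b)) = inl (v, b) := cycle3_of_ne (by simp) (by simp [hvw]) (by simp [hvw])
    rw [Net.leaves_move hb d1 d0, Net.leaves_move hb (d := d.symm) (by rw [symm_apply_eq, d1])
      fun x h1 h2 => by rw [symm_apply_eq, d0 x h1 h2]]
    split_ifs
    · exact h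
    · simp

end Under

section Main

variable {m : ℕ} {R Lf : Type} [Fintype R] [DecidableEq R]

lemma netVal_recolour {ι ι' : Type} [Fintype Lf] [Fintype ι] [Fintype ι'] [DecidableEq ι]
    [DecidableEq ι'] (φ : ι ≃ ι') (c : ι → ι → ι → K) (c' : ι' → ι' → ι' → K)
    (h : ∀ i j k, c' (φ i) (φ j) (φ k) = c i j k) (lc : Lf → ι) (rc : R → ι) (g : Net m R Lf) :
    netVal c' (φ ∘ lc) (φ ∘ rc) g = netVal c lc rc g := by
  unfold netVal
  rw [← sum_comp (arrowCongr (Equiv.refl _) φ)]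
  refine sum_congr rfl fun γ _ => ?_
  simp [arrowCongr, h]

lemma netVal_relabel {ι Lf' : Type} [Fintype Lf] [Fintype Lf'] [Fintype ι] [DecidableEq ι]
    (c : ι → ι → ι → K) (e : Lf ≃ Lf') (lc : Lf' → ι) (rc : R → ι) (g : Net m R Lf) :
    netVal c lc rc (g.trans (sumCongr (Equiv.refl _) e) : Net m R Lf') =
      netVal c (lc ∘ e) rc g := by
  unfold netVal
  refine sum_congr rfl fun γ _ => ?_
  congr 2
  rw [← Equiv.prod_comp e]
  simp

lemma IsWeight.relabel {Lf' : Type} {X : Type u} [AddCommGroup X] [Module K X] (e : Lf' ≃ Lf)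
    {θ : Net m R Lf → X} (hθ : IsWeight K θ) :
    IsWeight K fun g : Net m R Lf' =>
      θ (g.trans (sumCongr (Equiv.refl _) e) : Net m R Lf) where
  swap g v := hθ.swap (g.trans (sumCongr (Equiv.refl _) e)) v
  rename g τ := by
    refine Eq.trans ?_ (hθ.rename _ τ)
    congr 1
    ext x
    simp only [Net.rename, trans_apply]
    generalize g _ = y
    rcases y with y | y <;> rfl
  ihx g v w b hl hvw hb hw := by
    refine hθ.ihx (g.trans (sumCongr (Equiv.refl _) e)) v w b ?_ hvw ?_ ?_
    · intro u b' h
      refine hl u b' ?_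
      rcases hy : g (inl (u, b')) with y | y <;> simp [hy] at h ⊢
      exact h
    · simp [hb]
    · intro b' h
      refine hw b' ?_
      rcases hy : g (inl (w, b')) with y | y <;> simp [hy] at h ⊢
      exact h

lemma not_plainAt_of_under {g : Net m R (Fin m ⊕ R)} {r : R} (h : g.Under r (inr (inr r))) :
    ¬ PlainAt g (g (inr r)) := by
  intro hp
  have key y : g.Under r y → PlainAt g y := by
    intro hy
    induction hy with
    | root => exact hp
    | step v b _ ih => exact (plainAt_vertex_iff g v).1 ih b
  exact not_plainAt_special g r (key _ h)

lemma netVal_eq_zero_of_not_rooted {t : ℕ} (σ₀ : Equiv.Perm (Fin m ⊕ R)) (g : Net m R (Fin m ⊕ R))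
    (hg : ¬ g.Rooted) :
    netVal (unitConst K (Fin m ⊕ R) (Fin (t + 1))) (leafCol σ₀) (rootCol σ₀) g = 0 := by
  unfold Net.Rooted at hg
  push Not at hg
  obtain ⟨r, hr⟩ := hg
  refine sum_eq_zero fun γ _ => ?_
  by_contra hne
  have h1 := left_ne_zero_of_mul hne
  have h2 := left_ne_zero_of_mul (right_ne_zero_of_mul hne)
  have h3 := right_ne_zero_of_mul (right_ne_zero_of_mul hne)
  rw [prod_ne_zero_iff] at h1 h2 h3
  have key y : PlainAt g y → ∃ a, (γ (g.symm y)).2 = inl a := by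
    intro hy
    induction hy with
    | leaf l =>
      have : γ (g.symm (inr (inl l))) = (inl l, inl (σ₀ (inl l))) := by
        by_contra hc
        exact h3 (inl l) (mem_univ _) (if_neg hc)
      rw [this]
      exact ⟨_, rfl⟩
    | vertex v _ ih =>
      obtain ⟨a, ha⟩ := ih false
      obtain ⟨b, hb⟩ := ih true
      rw [symm_apply_apply] at ha hb
      have hv := h1 v (mem_univ _)
      by_contra hc
      push Not at hc
      refine hv ?_
      rw [unitConst, if_neg, if_neg, sub_zero]
      · rintro ⟨-, h⟩; exact hc a (by rw [h]; exact ha)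
      · rintro ⟨-, h⟩; exact hc b (by rw [h]; exact hb)
  obtain ⟨a, ha⟩ := key _ hr
  rw [symm_apply_apply] at ha
  have : γ (inr r) = (σ₀ (inr r), inr 0) := by
    by_contra hc
    exact h2 r (mem_univ _) (if_neg hc)
  rw [this] at ha
  simp at ha

open Classical in
lemma sum_rooted_eq_zero [CharZero K] (W : Net m R (Fin m ⊕ R) → K)
    (hW : ∀ g, ¬ g.Loopless → W g = 0)
    (h : ∀ (L : BasedLie K) (lc : Fin m ⊕ R → Fin L.dim) (rc : R → Fin L.dim),
      ∑ g, W g * netVal L.c lc rc g = 0) {X : Type u} [AddCommGroup X] [Module K X]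
    (θ : Net m R (Fin m ⊕ R) → X) (hθ : IsWeight K θ) :
    ∑ g, (if g.Rooted then W g • θ g else 0) = 0 := by
  have hex (g : Net m R (Fin m ⊕ R)) : ∃ c : Equiv.Perm (Fin m ⊕ R) → K, g.Loopless → g.Rooted →
      ∀ (X : Type u) [AddCommGroup X] [Module K X]
      (θ : Net m R (Fin m ⊕ R) → X), IsWeight K θ → θ g = ∑ σ, c σ • θ (comb σ) := by
    by_cases hg : g.Loopless ∧ g.Rooted
    · obtain ⟨c, hc⟩ := exists_coeff K _ g hg.1 hg.2 le_rfl
      exact ⟨c, fun _ _ => hc⟩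
    · exact ⟨0, fun h1 h2 => absurd ⟨h1, h2⟩ hg⟩
  choose c hc using hex
  let U : Equiv.Perm (Fin m ⊕ R) → K := fun σ => ∑ g, if g.Rooted then W g * c g σ else 0
  have hθU : ∀ (X : Type u) [AddCommGroup X] [Module K X]
      (θ : Net m R (Fin m ⊕ R) → X), IsWeight K θ →
      ∑ g, (if g.Rooted then W g • θ g else 0) = ∑ σ, U σ • θ (comb σ) := by
    intro X _ _ θ hθ
    simp only [U, sum_smul]
    rw [sum_comm]
    refine sum_congr rfl fun g _ => ?_
    by_cases hg : g.Rooted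
    · simp only [if_pos hg]
      by_cases hl : g.Loopless
      · rw [hc g hl hg X θ hθ, smul_sum]
        simp only [mul_smul]
      · simp [hW g hl]
    · simp [hg]
  have hU σ₀ : U σ₀ = 0 := by
    refine coeff_eq_zero_of_netVal_comb σ₀ U fun t => ?_
    let L := unitLie K (Fin m ⊕ R) (Fin (t + 1))
    let φ : (Fin m ⊕ R) × ((Fin m ⊕ R) ⊕ Fin (t + 1)) ≃ Fin L.dim :=
      unitIndex (Fin m ⊕ R) (Fin (t + 1))
    have hφ (g : Net m R (Fin m ⊕ R)) : netVal L.c (φ ∘ leafCol σ₀) (φ ∘ rootCol σ₀) g =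
        netVal (unitConst K (Fin m ⊕ R) (Fin (t + 1))) (leafCol σ₀) (rootCol σ₀) g :=
      netVal_recolour φ _ _ (unitLie_c K _ _) _ _ g
    have hw := hθU K _ (isWeight_netVal L.c L.c_antisymm L.c_jacobi (φ ∘ leafCol σ₀) (φ ∘ rootCol σ₀))
    simp only [hφ, smul_eq_mul] at hw
    refine hw.symm.trans (Eq.trans ?_ (h L (φ ∘ leafCol σ₀) (φ ∘ rootCol σ₀)))
    refine sum_congr rfl fun g _ => ?_
    rw [hφ]
    split_ifs with hg
    · rfl
    · rw [netVal_eq_zero_of_not_rooted σ₀ g hg, mul_zero]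
  rw [hθU X θ hθ]
  simp [hU]

lemma Net.Under.map {Lf' : Type} (e : Lf ≃ Lf') {g : Net m R Lf} {r : R} {y : Fin m ⊕ Lf}
    (h : g.Under r y) :
    Net.Under (g.trans (sumCongr (Equiv.refl _) e)) r (Sum.map id e y) := by
  induction h with
  | root => exact Net.Under.root (g := (g.trans (sumCongr (Equiv.refl _) e) : Net m R Lf'))
  | step v b _ ih =>
    exact Net.Under.step (g := (g.trans (sumCongr (Equiv.refl _) e) : Net m R Lf')) v b ih

lemma exists_leafEquiv [Fintype Lf] (g : Net m R Lf) (s : R → Lf) (hs : Function.Injective s) :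
    ∃ e : Lf ≃ Fin m ⊕ R, ∀ r, e (s r) = inr r := by
  classical
  have h1 := card_congr g
  simp only [card_sum, Fintype.card_prod, card_fin, card_bool] at h1
  have h2 : card {l // ¬ l ∈ Set.range s} = m := by
    rw [Fintype.card_subtype_compl]
    have : card {l // l ∈ Set.range s} = card R :=
      (card_congr (Equiv.ofInjective s hs)).symm
    omega
  let e₁ : {l // ¬ l ∈ Set.range s} ≃ Fin m := Fintype.equivFinOfCardEq h2
  let e₂ : {l // l ∈ Set.range s} ≃ R := (Equiv.ofInjective s hs).symm
  refine ⟨(Equiv.sumCompl (· ∈ Set.range s)).symm.trans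
    ((sumCongr e₂ e₁).trans (Equiv.sumComm _ _)), fun r => ?_⟩
  have : s r ∈ Set.range s := ⟨r, rfl⟩
  simp only [trans_apply]
  rw [Equiv.sumCompl_symm_apply_of_pos (p := (· ∈ Set.range s)) this]
  simp only [Equiv.sumCongr_apply, map_inl, Equiv.sumComm_apply, Sum.swap_inl]
  exact congrArg _ (Equiv.ofInjective_symm_apply hs r)

/-- The structure constants of Lie algebras detect all linear combinations of trivalent graphs that do
not vanish modulo the antisymmetry and IHX relations. -/
lemma sum_smul_weight_eq_zero [CharZero K] [Fintype Lf] [DecidableEq Lf] (W : Net m R Lf → K)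
    (hW : ∀ g, ¬ g.Loopless → W g = 0)
    (h : ∀ (L : BasedLie K) (lc : Lf → Fin L.dim) (rc : R → Fin L.dim),
      ∑ g, W g * netVal L.c lc rc g = 0) {X : Type u} [AddCommGroup X] [Module K X]
    (θ : Net m R Lf → X) (hθ : IsWeight K θ) : ∑ g, W g • θ g = 0 := by
  classical
  have hρ (ρ : R → Lf → Prop) : ∑ g, W g • (if Net.leaves g = ρ then θ g else 0) = 0 := by
    by_cases hex : ∃ g : Net m R Lf, Net.leaves g = ρ
    · obtain ⟨g₀, hg₀⟩ := hex
      choose s hs using g₀.exists_under_leaf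
      have hsi : Function.Injective s := fun r r' hrr => by
        have := hs r
        rw [hrr] at this
        exact this.unique (hs r')
      obtain ⟨e, he⟩ := exists_leafEquiv g₀ s hsi
      let T : Net m R Lf ≃ Net m R (Fin m ⊕ R) :=
        (Equiv.refl _).equivCongr (sumCongr (Equiv.refl _) e)
      have hT g : T g = g.trans (sumCongr (Equiv.refl _) e) := by
        ext x; rfl
      have hT' g : (T.symm g).trans (sumCongr (Equiv.refl _) e) = g := by
        rw [← hT, apply_symm_apply]
      have hTs g : T.symm g = g.trans (sumCongr (Equiv.refl _) e.symm) := by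
        rw [symm_apply_eq, hT]; ext x
        simp only [trans_apply]
        rcases g x with y | y <;> simp
      have key := sum_rooted_eq_zero (fun g => W (T.symm g)) (fun g hg => hW _ fun hl => hg (by
        intro v b hv
        refine hl v b ?_
        rw [hTs, trans_apply, hv]; rfl)) (fun L lc rc => by
        rw [← h L (lc ∘ e) rc, ← T.symm.sum_comp]
        refine sum_congr rfl fun g _ => ?_
        rw [← netVal_relabel, hT']) _
        ((hθ.restrict_leaves ρ).relabel e.symm)
      refine Eq.trans ?_ key
      rw [← T.symm.sum_comp]
      refine sum_congr rfl fun g _ => ?_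
      rw [← hTs]
      split_ifs with h1 h2
      · rfl
      · refine absurd (fun r => not_plainAt_of_under ?_) h2
        have h3 : (T.symm g).leaves r (s r) := by
          rw [h1, ← hg₀]; exact hs r
        have h4 := Net.Under.map e h3
        rw [hT', map_inr, he] at h4
        exact h4
      all_goals simp
    · push Not at hex
      simp [hex]
  calc ∑ g, W g • θ g = ∑ g, ∑ ρ : R → Lf → Prop, W g • (if Net.leaves g = ρ then θ g else 0) := by
        refine sum_congr rfl fun g _ => ?_
        rw [← smul_sum, sum_ite_eq]
        simp
    _ = 0 := by
        rw [sum_comm]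
        exact sum_eq_zero fun ρ _ => hρ ρ

end Main

section SuperPoly

variable {ι ι' ι'' : Type} [Fintype ι] [DecidableEq ι] [Fintype ι']
  [DecidableEq ι'] [DecidableEq ι'']

/-- The even variable with index `i`. -/
def xv (K : Type u) [Field K] {ι : Type} (i : ι) : SuperPoly K ι := MvPolynomial.X i ⊗ₜ[K] 1

/-- The odd variable with index `i`. -/
def pv (K : Type u) [Field K] {ι : Type} [DecidableEq ι] (i : ι) : SuperPoly K ι :=
  1 ⊗ₜ[K] ExteriorAlgebra.ι K (Pi.single i 1)

lemma ext_ι_eq_sum (v : ι → K) :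
    ExteriorAlgebra.ι K v = ∑ i, v i • ExteriorAlgebra.ι K (Pi.single i (1 : K)) := by
  have : v = ∑ i, v i • Pi.single i (1 : K) := by
    simpa [single_apply] using (pi_eq_sum_univ' v)
  conv_lhs => rw [this]
  simp

lemma SuperPoly.induction {p : SuperPoly K ι → Prop} (one : p 1)
    (add : ∀ a b, p a → p b → p (a + b)) (smul : ∀ (r : K) a, p a → p (r • a))
    (x : ∀ i a, p a → p (xv K i * a)) (odd : ∀ i a, p a → p (pv K i * a)) (a : SuperPoly K ι) :
    p a := by
  have zero : p 0 := by simpa using smul 0 1 one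
  have sum : ∀ (s : Finset ι) (f : ι → SuperPoly K ι), (∀ i, p (f i)) → p (∑ i ∈ s, f i) :=
    fun s f h => Finset.sum_induction _ p add zero fun i _ => h i
  induction a using TensorProduct.induction_on with
  | zero => exact zero
  | add a b ha hb => exact add _ _ ha hb
  | tmul P w =>
    induction P using MvPolynomial.induction_on with
    | C r =>
      rw [← mul_one (MvPolynomial.C r), MvPolynomial.C_mul', ← TensorProduct.smul_tmul']
      refine smul _ _ ?_
      induction w using left_induction with
      | algebraMap r =>
        rw [Algebra.algebraMap_eq_smul_one, tmul_smul]
        exact smul _ _ one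
      | add w w' h h' => rw [tmul_add]; exact add _ _ h h'
      | ι_mul w v h =>
        have hv := ext_ι_eq_sum v
        change CliffordAlgebra.ι _ v = _ at hv
        rw [hv, sum_mul, TensorProduct.tmul_sum]
        refine sum _ _ fun i => ?_
        rw [smul_mul_assoc, tmul_smul]
        refine smul _ _ ?_
        have := odd i _ h
        rwa [pv, tmul_mul_tmul, one_mul] at this
    | add P P' h h' => rw [add_tmul]; exact add _ _ h h'
    | mul_X P i h =>
      have := x i _ h
      rwa [xv, tmul_mul_tmul, one_mul, mul_comm] at this

lemma SuperPoly.algHom_ext {B : Type u} [Ring B] [Algebra K B] {f g : SuperPoly K ι →ₐ[K] B}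
    (hx : ∀ i, f (xv K i) = g (xv K i)) (hp : ∀ i, f (pv K i) = g (pv K i)) : f = g := by
  refine AlgHom.ext fun a => ?_
  induction a using SuperPoly.induction with
  | one => rw [map_one, map_one]
  | add a b ha hb => rw [map_add, map_add, ha, hb]
  | smul r a ha => rw [map_smul, map_smul, ha]
  | x i a ha => rw [map_mul, map_mul, ha, hx]
  | odd i a ha => rw [map_mul, map_mul, ha, hp]

/-- Substitution of variables. -/
def gmap (K : Type u) [Field K] {ι ι' : Type} [Fintype ι] [DecidableEq ι'] (f : ι → ι') :
    SuperPoly K ι →ₐ[K] SuperPoly K ι' :=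
  Algebra.TensorProduct.map (MvPolynomial.rename f)
    (ExteriorAlgebra.map (LinearMap.pi fun j => ∑ i, if f i = j then proj i else 0))

@[simp] lemma gmap_xv (f : ι → ι') (i : ι) : gmap K f (xv K i) = xv K (f i) := by
  simp [gmap, xv]

@[simp] lemma gmap_pv (f : ι → ι') (i : ι) : gmap K f (pv K i) = pv K (f i) := by
  simp only [gmap, pv, map_tmul, map_one, map_apply_ι]
  congr 2
  funext j
  simp only [pi_apply, LinearMap.sum_apply]
  rw [Fintype.sum_eq_single i fun k hk => by split_ifs <;> simp [hk]]
  split_ifs with h <;> simp [h, single_apply, eq_comm]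

lemma gmap_gmap [Fintype ι''] (f : ι → ι') (g : ι' → ι'') (a : SuperPoly K ι) :
    gmap K g (gmap K f a) = gmap K (g ∘ f) a := by
  rw [← AlgHom.comp_apply]
  congr 1
  refine SuperPoly.algHom_ext (fun i => ?_) fun i => ?_
  · rw [AlgHom.comp_apply, gmap_xv, gmap_xv, gmap_xv]; rfl
  · rw [AlgHom.comp_apply, gmap_pv, gmap_pv, gmap_pv]; rfl

lemma gmap_congr {f g : ι → ι'} (h : ∀ i, f i = g i) (a : SuperPoly K ι) :
    gmap K f a = gmap K g a := by rw [funext h]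

/-- The parity operator. -/
def par (K : Type u) [Field K] {ι : Type} : SuperPoly K ι →ₐ[K] SuperPoly K ι :=
  Algebra.TensorProduct.map (AlgHom.id K _) (ExteriorAlgebra.map (-LinearMap.id))

/-- The powers of the parity operator. -/
notation:max "par[" K "]^" p:max => (par K ^ p : SuperPoly K _ →ₐ[K] SuperPoly K _)

lemma par_pow_apply (p : ℕ) (a : SuperPoly K ι) : par[K]^(p + 1) a = par K (par[K]^p a) := by
  rw [pow_succ', AlgHom.mul_apply]

lemma par_pow_smul {k : ℕ} {a : SuperPoly K ι} (h : par K a = (-1 : K) ^ k • a) (p : ℕ) :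
    par[K]^p a = (-1 : K) ^ (p * k) • a := by
  induction p with
  | zero => simp
  | succ p ih => rw [par_pow_apply, ih, map_smul, h, smul_smul, ← pow_add, Nat.succ_mul]

lemma map_par_pow {f : SuperPoly K ι → SuperPoly K ι'} (h : ∀ x, f (par K x) = par K (f x))
    (p : ℕ) (x : SuperPoly K ι) : f (par[K]^p x) = par[K]^p (f x) := by
  induction p with
  | zero => rfl
  | succ p ih => rw [par_pow_apply, par_pow_apply, h, ih]

@[simp] lemma par_xv (i : ι) : par K (xv K i) = xv K i := by simp [par, xv]

@[simp] lemma par_pv (i : ι) : par K (pv K i) = (-1 : K) • pv K i := by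
  simp only [par, pv, map_tmul, map_one, map_apply_ι]
  rw [LinearMap.neg_apply, id_apply, ← neg_one_smul K (Pi.single i (1 : K) : ι → K),
    map_smul, tmul_smul]

lemma par_par (a : SuperPoly K ι) : par K (par K a) = a := by
  rw [← AlgHom.comp_apply, ← AlgHom.id_apply (R := K) a]
  congr 1
  refine SuperPoly.algHom_ext (by simp) fun i => ?_
  rw [AlgHom.comp_apply, par_pv, map_smul, par_pv, smul_smul, neg_mul_neg, one_mul, one_smul,
    AlgHom.id_apply]

lemma par_gmap (f : ι → ι') (a : SuperPoly K ι) : par K (gmap K f a) = gmap K f (par K a) := by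
  rw [← AlgHom.comp_apply, ← AlgHom.comp_apply]
  congr 1
  exact SuperPoly.algHom_ext (by simp) (by simp)

lemma dx_one (i : ι) : dx K i (1 : SuperPoly K ι) = 0 := by
  simp [dx, one_def]

lemma dp_one (i : ι) : dp K i (1 : SuperPoly K ι) = 0 := by
  simp [dp, one_def]

lemma dx_xv_mul (i j : ι) (a : SuperPoly K ι) :
    dx K i (xv K j * a) = (if j = i then a else 0) + xv K j * dx K i a := by
  induction a using TensorProduct.induction_on with
  | zero => simp
  | add a b ha hb =>
    rw [mul_add, map_add, ha, hb, map_add, mul_add]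
    split_ifs <;> abel
  | tmul P w =>
    simp only [dx, xv, tmul_mul_tmul, TensorProduct.map_tmul, one_mul,
      id_apply, Derivation.coeFn_coe, Derivation.leibniz, MvPolynomial.pderiv_X,
      smul_eq_mul, add_tmul]
    by_cases h : j = i
    · subst h; simp [add_comm]
    · simp [h, Ne.symm h, single_apply]

lemma dx_pv_mul (i j : ι) (a : SuperPoly K ι) :
    dx K i (pv K j * a) = pv K j * dx K i a := by
  induction a using TensorProduct.induction_on <;> simp_all [dx, pv, mul_add]

lemma dp_xv_mul (i j : ι) (a : SuperPoly K ι) :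
    dp K i (xv K j * a) = xv K j * dp K i a := by
  induction a using TensorProduct.induction_on <;> simp_all [dp, xv, mul_add]

lemma dp_pv_mul (i j : ι) (a : SuperPoly K ι) :
    dp K i (pv K j * a) = (if j = i then a else 0) + (-1 : K) • (pv K j * dp K i a) := by
  induction a using TensorProduct.induction_on with
  | zero => simp
  | add a b ha hb =>
    rw [mul_add, map_add, ha, hb, map_add, mul_add, smul_add]
    split_ifs <;> abel
  | tmul P w =>
    simp only [dp, pv, tmul_mul_tmul, TensorProduct.map_tmul, one_mul,
      id_apply]
    rw [show (ExteriorAlgebra.ι K (Pi.single j (1 : K)) : ExteriorAlgebra K (ι → K)) =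
      CliffordAlgebra.ι _ (Pi.single j (1 : K)) from rfl, contractLeft_ι_mul,
      sub_eq_add_neg, ← neg_one_smul K (CliffordAlgebra.ι _ _ * _), tmul_add,
      tmul_smul, tmul_smul]
    congr 1
    by_cases h : j = i
    · subst h; simp
    · simp [h, Ne.symm h, single_apply]

lemma dx_mul (i : ι) (a b : SuperPoly K ι) : dx K i (a * b) = dx K i a * b + a * dx K i b := by
  induction a using SuperPoly.induction with
  | one => simp [dx_one]
  | add a a' h h' => rw [add_mul, map_add, h, h', map_add]; noncomm_ring
  | smul r a h => simp only [smul_mul_assoc, map_smul, h, smul_add]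
  | x j a h =>
    rw [mul_assoc, dx_xv_mul, dx_xv_mul, h]
    split_ifs <;> noncomm_ring
  | odd j a h => rw [mul_assoc, dx_pv_mul, dx_pv_mul, h]; noncomm_ring

lemma dp_mul (i : ι) (a b : SuperPoly K ι) :
    dp K i (a * b) = dp K i a * b + par K a * dp K i b := by
  induction a using SuperPoly.induction with
  | one => simp [dp_one]
  | add a a' h h' => rw [add_mul, map_add, h, h', map_add, map_add]; noncomm_ring
  | smul r a h => simp only [smul_mul_assoc, map_smul, h, smul_add]
  | x j a h =>
    rw [mul_assoc, dp_xv_mul, dp_xv_mul, h, map_mul, par_xv]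
    noncomm_ring
  | odd j a h =>
    rw [mul_assoc, dp_pv_mul, dp_pv_mul, h, map_mul, par_pv]
    split_ifs <;> simp only [mul_add, add_mul, smul_add, smul_mul_assoc, mul_assoc, zero_mul,
      zero_add, add_assoc]

lemma dx_gmap (f : ι → ι') (j : ι') (a : SuperPoly K ι) :
    dx K j (gmap K f a) = ∑ i, if f i = j then gmap K f (dx K i a) else 0 := by
  rw [← sum_filter]
  induction a using SuperPoly.induction with
  | one => simp [dx_one]
  | add a a' h h' => simp [h, h', sum_add_distrib]
  | smul r a h => simp [h, smul_sum]
  | x k a h => simp [dx_xv_mul, h, mul_sum, sum_add_distrib, apply_ite (gmap K f)]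
  | odd k a h => simp [dx_pv_mul, h, mul_sum]

lemma dp_gmap (f : ι → ι') (j : ι') (a : SuperPoly K ι) :
    dp K j (gmap K f a) = ∑ i, if f i = j then gmap K f (dp K i a) else 0 := by
  rw [← sum_filter]
  induction a using SuperPoly.induction with
  | one => simp [dp_one]
  | add a a' h h' => simp [h, h', sum_add_distrib]
  | smul r a h => simp [h, smul_sum]
  | odd k a h => simp [dp_pv_mul, h, mul_sum, sum_add_distrib, apply_ite (gmap K f)]; exact smul_sum
  | x k a h => simp [dp_xv_mul, h, mul_sum]

lemma dx_gmap_of_injective {f : ι → ι'} (hf : Function.Injective f) (i : ι) (a : SuperPoly K ι) :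
    dx K (f i) (gmap K f a) = gmap K f (dx K i a) := by
  simp [dx_gmap, hf.eq_iff]

lemma dp_gmap_of_injective {f : ι → ι'} (hf : Function.Injective f) (i : ι) (a : SuperPoly K ι) :
    dp K (f i) (gmap K f a) = gmap K f (dp K i a) := by
  simp [dp_gmap, hf.eq_iff]

lemma dx_gmap_of_notMem {f : ι → ι'} {j : ι'} (hj : ∀ i, f i ≠ j) (a : SuperPoly K ι) :
    dx K j (gmap K f a) = 0 := by
  simp [dx_gmap, hj]

lemma dp_gmap_of_notMem {f : ι → ι'} {j : ι'} (hj : ∀ i, f i ≠ j) (a : SuperPoly K ι) :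
    dp K j (gmap K f a) = 0 := by
  simp [dp_gmap, hj]

lemma dx_par (i : ι) (a : SuperPoly K ι) : dx K i (par K a) = par K (dx K i a) := by
  induction a using SuperPoly.induction <;>
    simp_all [dx_one, dx_xv_mul, dx_pv_mul, apply_ite (par K), smul_mul_assoc]

lemma dp_par (i : ι) (a : SuperPoly K ι) : dp K i (par K a) = (-1 : K) • par K (dp K i a) := by
  induction a using SuperPoly.induction with
  | one => simp [dp_one]
  | add a a' h h' => simp only [map_add, h, h', smul_add]
  | smul r a h => simp only [map_smul, h, smul_comm r]
  | x j a h => rw [map_mul, par_xv, dp_xv_mul, dp_xv_mul, h, map_mul, par_xv, mul_smul_comm]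
  | odd j a h =>
    rw [map_mul, par_pv, dp_pv_mul, smul_mul_assoc, map_smul, dp_pv_mul, h, map_add, map_smul,
      map_mul, par_pv]
    split_ifs <;> simp only [smul_add, smul_smul, mul_smul_comm, smul_mul_assoc, smul_zero,
      zero_add, map_zero]

lemma pv_mul_pv (i j : ι) : pv K j * pv K i = (-1 : K) • (pv K i * pv K j) := by
  simp only [pv, tmul_mul_tmul, ← tmul_smul]
  rw [eq_neg_of_add_eq_zero_left (ι_add_mul_swap (R := K)
    (Pi.single j (1 : K) : ι → K) (Pi.single i (1 : K) : ι → K)), neg_one_smul]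

/-- Even elements are central. -/
lemma mul_comm_of_even {a : SuperPoly K ι} (ha : par K a = a) (b : SuperPoly K ι)
    (h2 : (2 : K) ≠ 0) : a * b = b * a := by
  have key (a : SuperPoly K ι) (j : ι) : pv K j * a = par K a * pv K j := by
    induction a using SuperPoly.induction with
    | one => simp
    | add a a' h h' => rw [mul_add, h, h', map_add, add_mul]
    | smul r a h => rw [mul_smul_comm, h, map_smul, smul_mul_assoc]
    | x i a h =>
      have : pv K j * xv K i = xv K i * pv K j := by simp [pv, xv]
      rw [← mul_assoc, this, mul_assoc, h, map_mul, par_xv, mul_assoc]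
    | odd i a h => simp [← mul_assoc, pv_mul_pv i j, mul_assoc _ _ a, h, smul_mul_assoc]
  have hx (a : SuperPoly K ι) (j : ι) : xv K j * a = a * xv K j := by
    induction a using TensorProduct.induction_on <;> simp_all [xv, mul_add, add_mul, mul_comm]
  induction b using SuperPoly.induction with
  | one => simp
  | add b b' h h' => rw [mul_add, h, h', add_mul]
  | smul r b h => rw [mul_smul_comm, h, smul_mul_assoc]
  | x i b h => rw [← mul_assoc, ← hx, mul_assoc, h, mul_assoc]
  | odd i b h => rw [mul_assoc, ← h, ← mul_assoc, ← mul_assoc, key, ha]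

end SuperPoly

section Slots

variable (L : BasedLie K) {V V' : Type} [Fintype V] [DecidableEq V]
  [Fintype V'] [DecidableEq V']

lemma BasedLie.slot_eq (v : V) : L.slot v = gmap K (Prod.mk v) := by
  refine SuperPoly.algHom_ext (fun i => ?_) fun i => ?_
  · rw [gmap_xv]; simp [BasedLie.slot, xv]
  · rw [gmap_pv]
    simp only [BasedLie.slot, pv, map_tmul, map_one,
      map_apply_ι]
    congr 2
    funext q
    obtain ⟨w, j⟩ := q
    simp only [pi_apply]
    by_cases h : w = v
    · subst h; simp [single_apply]
    · simp [h, single_apply]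

lemma BasedLie.merge_eq : L.merge V = gmap K snd := by
  refine SuperPoly.algHom_ext (fun i => ?_) fun i => ?_
  · rw [gmap_xv]; simp [BasedLie.merge, xv]
  · rw [gmap_pv]
    simp only [BasedLie.merge, pv, map_tmul, map_one,
      map_apply_ι]
    congr 2
    funext j
    obtain ⟨w, i⟩ := i
    simp only [pi_apply, LinearMap.sum_apply, LinearMap.proj_apply]
    rw [Fintype.sum_eq_single w fun v hv => by simp [single_apply, hv]]
    simp [single_apply]

/-- The merging of tensor factors along a map. -/
def BasedLie.fuse (c : V' → V) : L.Slots V' →ₐ[K] L.Slots V := gmap K (Prod.map c id)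

lemma BasedLie.fuse_slot (c : V' → V) (v : V') (a : L.A) :
    L.fuse c (L.slot v a) = L.slot (c v) a := by
  rw [L.slot_eq, L.slot_eq, BasedLie.fuse, gmap_gmap]; rfl

lemma BasedLie.merge_fuse (c : V' → V) (G : L.Slots V') :
    L.merge V (L.fuse c G) = L.merge V' G := by
  rw [L.merge_eq, L.merge_eq, BasedLie.fuse, gmap_gmap]; rfl

lemma BasedLie.merge_slot (v : V) (a : L.A) : L.merge V (L.slot v a) = a := by
  rw [L.merge_eq, L.slot_eq, gmap_gmap]
  have : gmap K (snd ∘ Prod.mk v) = AlgHom.id K L.A :=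
    SuperPoly.algHom_ext (by simp) (by simp)
  rw [this]; rfl

lemma BasedLie.fuse_fuse {V'' : Type} [Fintype V''] [DecidableEq V''] (c : V' → V) (d : V'' → V')
    (G : L.Slots V'') : L.fuse c (L.fuse d G) = L.fuse (c ∘ d) G := by
  rw [BasedLie.fuse, BasedLie.fuse, gmap_gmap]; rfl

/-- The elements that do not involve the tensor factors in `S`. -/
def BasedLie.freeOf (S : Set V) : Subalgebra K (L.Slots V) where
  carrier := {G | ∀ v ∈ S, ∀ l, dx K (v, l) G = 0 ∧ dp K (v, l) G = 0}
  mul_mem' {a b} ha hb v hv l := by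
    rw [dx_mul, dp_mul, (ha v hv l).1, (ha v hv l).2, (hb v hv l).1, (hb v hv l).2]
    simp
  add_mem' {a b} ha hb v hv l := by
    rw [map_add, map_add, (ha v hv l).1, (ha v hv l).2, (hb v hv l).1, (hb v hv l).2]
    simp
  algebraMap_mem' r v _ l := by
    rw [Algebra.algebraMap_eq_smul_one, map_smul, map_smul, dx_one, dp_one, smul_zero]
    exact ⟨rfl, rfl⟩

lemma BasedLie.slot_mem_freeOf {S : Set V} {v : V} (hv : v ∉ S) (a : L.A) :
    L.slot v a ∈ L.freeOf S := by
  intro w hw l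
  rw [L.slot_eq]
  have : ∀ i, (v, i) ≠ (w, l) := fun i h => hv (by
    have h1 : v = w := congrArg Prod.fst h
    rw [h1]; exact hw)
  exact ⟨dx_gmap_of_notMem this a, dp_gmap_of_notMem this a⟩

lemma BasedLie.dx_slot (v : V) (l : Fin L.dim) (a : L.A) :
    dx K (v, l) (L.slot v a) = L.slot v (dx K l a) := by
  rw [L.slot_eq]; exact dx_gmap_of_injective (Prod.mk_right_injective v) l a

lemma BasedLie.dp_slot (v : V) (l : Fin L.dim) (a : L.A) :
    dp K (v, l) (L.slot v a) = L.slot v (dp K l a) := by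
  rw [L.slot_eq]; exact dp_gmap_of_injective (Prod.mk_right_injective v) l a

lemma BasedLie.par_slot (v : V) (a : L.A) : par K (L.slot v a) = L.slot v (par K a) := by
  rw [L.slot_eq, par_gmap]

end Slots

section Action

variable {V V' : Type} [Fintype V] [DecidableEq V] [Fintype V']
  [DecidableEq V']

lemma Gra.induction {p : Gra K V → Prop} (one : p 1) (add : ∀ a b, p a → p b → p (a + b))
    (smul : ∀ (r : K) a, p a → p (r • a)) (arrow_mul : ∀ e a, p a → p (arrow K e * a))
    (a : Gra K V) : p a := by
  have zero : p 0 := by simpa using smul 0 1 one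
  induction a using left_induction with
  | algebraMap r => rw [Algebra.algebraMap_eq_smul_one]; exact smul _ _ one
  | add w w' h h' => exact add _ _ h h'
  | ι_mul w v h =>
    have hv := ext_ι_eq_sum v
    change CliffordAlgebra.ι _ v = _ at hv
    rw [hv, sum_mul]
    refine Finset.sum_induction _ p add zero fun i _ => ?_
    rw [smul_mul_assoc]
    exact smul _ _ (arrow_mul i _ h)

lemma sum_edges {M : Type u} [AddCommMonoid M] (c : V' → Option V) (e : Edge V) (F : V' → V' → M) :
    ∑ q : {q : Edge V' // c q.1.1 = some e.1.1 ∧ c q.1.2 = some e.1.2}, F q.1.1.1 q.1.1.2 =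
      ∑ a, if c a = some e.1.1 then ∑ b, (if c b = some e.1.2 then F a b else 0) else 0 := by
  have h1 a : (if c a = some e.1.1 then ∑ b, (if c b = some e.1.2 then F a b else 0) else 0) =
      ∑ b, if c a = some e.1.1 ∧ c b = some e.1.2 then F a b else 0 := by
    by_cases h : c a = some e.1.1 <;> simp [h]
  simp only [h1]
  rw [← sum_prod_type' (f := fun a b => if c a = some e.1.1 ∧ c b = some e.1.2 then F a b else 0),
    ← sum_filter]
  refine Finset.sum_bij (fun q _ => q.1.1) (fun q _ => by simpa using q.2) (fun q _ q' _ h =>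
    Subtype.ext (Subtype.ext h)) (fun p hp => ?_) (fun _ _ => rfl)
  have hp := (mem_filter.1 hp).2
  refine ⟨⟨⟨p, fun h => e.2 ?_⟩, hp⟩, mem_univ _, rfl⟩
  have := hp.1
  rw [h, hp.2] at this
  exact (Option.some.inj this).symm

variable [CharZero K] (L : BasedLie K)

lemma BasedLie.act_arrow (e : Edge V) : L.act V (arrow K e) = L.tau e := by
  simp [BasedLie.act, arrow, Pi.single_apply]

lemma BasedLie.tau_apply (e : Edge V) (G : L.Slots V) :
    L.tau e G = ∑ l, dp K (e.1.1, l) (dx K (e.1.2, l) G) := by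
  simp [BasedLie.tau, LinearMap.sum_apply]

lemma BasedLie.dx_fuse (c : V' → V) (v : V) (l : Fin L.dim) (G : L.Slots V') :
    dx K (v, l) (L.fuse c G) = ∑ v', if c v' = v then L.fuse c (dx K (v', l) G) else 0 := by
  simp [BasedLie.fuse, dx_gmap, sum_prod_type, ext_iff, ite_and, Finset.sum_ite_irrel]

lemma BasedLie.dp_fuse (c : V' → V) (v : V) (l : Fin L.dim) (G : L.Slots V') :
    dp K (v, l) (L.fuse c G) = ∑ v', if c v' = v then L.fuse c (dp K (v', l) G) else 0 := by
  simp [BasedLie.fuse, dp_gmap, sum_prod_type, ext_iff, ite_and, Finset.sum_ite_irrel]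

lemma BasedLie.act_fuse (c : V' → V) (a : Gra K V) (G : L.Slots V') :
    L.act V a (L.fuse c G) = L.fuse c (L.act V' (pull K (fun x => some (c x)) a) G) := by
  induction a using Gra.induction with
  | one => simp
  | add a b ha hb => simp only [map_add, LinearMap.add_apply, ha, hb]
  | smul r a ha => simp only [map_smul, LinearMap.smul_apply, ha]
  | arrow_mul e a ha =>
    rw [map_mul, map_mul, map_mul, Module.End.mul_apply, Module.End.mul_apply, ha, L.act_arrow,
      pull_arrow, map_sum]
    generalize L.act V' (pull K (fun x => some (c x)) a) G = H
    simp only [L.act_arrow, LinearMap.sum_apply, map_sum, L.tau_apply, L.dx_fuse,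
      apply_ite (dp K _), map_zero, L.dp_fuse]
    refine Eq.trans ?_ (sum_edges (fun x => some (c x)) e fun a b =>
      ∑ l, L.fuse c (dp K (a, l) (dx K (b, l) H))).symm
    have h1 (a : V') : (if some (c a) = some e.1.1 then ∑ b, (if some (c b) = some e.1.2 then
        ∑ l, L.fuse c (dp K (a, l) (dx K (b, l) H)) else 0) else 0) = ∑ l, ∑ b, if c b = e.1.2 then
          (if c a = e.1.1 then L.fuse c (dp K (a, l) (dx K (b, l) H)) else 0) else 0 := by
      rw [sum_comm]
      by_cases h : c a = e.1.1
      · simp only [h, if_true, Option.some.injEq]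
        refine sum_congr rfl fun b _ => ?_
        split_ifs <;> simp
      · simp [h]
    simp only [h1]
    refine Eq.trans ?_ sum_comm
    refine sum_congr rfl fun l _ => ?_
    refine Eq.trans ?_ sum_comm
    refine sum_congr rfl fun b _ => ?_
    split_ifs <;> simp

lemma BasedLie.act_fuse_of_injective (c : V' → V) (d : V → Option V') (hd : ∀ x y, d x = some y ↔ x = c y)
    (a : Gra K V') (G : L.Slots V') :
    L.act V (pull K d a) (L.fuse c G) = L.fuse c (L.act V' a G) := by
  have hc : Function.Injective c := fun x y h => by
    have := (hd (c x) y).2 h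
    rw [(hd (c x) x).2 rfl] at this
    exact Option.some.inj this
  induction a using Gra.induction with
  | one => simp
  | add a b ha hb => simp only [map_add, LinearMap.add_apply, ha, hb]
  | smul r a ha => simp only [map_smul, LinearMap.smul_apply, ha]
  | arrow_mul e a ha =>
    rw [map_mul, map_mul, map_mul, Module.End.mul_apply, Module.End.mul_apply, ha, L.act_arrow,
      pull_arrow, map_sum]
    generalize L.act V' a G = H
    have h : Function.Injective (Prod.map c (id : Fin L.dim → _)) := hc.prodMap injective_id
    simp only [L.act_arrow, LinearMap.sum_apply, L.tau_apply]
    have := sum_edges d e fun a b => ∑ l, dp K (a, l) (dx K (b, l) (L.fuse c H))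
    rw [this]
    simp only [hd]
    rw [sum_ite_eq' univ (c e.1.1)]
    simp only [mem_univ, if_true, sum_ite_eq']
    rw [map_sum]
    refine sum_congr rfl fun l _ => ?_
    rw [BasedLie.fuse, ← dp_gmap_of_injective h, ← dx_gmap_of_injective h]
    rfl

end Action

section Relations

variable (L : BasedLie K)

lemma BasedLie.pi_eq : L.pi = ∑ i, ∑ j, ∑ k, L.c i j k • (xv K k * (pv K i * pv K j)) := by
  simp [BasedLie.pi, xv, pv, tmul_mul_tmul]

lemma BasedLie.par_pi : par K L.pi = L.pi := by
  simp only [L.pi_eq, map_sum, map_smul, map_mul, par_xv, par_pv, smul_mul_smul_comm, neg_mul_neg,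
    one_mul, one_smul]

lemma dx_pv (i l : Fin L.dim) : dx K l (pv K i) = 0 := by
  rw [← mul_one (pv K i), dx_pv_mul, dx_one, mul_zero]

lemma dp_xv (i l : Fin L.dim) : dp K l (xv K i) = 0 := by
  rw [← mul_one (xv K i), dp_xv_mul, dp_one, mul_zero]

lemma dp_pv (i l : Fin L.dim) : dp K l (pv K i) = if i = l then 1 else 0 := by
  rw [← mul_one (pv K i), dp_pv_mul, dp_one, mul_zero, smul_zero, add_zero]

lemma BasedLie.dx_pi (l : Fin L.dim) : dx K l L.pi = ∑ i, ∑ j, L.c i j l • (pv K i * pv K j) := by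
  simp only [L.pi_eq, map_sum, map_smul, dx_xv_mul, dx_pv_mul, dx_pv, mul_zero, add_zero, smul_ite,
    smul_zero, sum_ite_eq', mem_univ, if_true]

lemma BasedLie.dp_pi (l : Fin L.dim) :
    dp K l L.pi = (2 : K) • ∑ j, ∑ k, L.c l j k • (xv K k * pv K j) := by
  have h1 i j k : dp K l (L.c i j k • (xv K k * (pv K i * pv K j))) =
      (if i = l then L.c i j k • (xv K k * pv K j) else 0) +
        if j = l then L.c j i k • (xv K k * pv K i) else 0 := by
    rw [map_smul, dp_xv_mul, dp_pv_mul, dp_pv, mul_add, smul_add]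
    congr 1
    · split_ifs <;> simp only [mul_zero, smul_zero]
    · split_ifs
      · rw [mul_one, mul_smul_comm, smul_smul, L.c_antisymm j i k, mul_neg_one]
      · simp only [mul_zero, smul_zero]
  simp only [L.pi_eq, map_sum, h1, sum_add_distrib]
  rw [two_smul]
  congr 1
  · rw [Fintype.sum_eq_single l fun i hi => by simp [hi]]
    simp
  · refine sum_congr rfl fun i _ => ?_
    rw [Fintype.sum_eq_single l fun i hi => by simp [hi]]
    simp

lemma BasedLie.dx_dx_pi (l l' : Fin L.dim) : dx K l' (dx K l L.pi) = 0 := by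
  simp [L.dx_pi, dx_pv_mul, dx_pv]

lemma BasedLie.dp_dp_dp_pi (l l' l'' : Fin L.dim) : dp K l'' (dp K l' (dp K l L.pi)) = 0 := by
  have : dp K l' (dp K l L.pi) = (2 : K) • ∑ k, L.c l l' k • xv K k := by
    simp only [L.dp_pi, map_smul, map_sum, dp_xv_mul, dp_pv]
    rw [Fintype.sum_eq_single l' fun i hi => by simp [hi]]
    simp
  rw [this]
  simp [dp_xv]

lemma BasedLie.sum_dp_pi_mul_dx_pi [CharZero K] : ∑ l, dp K l L.pi * dx K l L.pi = 0 := by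
  let F : Fin L.dim → Fin L.dim → Fin L.dim → L.A := fun j a b =>
    ∑ k, (∑ l, L.c l j k * L.c a b l) • (xv K k * (pv K j * (pv K a * pv K b)))
  have h1 : ∑ l, dp K l L.pi * dx K l L.pi = (2 : K) • ∑ j, ∑ a, ∑ b, F j a b := by
    have e l : (∑ j, ∑ k, L.c l j k • (xv K k * pv K j)) * (∑ a, ∑ b, L.c a b l • (pv K a * pv K b))
        = ∑ j, ∑ a, ∑ b, ∑ k, (L.c l j k * L.c a b l) •
          (xv K k * (pv K j * (pv K a * pv K b)) : L.A) := by
      rw [sum_mul]; congr! 1 with j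
      rw [mul_sum]; congr! 1 with a
      rw [mul_sum]; congr! 1 with b
      rw [sum_mul]; congr! 1 with k
      rw [smul_mul_smul_comm, mul_assoc]
    have e' l : dp K l L.pi * dx K l L.pi = (2 : K) • ∑ j, ∑ a, ∑ b, ∑ k,
        (L.c l j k * L.c a b l) • (xv K k * (pv K j * (pv K a * pv K b)) : L.A) := by
      rw [L.dp_pi, L.dx_pi, smul_mul_assoc, e]
    rw [sum_congr rfl fun l _ => e' l, ← smul_sum]
    refine congrArg _ ?_
    rw [sum_comm]; congr! 1 with j
    rw [sum_comm]; congr! 1 with a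
    rw [sum_comm]; congr! 1 with b
    rw [sum_comm]; congr! 1 with k
    rw [sum_smul]
  have hM (j a b : Fin L.dim) : pv K j * (pv K a * pv K b) = pv K a * (pv K b * pv K j) := by
    rw [← mul_assoc, pv_mul_pv a j, smul_mul_assoc, mul_assoc, pv_mul_pv b j, mul_smul_comm,
      smul_smul, neg_mul_neg, one_mul, one_smul]
  have h2 j a b : F j a b + F a b j + F b j a = 0 := by
    simp only [F]
    rw [← hM j a b, hM b j a, ← sum_add_distrib, ← sum_add_distrib]
    refine sum_eq_zero fun k _ => ?_
    rw [← add_smul, ← add_smul, ← sum_add_distrib, ← sum_add_distrib]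
    have := L.c_jacobi j a b k
    rw [← neg_eq_zero, ← sum_neg_distrib] at this
    have h3 : ∑ l, (L.c l j k * L.c a b l + L.c l a k * L.c b j l + L.c l b k * L.c j a l) = 0 := by
      rw [← this]
      refine sum_congr rfl fun l _ => ?_
      rw [L.c_antisymm l j, L.c_antisymm l a, L.c_antisymm l b]; ring
    rw [h3, zero_smul]
  have hc (F : Fin L.dim → Fin L.dim → Fin L.dim → L.A) :
      ∑ j, ∑ a, ∑ b, F a b j = ∑ j, ∑ a, ∑ b, F j a b := by
    rw [sum_comm]; congr! 1; rw [sum_comm]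
  have h3 := hc F
  have h4 := (hc fun j a b => F a b j).trans h3
  have h5 : (3 : K) • ∑ j, ∑ a, ∑ b, F j a b = 0 := by
    rw [show (3 : K) = 1 + 1 + 1 by norm_num, add_smul, add_smul, one_smul]
    nth_rewrite 2 [← h3]
    nth_rewrite 2 [← h4]
    simp only [← sum_add_distrib, h2, sum_const_zero]
  rw [h1, (smul_eq_zero.1 h5).resolve_left three_ne_zero, smul_zero]

end Relations

section Input

variable [CharZero K] (L : BasedLie K) {V V' : Type} [Fintype V]
  [DecidableEq V] [Fintype V'] [DecidableEq V']

/-- The factor `π` at a vertex, as an element of the centre. -/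
def BasedLie.piC (v : V) : center K (L.Slots V) :=
  ⟨L.slot v L.pi, Subalgebra.mem_center_iff.2 fun b =>
    (mul_comm_of_even (by rw [L.par_slot, L.par_pi]) b two_ne_zero).symm⟩

/-- The product of the factors `π` at the vertices in a finite set. -/
def BasedLie.pis (s : Finset V) : L.Slots V := ((∏ v ∈ s, L.piC v : center K (L.Slots V)) :
  L.Slots V)

lemma BasedLie.pis_comm (s : Finset V) (b : L.Slots V) : b * L.pis s = L.pis s * b :=
  Subalgebra.mem_center_iff.1 (∏ v ∈ s, L.piC v : center K (L.Slots V)).2 b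

lemma BasedLie.pis_empty : L.pis (∅ : Finset V) = 1 := rfl

lemma BasedLie.pis_insert {s : Finset V} {v : V} (hv : v ∉ s) :
    L.pis (insert v s) = L.slot v L.pi * L.pis s := by
  unfold BasedLie.pis
  rw [Finset.prod_insert hv]; rfl

lemma BasedLie.pis_union {s t : Finset V} (h : Disjoint s t) :
    L.pis (s ∪ t) = L.pis s * L.pis t := by
  unfold BasedLie.pis
  rw [Finset.prod_union h]; rfl

lemma BasedLie.pis_mem_freeOf {S : Set V} {s : Finset V} (h : ∀ v ∈ s, v ∉ S) :
    L.pis s ∈ L.freeOf S := by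
  induction s using Finset.induction_on with
  | empty => exact one_mem _
  | insert v s hv ih =>
    rw [L.pis_insert hv]
    exact mul_mem (L.slot_mem_freeOf (h v (Finset.mem_insert_self _ _)) _)
      (ih fun w hw => h w (Finset.mem_insert_of_mem hw))

lemma BasedLie.fuse_pis (c : V' → V) (s : Finset V') (hc : Set.InjOn c s) :
    L.fuse c (L.pis s) = L.pis (s.image c) := by
  induction s using Finset.induction_on with
  | empty => simp [L.pis_empty]
  | insert v s hv ih =>
    rw [L.pis_insert hv, map_mul, L.fuse_slot, Finset.image_insert, L.pis_insert, ih]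
    · exact hc.mono (by simp)
    · intro h
      obtain ⟨w, hw, hwv⟩ := mem_image.1 h
      exact hv (hc (by simp [hw]) (by simp) hwv ▸ hw)

lemma BasedLie.par_pis (s : Finset V) : par K (L.pis s) = L.pis s := by
  induction s using Finset.induction_on with
  | empty => simp [L.pis_empty]
  | insert v s hv ih => rw [L.pis_insert hv, map_mul, ih, L.par_slot, L.par_pi]

lemma BasedLie.act_mul_apply (a b : Gra K V) (G : L.Slots V) :
    L.act V (a * b) G = L.act V a (L.act V b G) := by rw [map_mul, Module.End.mul_apply]

/-- The internal vertices. -/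
def ints (n m : ℕ) : Finset (Vert n m) := univ.map Function.Embedding.inr

lemma mem_ints {n m : ℕ} (v : Fin m) : (inr v : Vert n m) ∈ ints n m := by simp [ints]

lemma notMem_ints {n m : ℕ} (i : Fin (n + 1)) : (inl i : Vert n m) ∉ ints n m := by simp [ints]

/-- The product of elements of the tensor factors of the external vertices. -/
def BasedLie.exts {n : ℕ} (m : ℕ) (f : Fin (n + 1) → L.A) : L.Slots (Vert n m) :=
  (ofFn fun i => L.slot (inl i : Vert n m) (f i)).prod

lemma BasedLie.prod_ofFn_pi (n m : ℕ) :
    (ofFn fun v : Fin m => L.slot (inr v : Vert n m) L.pi).prod = L.pis (ints n m) := by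
  unfold BasedLie.pis ints
  rw [Finset.prod_map, ← List.prod_ofFn]
  change _ = (center K (L.Slots (Vert n m))).val _
  rw [map_list_prod, map_ofFn]
  rfl

lemma BasedLie.B_apply {n m : ℕ} (a : Gra K (Vert n m)) (f : Fin (n + 1) → L.A) :
    L.B a f = L.merge _ (L.act _ a (L.pis (ints n m) * L.exts m f)) := by
  rw [← L.prod_ofFn_pi]
  simp [BasedLie.B, BasedLie.exts]

lemma BasedLie.prod_slot_mem_freeOf {S : Set V} {k : ℕ} {g : Fin k → V} (h : ∀ i, g i ∉ S)
    (f : Fin k → L.A) : (ofFn fun i => L.slot (g i) (f i)).prod ∈ L.freeOf S := by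
  refine list_prod_mem fun x hx => ?_
  obtain ⟨i, rfl⟩ := (List.mem_ofFn' _ _).1 hx
  exact L.slot_mem_freeOf (h i) _

lemma BasedLie.exists_input_eq {n m : ℕ} (s : Finset (Vert n m)) (hs : s ⊆ ints n m)
    (f : Fin (n + 1) → L.A) : ∃ H ∈ L.freeOf (s : Set (Vert n m)),
      L.pis (ints n m) * L.exts m f = L.pis s * H := by
  refine ⟨L.pis (ints n m \ s) * L.exts m f, mul_mem (L.pis_mem_freeOf fun v hv => ?_)
    (L.prod_slot_mem_freeOf (fun i hi => notMem_ints i (hs hi)) f), ?_⟩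
  · simpa using (Finset.mem_sdiff.1 hv).2
  · rw [← mul_assoc, ← L.pis_union Finset.disjoint_sdiff, Finset.union_sdiff_of_subset hs]

lemma BasedLie.dx_slot_mul {S : Set V} {v : V} (hv : v ∈ S) {H : L.Slots V} (hH : H ∈ L.freeOf S)
    (l : Fin L.dim) (a : L.A) : dx K (v, l) (L.slot v a * H) = L.slot v (dx K l a) * H := by
  rw [dx_mul, L.dx_slot, (hH v hv l).1, mul_zero, add_zero]

lemma BasedLie.dp_slot_mul {S : Set V} {v : V} (hv : v ∈ S) {H : L.Slots V} (hH : H ∈ L.freeOf S)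
    (l : Fin L.dim) (a : L.A) : dp K (v, l) (L.slot v a * H) = L.slot v (dp K l a) * H := by
  rw [dp_mul, L.dp_slot, (hH v hv l).2, mul_zero, add_zero]

lemma dx_dp_apply {ι : Type} (i j : ι) (G : SuperPoly K ι) :
    dx K i (dp K j G) = dp K j (dx K i G) := by
  have := LinearMap.congr_fun (dx_dp K i j) G
  simpa only [Module.End.mul_apply] using this

lemma BasedLie.B_twoIn {n m : ℕ} (v : Fin m) (e e' : Edge (Vert n m)) (a : Gra K (Vert n m))
    (h : e.1.2 = inr v) (h' : e'.1.2 = inr v) : L.B (a * arrow K e * arrow K e') = 0 := by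
  ext f
  obtain ⟨H, hH, hG⟩ := L.exists_input_eq {inr v} (by simpa using mem_ints v) f
  rw [L.B_apply, hG, L.act_mul_apply, L.act_mul_apply, L.act_arrow, L.act_arrow]
  have hz : L.tau e (L.tau e' (L.pis {inr v} * H)) = 0 := by
    simp only [L.tau_apply, map_sum]
    refine sum_eq_zero fun l _ => sum_eq_zero fun l' _ => ?_
    rw [dx_dp_apply, h, h', ← insert_empty_eq, L.pis_insert (by simp), L.pis_empty, mul_one,
      L.dx_slot_mul (by simp) hH, L.dx_slot_mul (by simp) hH, L.dx_dx_pi, map_zero, zero_mul, map_zero,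
      map_zero]
  rw [hz, map_zero, map_zero]; rfl

lemma BasedLie.B_threeOut {n m : ℕ} (v : Fin m) (e e' e'' : Edge (Vert n m))
    (a : Gra K (Vert n m)) (h : e.1.1 = inr v) (h' : e'.1.1 = inr v)
    (h'' : e''.1.1 = inr v) : L.B (a * arrow K e * arrow K e' * arrow K e'') = 0 := by
  ext f
  obtain ⟨H, hH, hG⟩ := L.exists_input_eq {inr v} (by simpa using mem_ints v) f
  rw [L.B_apply, hG, L.act_mul_apply, L.act_mul_apply, L.act_mul_apply, L.act_arrow, L.act_arrow,
    L.act_arrow]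
  have hz : L.tau e (L.tau e' (L.tau e'' (L.pis {inr v} * H))) = 0 := by
    simp only [L.tau_apply, map_sum]
    refine sum_eq_zero fun l _ => sum_eq_zero fun l' _ =>
      sum_eq_zero fun l'' _ => ?_
    rw [← dx_dp_apply, ← dx_dp_apply, ← dx_dp_apply, ← dx_dp_apply, ← dx_dp_apply, ← dx_dp_apply, h,
      h', h'', ← insert_empty_eq, L.pis_insert (by simp), L.pis_empty, mul_one,
      L.dp_slot_mul (by simp) hH, L.dp_slot_mul (by simp) hH, L.dp_slot_mul (by simp) hH,
      L.dp_dp_dp_pi, map_zero, zero_mul, map_zero, map_zero, map_zero]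
  rw [hz, map_zero, map_zero]; rfl

lemma BasedLie.fuse_exts {n m m' : ℕ} (c : Vert n m → Vert n m') (hc : ∀ i, c (inl i) = inl i)
    (f : Fin (n + 1) → L.A) : L.fuse c (L.exts m f) = L.exts m' f := by
  unfold BasedLie.exts
  rw [map_list_prod, map_ofFn]
  congr 2
  funext i
  simp [L.fuse_slot, hc]

lemma BasedLie.B_relabel {n m : ℕ} (σ : Equiv.Perm (Fin m)) (a : Gra K (Vert n m)) :
    L.B (pull K (relabel σ) a) = L.B a := by
  ext f
  have h1 : pull K (relabel σ) a = pull K (fun x => some (Sum.map id σ x : Vert n m)) a := rfl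
  rw [L.B_apply, L.B_apply, h1, ← L.merge_fuse (Sum.map id σ : Vert n m → Vert n m), ← L.act_fuse,
    map_mul, L.fuse_exts _ (fun i => rfl), L.fuse_pis]
  · congr 3
    congr 1
    ext x
    simp only [mem_image, ints, mem_map, mem_univ, true_and]
    constructor
    · rintro ⟨_, ⟨v, rfl⟩, rfl⟩; exact ⟨σ v, rfl⟩
    · rintro ⟨v, rfl⟩; exact ⟨_, ⟨σ.symm v, rfl⟩, by simp⟩
  · exact (Sum.map_injective.2 ⟨injective_id, σ.injective⟩).injOn

lemma BasedLie.B_ihx {n m : ℕ} (v w : Fin m) (h : (inr v : Vert n m) ≠ inr w)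
    (a : Gra K (Vert n m)) :
    L.B (pull K (contract v w) a * arrow K ⟨(inr v, inr w), h⟩) = 0 := by
  ext f
  let c : Vert n m → Vert n m := fun u => if u = inr w then inr v else u
  have h1 : pull K (contract v w) a = pull K (fun x => some (c x)) a := rfl
  obtain ⟨H, hH, hG⟩ := L.exists_input_eq {inr v, inr w} (by
    intro x hx
    simp only [Finset.mem_insert, Finset.mem_singleton] at hx
    rcases hx with rfl | rfl <;> exact mem_ints _) f
  have h2 : L.pis {inr v, inr w} * H = L.slot (inr v) L.pi * (L.slot (inr w) L.pi * H) := by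
    rw [L.pis_insert (by simpa using h), ← insert_empty_eq, L.pis_insert (by simp), L.pis_empty,
      mul_one, mul_assoc]
  have hv : ∀ x : L.A, L.slot (inr w : Vert n m) x ∈ L.freeOf {(inr v : Vert n m)} := fun x =>
    L.slot_mem_freeOf (by simpa using h.symm) x
  have hw : ∀ x : L.A, L.slot (inr v : Vert n m) x ∈ L.freeOf {(inr w : Vert n m)} := fun x =>
    L.slot_mem_freeOf (by simpa using h) x
  have hHv : H ∈ L.freeOf {(inr v : Vert n m)} := fun x hx l => hH x (by
    rw [Set.mem_singleton_iff.1 hx]; simp) l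
  have hHw : H ∈ L.freeOf {(inr w : Vert n m)} := fun x hx l => hH x (by
    rw [Set.mem_singleton_iff.1 hx]; simp) l
  have hz : L.fuse c (L.tau ⟨(inr v, inr w), h⟩ (L.pis {inr v, inr w} * H)) = 0 := by
    have hl l : L.fuse c (dp K (inr v, l) (dx K (inr w, l)
        (L.slot (inr v) L.pi * (L.slot (inr w) L.pi * H)))) =
        L.slot (inr v) (dp K l L.pi * dx K l L.pi) * L.fuse c H := by
      rw [dx_mul, (hw L.pi _ rfl l).1, zero_mul, zero_add, L.dx_slot_mul (Set.mem_singleton _) hHw,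
        L.dp_slot_mul (Set.mem_singleton _) (mul_mem (hv _) hHv), map_mul, map_mul, L.fuse_slot, L.fuse_slot, map_mul,
        mul_assoc]
      simp only [c, if_neg h, if_true]
    rw [h2, L.tau_apply, map_sum]
    simp only [hl]
    rw [← sum_mul, ← map_sum, L.sum_dp_pi_mul_dx_pi, map_zero, zero_mul]
  rw [L.B_apply, hG, L.act_mul_apply, L.act_arrow, h1, ← L.merge_fuse c, ← L.act_fuse,
    hz, map_zero, map_zero]
  rfl

lemma BasedLie.B_add {n m : ℕ} (a b : Gra K (Vert n m)) : L.B (a + b) = L.B a + L.B b := by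
  ext f; simp [L.B_apply]

lemma BasedLie.B_smul {n m : ℕ} (r : K) (a : Gra K (Vert n m)) : L.B (r • a) = r • L.B a := by
  ext f; simp [L.B_apply]

/-- `B` as a linear map. -/
def BasedLie.Blin (n m : ℕ) :
    Gra K (Vert n m) →ₗ[K] MultilinearMap K (fun _ : Fin (n + 1) => L.A) L.A where
  toFun := L.B
  map_add' := L.B_add
  map_smul' := L.B_smul

/-- `B` vanishes on the relations. -/
lemma BasedLie.B_eq_zero_of_mem {n m : ℕ} {a : Gra K (Vert n m)} (ha : a ∈ relations K n m) :
    L.B a = 0 := by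
  refine LinearMap.mem_ker.1 (span_le (p := LinearMap.ker (L.Blin n m)).2 ?_ ha)
  rintro _ (⟨v, e, e', a, b, h, h'⟩ | ⟨v, e, e', e'', a, b, h, h', h''⟩ | ⟨σ, a⟩ | ⟨v, w, h, a⟩)
  · have : a * arrow K e * arrow K e' * b = a * twist K 1 (twist K 1 b) * arrow K e * arrow K e' := by
      rw [mul_assoc, arrow_mul, mul_assoc a, ← mul_assoc (arrow K e), arrow_mul]
      simp only [mul_assoc]
    exact this ▸ L.B_twoIn v e e' _ h h'
  · have : a * arrow K e * arrow K e' * arrow K e'' * b =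
        a * twist K 1 (twist K 1 (twist K 1 b)) * arrow K e * arrow K e' * arrow K e'' := by
      rw [mul_assoc, arrow_mul, mul_assoc (a * arrow K e), ← mul_assoc (arrow K e'), arrow_mul,
        mul_assoc a, ← mul_assoc (arrow K e), ← mul_assoc (arrow K e), arrow_mul]
      simp only [mul_assoc]
    exact this ▸ L.B_threeOut v e e' e'' _ h h' h''
  · have : L.B a + (-1 : K) • L.B a = ((1 : K) + (-1)) • L.B a := by rw [add_smul, one_smul]
    change L.B _ = 0
    rw [sub_eq_add_neg, ← neg_one_smul K a, L.B_add, L.B_smul, L.B_relabel, this, add_neg_cancel,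
      zero_smul]
  · exact L.B_ihx v w h a

end Input

lemma prod_ofFn_split {X : Type u} [Monoid X] {N : ℕ} (a b c : ℕ) (h : N = a + (b + c))
    (g : Fin N → X) : (ofFn g).prod = (ofFn fun i : Fin a => g ⟨i, by omega⟩).prod *
      ((ofFn fun i : Fin b => g ⟨a + i, by omega⟩).prod *
        (ofFn fun i : Fin c => g ⟨a + b + i, by omega⟩).prod) := by
  rw [List.ofFn_congr h, List.ofFn_add, List.ofFn_add, prod_append, prod_append]
  congr 4
  funext i
  congr 1
  ext
  simp [add_assoc]

lemma twist_zero (K : Type u) [Field K] {V : Type} (a : Gra K V) : twist K 0 a = a := by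
  simp [twist]

section Parity

variable [CharZero K] (L : BasedLie K) {V V' : Type} [Fintype V]
  [DecidableEq V] [Fintype V'] [DecidableEq V']

lemma BasedLie.par_mem_freeOf {S : Set V} {H : L.Slots V} (hH : H ∈ L.freeOf S) :
    par K H ∈ L.freeOf S := by
  intro v hv l
  rw [dx_par, dp_par, (hH v hv l).1, (hH v hv l).2]
  simp

lemma BasedLie.tau_mul_left {S : Set V} {H : L.Slots V} (hH : H ∈ L.freeOf S) {e : Edge V}
    (h1 : e.1.1 ∈ S) (h2 : e.1.2 ∈ S) (Y : L.Slots V) : L.tau e (H * Y) = par K H * L.tau e Y := by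
  rw [L.tau_apply, L.tau_apply, mul_sum]
  refine sum_congr rfl fun l _ => ?_
  rw [dx_mul, (hH _ h2 l).1, zero_mul, zero_add, dp_mul, (hH _ h1 l).2, zero_mul, zero_add]

lemma BasedLie.tau_mul_right {S : Set V} {H : L.Slots V} (hH : H ∈ L.freeOf S) {e : Edge V}
    (h1 : e.1.1 ∈ S) (h2 : e.1.2 ∈ S) (Y : L.Slots V) : L.tau e (Y * H) = L.tau e Y * H := by
  rw [L.tau_apply, L.tau_apply, sum_mul]
  refine sum_congr rfl fun l _ => ?_
  rw [dx_mul, (hH _ h2 l).1, mul_zero, add_zero, dp_mul, (hH _ h1 l).2, mul_zero, add_zero]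

lemma BasedLie.act_pull_mul_right {S : Set V} {H : L.Slots V} (hH : H ∈ L.freeOf S)
    (d : V → Option V') (hd : ∀ x y, d x = some y → x ∈ S) (b : Gra K V') (Y : L.Slots V) :
    L.act V (pull K d b) (Y * H) = L.act V (pull K d b) Y * H := by
  induction b using Gra.induction with
  | one => simp
  | add a b ha hb => simp only [map_add, LinearMap.add_apply, ha, hb, add_mul]
  | smul r a ha => simp only [map_smul, LinearMap.smul_apply, ha, smul_mul_assoc]
  | arrow_mul e a ha =>
    rw [map_mul (pull K d), L.act_mul_apply, L.act_mul_apply, ha, pull_arrow, map_sum, LinearMap.sum_apply,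
      LinearMap.sum_apply, sum_mul]
    refine sum_congr rfl fun q _ => ?_
    rw [L.act_arrow, L.tau_mul_right hH (hd _ _ q.2.1) (hd _ _ q.2.2)]

lemma BasedLie.act_pull_mul_left {S : Set V} {H : L.Slots V} (hH : H ∈ L.freeOf S) {k : ℕ}
    (hk : par K H = (-1 : K) ^ k • H)
    (d : V → Option V') (hd : ∀ x y, d x = some y → x ∈ S) (b : Gra K V') (Y : L.Slots V) :
    L.act V (pull K d b) (H * Y) = H * L.act V (pull K d (twist K k b)) Y := by
  induction b using Gra.induction with
  | one => simp
  | add a b ha hb => simp only [map_add, LinearMap.add_apply, ha, hb, mul_add]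
  | smul r a ha => simp only [map_smul, LinearMap.smul_apply, ha, mul_smul_comm]
  | arrow_mul e a ha =>
    rw [map_mul (pull K d), L.act_mul_apply, ha, map_mul (twist K k), map_mul (pull K d), L.act_mul_apply, twist_arrow, map_smul,
      map_smul, LinearMap.smul_apply, pull_arrow, map_sum, LinearMap.sum_apply, LinearMap.sum_apply,
      smul_sum, mul_sum]
    refine sum_congr rfl fun q _ => ?_
    rw [L.act_arrow, L.tau_mul_left hH (hd _ _ q.2.1) (hd _ _ q.2.2), hk, smul_mul_assoc,
      mul_smul_comm]

lemma BasedLie.act_pull_mul_left' {S : Set V} {H : L.Slots V} (hH : H ∈ L.freeOf S) {p : ℕ}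
    (d : V → Option V') (hd : ∀ x y, d x = some y → x ∈ S) {b : Gra K V'}
    (hb : twist K 1 b = (-1 : K) ^ p • b) (Y : L.Slots V) :
    L.act V (pull K d b) (H * Y) = par[K]^p H *
      L.act V (pull K d b) Y := by
  have h {k : ℕ} {A : L.Slots V} (hA : A ∈ L.freeOf S) (hk : par K A = (-1 : K) ^ k • A)
      (hb : twist K k b = (-1 : K) ^ (p * k) • b) :
      L.act V (pull K d b) (A * Y) = par[K]^p A * L.act V (pull K d b) Y := by
    rw [L.act_pull_mul_left hA hk d hd, hb, map_smul, map_smul, LinearMap.smul_apply, mul_smul_comm,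
      par_pow_smul hk, smul_mul_assoc]
  have hp := L.par_mem_freeOf hH
  have hs : H = (2 : K)⁻¹ • ((H + par K H) + (H - par K H)) := by
    rw [add_add_sub_cancel, ← two_smul K H, smul_smul, inv_mul_cancel₀ two_ne_zero, one_smul]
  rw [hs, smul_mul_assoc, map_smul, map_smul, add_mul, map_add,
    h (k := 0) (add_mem hH hp) (by simp [par_par, add_comm]) (by simp [twist_zero]),
    h (k := 1) (sub_mem hH hp) (by rw [map_sub, par_par]; module) (by simpa using hb), ← add_mul,
    ← map_add, smul_mul_assoc]

end Parity

/-- The arguments of the outer map in a composition. -/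
def BasedLie.compArg [CharZero K] (L : BasedLie K) {n₁ n₂ N : ℕ}
    (hN : n₁ + n₂ = N) (j : Fin (n₁ + 1)) (p : ℕ) (b : MultilinearMap K (fun _ : Fin (n₂ + 1) => L.A) L.A)
    (f : Fin (N + 1) → L.A) (i : Fin (n₁ + 1)) : L.A :=
  if h : i.1 < j.1 then par[K]^p (f ⟨i.1, by omega⟩)
  else if i.1 = j.1 then b fun k => f ⟨j.1 + k.1, by omega⟩ else f ⟨i.1 + n₂, by omega⟩

section Composition

variable {n₁ n₂ m₁ m₂ N M : ℕ} (hN : n₁ + n₂ = N) (hM : m₁ + m₂ = M) (j : Fin (n₁ + 1))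

/-- `collapse` as a total function. -/
def colV (x : Vert N M) : Vert n₁ m₁ := (collapse hN hM j x).getD (inl j)

lemma collapse_eq (x : Vert N M) : collapse hN hM j x = some (colV hN hM j x) := by
  rcases x with k | k <;> simp only [colV, collapse] <;> split_ifs <;> rfl

/-- The inclusion of the vertices of the inserted graph. -/
def embV : Vert n₂ m₂ → Vert N M
  | inl k => inl ⟨j + k, by omega⟩
  | inr k => inr ⟨m₁ + k, by omega⟩

lemma restrict_eq_some_iff (x : Vert N M) (y : Vert n₂ m₂) :
    restrict hN hM j x = some y ↔ x = embV hN hM j y := by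
  rcases x with k | k <;> rcases y with l | l <;> simp only [restrict, embV] <;> split_ifs <;>
    simp [Fin.ext_iff] <;> omega

lemma colV_embV (y : Vert n₂ m₂) : colV hN hM j (embV hN hM j y) = inl j := by
  rcases y with l | l
  · simp only [colV, embV, collapse]
    rw [dif_neg (by omega), dif_pos (by omega)]; rfl
  · simp only [colV, embV, collapse]
    rw [dif_neg (by omega)]; rfl

lemma colV_inl_lt {k : ℕ} (hk : k < j.1) :
    colV hN hM j (inl ⟨k, by omega⟩) = inl ⟨k, by omega⟩ := by
  simp only [colV, collapse]
  rw [dif_pos hk]; rfl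

lemma colV_inl_gt {k : ℕ} (hk : j.1 + (n₂ + 1) + k < N + 1) :
    colV hN hM j (inl ⟨j.1 + (n₂ + 1) + k, hk⟩) = inl ⟨j.1 + 1 + k, by omega⟩ := by
  simp only [colV, collapse]
  rw [dif_neg (by omega), dif_neg (by omega)]
  simp only [Option.getD_some, inl.injEq, Fin.mk.injEq]
  omega

lemma colV_inr_lt {k : ℕ} (hk : k < m₁) :
    colV hN hM j (inr ⟨k, by omega⟩) = inr ⟨k, hk⟩ := by
  simp only [colV, collapse]
  rw [dif_pos hk]; rfl

variable [CharZero K] (L : BasedLie K)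

lemma BasedLie.fuse_fuse_embV (G : L.Slots (Vert n₂ m₂)) :
    L.fuse (colV hN hM j) (L.fuse (embV hN hM j) G) = L.slot (inl j) (L.merge _ G) := by
  rw [L.fuse_fuse, L.slot_eq, L.merge_eq, gmap_gmap, BasedLie.fuse]
  refine gmap_congr (fun x => ?_) G
  show (_, _) = (_, _)
  rw [← colV_embV hN hM j x.1]; rfl

/-- `B` respects operadic compositions. -/
lemma BasedLie.B_compose {p : ℕ} (a : Gra K (Vert n₁ m₁)) {b : Gra K (Vert n₂ m₂)}
    (hb : twist K 1 b = (-1 : K) ^ p • b) (f : Fin (N + 1) → L.A) :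
    L.B (compose K hN hM j a b) f = L.B a (L.compArg hN j p (L.B b) f) := by
  have hj := j.2
  have hc : compose K hN hM j a b =
      pull K (fun x => some (colV hN hM j x)) a * pull K (restrict hN hM j) b := by
    rw [← pull_congr K (collapse_eq hN hM j) a]; rfl
  set S : Set (Vert N M) := Set.range (embV hN hM j) with hS
  have hd : ∀ x y, restrict hN hM j x = some y → x ∈ S := fun x y h =>
    ⟨y, ((restrict_eq_some_iff hN hM j x y).1 h).symm⟩
  rw [L.B_apply, hc, L.act_mul_apply, ← L.merge_fuse (colV hN hM j), ← L.act_fuse, L.B_apply]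
  refine congrArg (fun G => L.merge _ (L.act _ a G)) ?_
  -- the factors
  let s₁ : Finset (Vert N M) := univ.image fun k : Fin m₁ => inr ⟨k.1, by omega⟩
  let s₂ : Finset (Vert N M) := (ints n₂ m₂).image (embV hN hM j)
  have hdis : Disjoint s₁ s₂ := by
    rw [Finset.disjoint_left]
    intro x h1 h2
    obtain ⟨k, -, rfl⟩ := mem_image.1 h1
    obtain ⟨y, hy, hyx⟩ := mem_image.1 h2
    obtain ⟨l, -, rfl⟩ := mem_map.1 hy
    simp [embV, Fin.ext_iff] at hyx
    omega
  have hun : ints N M = s₁ ∪ s₂ := by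
    ext x
    rcases x with k | k
    · simp [ints, s₁, s₂, embV]
    · simp only [mem_ints, Finset.mem_union, s₁, s₂, true_iff]
      by_cases hk : k.1 < m₁
      · exact Or.inl (mem_image.2 ⟨⟨k.1, hk⟩, mem_univ _, rfl⟩)
      · refine Or.inr (mem_image.2 ⟨inr ⟨k.1 - m₁, by omega⟩, mem_ints _, ?_⟩)
        simp [embV, Fin.ext_iff]; omega
  have hemb : Function.Injective (embV hN hM j) := fun x y h => by
    have h1 := (restrict_eq_some_iff hN hM j _ x).2 rfl
    rw [(restrict_eq_some_iff hN hM j _ y).2 h] at h1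
    exact (Option.some.inj h1).symm
  have hs₁ : ∀ v ∈ s₁, v ∉ S := by
    rintro v hv ⟨y, rfl⟩
    obtain ⟨k, -, hk⟩ := mem_image.1 hv
    rcases y with l | l
    · simp [embV] at hk
    · simp [embV, Fin.ext_iff] at hk; omega
  let E₁ : L.Slots (Vert N M) := (ofFn fun i : Fin j.1 =>
    L.slot (inl ⟨i.1, by omega⟩ : Vert N M) (f ⟨i.1, by omega⟩)).prod
  let E₂ : L.Slots (Vert N M) := (ofFn fun i : Fin (n₂ + 1) =>
    L.slot (inl ⟨j.1 + i.1, by omega⟩ : Vert N M) (f ⟨j.1 + i.1, by omega⟩)).prod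
  let E₃ : L.Slots (Vert N M) := (ofFn fun i : Fin (n₁ - j.1) =>
    L.slot (inl ⟨j.1 + (n₂ + 1) + i.1, by omega⟩ : Vert N M)
      (f ⟨j.1 + (n₂ + 1) + i.1, by omega⟩)).prod
  have hE : L.exts M f = E₁ * (E₂ * E₃) := prod_ofFn_split j.1 (n₂ + 1) (n₁ - j.1) (by omega) _
  have hE₁ : E₁ ∈ L.freeOf S := by
    refine L.prod_slot_mem_freeOf ?_ _
    rintro i ⟨l | l, hy⟩ <;> simp [embV, Fin.ext_iff] at hy
    omega
  have hE₃ : E₃ ∈ L.freeOf S := by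
    refine L.prod_slot_mem_freeOf ?_ _
    rintro i ⟨l | l, hy⟩ <;> simp [embV, Fin.ext_iff] at hy
    omega
  have hE₂ : L.pis s₂ * E₂ = L.fuse (embV hN hM j) (L.pis (ints n₂ m₂) *
      L.exts m₂ fun k => f ⟨j.1 + k.1, by omega⟩) := by
    rw [map_mul, L.fuse_pis _ _ hemb.injOn, BasedLie.exts, map_list_prod, map_ofFn]
    refine congrArg (fun l => L.pis s₂ * prod l) (congrArg ofFn ?_)
    funext i
    simp only [comp_apply, L.fuse_slot]
    rfl
  have hT : L.act _ (pull K (restrict hN hM j) b) (L.pis (ints N M) * L.exts M f) =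
      par[K]^p (L.pis s₁ * E₁) *
        (L.fuse (embV hN hM j) (L.act _ b (L.pis (ints n₂ m₂) *
          L.exts m₂ fun k => f ⟨j.1 + k.1, by omega⟩)) * E₃) := by
    have : L.pis (ints N M) * L.exts M f = (L.pis s₁ * E₁) * ((L.pis s₂ * E₂) * E₃) := by
      have hc : E₁ * L.pis s₂ = L.pis s₂ * E₁ := L.pis_comm s₂ E₁
      rw [hun, L.pis_union hdis, hE, mul_assoc, ← mul_assoc (L.pis s₂), ← hc]
      simp only [mul_assoc]
    rw [this, L.act_pull_mul_left' (mul_mem (L.pis_mem_freeOf hs₁) hE₁) _ hd hb,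
      L.act_pull_mul_right hE₃ _ hd, hE₂,
      L.act_fuse_of_injective _ _ (restrict_eq_some_iff hN hM j)]
  have hparfuse := map_par_pow (f := L.fuse (colV hN hM j)) fun x => (par_gmap _ x).symm
  have hparslot (v : Vert n₁ m₁) := map_par_pow (f := L.slot v) fun x => (L.par_slot v x).symm
  have hparpis (p : ℕ) (s : Finset (Vert n₁ m₁)) : par[K]^p (L.pis s) = L.pis s := by
    rw [par_pow_smul (k := 0) (by simp [L.par_pis])]; simp
  rw [hT, map_mul (L.fuse (colV hN hM j)), map_mul (L.fuse (colV hN hM j)), hparfuse,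
    map_mul (L.fuse (colV hN hM j)), map_mul (par K ^ p), L.fuse_fuse_embV, ← L.B_apply, L.fuse_pis,
    hparpis, mul_assoc]
  · have i1 : s₁.image (colV hN hM j) = ints n₁ m₁ := by
      ext x
      simp only [mem_image, s₁, mem_univ, true_and, ints, mem_map]
      constructor
      · rintro ⟨_, ⟨k, rfl⟩, rfl⟩
        exact ⟨k, (colV_inr_lt hN hM j k.2).symm⟩
      · rintro ⟨k, rfl⟩
        exact ⟨_, ⟨k, rfl⟩, colV_inr_lt hN hM j k.2⟩
    rw [i1]
    congr 1
    have hsplit : L.exts m₁ (L.compArg hN j p (L.B b) f) = _ :=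
      prod_ofFn_split j.1 1 (n₁ - j.1) (by omega) _
    rw [hsplit]
    congr 1
    · rw [map_list_prod, map_list_prod, map_ofFn, map_ofFn]
      congr 2
      funext i
      simp only [comp_apply, L.fuse_slot, colV_inl_lt hN hM j i.2, ← hparslot]
      rw [BasedLie.compArg, dif_pos i.2]
    · congr 1
      · simp only [ofFn_succ, List.ofFn_zero, prod_cons, prod_nil, mul_one]
        rw [BasedLie.compArg, dif_neg (by simp), if_pos (by simp)]
        congr 2
      · rw [map_list_prod, map_ofFn]
        congr 2
        funext i
        simp only [comp_apply, L.fuse_slot]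
        rw [colV_inl_gt, BasedLie.compArg, dif_neg (by simp; omega), if_neg (by simp; omega)]
        congr 3
        simp only [Fin.mk.injEq]
        omega
  · intro x hx y hy h
    obtain ⟨k, -, rfl⟩ := mem_image.1 hx
    obtain ⟨l, -, rfl⟩ := mem_image.1 hy
    rw [colV_inr_lt hN hM j k.2, colV_inr_lt hN hM j l.2] at h
    simpa [Fin.ext_iff] using h

end Composition

lemma map_mem_of_mem_span {R M N : Type*} [Semiring R] [AddCommMonoid M] [AddCommMonoid N]
    [Module R M] [Module R N] {s : Set M} {T : Submodule R N} (f : M →ₗ[R] N)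
    (h : ∀ x ∈ s, f x ∈ T) {x : M} (hx : x ∈ span R s) : f x ∈ T :=
  span_le (p := T.comap f).2 h hx

lemma map₂_mem_of_mem_span {R M N P : Type*} [CommSemiring R] [AddCommMonoid M] [AddCommMonoid N]
    [AddCommMonoid P] [Module R M] [Module R N] [Module R P] {s : Set M} {t : Set N}
    {T : Submodule R P} (f : M →ₗ[R] N →ₗ[R] P) (h : ∀ x ∈ s, ∀ y ∈ t, f x y ∈ T) {x : M}
    (hx : x ∈ span R s) {y : N} (hy : y ∈ span R t) : f x y ∈ T :=
  map_mem_of_mem_span (f.flip y) (fun x hx => map_mem_of_mem_span (f x) (h x hx) hy) hx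

lemma exteriorPower_eq (R : Type*) [CommRing R] (M : Type*) [AddCommGroup M] [Module R M] (j : ℕ) :
    (⋀[R]^j M : Submodule R (ExteriorAlgebra R M)) = LinearMap.range (ExteriorAlgebra.ι R) ^ j := rfl

lemma map_mem_exteriorPower {R M N : Type*} [CommRing R] [AddCommGroup M] [Module R M]
    [AddCommGroup N] [Module R N] (f : M →ₗ[R] N) {j : ℕ} {w : ExteriorAlgebra R M}
    (hw : w ∈ (⋀[R]^j M : Submodule R (ExteriorAlgebra R M))) :
    ExteriorAlgebra.map f w ∈ (⋀[R]^j N : Submodule R (ExteriorAlgebra R N)) := by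
  have := Submodule.mem_map_of_mem (f := (ExteriorAlgebra.map f).toLinearMap) hw
  rw [exteriorPower_eq, Submodule.map_pow] at this
  refine SetLike.le_def.1 (pow_le_pow_left' ?_ j) this
  rintro _ ⟨_, ⟨v, rfl⟩, rfl⟩
  exact ⟨f v, (map_apply_ι ..).symm⟩

section Bihom

open scoped Pointwise
variable {ι ι' : Type} [Fintype ι] [DecidableEq ι] [Fintype ι']
  [DecidableEq ι']

local notation "Λ^" j:max => (⋀[K]^j (ι → K) : Submodule K (ExteriorAlgebra K (ι → K)))

variable (K) in
/-- The sums of bihomogeneous superpolynomials with bidegrees (in the even, in the odd variables)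
in a given set. -/
def bihom (S : Set (ℤ × ℤ)) : Submodule K (SuperPoly K ι) :=
  span K {a | ∃ (i j : ℕ) (P : MvPolynomial ι K) (w : ExteriorAlgebra K (ι → K)),
    P.IsHomogeneous i ∧ w ∈ Λ^ j ∧ ((i : ℤ), (j : ℤ)) ∈ S ∧ a = P ⊗ₜ[K] w}

lemma bihom_mono {S T : Set (ℤ × ℤ)} (h : S ⊆ T) : bihom K (ι := ι) S ≤ bihom K T :=
  span_mono fun _ ⟨i, j, P, w, hP, hw, hS, ha⟩ => ⟨i, j, P, w, hP, hw, h hS, ha⟩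

lemma tmul_mem_bihom {S : Set (ℤ × ℤ)} {i j : ℕ} {P : MvPolynomial ι K}
    {w : ExteriorAlgebra K (ι → K)} (hP : P.IsHomogeneous i) (hw : w ∈ Λ^ j)
    (h : ((i : ℤ), (j : ℤ)) ∈ S) : P ⊗ₜ[K] w ∈ bihom K S :=
  subset_span ⟨i, j, P, w, hP, hw, h, rfl⟩

lemma map_mem_bihom {S T : Set (ℤ × ℤ)} (f : SuperPoly K ι →ₗ[K] SuperPoly K ι')
    (h : ∀ (i j : ℕ) (P : MvPolynomial ι K) (w : ExteriorAlgebra K (ι → K)), P.IsHomogeneous i →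
      w ∈ Λ^ j → ((i : ℤ), (j : ℤ)) ∈ S → f (P ⊗ₜ[K] w) ∈ bihom K T) {a : SuperPoly K ι} (ha : a ∈ bihom K S) : f a ∈ bihom K T :=
  map_mem_of_mem_span f (by rintro _ ⟨i, j, P, w, hP, hw, hS, rfl⟩; exact h i j P w hP hw hS) ha

lemma one_mem_bihom : (1 : SuperPoly K ι) ∈ bihom K {0} :=
  tmul_mem_bihom (isHomogeneous_one ι K) (j := 0)
    (by rw [exteriorPower_eq, pow_zero]; exact Submodule.one_le.1 le_rfl) (by simp)

lemma mul_mem_bihom {S T : Set (ℤ × ℤ)} {a b : SuperPoly K ι} (ha : a ∈ bihom K S)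
    (hb : b ∈ bihom K T) : a * b ∈ bihom K (S + T) := by
  refine map_mem_bihom (mulLeft K a) (fun i' j' P' w' hP' hw' hT => ?_) hb
  refine map_mem_bihom (LinearMap.mulRight K (P' ⊗ₜ[K] w')) (fun i j P w hP hw hS => ?_) ha
  rw [LinearMap.mulRight_apply, tmul_mul_tmul]
  refine tmul_mem_bihom (hP.mul hP') (j := j + j') ?_ (Set.mem_add.2 ⟨_, hS, _, hT, by simp⟩)
  rw [exteriorPower_eq, pow_add]
  exact mul_mem_mul hw hw'

lemma list_prod_mem_bihom {n : ℕ} (g : Fin n → SuperPoly K ι) (S : Fin n → Set (ℤ × ℤ))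
    (h : ∀ i, g i ∈ bihom K (S i)) : (ofFn g).prod ∈ bihom K (∑ i, S i) := by
  induction n with
  | zero =>
    rw [List.ofFn_zero, prod_nil, Fin.sum_univ_zero]
    exact one_mem_bihom
  | succ n ih =>
    rw [ofFn_succ, prod_cons, sum_univ_succ]
    exact mul_mem_bihom (h 0) (ih _ _ fun i => h i.succ)

lemma dx_mem_bihom {S : Set (ℤ × ℤ)} (l : ι) {a : SuperPoly K ι} (ha : a ∈ bihom K S) :
    dx K l a ∈ bihom K (S + {(-1, 0)}) := by
  refine map_mem_bihom (dx K l) (fun i j P w hP hw hS => ?_) ha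
  rw [dx, TensorProduct.map_tmul, id_apply]
  rcases Nat.eq_zero_or_pos i with rfl | hi
  · rw [← MvPolynomial.totalDegree_zero_iff_isHomogeneous, MvPolynomial.totalDegree_eq_zero_iff_eq_C]
      at hP
    have h0 : (MvPolynomial.pderiv l : Derivation K (MvPolynomial ι K) _).toLinearMap
        (MvPolynomial.C (MvPolynomial.coeff 0 P)) = 0 := MvPolynomial.pderiv_C
    rw [hP, h0, zero_tmul]
    exact zero_mem _
  · refine tmul_mem_bihom hP.pderiv hw (Set.mem_add.2 ⟨_, hS, _, rfl, ?_⟩)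
    simp only [mk_add_mk, add_zero, Prod.mk.injEq, and_true]
    omega

lemma contractLeft_mem {M : Type*} [AddCommGroup M] [Module K M] (d : Module.Dual K M) (j : ℕ) {w : ExteriorAlgebra K M}
    (hw : w ∈ (⋀[K]^(j + 1) M : Submodule K (ExteriorAlgebra K M))) :
    CliffordAlgebra.contractLeft d w ∈ (⋀[K]^j M : Submodule K (ExteriorAlgebra K M)) := by
  induction j generalizing w with
  | zero =>
    rw [exteriorPower_eq, zero_add, pow_one] at hw
    obtain ⟨v, rfl⟩ := hw
    rw [exteriorPower_eq, pow_zero]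
    exact ⟨d v, by
      rw [ExteriorAlgebra.ι, CliffordAlgebra.contractLeft_ι]
      exact (Algebra.algebraMap_eq_smul_one _).symm⟩
  | succ j ih =>
    rw [exteriorPower_eq, pow_succ'] at hw
    induction hw using Submodule.mul_induction_on' with
    | mem_mul_mem v hv w hw =>
      obtain ⟨v, rfl⟩ := hv
      have := contractLeft_ι_mul (Q := (0 : QuadraticForm K M)) d v w
      refine this ▸ sub_mem (smul_mem _ _ hw) ?_
      rw [exteriorPower_eq, pow_succ']
      exact mul_mem_mul ⟨v, rfl⟩ (ih hw)
    | add x _ y _ hx hy => rw [map_add]; exact add_mem hx hy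

lemma dp_mem_bihom {S : Set (ℤ × ℤ)} (l : ι) {a : SuperPoly K ι} (ha : a ∈ bihom K S) :
    dp K l a ∈ bihom K (S + {(0, -1)}) := by
  refine map_mem_bihom (dp K l) (fun i j P w hP hw hS => ?_) ha
  rw [dp, TensorProduct.map_tmul, id_apply]
  rcases j with _ | j
  · rw [exteriorPower_eq, pow_zero] at hw
    obtain ⟨r, rfl⟩ := hw
    have : CliffordAlgebra.contractLeft (proj l : Module.Dual K (ι → K))
        (algebraMap K (ExteriorAlgebra K (ι → K)) r) = 0 :=
      CliffordAlgebra.contractLeft_algebraMap _ _ _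
    rw [LinearMap.toSpanSingleton_apply, ← Algebra.algebraMap_eq_smul_one, this,
      tmul_zero]
    exact zero_mem _
  · refine tmul_mem_bihom hP (contractLeft_mem _ j hw) (Set.mem_add.2 ⟨_, hS, _, rfl, ?_⟩)
    simp

lemma gmap_mem_bihom {S : Set (ℤ × ℤ)} (f : ι → ι') {a : SuperPoly K ι} (ha : a ∈ bihom K S) :
    gmap K f a ∈ bihom K S :=
  map_mem_bihom (gmap K f).toLinearMap (fun i j P w hP hw hS => by
    rw [AlgHom.toLinearMap_apply, gmap, map_tmul]
    exact tmul_mem_bihom hP.rename_isHomogeneous (map_mem_exteriorPower _ hw) hS) ha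

lemma bihom_eq_bot {S : Set (ℤ × ℤ)}
    (h : ∀ p ∈ S, p.1 < 0 ∨ p.2 < 0 ∨ (card ι : ℤ) < p.2) : bihom K (ι := ι) S = ⊥ := by
  rw [eq_bot_iff]
  refine span_le.2 ?_
  rintro _ ⟨i, j, P, w, hP, hw, hS, rfl⟩
  have h1 : card ι < j := by
    have := h _ hS
    simp only at this
    omega
  have h2 : Λ^ j = ⊥ := by
    rw [← Submodule.finrank_eq_zero, exteriorPower.finrank_eq, Module.finrank_fintype_fun_eq_card,
      Nat.choose_eq_zero_of_lt h1]
  rw [h2, mem_bot] at hw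
  rw [hw, tmul_zero]
  exact zero_mem _

variable (K) in
/-- The projection to the component of a given bidegree. -/
def biProj (i j : ℕ) : SuperPoly K ι →ₗ[K] SuperPoly K ι :=
  TensorProduct.map (MvPolynomial.homogeneousComponent i) (GradedAlgebra.proj (fun i : ℕ => Λ^ i) j)

lemma biProj_of_mem {i j : ℕ} {a : SuperPoly K ι} (ha : a ∈ bihom K {(↑i, ↑j)}) :
    biProj K i j a = a := by
  refine LinearMap.eqOn_span (g := .id) ?_ ha
  rintro _ ⟨i', j', P, w, hP, hw, hS, rfl⟩
  simp only [Set.mem_singleton_iff, Prod.mk.injEq, Nat.cast_inj] at hS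
  obtain ⟨rfl, rfl⟩ := hS
  rw [biProj, TensorProduct.map_tmul, MvPolynomial.homogeneousComponent_eq_self hP, proj_apply,
    DirectSum.decompose_of_mem_same (fun i : ℕ => Λ^ i) hw, id_apply]

lemma biProj_of_notMem {S : Set (ℤ × ℤ)} {i j : ℕ} (h : ((i : ℤ), (j : ℤ)) ∉ S)
    {a : SuperPoly K ι} (ha : a ∈ bihom K S) : biProj K i j a = 0 := by
  refine LinearMap.eqOn_span (g := 0) ?_ ha
  rintro _ ⟨i', j', P, w, hP, hw, hS, rfl⟩
  rw [biProj, TensorProduct.map_tmul, LinearMap.zero_apply]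
  by_cases hi : i' = i
  · rw [proj_apply, DirectSum.decompose_of_mem_ne (fun i : ℕ => Λ^ i) hw
      (by rintro rfl; exact h (hi ▸ hS)), tmul_zero]
  · rw [MvPolynomial.homogeneousComponent_of_mem hP, if_neg (Ne.symm hi), zero_tmul]

lemma iSup_bihom : (⨆ p : ℕ × ℕ, bihom K (ι := ι) {(↑p.1, ↑p.2)}) = ⊤ := by
  rw [eq_top_iff]
  rintro a -
  induction a using TensorProduct.induction_on with
  | zero => exact zero_mem _
  | add x y hx hy => exact add_mem hx hy
  | tmul P w =>
    rw [← MvPolynomial.sum_homogeneousComponent P, sum_tmul]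
    refine Submodule.sum_mem _ fun i _ => ?_
    induction w using DirectSum.Decomposition.inductionOn
      fun i : ℕ => Λ^ i with
    | zero => rw [tmul_zero]; exact zero_mem _
    | add x y hx hy => rw [tmul_add]; exact add_mem hx hy
    | @homogeneous j w =>
      exact mem_iSup_of_mem (i, j) (tmul_mem_bihom
        (MvPolynomial.homogeneousComponent_isHomogeneous _ _) w.2 rfl)

lemma exists_mem_bihom (a : SuperPoly K ι) :
    ∃ D : ℕ, a ∈ bihom K {p : ℤ × ℤ | p.1 ≤ D} := by
  induction iSup_bihom (K := K) (ι := ι) ▸ mem_top (x := a) using iSup_induction' with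
  | mem p x hx => exact ⟨p.1, bihom_mono (by simp) hx⟩
  | zero => exact ⟨0, zero_mem _⟩
  | add x y _ _ hx hy =>
    obtain ⟨D, hD⟩ := hx
    obtain ⟨D', hD'⟩ := hy
    exact ⟨max D D', add_mem (bihom_mono (fun p (hp : p.1 ≤ D) => hp.trans (by simp)) hD)
      (bihom_mono (fun p (hp : p.1 ≤ D') => hp.trans (by simp)) hD')⟩

lemma xv_mem_bihom (i : ι) : xv K i ∈ bihom K {(1, 0)} :=
  tmul_mem_bihom (MvPolynomial.isHomogeneous_X K i) (j := 0)
    (by rw [exteriorPower_eq, pow_zero]; exact Submodule.one_le.1 le_rfl) rfl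

lemma pv_mem_bihom (i : ι) : pv K i ∈ bihom K {(0, 1)} :=
  tmul_mem_bihom (isHomogeneous_one ι K) (j := 1)
    (by rw [exteriorPower_eq, pow_one]; exact ⟨_, rfl⟩) rfl

end Bihom

section BihomB

open scoped Pointwise
variable [CharZero K] (L : BasedLie K) {V : Type} [Fintype V]
  [DecidableEq V]

lemma BasedLie.gr_eq (k : ℤ) : L.gr k = bihom K {p | p.2 = k} := by
  refine le_antisymm (span_le.2 ?_) (span_le.2 ?_)
  · rintro _ ⟨P, j, w, hw, hk, rfl⟩
    rw [← MvPolynomial.sum_homogeneousComponent P, sum_tmul]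
    exact Submodule.sum_mem _ fun i _ => tmul_mem_bihom
        (MvPolynomial.homogeneousComponent_isHomogeneous _ _) hw hk
  · rintro _ ⟨i, j, P, w, -, hw, hS, rfl⟩
    exact subset_span ⟨P, j, w, hw, hS, rfl⟩

lemma BasedLie.tau_mem_bihom {S : Set (ℤ × ℤ)} (e : Edge V) {G : L.Slots V} (hG : G ∈ bihom K S) :
    L.tau e G ∈ bihom K (S + {(-1, -1)}) := by
  rw [L.tau_apply]
  refine Submodule.sum_mem _ fun l _ => ?_
  have := dp_mem_bihom (e.1.1, l) (dx_mem_bihom (e.1.2, l) hG)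
  rwa [add_assoc, singleton_add_singleton, mk_add_mk, add_zero, zero_add] at this

lemma BasedLie.act_graph_mem_bihom {S : Set (ℤ × ℤ)} (l : List (Edge V)) {G : L.Slots V}
    (hG : G ∈ bihom K S) :
    L.act V (graph K l) G ∈ bihom K (S + {(-↑l.length, -↑l.length)}) := by
  induction l with
  | nil =>
    simp only [graph, map_nil, prod_nil, map_one, Module.End.one_apply, List.length_nil,
      Nat.cast_zero, neg_zero]
    rwa [← Prod.zero_eq_mk, Set.singleton_zero, add_zero]
  | cons e l ih =>
    rw [graph, map_cons, prod_cons, L.act_mul_apply, L.act_arrow]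
    have := L.tau_mem_bihom e ih
    rw [add_assoc, singleton_add_singleton, mk_add_mk] at this
    refine bihom_mono (le_of_eq ?_) this
    rw [length_cons]
    push_cast
    ring_nf

lemma BasedLie.slot_mem_bihom {S : Set (ℤ × ℤ)} (v : V) {a : L.A} (ha : a ∈ bihom K S) :
    L.slot v a ∈ bihom K S := by
  rw [L.slot_eq]; exact gmap_mem_bihom _ ha

lemma BasedLie.pi_mem_bihom : L.pi ∈ bihom K {(1, 2)} := by
  rw [L.pi_eq]
  refine Submodule.sum_mem _ fun i _ => Submodule.sum_mem _ fun j _ => Submodule.sum_mem _ fun k _ =>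
    smul_mem _ _ ?_
  have := mul_mem_bihom (xv_mem_bihom k) (mul_mem_bihom (pv_mem_bihom i) (pv_mem_bihom (K := K) j))
  rw [singleton_add_singleton, singleton_add_singleton] at this
  exact this

lemma BasedLie.pis_mem_bihom (s : Finset V) :
    L.pis s ∈ bihom K {((s.card : ℤ), 2 * (s.card : ℤ))} := by
  induction s using Finset.induction_on with
  | empty => rw [L.pis_empty]; exact one_mem_bihom
  | insert v s hv ih =>
    rw [L.pis_insert hv, Finset.card_insert_of_notMem hv]
    have := mul_mem_bihom (L.slot_mem_bihom v L.pi_mem_bihom) ih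
    rw [singleton_add_singleton, mk_add_mk] at this
    refine bihom_mono (le_of_eq ?_) this
    push_cast
    ring_nf

lemma BasedLie.B_mem_bihom {n m : ℕ} (l : List (Edge (Vert n m))) (f : Fin (n + 1) → L.A)
    (S : Fin (n + 1) → Set (ℤ × ℤ)) (h : ∀ i, f i ∈ bihom K (S i)) :
    L.B (graph K l) f ∈ bihom K ({((m : ℤ) - l.length, 2 * (m : ℤ) - l.length)} + ∑ i, S i) := by
  rw [L.B_apply, L.merge_eq]
  refine gmap_mem_bihom _ (bihom_mono (le_of_eq ?_) (L.act_graph_mem_bihom l (mul_mem_bihom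
    (L.pis_mem_bihom _) (list_prod_mem_bihom _ S fun i => L.slot_mem_bihom _ (h i)))))
  have : (ints n m).card = m := by simp [ints]
  rw [this, add_right_comm, singleton_add_singleton, mk_add_mk]
  rfl

end BihomB

lemma exists_append_of_countP_pos {X : Type*} (p : X → Bool) (l : List X) (h : 1 ≤ l.countP p) :
    ∃ a e b, l = a ++ e :: b ∧ p e = true ∧ b.countP p + 1 = l.countP p := by
  induction l with
  | nil => simp at h
  | cons x l ih =>
    by_cases hx : p x = true
    · exact ⟨[], x, l, rfl, hx, by simp [hx]⟩
    · rw [List.countP_cons_of_neg hx] at h ⊢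
      obtain ⟨a, e, b, rfl, he, hb⟩ := ih h
      exact ⟨x :: a, e, b, rfl, he, hb⟩

lemma countP_or_le {X : Type*} (p q : X → Bool) (l : List X) :
    l.countP (fun x => p x || q x) ≤ l.countP p + l.countP q := by
  induction l with
  | nil => simp
  | cons x l ih =>
    simp only [countP_cons]
    cases p x <;> cases q x <;> simp <;> omega

section Graph

variable (K) {V V' : Type} [DecidableEq V] [DecidableEq V']

lemma graph_nil : graph K ([] : List (Edge V)) = 1 := rfl

lemma graph_cons (e : Edge V) (l : List (Edge V)) : graph K (e :: l) = arrow K e * graph K l := by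
  simp [graph]

lemma graph_append (l l' : List (Edge V)) : graph K (l ++ l') = graph K l * graph K l' := by
  simp [graph]

lemma arrow_mul_self (e : Edge V) : arrow K e * arrow K e = 0 := ExteriorAlgebra.ι_sq_zero _

lemma arrow_mul_left_comm (e : Edge V) (a b : Gra K V) :
    arrow K e * (a * b) = twist K 1 a * (arrow K e * b) := by
  rw [← mul_assoc, arrow_mul, mul_assoc]

lemma graph_eq_zero {l : List (Edge V)} (h : ¬ l.Nodup) : graph K l = 0 := by
  induction l with
  | nil => simp at h
  | cons e l ih =>
    rw [graph_cons]
    by_cases he : e ∈ l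
    · obtain ⟨s, t, rfl⟩ := List.append_of_mem he
      rw [graph_append, graph_cons, ← mul_assoc, arrow_mul, mul_assoc, ← mul_assoc (arrow K e),
        arrow_mul_self, zero_mul, mul_zero]
    · rw [ih fun hl => h (nodup_cons.2 ⟨he, hl⟩), mul_zero]

lemma twist_graph (k : ℕ) (l : List (Edge V)) :
    twist K k (graph K l) = (-1 : K) ^ (k * l.length) • graph K l := by
  induction l with
  | nil => simp [graph]
  | cons e l ih =>
    rw [graph_cons, map_mul, ih, twist_arrow, smul_mul_smul_comm, ← pow_add, length_cons,
      Nat.mul_succ, add_comm]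

/-- `l'` arises from `l` by reconnecting edges according to `c`. -/
def Lifts (c : V' → Option V) : List (Edge V') → List (Edge V) → Prop :=
  List.Forall₂ fun q e => c q.1.1 = some e.1.1 ∧ c q.1.2 = some e.1.2

lemma Lifts.exists_mem {c : V' → Option V} {l' : List (Edge V')} {l : List (Edge V)}
    (h : Lifts c l' l) {e : Edge V} (he : e ∈ l) :
    ∃ q ∈ l', c q.1.1 = some e.1.1 ∧ c q.1.2 = some e.1.2 := by
  induction h with
  | nil => simp at he
  | @cons q e' l' l hq _ ih =>
    rcases mem_cons.1 he with rfl | he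
    · exact ⟨q, by simp, hq⟩
    · obtain ⟨q', hq', h'⟩ := ih he
      exact ⟨q', by simp [hq'], h'⟩

lemma pull_graph_mem [Fintype V'] (c : V' → Option V) (l : List (Edge V)) :
    pull K c (graph K l) ∈ span K {a | ∃ l', Lifts c l' l ∧ a = graph K l'} := by
  induction l with
  | nil =>
    rw [graph_nil, map_one]
    exact subset_span ⟨[], List.Forall₂.nil, rfl⟩
  | cons e l ih =>
    rw [graph_cons, map_mul, pull_arrow, sum_mul]
    refine Submodule.sum_mem _ fun q _ => map_mem_of_mem_span (mulLeft K (arrow K q.1)) ?_ ih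
    rintro _ ⟨l', hl', rfl⟩
    exact subset_span ⟨q.1 :: l', List.Forall₂.cons q.2 hl', (graph_cons K _ _).symm⟩

end Graph

section Closure

variable (K) {n m : ℕ}

lemma graph_mem_relations_of_incoming {l : List (Edge (Vert n m))} {v : Fin m}
    (h : 2 ≤ l.countP (fun e => decide (e.1.2 = inr v))) : graph K l ∈ relations K n m := by
  obtain ⟨a, e, b, rfl, he, hb⟩ := exists_append_of_countP_pos
    (fun e : Edge (Vert n m) => decide (e.1.2 = inr v)) l (by omega)
  obtain ⟨b, e', c, rfl, he', -⟩ := exists_append_of_countP_pos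
    (fun e : Edge (Vert n m) => decide (e.1.2 = inr v)) b (by omega)
  have := Relator.twoIn v e e' (graph K a * twist K 1 (graph K b)) (graph K c)
    (of_decide_eq_true he) (of_decide_eq_true he')
  refine subset_span ?_
  rw [graph_append, graph_cons, graph_append, graph_cons, arrow_mul_left_comm]
  simpa only [mul_assoc, mem_setOf_eq] using this

lemma graph_mem_relations_of_outgoing {l : List (Edge (Vert n m))} {v : Fin m}
    (h : 3 ≤ l.countP (fun e => decide (e.1.1 = inr v))) : graph K l ∈ relations K n m := by
  obtain ⟨a, e, b, rfl, he, hb⟩ := exists_append_of_countP_pos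
    (fun e : Edge (Vert n m) => decide (e.1.1 = inr v)) l (by omega)
  obtain ⟨b, e', c, rfl, he', hc⟩ := exists_append_of_countP_pos
    (fun e : Edge (Vert n m) => decide (e.1.1 = inr v)) b (by omega)
  obtain ⟨c, e'', d, rfl, he'', -⟩ := exists_append_of_countP_pos
    (fun e : Edge (Vert n m) => decide (e.1.1 = inr v)) c (by omega)
  have := Relator.threeOut v e e' e'' (graph K a * twist K 1 (graph K b * twist K 1 (graph K c)))
    (graph K d) (of_decide_eq_true he) (of_decide_eq_true he') (of_decide_eq_true he'')
  refine subset_span ?_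
  rw [graph_append, graph_cons, graph_append, graph_cons, graph_append, graph_cons,
    arrow_mul_left_comm K e', ← mul_assoc (graph K b), arrow_mul_left_comm K e]
  simpa only [mul_assoc, mem_setOf_eq] using this

/-- Every internal vertex is connected to an external one. -/
def IsConn (l : List (Edge (Vert n m))) : Prop := ∀ v : Fin m, ∃ i : Fin (n + 1),
  Relation.EqvGen (fun a b => ∃ e ∈ l, e.1.1 = a ∧ e.1.2 = b) (inr v) (inl i)

lemma cls_graph_mem {l : List (Edge (Vert n m))} (h : IsConn l) :
    cls K n m (graph K l) ∈ dgraphsDeg K (2 * (m : ℤ) - l.length + n) n m := by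
  by_cases hl : IsAdmissible l
  · exact subset_span ⟨l, hl, rfl, rfl⟩
  · suffices hg : graph K l ∈ relations K n m by
      have h0 : cls K n m (graph K l) = 0 := (mk_eq_zero _).2 hg
      rw [h0]; exact zero_mem _
    by_contra hg
    have h1 (v : Fin m) : l.countP (fun e => decide (e.1.2 = inr v)) ≤ 1 := by
      by_contra hv
      exact hg (graph_mem_relations_of_incoming K (v := v) (by omega))
    have h2 (v : Fin m) : l.countP (fun e => decide (e.1.1 = inr v)) ≤ 2 := by
      by_contra hv
      exact hg (graph_mem_relations_of_outgoing K (v := v) (by omega))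
    refine hl ⟨?_, fun v => ?_, h1, h2, h⟩
    · by_contra hn
      exact hg (graph_eq_zero K hn ▸ zero_mem _)
    · have := countP_or_le (fun e : Edge (Vert n m) => decide (e.1.1 = inr v))
        (fun e => decide (e.1.2 = inr v)) l
      simp only [Bool.decide_or]
      linarith [h1 v, h2 v]

variable {n₁ n₂ m₁ m₂ N M : ℕ} (hN : n₁ + n₂ = N) (hM : m₁ + m₂ = M) (j : Fin (n₁ + 1))

lemma eq_embV_or (x : Vert N M) : (∃ y, x = embV hN hM j y) ∨ (∃ i, x = inl i) ∨
    ∃ v : Fin m₁, x = inr ⟨v.1, by omega⟩ ∧ colV hN hM j x = inr v := by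
  rcases x with k | k
  · exact Or.inr (Or.inl ⟨k, rfl⟩)
  · by_cases hk : k.1 < m₁
    · exact Or.inr (Or.inr ⟨⟨k.1, hk⟩, rfl, colV_inr_lt hN hM j hk⟩)
    · refine Or.inl ⟨inr ⟨k.1 - m₁, by omega⟩, ?_⟩
      simp only [embV, inr.injEq, Fin.ext_iff]
      omega

lemma isConn_append {l₁ : List (Edge (Vert n₁ m₁))} {l₂ : List (Edge (Vert n₂ m₂))}
    (h₁ : IsConn l₁) (h₂ : IsConn l₂) {l₁' l₂' : List (Edge (Vert N M))}
    (hl₁ : Lifts (collapse hN hM j) l₁' l₁) (hl₂ : Lifts (restrict hN hM j) l₂' l₂) :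
    IsConn (l₁' ++ l₂') := by
  let r : Vert N M → Vert N M → Prop := fun a b => ∃ e ∈ l₁' ++ l₂', e.1.1 = a ∧ e.1.2 = b
  let G : Vert N M → Prop := fun x => ∃ i, Relation.EqvGen r x (inl i)
  have gext i : G (inl i) := ⟨i, Relation.EqvGen.refl _⟩
  have gstep : ∀ q ∈ l₁' ++ l₂', (G q.1.1 ↔ G q.1.2) := fun q hq =>
    ⟨fun ⟨i, hi⟩ => ⟨i, (Relation.EqvGen.symm _ _ (Relation.EqvGen.rel _ _ ⟨q, hq, rfl, rfl⟩)).trans _ _ _ hi⟩,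
      fun ⟨i, hi⟩ => ⟨i, (Relation.EqvGen.rel _ _ ⟨q, hq, rfl, rfl⟩).trans _ _ _ hi⟩⟩
  have gemb y : G (embV hN hM j y) := by
    have key (a b : Vert n₂ m₂) : Relation.EqvGen (fun a b => ∃ e ∈ l₂, e.1.1 = a ∧ e.1.2 = b) a b →
        (G (embV hN hM j a) ↔ G (embV hN hM j b)) := by
      intro hab
      induction hab with
      | rel a b h =>
        obtain ⟨e, he, rfl, rfl⟩ := h
        obtain ⟨q, hq, hq1, hq2⟩ := hl₂.exists_mem he
        rw [← (restrict_eq_some_iff hN hM j _ _).1 hq1, ← (restrict_eq_some_iff hN hM j _ _).1 hq2]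
        exact gstep q (List.mem_append_right _ hq)
      | refl a => rfl
      | symm a b _ ih => exact ih.symm
      | trans a b c _ _ ih ih' => exact ih.trans ih'
    rcases y with i | v
    · exact gext _
    · obtain ⟨i, hi⟩ := h₂ v
      exact (key _ _ hi).2 (gext _)
  let P : Vert n₁ m₁ → Prop := fun y => ∀ x, colV hN hM j x = y → G x
  have hP x : (P (colV hN hM j x) ↔ G x) := by
    refine ⟨fun h => h x rfl, fun h x' hx' => ?_⟩
    rcases eq_embV_or hN hM j x' with ⟨y, rfl⟩ | ⟨i, rfl⟩ | ⟨v, hx, hv⟩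
    · exact gemb y
    · exact gext i
    · rw [hv] at hx'
      rcases eq_embV_or hN hM j x with ⟨y, rfl⟩ | ⟨i, rfl⟩ | ⟨w, hw, hw'⟩
      · rw [colV_embV] at hx'; cases hx'
      · exfalso
        simp only [colV, collapse] at hx'
        split_ifs at hx' <;> simp at hx'
      · rw [hw'] at hx'
        cases hx'
        rw [hx, ← hw]; exact h
  have pext i : P (inl i) := by
    intro x hx
    rcases eq_embV_or hN hM j x with ⟨y, rfl⟩ | ⟨i, rfl⟩ | ⟨v, -, hv⟩
    · exact gemb y
    · exact gext i
    · rw [hv] at hx; cases hx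
  have key (a b : Vert n₁ m₁) : Relation.EqvGen (fun a b => ∃ e ∈ l₁, e.1.1 = a ∧ e.1.2 = b) a b →
      (P a ↔ P b) := by
    intro hab
    induction hab with
    | rel a b h =>
      obtain ⟨e, he, rfl, rfl⟩ := h
      obtain ⟨q, hq, hq1, hq2⟩ := hl₁.exists_mem he
      rw [collapse_eq, Option.some.injEq] at hq1 hq2
      rw [← hq1, ← hq2, hP, hP]
      exact gstep q (List.mem_append_left _ hq)
    | refl a => rfl
    | symm a b _ ih => exact ih.symm
    | trans a b c _ _ ih ih' => exact ih.trans ih'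
  intro v
  rcases eq_embV_or hN hM j (inr v) with ⟨y, hy⟩ | ⟨i, hi⟩ | ⟨w, hx, hw⟩
  · rw [hy]; exact gemb y
  · cases hi
  · obtain ⟨i, hi⟩ := h₁ w
    exact (key _ _ hi).2 (pext i) _ hw

lemma cls_compose_mem {l₁ : List (Edge (Vert n₁ m₁))} {l₂ : List (Edge (Vert n₂ m₂))}
    (h₁ : IsConn l₁) (h₂ : IsConn l₂) :
    cls K N M (compose K hN hM j (graph K l₁) (graph K l₂)) ∈
      dgraphsDeg K ((2 * (m₁ : ℤ) - l₁.length + n₁) + (2 * (m₂ : ℤ) - l₂.length + n₂)) N M := by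
  refine map₂_mem_of_mem_span ((LinearMap.mul K (Gra K (Vert N M))).compr₂ (cls K N M)) ?_
    (pull_graph_mem K _ l₁) (pull_graph_mem K _ l₂)
  rintro _ ⟨l, hl, rfl⟩ _ ⟨l', hl', rfl⟩
  have := cls_graph_mem K (isConn_append hN hM j h₁ h₂ hl hl')
  rw [List.length_append, List.Forall₂.length_eq hl, List.Forall₂.length_eq hl'] at this
  change cls K N M (graph K l * graph K l') ∈ _
  rw [← graph_append]
  convert this using 1
  congr 1; omega

/-- `compSign` as a bilinear map. -/
def compQ (k : ℕ) : QGra K n₁ m₁ →ₗ[K] QGra K n₂ m₂ →ₗ[K] QGra K N M :=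
  mk₂ K (compSign K hN hM j k)
    (by rintro ⟨x⟩ ⟨x'⟩ ⟨y⟩; exact congrArg (cls K N M) (by simp))
    (by rintro r ⟨x⟩ ⟨y⟩; exact congrArg (cls K N M) (by simp))
    (by rintro ⟨x⟩ ⟨y⟩ ⟨y'⟩; exact congrArg (cls K N M) (by simp))
    (by rintro r ⟨x⟩ ⟨y⟩; exact congrArg (cls K N M) (by simp))

lemma compQ_apply (k : ℕ) (x : QGra K n₁ m₁) (y : QGra K n₂ m₂) :
    compQ K hN hM j k x y = compSign K hN hM j k x y := rfl

lemma compQ_cls (k : ℕ) (a : Gra K (Vert n₁ m₁)) (b : Gra K (Vert n₂ m₂)) :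
    compQ K hN hM j k (cls K n₁ m₁ a) (cls K n₂ m₂ b) =
      cls K N M (compose K hN hM j a (twist K k b)) := rfl

lemma compSign_mem_dgraphsDeg (k : ℕ) {p q : ℤ} {x : QGra K n₁ m₁} (hx : x ∈ dgraphsDeg K p n₁ m₁)
    {y : QGra K n₂ m₂} (hy : y ∈ dgraphsDeg K q n₂ m₂) :
    compSign K hN hM j k x y ∈ dgraphsDeg K (p + q) N M := by
  refine map₂_mem_of_mem_span (compQ K hN hM j k) ?_ hx hy
  rintro _ ⟨l, hl, rfl, rfl⟩ _ ⟨l', hl', rfl, rfl⟩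
  rw [compQ_cls, twist_graph, map_smul, map_smul]
  exact smul_mem _ _ (cls_compose_mem K hN hM j hl.connected hl'.connected)

lemma dgraphs_eq (n m : ℕ) : dgraphs K n m = ⨆ q, dgraphsDeg K q n m := by
  refine le_antisymm ?_ (iSup_le fun q => span_le.2 ?_)
  · rw [dgraphs, dgr, Submodule.map_span, span_le]
    rintro _ ⟨_, ⟨l, hl, rfl⟩, rfl⟩
    exact mem_iSup_of_mem _ (subset_span ⟨l, hl, rfl, rfl⟩)
  · rintro _ ⟨l, hl, -, rfl⟩
    exact Submodule.mem_map_of_mem (subset_span ⟨l, hl, rfl⟩)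

lemma compSign_mem_dgraphs (k : ℕ) {x : QGra K n₁ m₁} (hx : x ∈ dgraphs K n₁ m₁)
    {y : QGra K n₂ m₂} (hy : y ∈ dgraphs K n₂ m₂) :
    compSign K hN hM j k x y ∈ dgraphs K N M := by
  rw [dgraphs, dgr, Submodule.map_span] at hx hy
  refine map₂_mem_of_mem_span (compQ K hN hM j k) ?_ hx hy
  rintro _ ⟨_, ⟨l, hl, rfl⟩, rfl⟩ _ ⟨_, ⟨l', hl', rfl⟩, rfl⟩
  rw [dgraphs_eq]
  exact mem_iSup_of_mem _ (compSign_mem_dgraphsDeg K hN hM j k (subset_span ⟨l, hl, rfl, rfl⟩)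
    (subset_span ⟨l', hl', rfl, rfl⟩))

end Closure

section PreLie

/-- The pre-Lie product as a bilinear map. -/
def preLieL : Conv K →ₗ[K] Conv K →ₗ[K] Conv K := by
  refine mk₂ K (preLie K) ?_ ?_ ?_ ?_ <;> intros <;> funext N M <;>
    simp only [preLie, ← compQ_apply, Pi.add_apply, Pi.smul_apply, map_add, map_smul,
      LinearMap.add_apply, LinearMap.smul_apply, smul_add, sum_add_distrib, smul_sum, smul_smul,
      mul_comm]

lemma preLieL_apply (x y : Conv K) : preLieL x y = preLie K x y := rfl

lemma IsConvElement.preLie {x y : Conv K} (hx : IsConvElement K x) (hy : IsConvElement K y) :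
    IsConvElement K (preLie K x y) := fun _ _ =>
  Submodule.sum_mem _ fun _ _ => Submodule.sum_mem _ fun _ _ => Submodule.sum_mem _ fun _ _ =>
    smul_mem _ _ (compSign_mem_dgraphs K _ _ _ _ (hx _ _) (hy _ _))

lemma IsConvDegree.preLie {p q : ℤ} {x y : Conv K} (hx : IsConvDegree K p x)
    (hy : IsConvDegree K q y) : IsConvDegree K (p + q) (preLie K x y) := fun _ _ =>
  Submodule.sum_mem _ fun _ _ => Submodule.sum_mem _ fun _ _ => Submodule.sum_mem _ fun _ _ =>
    smul_mem _ _ (compSign_mem_dgraphsDeg K _ _ _ _ (hx _ _) (hy _ _))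

lemma IsConvDegree.isConvElement {p : ℤ} {x : Conv K} (hx : IsConvDegree K p x) :
    IsConvElement K x := fun n m => by
  rw [dgraphs_eq]; exact mem_iSup_of_mem p (hx n m)

end PreLie

section XFil

open scoped Pointwise

variable {ι : Type} [Fintype ι] [DecidableEq ι]

/-- Bidegrees with bounded degree in the even variables. -/
def xle (D : ℤ) : Set (ℤ × ℤ) := {p | p.1 ≤ D ∧ 0 ≤ p.2}

lemma xle_add (D D' : ℤ) : xle D + xle D' ⊆ xle (D + D') := by
  rintro _ ⟨p, hp, p', hp', rfl⟩
  exact ⟨add_le_add hp.1 hp'.1, add_nonneg hp.2 hp'.2⟩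

lemma sum_xle {n : ℕ} (D : Fin n → ℤ) : ∑ i, xle (D i) ⊆ xle (∑ i, D i) := by
  induction n with
  | zero => simp [xle]
  | succ n ih =>
    rw [sum_univ_succ, sum_univ_succ]
    exact (Set.add_subset_add_left (ih _)).trans (xle_add _ _)

lemma bihom_le_xle {S : Set (ℤ × ℤ)} {D : ℤ} (h : ∀ p ∈ S, 0 ≤ p.2 → p.1 ≤ D) :
    bihom K (ι := ι) S ≤ bihom K (xle D) := by
  refine span_le.2 ?_
  rintro _ ⟨i, j, P, w, hP, hw, hS, rfl⟩
  exact tmul_mem_bihom hP hw ⟨h _ hS (Int.natCast_nonneg j), Int.natCast_nonneg j⟩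

lemma bihom_xle_mono {D D' : ℤ} (h : D ≤ D') : bihom K (ι := ι) (xle D) ≤ bihom K (xle D') :=
  bihom_mono fun _ hp => ⟨hp.1.trans h, hp.2⟩

lemma exists_mem_xle (a : SuperPoly K ι) : ∃ D : ℕ, a ∈ bihom K (xle D) := by
  obtain ⟨D, hD⟩ := exists_mem_bihom a
  exact ⟨D, bihom_le_xle (fun p hp _ => hp) hD⟩

lemma bihom_xle_eq_bot {D : ℤ} (h : D < 0) : bihom K (ι := ι) (xle D) = ⊥ :=
  bihom_eq_bot fun _ hp => Or.inl (hp.1.trans_lt h)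

lemma par_mem_bihom {S : Set (ℤ × ℤ)} {a : SuperPoly K ι} (ha : a ∈ bihom K S) :
    par K a ∈ bihom K S :=
  map_mem_bihom (par K).toLinearMap (fun i j P w hP hw hS => by
    rw [AlgHom.toLinearMap_apply, par, map_tmul, AlgHom.id_apply]
    exact tmul_mem_bihom hP (map_mem_exteriorPower _ hw) hS) ha

lemma par_of_mem_bihom {k : ℕ} {a : SuperPoly K ι} (ha : a ∈ bihom K {p | p.2 = k}) :
    par K a = (-1 : K) ^ k • a := by
  refine LinearMap.eqOn_span (f := (par K).toLinearMap) (g := (-1 : K) ^ k • .id) ?_ ha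
  rintro _ ⟨i, j, P, w, -, hw, hS, rfl⟩
  obtain rfl : j = k := by simpa using hS
  rw [AlgHom.toLinearMap_apply, LinearMap.smul_apply, id_apply, par, map_tmul, AlgHom.id_apply,
    ← tmul_smul]
  congr 1
  clear hS ha
  induction hw using Submodule.pow_induction_on_left' with
  | algebraMap r => rw [commutes, pow_zero, one_smul]
  | add x y i hx hy ihx ihy => rw [map_add, ihx, ihy, smul_add]
  | mem_mul m hm i x hx ih =>
    obtain ⟨v, rfl⟩ := hm
    rw [map_mul, ih, map_apply_ι, pow_succ']
    simp [mul_smul]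

lemma par_pow_mem_bihom {S : Set (ℤ × ℤ)} (p : ℕ) {a : SuperPoly K ι} (ha : a ∈ bihom K S) :
    par[K]^p a ∈ bihom K S := by
  induction p with
  | zero => exact ha
  | succ p ih => rw [par_pow_apply]; exact par_mem_bihom ih

lemma par_pow_congr {p q : ℕ} (h : Even (p + q)) :
    (par[K]^p : SuperPoly K ι →ₐ[K] SuperPoly K ι) = par K ^ q := by
  have h2 : (par K : SuperPoly K ι →ₐ[K] SuperPoly K ι) ^ 2 = 1 := by
    rw [pow_two]
    exact AlgHom.ext par_par
  have key (p : ℕ) : (par K : SuperPoly K ι →ₐ[K] SuperPoly K ι) ^ p = par K ^ (p % 2) := by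
    conv_lhs => rw [← Nat.div_add_mod p 2, pow_add, pow_mul, h2, one_pow, one_mul]
  rw [key p, key q, show p % 2 = q % 2 by grind]

end XFil

/-- Evaluation at a tuple. -/
def evalₗ {R ι M N : Type*} [CommSemiring R] [AddCommMonoid M] [AddCommMonoid N] [Module R M]
    [Module R N] (f : ι → M) : MultilinearMap R (fun _ : ι => M) N →ₗ[R] N where
  toFun g := g f
  map_add' _ _ := rfl
  map_smul' _ _ := rfl

section Rep

open scoped Pointwise

variable [CharZero K]

lemma mem_span_graph {V : Type} [Fintype V] [DecidableEq V] (a : Gra K V) :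
    a ∈ span K (Set.range (graph K (V := V))) := by
  induction a using Gra.induction with
  | one => exact subset_span ⟨[], rfl⟩
  | add a b ha hb => exact add_mem ha hb
  | smul r a ha => exact smul_mem _ _ ha
  | arrow_mul e a ha =>
    refine map_mem_of_mem_span (mulLeft K (arrow K e)) ?_ ha
    rintro _ ⟨l, rfl⟩
    exact subset_span ⟨e :: l, graph_cons K _ _⟩

variable (L : BasedLie K)

lemma BasedLie.B_eq_zero_of_lt {n m : ℕ} (a : Gra K (Vert n m)) (f : Fin (n + 1) → L.A)
    (D : Fin (n + 1) → ℤ) (h : ∀ i, f i ∈ bihom K (xle (D i))) (hm : L.dim + ∑ i, D i < m) :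
    L.B a f = 0 := by
  refine LinearMap.eqOn_span (f := evalₗ f ∘ₗ L.Blin n m) (g := 0) ?_ (mem_span_graph a)
  rintro _ ⟨l, rfl⟩
  have := bihom_mono (Set.add_subset_add_left (sum_xle D)) (L.B_mem_bihom l f _ h)
  rw [bihom_eq_bot] at this
  · exact (mem_bot K).1 this
  · rintro _ ⟨_, rfl, p, hp, rfl⟩
    rw [card_fin]
    simp only [xle, mem_setOf_eq, fst_add, snd_add] at hp ⊢
    omega

/-- `B` on classes of graphs. -/
def BasedLie.BQ (n m : ℕ) :
    QGra K n m →ₗ[K] MultilinearMap K (fun _ : Fin (n + 1) => L.A) L.A where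
  toFun y := Quotient.liftOn y L.B fun a b h => by
    rw [← sub_add_cancel a b, L.B_add,
      L.B_eq_zero_of_mem ((Submodule.quotientRel_def _).1 h), zero_add]
  map_add' := by rintro ⟨x⟩ ⟨y⟩; exact L.B_add _ _
  map_smul' r := by rintro ⟨x⟩; exact L.B_smul _ _

lemma BasedLie.BQ_cls {n m : ℕ} (a : Gra K (Vert n m)) : L.BQ n m (cls K n m a) = L.B a := rfl

lemma BasedLie.BQ_mem_bihom {n m : ℕ} {q : ℤ} {y : QGra K n m} (hy : y ∈ dgraphsDeg K q n m)
    (f : Fin (n + 1) → L.A) (S : Fin (n + 1) → Set (ℤ × ℤ)) (h : ∀ i, f i ∈ bihom K (S i)) :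
    L.BQ n m y f ∈ bihom K ({(q - n - m, q - n)} + ∑ i, S i) := by
  refine map_mem_of_mem_span (evalₗ f ∘ₗ L.BQ n m) ?_ hy
  rintro _ ⟨l, -, hq, rfl⟩
  rw [show q - n - m = m - l.length by omega, show q - n = 2 * m - l.length by omega]
  exact L.B_mem_bihom l f S h

lemma BasedLie.exists_bound {n : ℕ} (f : Fin (n + 1) → L.A) :
    ∃ M : ℕ, ∀ m, M ≤ m → ∀ y : QGra K n m, L.BQ n m y f = 0 := by
  choose D hD using fun i => exists_mem_xle (f i)
  refine ⟨L.dim + ∑ i, D i + 1, fun m hm => ?_⟩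
  rintro ⟨a⟩
  refine L.B_eq_zero_of_lt a f (fun i => D i) hD ?_
  rw [← Nat.cast_sum]
  omega

lemma BasedLie.finite_support (x : Conv K) {n : ℕ} (f : Fin (n + 1) → L.A) :
    (Function.support fun m => L.BQ n m (x n m) f).Finite := by
  obtain ⟨M, hM⟩ := L.exists_bound f
  exact (Set.finite_lt_nat M).subset fun m hm => by_contra fun h => hm (hM m (not_lt.1 h) _)

/-- The maps represented by a family of classes of graphs. -/
def BB (x : Conv K) : UFam K := fun L n =>
  { toFun := fun f => ∑ᶠ m, L.BQ n m (x n m) f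
    map_update_add' := fun f i a b => by
      simp only [map_update_add]
      exact finsum_add_distrib (L.finite_support x _) (L.finite_support x _)
    map_update_smul' := fun f i r a => by
      simp only [map_update_smul]
      exact (smul_finsum' r (L.finite_support x _)).symm }

lemma BB_apply (x : Conv K) {n M : ℕ} {f : Fin (n + 1) → L.A}
    (h : ∀ m, M ≤ m → ∀ y : QGra K n m, L.BQ n m y f = 0) :
    BB x L n f = ∑ m ∈ range M, L.BQ n m (x n m) f :=
  finsum_eq_sum_of_support_subset _ fun m hm => by
    by_contra hM
    exact hm (h m (by simpa using hM) _)

lemma realizes_BB (x : Conv K) : Realizes x (BB x) := by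
  choose a ha using fun n m => mkQ_surjective (relations K n m) (x n m)
  refine ⟨a, ha, fun L n f => ?_⟩
  obtain ⟨M, hM⟩ := L.exists_bound f
  filter_upwards [Filter.eventually_ge_atTop M] with M' hM'
  simp_rw [BB_apply L x fun m hm => hM m (hM'.trans hm), ← ha, L.BQ_cls]

lemma Realizes.eq_BB {x : Conv K} {F : UFam K} (h : Realizes x F) : F = BB x := by
  obtain ⟨a, ha, h⟩ := h
  funext L n
  ext f
  obtain ⟨M, hM⟩ := L.exists_bound f
  obtain ⟨M', hM', hM''⟩ := ((h L n f).and (Filter.eventually_ge_atTop M)).exists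
  simp_rw [hM', BB_apply L x fun m hm => hM m (hM''.trans hm), ← ha, L.BQ_cls]

lemma exists_twist_eq {n m p : ℕ} {q : ℤ} (hp : Even ((p : ℤ) - (q - n))) {y : QGra K n m}
    (hy : y ∈ dgraphsDeg K q n m) :
    ∃ b, cls K n m b = y ∧ ∀ k, twist K k b = (-1 : K) ^ (k * p) • b := by
  suffices h : y ∈ (⨅ k, LinearMap.eqLocus (twist K k).toLinearMap
      ((-1 : K) ^ (k * p) • LinearMap.id)).map (cls K n m) by
    simpa [and_comm] using h
  refine span_le.2 ?_ hy
  rintro _ ⟨l, hl, hq, rfl⟩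
  refine ⟨_, (Submodule.mem_iInf _).2 fun k => ?_, rfl⟩
  have h2 : Even (l.length + p) := by grind
  refine (twist_graph ..).trans (congrArg (· • _) (neg_one_pow_congr ?_))
  rw [Nat.even_mul, Nat.even_mul, Nat.even_add.1 h2]

end Rep

section Wick

variable {ι : Type} [Fintype ι] [DecidableEq ι]

/-- The derivatives with respect to the even variables `b 0, …, b (r - 1)`, in this order. -/
def iterDx (K : Type u) [Field K] {ι : Type} : ∀ {r : ℕ}, (Fin r → ι) → Module.End K (SuperPoly K ι)
  | 0, _ => 1
  | _ + 1, b => iterDx K (tail b) * dx K (b 0)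

/-- The derivatives with respect to the odd variables `a 0, …, a (r - 1)`, in this order. -/
def iterDp (K : Type u) [Field K] {ι : Type} : ∀ {r : ℕ}, (Fin r → ι) → Module.End K (SuperPoly K ι)
  | 0, _ => 1
  | _ + 1, a => iterDp K (tail a) * dp K (a 0)

lemma sum_perm_succ {r : ℕ} (F : (Fin (r + 1) → Fin (r + 1)) → K) :
    ∑ σ : Equiv.Perm (Fin (r + 1)), F σ =
      ∑ i : Fin (r + 1), ∑ σ : Equiv.Perm (Fin r), F (Fin.cons i fun j => i.succAbove (σ j)) := by
  let Ψ : Fin (r + 1) × Equiv.Perm (Fin r) → Equiv.Perm (Fin (r + 1)) := fun p =>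
    (finSuccEquiv' 0).trans ((Equiv.optionCongr p.2).trans (finSuccEquiv' p.1).symm)
  have h0 : ∀ p, ⇑(Ψ p) = Fin.cons p.1 fun j => p.1.succAbove (p.2 j) := by
    rintro ⟨i, σ⟩
    funext j
    refine Fin.cases ?_ (fun j => ?_) j
    · simp [Ψ]
    · have : (finSuccEquiv' (0 : Fin (r + 1))) j.succ = some j := by
        simpa using finSuccEquiv'_succAbove (0 : Fin (r + 1)) j
      simp [Ψ, this]
  have hinj : Function.Injective Ψ := by
    rintro ⟨i, σ⟩ ⟨i', σ'⟩ h
    have h1 : (Fin.cons i fun j => i.succAbove (σ j) : Fin (r + 1) → Fin (r + 1)) =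
        Fin.cons i' fun j => i'.succAbove (σ' j) := by
      rw [← h0 (i, σ), ← h0 (i', σ'), h]
    obtain rfl : i = i' := by simpa using congrFun h1 0
    have h2 j : σ j = σ' j := by simpa using congrFun h1 j.succ
    rw [Equiv.ext h2]
  have hbij : Function.Bijective Ψ := (Fintype.bijective_iff_injective_and_card _).2
    ⟨hinj, by simp [Fintype.card_perm, Nat.factorial_succ]⟩
  rw [← sum_prod_type' fun i (σ : Equiv.Perm (Fin r)) =>
    F (Fin.cons i fun j => i.succAbove (σ j))]
  exact (Fintype.sum_bijective Ψ hbij _ _ fun p => by rw [h0]).symm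

lemma dx_prod_xv {r : ℕ} (i : ι) (s : Fin (r + 1) → ι) (a : SuperPoly K ι) :
    dx K i ((ofFn fun j => xv K (s j)).prod * a) =
      ∑ j, (if i = s j then (ofFn fun k => xv K (s (j.succAbove k))).prod * a else 0) +
        (ofFn fun j => xv K (s j)).prod * dx K i a := by
  induction r with
  | zero =>
    rw [Fin.sum_univ_one]
    simp only [ofFn_succ, List.ofFn_zero, prod_cons, prod_nil, mul_one, one_mul,
      dx_xv_mul, eq_comm]
  | succ r ih =>
    rw [ofFn_succ, prod_cons, mul_assoc, dx_xv_mul, ih, sum_univ_succ (n := r + 1), mul_add,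
      mul_sum, ← mul_assoc, add_assoc ((if i = s 0 then _ else _))]
    congr 1
    · simp only [eq_comm, Fin.succAbove_zero]
    · congr 1
      refine sum_congr rfl fun j _ => ?_
      split_ifs
      · rw [ofFn_succ, prod_cons, mul_assoc]
        simp
      · rw [mul_zero]

lemma iterDx_prod {r : ℕ} (b s : Fin r → ι) (a : SuperPoly K ι) (ha : ∀ i, dx K i a = 0) :
    iterDx K b ((ofFn fun j => xv K (s j)).prod * a) =
      (∑ σ : Equiv.Perm (Fin r), ∏ j, if b j = s (σ j) then (1 : K) else 0) • a := by
  induction r with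
  | zero => simp [iterDx]
  | succ r ih =>
    rw [iterDx, Module.End.mul_apply, dx_prod_xv, ha, mul_zero, add_zero, map_sum,
      sum_perm_succ fun σ => ∏ j, if b j = s (σ j) then (1 : K) else 0, sum_smul]
    refine sum_congr rfl fun i _ => ?_
    simp only [Fin.prod_univ_succ, Fin.cons_zero, Fin.cons_succ, ← mul_sum]
    split_ifs with h
    · rw [ih (tail b) fun j => s (i.succAbove j), one_mul]; rfl
    · rw [map_zero, zero_mul, zero_smul]

lemma dp_prod_pv {r : ℕ} (i : ι) (t : Fin (r + 1) → ι) :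
    dp K i (ofFn fun j => pv K (t j)).prod = ∑ j : Fin (r + 1), ((-1 : K) ^ (j : ℕ) * if i = t j then 1 else 0) •
      (ofFn fun k => pv K (t (j.succAbove k))).prod := by
  induction r with
  | zero =>
    have := dp_pv_mul i (t 0) (1 : SuperPoly K ι)
    simp only [mul_one, dp_one, mul_zero, smul_zero, add_zero] at this
    rw [Fin.sum_univ_one]
    simp [this, eq_comm]
  | succ r ih =>
    rw [ofFn_succ, prod_cons, dp_pv_mul, ih, sum_univ_succ (n := r + 1), mul_sum, smul_sum]
    congr 1
    · simp [eq_comm]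
    · refine sum_congr rfl fun j _ => ?_
      rw [ofFn_succ, prod_cons, mul_smul_comm, smul_smul]
      congr 1
      · simp [pow_succ]
      · simp

lemma iterDp_prod {r : ℕ} (a t : Fin r → ι) :
    iterDp K a (ofFn fun j => pv K (t j)).prod =
      (∑ σ : Equiv.Perm (Fin r), ((Equiv.Perm.sign σ : ℤ) : K) * ∏ j, if a j = t (σ j) then (1 : K) else 0) •
        (1 : SuperPoly K ι) := by
  have hdet : ∀ {r : ℕ} (a t : Fin r → ι),
      (∑ σ : Equiv.Perm (Fin r), ((Equiv.Perm.sign σ : ℤ) : K) * ∏ j, if a j = t (σ j) then (1 : K) else 0) =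
      Matrix.det (Matrix.of fun i j => if a i = t j then (1 : K) else 0) := by
    intro r a t
    rw [← Matrix.det_transpose, Matrix.det_apply']
    rfl
  induction r with
  | zero => simp [iterDp]
  | succ r ih =>
    rw [iterDp, Module.End.mul_apply, dp_prod_pv, map_sum, hdet, Matrix.det_succ_row_zero, sum_smul]
    refine sum_congr rfl fun i _ => ?_
    rw [map_smul, ih (tail a) fun j => t (i.succAbove j), smul_smul,
      hdet (tail a) fun j => t (i.succAbove j)]
    rfl

lemma iterDx_dp [CharZero K] {r : ℕ} (b : Fin r → ι) (i : ι) (G : SuperPoly K ι) :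
    iterDx K b (dp K i G) = dp K i (iterDx K b G) := by
  induction r generalizing G with
  | zero => rfl
  | succ r ih => rw [iterDx, Module.End.mul_apply, Module.End.mul_apply, dx_dp_apply, ih]

end Wick

section Expansion

variable [CharZero K] (L : BasedLie K) {V : Type} [Fintype V] [DecidableEq V]

lemma BasedLie.act_graph_reverse {r : ℕ} (e : Fin r → Edge V) (G : L.Slots V) :
    L.act V (graph K (ofFn e).reverse) G = ∑ γ : Fin r → Fin L.dim,
      iterDp K (fun j => ((e j).1.1, γ j)) (iterDx K (fun j => ((e j).1.2, γ j)) G) := by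
  induction r generalizing G with
  | zero => simp [graph, iterDp, iterDx]
  | succ r ih =>
    rw [ofFn_succ, List.reverse_cons, graph_append, map_mul, Module.End.mul_apply, ih]
    simp only [graph, map_cons, map_nil, prod_cons, prod_nil, mul_one, L.act_arrow,
      L.tau_apply, map_sum]
    rw [sum_comm, ← sum_prod_type' (f := fun (l : Fin L.dim) (γ : Fin r → Fin L.dim) =>
      iterDp K (fun j => ((e j.succ).1.1, γ j)) (iterDx K (fun j => ((e j.succ).1.2, γ j))
        (dp K ((e 0).1.1, l) (dx K ((e 0).1.2, l) G))))]
    refine sum_equiv (Fin.consEquiv fun _ => Fin L.dim) _ _ fun p => ?_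
    rw [iterDx_dp]
    rfl

end Expansion

section Ports

variable {n m : ℕ}

/-- The outgoing half-edges at internal vertices, and `β i` outgoing half-edges at each external one. -/
abbrev OutP (n m : ℕ) (β : Fin (n + 1) → ℕ) : Type := Port m (Σ i, Fin (β i))

/-- The incoming half-edges at internal vertices, and `α i` incoming half-edges at each external one. -/
abbrev InP (n m : ℕ) (α : Fin (n + 1) → ℕ) : Type := Fin m ⊕ Σ i, Fin (α i)

variable {α β : Fin (n + 1) → ℕ}

/-- The vertex of an outgoing half-edge. -/
def outV : OutP n m β → Vert n m := elim (fun p => inr p.1) fun r => inl r.1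

/-- The vertex of an incoming half-edge. -/
def inV : InP n m α → Vert n m := elim inr fun r => inl r.1

variable (n m β) in
/-- The outgoing half-edges in a fixed order. -/
def outList : List (OutP n m β) :=
  (finRange m).flatMap (fun v => [inl (v, false), inl (v, true)]) ++
    (finRange (n + 1)).flatMap fun i => (finRange (β i)).map fun b => inr ⟨i, b⟩

variable (n m α) in
/-- The incoming half-edges in a fixed order. -/
def inList : List (InP n m α) :=
  (finRange m).map inl ++
    (finRange (n + 1)).flatMap fun i => (finRange (α i)).map fun b => inr ⟨i, b⟩

lemma nodup_flatMap_sigma {Y : Type} (γ : Fin (n + 1) → ℕ) (f : (Σ i, Fin (γ i)) → Y)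
    (hf : Function.Injective f) :
    ((finRange (n + 1)).flatMap fun i => (finRange (γ i)).map fun b => f ⟨i, b⟩).Nodup := by
  refine List.nodup_flatMap.2 ⟨fun i _ => (List.nodup_finRange _).map fun b b' h => ?_, ?_⟩
  · simpa using hf h
  · refine (List.nodup_finRange _).imp fun {i j} hij => ?_
    rw [onFun, List.disjoint_left]
    rintro y hy hy'
    obtain ⟨b, -, rfl⟩ := List.mem_map.1 hy
    obtain ⟨b', -, h⟩ := List.mem_map.1 hy'
    exact hij (congrArg Sigma.fst (hf h)).symm

lemma outList_nodup : (outList n m β).Nodup := by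
  refine List.nodup_append'.2 ⟨List.nodup_flatMap.2 ⟨fun v _ => by simp, ?_⟩,
    nodup_flatMap_sigma β _ Sum.inr_injective, ?_⟩
  · refine (List.nodup_finRange _).imp fun {i j} hij => ?_
    simp [onFun, hij, hij.symm]
  · rw [List.disjoint_left]
    intro y hy hy'
    simp only [List.mem_flatMap, List.mem_map] at hy hy'
    obtain ⟨v, -, hv⟩ := hy
    obtain ⟨i, -, b, -, rfl⟩ := hy'
    simp at hv

lemma inList_nodup : (inList n m α).Nodup := by
  refine List.nodup_append'.2 ⟨(List.nodup_finRange _).map Sum.inl_injective,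
    nodup_flatMap_sigma α _ Sum.inr_injective, ?_⟩
  rw [List.disjoint_left]
  intro y hy hy'
  simp only [List.mem_flatMap, List.mem_map] at hy hy'
  obtain ⟨v, -, rfl⟩ := hy
  obtain ⟨i, -, b, -, h⟩ := hy'
  simp at h

lemma mem_outList (o : OutP n m β) : o ∈ outList n m β := by
  rcases o with ⟨v, b⟩ | ⟨i, b⟩
  · cases b <;> simp [outList]
  · simp [outList]

lemma mem_inList (o : InP n m α) : o ∈ inList n m α := by
  rcases o with v | ⟨i, b⟩ <;> simp [inList]

variable (n m β) in
/-- The enumeration of the outgoing half-edges. -/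
def outE : Fin (outList n m β).length ≃ OutP n m β :=
  outList_nodup.getEquivOfForallMemList _ mem_outList

variable (n m α) in
/-- The enumeration of the incoming half-edges. -/
def inE : Fin (inList n m α).length ≃ InP n m α :=
  inList_nodup.getEquivOfForallMemList _ mem_inList

lemma length_outList : (outList n m β).length = 2 * m + ∑ i, β i := by
  have := card_congr (outE n m β)
  simp only [card_fin, card_sum, Fintype.card_prod, card_bool, card_sigma] at this
  omega

lemma length_inList : (inList n m α).length = m + ∑ i, α i := by
  have := card_congr (inE n m α)
  simp only [card_fin, card_sum, card_sigma] at this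
  omega

lemma map_outList {Y : Type*} (f : OutP n m β → Y) :
    (outList n m β).map f = ofFn fun i => f (outE n m β i) := by
  conv_lhs => rw [← List.ofFn_get (outList n m β), map_ofFn]
  rfl

lemma map_inList {Y : Type*} (f : InP n m α → Y) :
    (inList n m α).map f = ofFn fun i => f (inE n m α i) := by
  conv_lhs => rw [← List.ofFn_get (inList n m α), map_ofFn]
  rfl

end Ports

section Input

variable {n m : ℕ} {α β : Fin (n + 1) → ℕ}

lemma prod_map_mul_central {X A : Type*} [Monoid A] (l : List X) (a b : X → A)
    (ha : ∀ x y, a x * y = y * a x) :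
    (l.map fun x => a x * b x).prod = (l.map a).prod * (l.map b).prod := by
  induction l with
  | nil => simp
  | cons x l ih =>
    rw [map_cons, prod_cons, ih, map_cons, prod_cons, map_cons, prod_cons,
      mul_assoc (a x), mul_assoc (a x), ← mul_assoc (b x)]
    have : ∀ l : List X, b x * (l.map a).prod = (l.map a).prod * b x := fun l => by
      induction l with
      | nil => simp
      | cons y l ih => rw [map_cons, prod_cons, ← mul_assoc, ← ha, mul_assoc, ih, mul_assoc]
    rw [this, mul_assoc]

lemma prod_flatMap {X Y A : Type*} [Monoid A] (l : List X) (g : X → List Y) (h : Y → A) :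
    ((l.flatMap g).map h).prod = (l.map fun x => ((g x).map h).prod).prod := by
  induction l with
  | nil => simp
  | cons x l ih => simp [ih]

lemma xv_mul_comm {ι : Type} [Fintype ι] [DecidableEq ι] [CharZero K] (i : ι) (a : SuperPoly K ι) :
    xv K i * a = a * xv K i := mul_comm_of_even (par_xv i) a two_ne_zero

lemma prod_map_mul_comm {X A : Type*} [Monoid A] (l : List X) (f : X → A) (h : ∀ x y, f x * y = y * f x)
    (a : A) : (l.map f).prod * a = a * (l.map f).prod := by
  induction l with
  | nil => simp
  | cons y l ih => rw [map_cons, prod_cons, mul_assoc, ih, ← mul_assoc, h, mul_assoc]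

/-- The colours of the outgoing half-edges. -/
def outCol {ι : Type} (rc : (Σ i, Fin (β i)) → ι) (κ : Fin m → ι × ι × ι) : OutP n m β → ι
  | inl (v, false) => (κ v).1
  | inl (v, true) => (κ v).2.1
  | inr r => rc r

/-- The colours of the incoming half-edges. -/
def inCol {ι : Type} (lc : (Σ i, Fin (α i)) → ι) (κ : Fin m → ι × ι × ι) : InP n m α → ι :=
  elim (fun v => (κ v).2.2) lc

variable [CharZero K] (L : BasedLie K) (lc : (Σ i, Fin (α i)) → Fin L.dim) (rc : (Σ i, Fin (β i)) → Fin L.dim)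

/-- The monomial with given colours at an external vertex. -/
def BasedLie.testArg (i : Fin (n + 1)) : L.A :=
  ((finRange (α i)).map fun a => xv K (lc ⟨i, a⟩)).prod *
    ((finRange (β i)).map fun b => pv K (rc ⟨i, b⟩)).prod

lemma BasedLie.slot_xv {V : Type} [Fintype V] [DecidableEq V] (v : V) (i : Fin L.dim) :
    L.slot v (xv K i) = xv K (v, i) := by rw [L.slot_eq, gmap_xv]

lemma BasedLie.slot_pv {V : Type} [Fintype V] [DecidableEq V] (v : V) (i : Fin L.dim) :
    L.slot v (pv K i) = pv K (v, i) := by rw [L.slot_eq, gmap_pv]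

lemma BasedLie.exts_testArg : L.exts m (L.testArg lc rc) =
    ((finRange (n + 1)).map fun i => ((finRange (α i)).map fun a =>
      xv K ((inl i : Vert n m), lc ⟨i, a⟩)).prod).prod *
    ((finRange (n + 1)).map fun i => ((finRange (β i)).map fun b =>
      pv K ((inl i : Vert n m), rc ⟨i, b⟩)).prod).prod := by
  rw [BasedLie.exts, ofFn_eq_map, ← prod_map_mul_central _ _ _ fun i y =>
    prod_map_mul_comm (finRange (α i)) (fun a => xv K ((inl i : Vert n m), lc ⟨i, a⟩))
      (fun a y => xv_mul_comm _ y) y]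
  refine congrArg prod (map_congr_left fun i _ => ?_)
  rw [BasedLie.testArg, map_mul, map_list_prod, map_list_prod, map_map, map_map]
  simp only [Function.comp_def, L.slot_xv, L.slot_pv]

lemma BasedLie.pis_eq : L.pis (ints n m) = ∑ κ : Fin m → Fin L.dim × Fin L.dim × Fin L.dim,
    (∏ v, L.c (κ v).1 (κ v).2.1 (κ v).2.2) •
      (((finRange m).map fun v => xv K ((inr v : Vert n m), (κ v).2.2)).prod *
      ((finRange m).map fun v => pv K ((inr v : Vert n m), (κ v).1) *
        pv K ((inr v : Vert n m), (κ v).2.1)).prod) := by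
  have h (v : Fin m) : L.slot (inr v : Vert n m) L.pi = ∑ q : Fin L.dim × Fin L.dim × Fin L.dim,
      L.c q.1 q.2.1 q.2.2 • (xv K ((inr v : Vert n m), q.2.2) *
        (pv K ((inr v : Vert n m), q.1) * pv K ((inr v : Vert n m), q.2.1))) := by
    rw [L.pi_eq, sum_prod_type]
    simp only [sum_prod_type, map_sum, map_smul, map_mul, L.slot_xv, L.slot_pv]
  rw [← L.prod_ofFn_pi]
  simp only [h]
  rw [← mkPiAlgebraFin_apply (R := K), MultilinearMap.map_sum]
  refine sum_congr rfl fun κ _ => ?_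
  rw [map_smul_univ, mkPiAlgebraFin_apply, ofFn_eq_map,
    prod_map_mul_central _ _ _ fun v y => xv_mul_comm _ y]

lemma BasedLie.input_testArg : L.pis (ints n m) * L.exts m (L.testArg lc rc) =
    ∑ κ : Fin m → Fin L.dim × Fin L.dim × Fin L.dim, (∏ v, L.c (κ v).1 (κ v).2.1 (κ v).2.2) •
      ((ofFn fun j => xv K (inV (inE n m α j), inCol lc κ (inE n m α j))).prod *
        (ofFn fun j => pv K (outV (outE n m β j), outCol rc κ (outE n m β j))).prod) := by
  rw [L.pis_eq, L.exts_testArg, sum_mul]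
  refine sum_congr rfl fun κ _ => ?_
  rw [smul_mul_assoc]
  congr 1
  rw [← map_inList fun ℓ => xv K (inV ℓ, inCol lc κ ℓ), ← map_outList fun o => pv K (outV o, outCol rc κ o),
    inList, outList, List.map_append, List.map_append, prod_append, prod_append, map_map,
    prod_flatMap, prod_flatMap, prod_flatMap]
  simp only [map_map, map_cons, map_nil, prod_cons, prod_nil, mul_one]
  rw [mul_assoc, mul_assoc]
  congr 1
  rw [← mul_assoc, ← mul_assoc]
  congr 1
  exact (prod_map_mul_comm _ _ (fun i => prod_map_mul_comm _ _ fun a => xv_mul_comm _) _).symm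

end Input

section Value

variable [CharZero K] (L : BasedLie K) {n m : ℕ} {α β : Fin (n + 1) → ℕ}
  (lc : (Σ i, Fin (α i)) → Fin L.dim) (rc : (Σ i, Fin (β i)) → Fin L.dim)

lemma netVal_eq (c : Fin L.dim → Fin L.dim → Fin L.dim → K) (g : OutP n m β ≃ InP n m α) :
    netVal c lc rc g = ∑ κ : Fin m → Fin L.dim × Fin L.dim × Fin L.dim,
      (∏ v, c (κ v).1 (κ v).2.1 (κ v).2.2) *
        ∏ o, if outCol rc κ o = inCol lc κ (g o) then (1 : K) else 0 := by
  rw [netVal, ← Finset.sum_fiberwise (s := univ) (g := fun (γ : OutP n m β → Fin L.dim) (v : Fin m) =>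
    (γ (inl (v, false)), γ (inl (v, true)), γ (g.symm (inl v))))]
  refine sum_congr rfl fun κ _ => ?_
  have key (γ : OutP n m β → Fin L.dim) : ((fun v : Fin m =>
      (γ (inl (v, false)), γ (inl (v, true)), γ (g.symm (inl v)))) = κ ∧
      (∀ r, γ (inr r) = rc r) ∧ ∀ l, γ (g.symm (inr l)) = lc l) ↔
      γ = outCol rc κ ∧ ∀ o, outCol rc κ o = inCol lc κ (g o) := by
    constructor
    · rintro ⟨rfl, h1, h2⟩
      have h3 : γ = outCol rc fun v : Fin m =>
          (γ (inl (v, false)), γ (inl (v, true)), γ (g.symm (inl v))) := by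
        funext o
        rcases o with ⟨v, _ | _⟩ | r
        · rfl
        · rfl
        · exact h1 r
      refine ⟨h3, fun o => ?_⟩
      rw [← h3]
      obtain ⟨x, rfl⟩ := g.symm.surjective o
      rw [apply_symm_apply]
      rcases x with v | l
      · rfl
      · exact h2 l
    · rintro ⟨rfl, h⟩
      refine ⟨?_, fun r => rfl, fun l => ?_⟩
      · funext v
        have := h (g.symm (inl v))
        rw [apply_symm_apply] at this
        simp only [this]
        rfl
      · have := h (g.symm (inr l))
        rwa [apply_symm_apply] at this
  rw [sum_filter]
  rw [prod_ite_zero (p := fun o => outCol rc κ o = inCol lc κ (g o)), Finset.prod_const_one]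
  simp only [mem_univ, true_implies]
  have h4 : ∀ γ : OutP n m β → Fin L.dim, (if (fun v : Fin m =>
      (γ (inl (v, false)), γ (inl (v, true)), γ (g.symm (inl v)))) = κ then
      (∏ v, c (γ (inl (v, false))) (γ (inl (v, true))) (γ (g.symm (inl v)))) *
      ((∏ r, if γ (inr r) = rc r then (1 : K) else 0) *
        ∏ l, if γ (g.symm (inr l)) = lc l then (1 : K) else 0) else 0) =
      if γ = outCol rc κ then (∏ v, c (κ v).1 (κ v).2.1 (κ v).2.2) *
        (if ∀ o, outCol rc κ o = inCol lc κ (g o) then (1 : K) else 0) else 0 := by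
    intro γ
    rw [prod_ite_zero (p := fun r => γ (inr r) = rc r),
      prod_ite_zero (p := fun l => γ (g.symm (inr l)) = lc l)]
    simp only [mem_univ, true_implies, Finset.prod_const_one]
    by_cases h : (fun v : Fin m =>
      (γ (inl (v, false)), γ (inl (v, true)), γ (g.symm (inl v)))) = κ ∧
      (∀ r, γ (inr r) = rc r) ∧ ∀ l, γ (g.symm (inr l)) = lc l
    · obtain ⟨h1, h2⟩ := (key γ).1 h
      rw [if_pos h.1, if_pos h.2.1, if_pos h.2.2, if_pos h1, if_pos h2, ← h.1, mul_one]
    · have h' := fun x => h ((key γ).2 x)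
      trans (0 : K)
      · split_ifs with p1 p2 p3
        · exact absurd ⟨p1, p2, p3⟩ h
        all_goals simp
      · split_ifs with p1 p2
        · exact absurd ⟨p1, p2⟩ h'
        all_goals simp
  rw [sum_congr rfl fun γ _ => h4 γ, sum_ite_eq' , if_pos (mem_univ _)]

variable (K) in
lemma sum_match {V ι : Type} [DecidableEq V] [Fintype ι] [DecidableEq ι] {r : ℕ} (s s' t t' : Fin r → V)
    (p q : Fin r → ι) :
    ∑ γ : Fin r → ι, (∏ j, if (t j, γ j) = (t' j, q j) then (1 : K) else 0) *
      (∏ j, if (s j, γ j) = (s' j, p j) then (1 : K) else 0) =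
    if ∀ j, s j = s' j ∧ t j = t' j then ∏ j, (if p j = q j then (1 : K) else 0) else 0 := by
  have h1 := Finset.prod_univ_sum (fun _ : Fin r => (univ : Finset ι)) fun j c =>
    (if (t j, c) = (t' j, q j) then (1 : K) else 0) * (if (s j, c) = (s' j, p j) then (1 : K) else 0)
  rw [Fintype.piFinset_univ] at h1
  simp only [← Finset.prod_mul_distrib]
  rw [← h1]
  have h2 j : ∑ c, (if (t j, c) = (t' j, q j) then (1 : K) else 0) *
      (if (s j, c) = (s' j, p j) then (1 : K) else 0) =
      if s j = s' j ∧ t j = t' j then (if p j = q j then (1 : K) else 0) else 0 := by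
    by_cases h : s j = s' j ∧ t j = t' j
    · rw [if_pos h]
      simp only [h.1, h.2, Prod.mk.injEq, true_and]
      simp [eq_comm]
    · rw [if_neg h]
      refine sum_eq_zero fun c _ => ?_
      simp only [Prod.mk.injEq]
      split_ifs with h3 h4
      · exact absurd ⟨h4.1, h3.1⟩ h
      all_goals simp
  simp only [h2]
  rw [prod_ite_zero]
  simp

lemma dx_prod_pv {ι X : Type} [Fintype ι] [DecidableEq ι] (i : ι) (t : X → ι) (l : List X) :
    dx K i (l.map fun x => pv K (t x)).prod = 0 := by
  induction l with
  | nil => simp [dx_one]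
  | cons x l ih => rw [map_cons, prod_cons, dx_pv_mul, ih, mul_zero]

variable (K) in
/-- The signed number of ways in which a net describes a graph. -/
def netCoeff (hN : (inList n m α).length = (outList n m β).length)
    (e : Fin (outList n m β).length → Edge (Vert n m)) (g : OutP n m β ≃ InP n m α) : K :=
  ∑ σ : Equiv.Perm (Fin (outList n m β).length), ∑ σ' : Equiv.Perm (Fin (outList n m β).length),
    if (∀ j, (e j).1.1 = outV (outE n m β (σ j)) ∧
        (e j).1.2 = inV (inE n m α (finCongr hN.symm (σ' j)))) ∧
      ((outE n m β).symm.trans (σ.symm.trans σ')).trans ((finCongr hN.symm).trans (inE n m α)) = g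
    then ((Equiv.Perm.sign σ : ℤ) : K) else 0

lemma BasedLie.B_graph_testArg (hN : (inList n m α).length = (outList n m β).length)
    (e : Fin (outList n m β).length → Edge (Vert n m)) :
    L.B (graph K (ofFn e).reverse) (L.testArg lc rc) =
      (∑ g, netCoeff K hN e g * netVal L.c lc rc g) • (1 : L.A) := by
  have hx (κ : Fin m → Fin L.dim × Fin L.dim × Fin L.dim) :
      (ofFn fun j => xv K (inV (inE n m α j), inCol lc κ (inE n m α j))) =
      ofFn fun j : Fin (outList n m β).length => xv K (inV (inE n m α (finCongr hN.symm j)),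
        inCol lc κ (inE n m α (finCongr hN.symm j))) := List.ofFn_congr hN _
  rw [L.B_apply, L.input_testArg]
  simp only [hx, map_sum, map_smul, L.act_graph_reverse]
  have hd : ∀ (κ : Fin m → Fin L.dim × Fin L.dim × Fin L.dim) (i),
      dx K i (ofFn fun j => pv K (outV (outE n m β j), outCol rc κ (outE n m β j))).prod = 0 := by
    intro κ i
    rw [ofFn_eq_map]
    exact dx_prod_pv i (fun j => (outV (outE n m β j), outCol rc κ (outE n m β j))) _
  simp only [iterDx_prod _ _ _ (hd _), map_smul, iterDp_prod, map_one, smul_smul, ← sum_smul]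
  congr 1
  have h1 : ∀ g, netCoeff K hN e g * netVal L.c lc rc g = ∑ σ : Equiv.Perm (Fin (outList n m β).length),
      ∑ σ' : Equiv.Perm (Fin (outList n m β).length),
      if ((outE n m β).symm.trans (σ.symm.trans σ')).trans ((finCongr hN.symm).trans (inE n m α)) = g then
        (if ∀ j, (e j).1.1 = outV (outE n m β (σ j)) ∧
        (e j).1.2 = inV (inE n m α (finCongr hN.symm (σ' j))) then
          ((Equiv.Perm.sign σ : ℤ) : K) * netVal L.c lc rc g else 0) else 0 := by
    intro g
    rw [netCoeff, sum_mul]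
    refine sum_congr rfl fun σ _ => ?_
    rw [sum_mul]
    refine sum_congr rfl fun σ' _ => ?_
    split_ifs with h2 h3 h4 h3 h4
    · rfl
    · exact absurd h2.1 h4
    · exact absurd h2.2 h3
    · exact absurd ⟨h4, h3⟩ h2
    all_goals rw [zero_mul]
  rw [sum_congr rfl fun g _ => h1 g,
    sum_comm (s := (univ : Finset (OutP n m β ≃ InP n m α)))]
  have h2 : ∀ σ : Equiv.Perm (Fin (outList n m β).length), ∑ g : OutP n m β ≃ InP n m α,
      ∑ σ' : Equiv.Perm (Fin (outList n m β).length),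
      (if ((outE n m β).symm.trans (σ.symm.trans σ')).trans ((finCongr hN.symm).trans (inE n m α)) = g then
        (if ∀ j, (e j).1.1 = outV (outE n m β (σ j)) ∧
        (e j).1.2 = inV (inE n m α (finCongr hN.symm (σ' j))) then
          ((Equiv.Perm.sign σ : ℤ) : K) * netVal L.c lc rc g else 0) else 0) =
      ∑ κ : Fin m → Fin L.dim × Fin L.dim × Fin L.dim, ∑ σ' : Equiv.Perm (Fin (outList n m β).length),
        (∏ v, L.c (κ v).1 (κ v).2.1 (κ v).2.2) * (((Equiv.Perm.sign σ : ℤ) : K) *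
          if ∀ j, (e j).1.1 = outV (outE n m β (σ j)) ∧
            (e j).1.2 = inV (inE n m α (finCongr hN.symm (σ' j))) then
          ∏ j, if outCol rc κ (outE n m β (σ j)) = inCol lc κ (inE n m α (finCongr hN.symm (σ' j)))
            then (1 : K) else 0 else 0) := by
    intro σ
    rw [sum_comm, sum_comm (s := (univ : Finset (Fin m → _)))]
    refine sum_congr rfl fun σ' _ => ?_
    rw [sum_ite_eq, if_pos (mem_univ _), netVal_eq]
    split_ifs with h3
    · rw [mul_sum]
      refine sum_congr rfl fun κ _ => ?_
      rw [← (σ.trans (outE n m β)).prod_comp]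
      simp only [trans_apply, symm_apply_apply]
      ring
    · simp
  rw [sum_congr rfl fun σ _ => h2 σ,
    sum_comm (s := (univ : Finset (Equiv.Perm (Fin (outList n m β).length))))]
  conv_lhs => rw [sum_comm]
  refine sum_congr rfl fun κ _ => ?_
  simp only [← mul_sum (a := ∏ v, L.c (κ v).1 (κ v).2.1 (κ v).2.2)]
  refine congrArg _ ?_
  simp only [sum_mul, mul_sum]
  rw [sum_comm]
  refine sum_congr rfl fun σ _ => ?_
  rw [sum_comm]
  refine sum_congr rfl fun σ' _ => ?_
  rw [← sum_match K (fun j => (e j).1.1) (fun j => outV (outE n m β (σ j))) (fun j => (e j).1.2)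
    (fun j => inV (inE n m α (finCongr hN.symm (σ' j)))), mul_sum]
  exact sum_congr rfl fun γ _ => by ring

end Value

section NetGraph

variable (K) {V : Type} [DecidableEq V]

/-- The edge `u ⟶ v`, or zero if this is a loop. -/
def arr (u v : V) : Edge V → K := if h : u ≠ v then Pi.single ⟨(u, v), h⟩ 1 else 0

lemma arr_of_ne {u v : V} (h : u ≠ v) : arr K u v = Pi.single ⟨(u, v), h⟩ 1 := dif_pos h

lemma arr_edge (e : Edge V) : arr K e.1.1 e.1.2 = Pi.single e 1 := arr_of_ne K e.2

lemma ι_arr {u v : V} (h : u ≠ v) : ExteriorAlgebra.ι K (arr K u v) = arrow K ⟨(u, v), h⟩ := by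
  rw [arr_of_ne K h]; rfl

variable {n m : ℕ} {α β : Fin (n + 1) → ℕ}

variable (n m β) in
/-- The product of edges indexed by the outgoing half-edges. -/
def portProd : (Edge (Vert n m) → K) [⋀^OutP n m β]→ₗ[K] Gra K (Vert n m) :=
  (ιMulti K (outList n m β).length).domDomCongr (outE n m β)

lemma portProd_apply (G : OutP n m β → Edge (Vert n m) → K) :
    portProd K n m β G = ((outList n m β).map fun o => ExteriorAlgebra.ι K (G o)).prod := by
  rw [map_outList fun o => ExteriorAlgebra.ι K (G o)]
  exact ιMulti_apply _

/-- The graph described by a net, without loops. -/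
def netGraph (g : OutP n m β ≃ InP n m α) : Gra K (Vert n m) :=
  portProd K n m β fun o => arr K (outV o) (inV (g o))

lemma exists_prod_perm {X : Type} {l l' : List X} (h : l.Perm l') : ∃ s : K, s ≠ 0 ∧
    ∀ G : X → Edge V → K, (l.map fun o => ExteriorAlgebra.ι K (G o)).prod =
      s • (l'.map fun o => ExteriorAlgebra.ι K (G o)).prod := by
  induction h with
  | nil => exact ⟨1, one_ne_zero, fun G => (one_smul _ _).symm⟩
  | cons x _ ih =>
    obtain ⟨s, hs, h⟩ := ih
    exact ⟨s, hs, fun G => by rw [map_cons, prod_cons, h, mul_smul_comm]; rfl⟩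
  | swap x y l =>
    refine ⟨-1, neg_ne_zero.2 one_ne_zero, fun G => ?_⟩
    simp only [map_cons, prod_cons, ← mul_assoc]
    rw [eq_neg_of_add_eq_zero_left (ι_add_mul_swap (R := K) (G y) (G x)), neg_mul,
      neg_one_smul]
  | trans _ _ ih ih' =>
    obtain ⟨s, hs, h⟩ := ih
    obtain ⟨s', hs', h'⟩ := ih'
    exact ⟨s * s', mul_ne_zero hs hs', fun G => by rw [h, h', smul_smul]⟩

lemma mem_relations_twoIn (w : Fin m) {e e' : Edge (Vert n m)} (he : e.1.2 = inr w)
    (he' : e'.1.2 = inr w) (x y z : Gra K (Vert n m)) :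
    x * arrow K e * y * arrow K e' * z ∈ relations K n m := by
  have : x * arrow K e * y * arrow K e' * z = x * twist K 1 y * arrow K e * arrow K e' * z := by
    rw [mul_assoc x, arrow_mul, ← mul_assoc x]
  rw [this]
  exact subset_span (Relator.twoIn w _ _ _ _ he he')

lemma mem_relations_threeOut (w : Fin m) {e e' e'' : Edge (Vert n m)} (he : e.1.1 = inr w)
    (he' : e'.1.1 = inr w) (he'' : e''.1.1 = inr w) (x y z t : Gra K (Vert n m)) :
    x * arrow K e * y * arrow K e' * z * arrow K e'' * t ∈ relations K n m := by
  have : x * arrow K e * y * arrow K e' * z * arrow K e'' * t =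
      x * twist K 1 (y * twist K 1 z) * arrow K e * arrow K e' * arrow K e'' * t := by
    rw [mul_assoc x (twist K 1 _), ← arrow_mul]
    simp only [mul_assoc]
    rw [arrow_mul_left_comm K e' z]
  rw [this]
  exact subset_span (Relator.threeOut w _ _ _ _ _ he he' he'')

lemma contract_eq_some {v w : Fin m} {x y : Vert n m} (hvw : v ≠ w) :
    contract v w x = some y ↔ (y = inr v ∧ (x = inr v ∨ x = inr w)) ∨
      (y ≠ inr v ∧ y ≠ inr w ∧ x = y) := by
  rw [contract, Option.some.injEq]
  split_ifs with h
  · subst h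
    constructor
    · rintro rfl; exact Or.inl ⟨rfl, Or.inr rfl⟩
    · rintro (⟨rfl, -⟩ | ⟨-, h, h'⟩)
      · rfl
      · exact absurd h'.symm h
  · constructor
    · rintro rfl
      by_cases hx : x = inr v
      · exact Or.inl ⟨hx, Or.inl hx⟩
      · exact Or.inr ⟨hx, h, rfl⟩
    · rintro (⟨rfl, h' | h'⟩ | ⟨-, -, h'⟩)
      · exact h'
      · exact absurd h' h
      · exact h'

lemma pull_arrow_eq [Fintype V] {V' : Type} [Fintype V'] [DecidableEq V'] (c : V' → Option V) (e : Edge V) :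
    pull K c (arrow K e) = ∑ a, if c a = some e.1.1 then ∑ b, (if c b = some e.1.2 then
      ExteriorAlgebra.ι K (arr K a b) else 0) else 0 := by
  rw [pull_arrow, ← sum_edges c e fun a b => ExteriorAlgebra.ι K (arr K a b)]
  exact sum_congr rfl fun q _ => (ι_arr K q.1.2).symm

lemma sum_ite_or {X M : Type*} [Fintype X] [DecidableEq X] [AddCommMonoid M] {a b : X} (h : a ≠ b) (f : X → M) :
    (∑ x, if x = a ∨ x = b then f x else 0) = f a + f b := by
  rw [← sum_filter, show univ.filter (fun x => x = a ∨ x = b) = {a, b} by ext; simp,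
    Finset.sum_pair h]

variable {v w : Fin m} (hvw : v ≠ w)

include hvw in
lemma pull_contract_out {x : Vert n m} (hv : inr v ≠ x) (hw : inr w ≠ x) :
    pull K (contract v w) (arrow K ⟨(inr v, x), hv⟩) =
      arrow K ⟨(inr v, x), hv⟩ + arrow K ⟨(inr w, x), hw⟩ := by
  rw [pull_arrow_eq]
  simp only [contract_eq_some hvw, hv.symm, hw.symm, ne_eq, not_true_eq_false, not_false_eq_true, true_and,
    false_and, or_false, false_or, sum_ite_eq', mem_univ, if_true]
  rw [sum_ite_or (fun h => hvw (inr.inj h)), ι_arr K hv, ι_arr K hw]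

include hvw in
lemma pull_contract_in {x : Vert n m} (hv : x ≠ inr v) (hw : x ≠ inr w) :
    pull K (contract v w) (arrow K ⟨(x, inr v), hv⟩) =
      arrow K ⟨(x, inr v), hv⟩ + arrow K ⟨(x, inr w), hw⟩ := by
  rw [pull_arrow_eq]
  simp only [contract_eq_some hvw, hv, hw, ne_eq, not_true_eq_false, not_false_eq_true, true_and,
    false_and, or_false, false_or, sum_ite_eq', mem_univ, if_true]
  rw [sum_ite_or (fun h => hvw (inr.inj h)), ι_arr K hv, ι_arr K hw]

include hvw in
lemma pull_contract_of_ne {x y : Vert n m} (h1 : x ≠ inr v) (h2 : x ≠ inr w)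
    (h3 : y ≠ inr v) (h4 : y ≠ inr w) :
    pull K (contract v w) (ExteriorAlgebra.ι K (arr K x y)) = ExteriorAlgebra.ι K (arr K x y) := by
  by_cases h : x = y
  · simp [arr, h]
  · rw [ι_arr K h, pull_arrow_eq]
    simp only [contract_eq_some hvw, h1, h2, h3, h4, ne_eq, not_false_eq_true, true_and,
      false_and, false_or, sum_ite_eq', mem_univ, if_true]
    rw [ι_arr K h]

lemma arrow_mul_pull_mem (h : (inr v : Vert n m) ≠ inr w) (a : Gra K (Vert n m)) :
    arrow K ⟨(inr v, inr w), h⟩ * pull K (contract v w) a ∈ relations K n m := by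
  rw [arrow_mul, twist_pull]
  exact subset_span (Relator.ihx v w h _)

lemma ihx_mem (h : (inr v : Vert n m) ≠ inr w) {A B C D : Vert n m}
    (hA : inr v ≠ A) (hA' : inr w ≠ A) (hB : inr v ≠ B) (hB' : inr w ≠ B)
    (hC : inr v ≠ C) (hC' : inr w ≠ C) (hD : D ≠ inr v) (hD' : D ≠ inr w)
    {R : Gra K (Vert n m)} (hR : pull K (contract v w) R = R) :
    arrow K ⟨(inr v, inr w), h⟩ * (arrow K ⟨(inr v, A), hA⟩ * arrow K ⟨(inr w, B), hB'⟩ *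
        arrow K ⟨(inr w, C), hC'⟩ + arrow K ⟨(inr w, A), hA'⟩ * arrow K ⟨(inr v, B), hB⟩ *
        arrow K ⟨(inr w, C), hC'⟩ + arrow K ⟨(inr w, A), hA'⟩ * arrow K ⟨(inr w, B), hB'⟩ *
        arrow K ⟨(inr v, C), hC⟩) * arrow K ⟨(D, inr v), hD⟩ * R ∈ relations K n m := by
  have hvw : v ≠ w := fun h' => h (congrArg _ h')
  have key := arrow_mul_pull_mem K h (arrow K ⟨(inr v, A), hA⟩ * arrow K ⟨(inr v, B), hB⟩ *
    arrow K ⟨(inr v, C), hC⟩ * arrow K ⟨(D, inr v), hD⟩ * R)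
  simp only [map_mul, hR, pull_contract_out K hvw _ hA', pull_contract_out K hvw _ hB',
    pull_contract_out K hvw _ hC', pull_contract_in K hvw _ hD'] at key
  set e := arrow K (⟨(inr v, inr w), h⟩ : Edge (Vert n m)) with he
  set vA := arrow K (⟨(inr v, A), hA⟩ : Edge (Vert n m)) with hvA
  set vB := arrow K (⟨(inr v, B), hB⟩ : Edge (Vert n m)) with hvB
  set vC := arrow K (⟨(inr v, C), hC⟩ : Edge (Vert n m)) with hvC
  set wA := arrow K (⟨(inr w, A), hA'⟩ : Edge (Vert n m)) with hwA
  set wB := arrow K (⟨(inr w, B), hB'⟩ : Edge (Vert n m)) with hwB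
  set wC := arrow K (⟨(inr w, C), hC'⟩ : Edge (Vert n m)) with hwC
  set I := arrow K (⟨(D, inr v), hD⟩ : Edge (Vert n m)) with hI
  set I' := arrow K (⟨(D, inr w), hD'⟩ : Edge (Vert n m)) with hI'
  have h1 : ∀ t, 1 * e * 1 * vA * 1 * vB * t ∈ relations K n m := fun t =>
    mem_relations_threeOut K v rfl rfl rfl 1 1 1 t
  have h2 : ∀ t, 1 * e * 1 * vA * wB * vC * t ∈ relations K n m := fun t =>
    mem_relations_threeOut K v rfl rfl rfl 1 1 wB t
  have h3 : ∀ t, 1 * e * wA * vB * 1 * vC * t ∈ relations K n m := fun t =>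
    mem_relations_threeOut K v rfl rfl rfl 1 wA 1 t
  have h4 : ∀ t, e * wA * 1 * wB * 1 * wC * t ∈ relations K n m := fun t =>
    mem_relations_threeOut K w rfl rfl rfl e 1 1 t
  have h5 : ∀ y, 1 * e * y * I' * R ∈ relations K n m := fun y =>
    mem_relations_twoIn K w rfl rfl 1 y R
  have := sub_mem key (add_mem (add_mem (add_mem (add_mem (h1 ((vC + wC) * (I + I') * R))
    (h2 ((I + I') * R))) (h3 ((I + I') * R))) (h4 ((I + I') * R)))
    (h5 (vA * wB * wC + wA * vB * wC + wA * wB * vC)))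
  convert this using 1
  noncomm_ring

lemma sign_cycle3 {P : Type} [Fintype P] [DecidableEq P] {a b c : P} (hab : a ≠ b) (hbc : b ≠ c) :
    Equiv.Perm.sign (cycle3 a b c) = 1 := by
  rw [cycle3, map_mul, Equiv.Perm.sign_swap hab, Equiv.Perm.sign_swap hbc]; rfl

lemma netGraph_trans (g : OutP n m β ≃ InP n m α) (d : Equiv.Perm (OutP n m β))
    (hd : Equiv.Perm.sign d = 1) :
    netGraph K (d.trans g) = portProd K n m β fun o => arr K (outV (d.symm o)) (inV (g o)) := by
  have := (portProd K n m β).map_perm (fun o => arr K (outV (d.symm o)) (inV (g o))) d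
  rw [hd, one_smul] at this
  rw [← this, netGraph]
  congr 1
  funext o
  simp

lemma isWeight_cls_netGraph :
    IsWeight K fun g : OutP n m β ≃ InP n m α => cls K n m (netGraph K g) where
  swap g v := by
    rw [← map_neg]
    congr 1
    rw [netGraph, netGraph, ← (portProd K n m β).map_swap _ (show (inl (v, false) : OutP n m β) ≠
      inl (v, true) by simp)]
    congr 1
    funext o
    simp only [trans_apply, comp_apply]
    congr 1
    rcases eq_or_ne o (inl (v, false)) with rfl | h1
    · rw [Equiv.swap_apply_left]; rfl
    · rcases eq_or_ne o (inl (v, true)) with rfl | h2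
      · rw [Equiv.swap_apply_right]; rfl
      · rw [swap_apply_of_ne_of_ne h1 h2]
  rename g τ := by
    have h1 : netGraph K (Net.rename τ g) = pull K (relabel τ.symm) (netGraph K g) := by
      have hs : Equiv.Perm.sign (sumCongr (prodCongr τ (Equiv.refl Bool))
          (Equiv.refl (Σ i, Fin (β i)))) = 1 := by
        have : prodCongr τ (Equiv.refl Bool) = Equiv.prodCongrLeft fun _ : Bool => τ := by
          ext <;> rfl
        rw [Equiv.Perm.sign_sumCongr, this, Equiv.Perm.sign_prodCongrLeft, Fintype.prod_bool, Int.units_mul_self,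
          one_mul]
        exact Equiv.Perm.sign_refl
      have := (portProd K n m β).map_perm (fun o => arr K (outV o) (inV (Net.rename τ g o)))
        (sumCongr (prodCongr τ (Equiv.refl Bool)) (Equiv.refl (Σ i, Fin (β i))))
      rw [hs, one_smul] at this
      rw [netGraph, ← this, netGraph, portProd_apply, portProd_apply, map_list_prod, map_map]
      congr 2
      funext o
      have h2 : outV (sumCongr (prodCongr τ (Equiv.refl Bool)) (Equiv.refl (Σ i, Fin (β i))) o) =
          Sum.map id τ (outV o : Vert n m) := by
        rcases o with ⟨v, b⟩ | r <;> rfl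
      have h3 : inV (Net.rename τ g (sumCongr (prodCongr τ (Equiv.refl Bool))
          (Equiv.refl (Σ i, Fin (β i))) o)) = Sum.map id τ (inV (g o) : Vert n m) := by
        simp only [Net.rename, trans_apply, symm_apply_apply]
        rcases g o with v | l <;> rfl
      have h4 (a b : Vert n m) : ExteriorAlgebra.ι K (arr K (Sum.map id τ a) (Sum.map id τ b)) =
          pull K (relabel τ.symm) (ExteriorAlgebra.ι K (arr K a b)) := by
        by_cases h : a = b
        · simp [arr, h]
        · rw [ι_arr K h, pull_arrow_eq]
          have h5 (a b : Vert n m) : relabel τ.symm a = some b ↔ a = Sum.map id τ b := by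
            rw [relabel, Option.some.injEq]
            constructor
            · rintro rfl; rcases a with a | a <;> simp
            · rintro rfl; rcases b with a | a <;> simp
          simp only [h5, sum_ite_eq', mem_univ, if_true]
      simp only [comp_apply, h2, h3, h4]
    rw [h1]
    refine sub_eq_zero.1 ?_
    rw [← map_sub]
    exact (mk_eq_zero _).2 (subset_span (Relator.symm _ _))
  ihx g v w b hg hvw hb hw := by
    have h : (inr v : Vert n m) ≠ inr w := fun h' => hvw (inr.inj h')
    set o₀ : OutP n m β := inl (v, b) with ho₀
    set o₁ : OutP n m β := inl (v, !b) with ho₁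
    set o₂ : OutP n m β := inl (w, false) with ho₂
    set o₃ : OutP n m β := inl (w, true) with ho₃
    set o₄ : OutP n m β := g.symm (inl v) with ho₄
    have h01 : o₀ ≠ o₁ := by simp [ho₀, ho₁]
    have h02 : o₀ ≠ o₂ := by simp [ho₀, ho₂, hvw]
    have h03 : o₀ ≠ o₃ := by simp [ho₀, ho₃, hvw]
    have h12 : o₁ ≠ o₂ := by simp [ho₁, ho₂, hvw]
    have h13 : o₁ ≠ o₃ := by simp [ho₁, ho₃, hvw]
    have h23 : o₂ ≠ o₃ := by simp [ho₂, ho₃]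
    have g4 : g o₄ = inl v := apply_symm_apply _ _
    have h40 : o₄ ≠ o₀ := fun h' => hg v b (by rw [← ho₀, ← h', g4])
    have h41 : o₄ ≠ o₁ := fun h' => hg v (!b) (by rw [← ho₁, ← h', g4])
    have h42 : o₄ ≠ o₂ := fun h' => hw false (by rw [← ho₂, ← h', g4])
    have h43 : o₄ ≠ o₃ := fun h' => hw true (by rw [← ho₃, ← h', g4])
    obtain ⟨rest, hrest⟩ : ∃ rest, (outList n m β).Perm (o₀ :: o₁ :: o₂ :: o₃ :: o₄ :: rest) := by
      have hsub : [o₀, o₁, o₂, o₃, o₄].Subperm (outList n m β) := by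
        refine List.subperm_of_subset ?_ fun o _ => mem_outList o
        simp [h01, h02, h03, h12, h13, h23, h40.symm, h41.symm, h42.symm, h43.symm]
      obtain ⟨l', hp, hsl⟩ := hsub
      obtain ⟨rest, hr⟩ := hsl.exists_perm_append
      exact ⟨rest, hr.trans (hp.append_right rest)⟩
    obtain ⟨s, -, hs⟩ := exists_prod_perm K (V := Vert n m) hrest
    have hnd := hrest.nodup_iff.1 outList_nodup
    have hout : ∀ o : OutP n m β, outV o = inr v → o = o₀ ∨ o = o₁ := by
      rintro (⟨v', b'⟩ | r) ho
      · obtain rfl : v' = v := inr.inj ho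
        rcases eq_or_ne b' b with rfl | hb'
        · exact Or.inl rfl
        · exact Or.inr (by rw [ho₁, ← Bool.eq_not.2 hb'])
      · cases ho
    have hout' : ∀ o : OutP n m β, outV o = inr w → o = o₂ ∨ o = o₃ := by
      rintro (⟨v', b'⟩ | r) ho
      · obtain rfl : v' = w := inr.inj ho
        cases b'
        · exact Or.inl rfl
        · exact Or.inr rfl
      · cases ho
    have hin (o : OutP n m β) (u : Fin m) : inV (g o) = (inr u : Vert n m) → g o = inl u := by
      intro ho
      rcases hgo : g o with u' | l
      · rw [hgo] at ho
        exact congrArg _ (inr.inj ho)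
      · rw [hgo] at ho; cases ho
    have hinv : ∀ o, inV (g o) = (inr v : Vert n m) → o = o₄ := fun o ho => by
      rw [ho₄, ← hin o v ho, symm_apply_apply]
    have hinw : ∀ o, inV (g o) = (inr w : Vert n m) → o = o₀ := fun o ho =>
      g.injective (by rw [hin o w ho, ← hb])
    have hR (S : OutP n m β → Vert n m) : (∀ o, o ≠ o₁ → o ≠ o₂ → o ≠ o₃ → S o = outV o) →
        ∀ o ∈ rest, ExteriorAlgebra.ι K (arr K (S o) (inV (g o))) =
          ExteriorAlgebra.ι K (arr K (outV o) (inV (g o))) := by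
      intro hS o ho
      simp only [nodup_cons, mem_cons, not_or] at hnd
      rw [hS o]
      · rintro rfl; exact hnd.2.1.2.2.2 ho
      · rintro rfl; exact hnd.2.2.1.2.2 ho
      · rintro rfl; exact hnd.2.2.2.1.2 ho
    set R := (rest.map fun o => ExteriorAlgebra.ι K (arr K (outV o) (inV (g o) : Vert n m))).prod with hRdef
    have hpull : pull K (contract v w) R = R := by
      rw [hRdef, map_list_prod, map_map]
      refine congrArg prod (map_congr_left fun o ho => ?_)
      simp only [nodup_cons, mem_cons, not_or] at hnd
      refine pull_contract_of_ne K hvw ?_ ?_ ?_ ?_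
      · intro h'
        rcases hout o h' with rfl | rfl
        · exact hnd.1.2.2.2.2 ho
        · exact hnd.2.1.2.2.2 ho
      · intro h'
        rcases hout' o h' with rfl | rfl
        · exact hnd.2.2.1.2.2 ho
        · exact hnd.2.2.2.1.2 ho
      · intro h'
        obtain rfl := hinv o h'
        exact hnd.2.2.2.2.1 ho
      · intro h'
        obtain rfl := hinw o h'
        exact hnd.1.2.2.2.2 ho
    have key (S : OutP n m β → Vert n m) : (∀ o, o ≠ o₁ → o ≠ o₂ → o ≠ o₃ → S o = outV o) →
        portProd K n m β (fun o => arr K (S o) (inV (g o))) = s •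
          (arrow K ⟨(inr v, inr w), h⟩ * (ExteriorAlgebra.ι K (arr K (S o₁) (inV (g o₁))) *
            ExteriorAlgebra.ι K (arr K (S o₂) (inV (g o₂))) * ExteriorAlgebra.ι K (arr K (S o₃) (inV (g o₃)))) *
            ExteriorAlgebra.ι K (arr K (outV o₄) (inr v)) * R) := by
      intro hS
      rw [portProd_apply, hs]
      simp only [map_cons, prod_cons]
      rw [map_congr_left (hR S hS), hS o₀ h01 h02 h03, hS o₄ h41 h42 h43, g4, hb, ← hRdef, ← ι_arr K h]
      simp only [mul_assoc]
      rfl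
    have hne o : o = o₁ ∨ o = o₂ ∨ o = o₃ → (inr v : Vert n m) ≠ inV (g o) ∧
        (inr w : Vert n m) ≠ inV (g o) := by
      intro ho
      refine ⟨fun h' => ?_, fun h' => ?_⟩
      · have := hinv o h'.symm
        rcases ho with rfl | rfl | rfl
        · exact h41 this.symm
        · exact h42 this.symm
        · exact h43 this.symm
      · have := hinw o h'.symm
        rcases ho with rfl | rfl | rfl
        · exact h01 this.symm
        · exact h02 this.symm
        · exact h03 this.symm
    obtain ⟨hA, hA'⟩ := hne o₁ (Or.inl rfl)
    obtain ⟨hB, hB'⟩ := hne o₂ (Or.inr (Or.inl rfl))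
    obtain ⟨hC, hC'⟩ := hne o₃ (Or.inr (Or.inr rfl))
    have hD : outV o₄ ≠ (inr v : Vert n m) := fun h' => by
      rcases hout o₄ h' with h' | h'
      · exact h40 h'
      · exact h41 h'
    have hD' : outV o₄ ≠ (inr w : Vert n m) := fun h' => by
      rcases hout' o₄ h' with h' | h'
      · exact h42 h'
      · exact h43 h'
    have hsign := sign_cycle3 h12 h23
    have hc1 : cycle3 o₁ o₂ o₃ o₁ = o₂ := cycle3_left h12 h13
    have hc2 : cycle3 o₁ o₂ o₃ o₂ = o₃ := cycle3_mid h13 h23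
    have hc3 : cycle3 o₁ o₂ o₃ o₃ = o₁ := cycle3_right
    have e1 := key outV fun o _ _ _ => rfl
    have e2 := key (fun o => outV ((cycle3 o₁ o₂ o₃).symm o)) fun o a1 a2 a3 => by
      rw [(symm_apply_eq _).2 (cycle3_of_ne a1 a2 a3).symm]
    have e3 := key (fun o => outV (cycle3 o₁ o₂ o₃ o)) fun o a1 a2 a3 => by
      rw [cycle3_of_ne a1 a2 a3]
    rw [← map_add, ← map_add]
    refine (mk_eq_zero _).2 ?_
    rw [netGraph_trans K g _ hsign, netGraph_trans K g _ (by rw [Equiv.Perm.sign_symm, hsign]), Equiv.symm_symm,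
      e2, e3, netGraph, e1, ← smul_add, ← smul_add]
    refine smul_mem _ _ ?_
    have := ihx_mem K h hA hA' hB hB' hC hC' hD hD' hpull
    rw [(symm_apply_eq _).2 hc3.symm, (symm_apply_eq _).2 hc1.symm,
      (symm_apply_eq _).2 hc2.symm, hc1, hc2, hc3]
    have s1 : (outV o₁ : Vert n m) = inr v := rfl
    have s2 : (outV o₂ : Vert n m) = inr w := rfl
    have s3 : (outV o₃ : Vert n m) = inr w := rfl
    rw [s1, s2, s3, ι_arr K hA, ι_arr K hB', ι_arr K hC', ι_arr K hA', ι_arr K hB, ι_arr K hC, ι_arr K hD]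
    convert this using 1
    simp only [mul_add, add_mul, mul_assoc]

end NetGraph

section

open scoped TensorProduct Pointwise

section Matchings

lemma countP_ofFn {X : Type*} (p : X → Prop) [DecidablePred p] {N : ℕ} (e : Fin N → X) :
    (ofFn e).countP (fun x => decide (p x)) = card {j // p (e j)} := by
  rw [card_subtype]
  induction N with
  | zero => simp
  | succ N ih =>
    rw [ofFn_succ, countP_cons, ih, Fin.card_filter_univ_succ]
    by_cases h : p (e 0) <;> simp [h]

variable {V : Type} [DecidableEq V] {N : ℕ}

/-- The number of permutations that match `f` with `h`. -/
def matchings (f h : Fin N → V) : ℕ := card {σ : Equiv.Perm (Fin N) // ∀ j, f j = h (σ j)}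

lemma card_fibre_eq {f h : Fin N → V} (hm : matchings f h ≠ 0) (x : V) :
    card {j // f j = x} = card {j // h j = x} := by
  obtain ⟨σ, hσ⟩ := Fintype.card_pos_iff.1 (Nat.pos_of_ne_zero hm)
  exact card_congr (σ.subtypeEquiv fun j => by rw [hσ])

lemma matchings_eq {f h : Fin N → V} (hf : ∀ x, card {j // f j = x} = card {j // h j = x}) :
    matchings f h = matchings h h := by
  let σ : Equiv.Perm (Fin N) := Equiv.ofFiberEquiv fun x => Fintype.equivOfCardEq (hf x)
  have hσ : ∀ j, h (σ j) = f j := Equiv.ofFiberEquiv_map _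
  refine card_congr ((Equiv.mulRight σ⁻¹).subtypeEquiv fun ρ => ⟨fun h' j => ?_, fun h' j => ?_⟩)
  · have := h' (σ⁻¹ j)
    rw [← hσ] at this
    simpa using this
  · have := h' (σ j)
    simpa [hσ] using this

lemma matchings_self_ne_zero (h : Fin N → V) : matchings h h ≠ 0 :=
  (Fintype.card_pos_iff.2 ⟨⟨1, fun _ => rfl⟩⟩).ne'

lemma card_fibre_eq_of_le {n m : ℕ} {f h : Fin N → Vert n m}
    (hext : ∀ i, card {j // f j = inl i} = card {j // h j = inl i})
    (hint : ∀ v, card {j // f j = inr v} ≤ card {j // h j = inr v}) (x : Vert n m) :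
    card {j // f j = x} = card {j // h j = x} := by
  have key (g : Fin N → Vert n m) : (∑ i, card {j // g j = inl i}) +
      ∑ v, card {j // g j = inr v} = N := by
    rw [← sum_sum_type fun x => card {j // g j = x}, ← card_sigma,
      card_congr (Equiv.sigmaFiberEquiv g), card_fin]
  have h1 := key f
  have h2 := key h
  rw [sum_congr rfl fun i _ => hext i] at h1
  have h3 := (Finset.sum_eq_sum_iff_of_le (s := univ) fun v _ => hint v).1 (by omega)
  rcases x with i | v
  · exact hext i
  · exact h3 v (mem_univ _)

end Matchings

section Endpoints

variable {V V' : Type}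

/-- The source or the target of an edge. -/
def endpt (b : Bool) (e : Edge V) : V := bif b then e.1.1 else e.1.2

/-- The numbers of outgoing and incoming edges at internal vertices. -/
def cap (b : Bool) : ℕ := bif b then 2 else 1

/-- The numbers of edges going out of and into the external vertices are prescribed. -/
def HasValences {n m : ℕ} (γ : Bool → Fin (n + 1) → ℕ) (l : List (Edge (Vert n m))) : Prop :=
  ∀ b i, l.countP (fun e => decide (endpt b e = inl i)) = γ b i

instance {n m : ℕ} (γ : Bool → Fin (n + 1) → ℕ) (l : List (Edge (Vert n m))) : Decidable (HasValences γ l) := by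
  unfold HasValences
  infer_instance

lemma graph_mem_relations {n m : ℕ} {l : List (Edge (Vert n m))} {b : Bool} {v : Fin m}
    (h : cap b < l.countP (fun e => decide (endpt b e = inr v))) : graph K l ∈ relations K n m := by
  cases b
  · exact graph_mem_relations_of_incoming K h
  · exact graph_mem_relations_of_outgoing K h

end Endpoints

section Balanced

variable {n m : ℕ}

/-- The vertices of the half-edges, in order. -/
def halfV (n m : ℕ) (γ : Bool → Fin (n + 1) → ℕ)
    (hN : (inList n m (γ false)).length = (outList n m (γ true)).length) :
    Bool → Fin (outList n m (γ true)).length → Vert n m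
  | true, j => outV (outE n m (γ true) j)
  | false, j => inV (inE n m (γ false) (finCongr hN.symm j))

variable {γ : Bool → Fin (n + 1) → ℕ} (hN : (inList n m (γ false)).length = (outList n m (γ true)).length)

lemma card_halfV_inl (b : Bool) (i : Fin (n + 1)) :
    card {j // halfV n m γ hN b j = inl i} = γ b i := by
  have key : ∀ {X : Type} [Fintype X] (α : Fin (n + 1) → ℕ) (E : Fin (outList n m (γ true)).length ≃ X ⊕ Σ i, Fin (α i))
      (F : X ⊕ (Σ i, Fin (α i)) → Vert n m), (∀ x, F (inl x) ≠ inl i) →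
      (∀ r, F (inr r) = inl r.1) → card {j // F (E j) = inl i} = α i := by
    intro X _ α E F h1 h2
    rw [← card_fin (α i)]
    refine card_congr ((E.subtypeEquiv (q := fun y => F y = inl i) fun j => Iff.rfl).trans
      ⟨fun y => match y with
        | ⟨inl x, h⟩ => absurd h (h1 x)
        | ⟨inr ⟨i', c⟩, h⟩ => Fin.cast (by rw [h2] at h; rw [← inl.inj h]) c,
      fun c => ⟨inr ⟨i, c⟩, h2 _⟩, ?_, fun c => rfl⟩)
    rintro ⟨x | ⟨i', c⟩, h⟩
    · exact absurd h (h1 x)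
    · have h' := h
      rw [h2] at h'
      obtain rfl : i' = i := inl.inj h'
      rfl
  cases b
  · exact key (γ false) ((finCongr hN.symm).trans (inE n m (γ false))) inV (fun x h => by cases h) fun r => rfl
  · exact key (γ true) (outE n m (γ true)) outV (fun x h => by cases h) fun r => rfl

lemma card_halfV_inr (b : Bool) (v : Fin m) :
    card {j // halfV n m γ hN b j = inr v} = cap b := by
  have key : ∀ {X : Type} [Fintype X] (α : Fin (n + 1) → ℕ) (E : Fin (outList n m (γ true)).length ≃ X ⊕ Σ i, Fin (α i))
      (F : X ⊕ (Σ i, Fin (α i)) → Vert n m), (∀ r, F (inr r) = inl r.1) →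
      card {j // F (E j) = inr v} = Nat.card {x // F (inl x) = inr v} := by
    intro X _ α E F h2
    rw [← Nat.card_eq_fintype_card]
    refine Nat.card_congr ((E.subtypeEquiv (q := fun y => F y = inr v) fun j => Iff.rfl).trans
      ⟨fun y => match y with
        | ⟨inl x, h⟩ => ⟨x, h⟩
        | ⟨inr r, h⟩ => absurd (h2 r ▸ h) (by simp),
      fun c => ⟨inl c.1, c.2⟩, ?_, fun c => rfl⟩)
    rintro ⟨x | r, h⟩
    · rfl
    · exact absurd (h2 r ▸ h) (by simp)
  cases b
  · refine (key (γ false) ((finCongr hN.symm).trans (inE n m (γ false))) inV fun r => rfl).trans ?_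
    refine (Nat.card_congr ⟨fun _ => (), fun _ => ⟨v, rfl⟩, fun x => ?_, fun _ => rfl⟩).trans Nat.card_unique
    exact Subtype.ext (inr.inj x.2).symm
  · refine (key (γ true) (outE n m (γ true)) outV fun r => rfl).trans ?_
    refine (Nat.card_congr ⟨fun x => x.1.2, fun b => ⟨(v, b), rfl⟩, fun x => ?_, fun _ => rfl⟩).trans
      (Nat.card_eq_fintype_card.trans card_bool)
    exact Subtype.ext (Prod.ext (inr.inj x.2).symm rfl)

lemma sum_netCoeff_smul (e : Fin (outList n m (γ true)).length → Edge (Vert n m)) :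
    ∑ g, netCoeff K hN e g • netGraph K g = ((∏ b, matchings (fun j => endpt b (e j)) (halfV n m γ hN b) : ℕ) : K) •
      graph K (ofFn e) := by
  have h1 : ∀ σ σ' : Equiv.Perm (Fin (outList n m (γ true)).length),
      (∑ g : OutP n m (γ true) ≃ InP n m (γ false), (if (∀ j, (e j).1.1 = outV (outE n m (γ true) (σ j)) ∧
        (e j).1.2 = inV (inE n m (γ false) (finCongr hN.symm (σ' j)))) ∧
      ((outE n m (γ true)).symm.trans (σ.symm.trans σ')).trans ((finCongr hN.symm).trans (inE n m (γ false))) = g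
    then ((Equiv.Perm.sign σ : ℤ) : K) else 0) • netGraph K g) =
      if (∀ j, endpt true (e j) = halfV n m γ hN true (σ j)) ∧ ∀ j, endpt false (e j) = halfV n m γ hN false (σ' j)
      then graph K (ofFn e) else 0 := by
    intro σ σ'
    by_cases hc : (∀ j, endpt true (e j) = halfV n m γ hN true (σ j)) ∧
        ∀ j, endpt false (e j) = halfV n m γ hN false (σ' j)
    · rw [if_pos hc]
      replace hc := forall_and.2 hc
      change ∀ j, (e j).1.1 = outV (outE n m (γ true) (σ j)) ∧
        (e j).1.2 = inV (inE n m (γ false) (finCongr hN.symm (σ' j))) at hc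
      simp only [eq_true hc, true_and, ite_smul, zero_smul, sum_ite_eq, mem_univ, if_true]
      have h2 := (ιMulti K (M := Edge (Vert n m) → K) (outList n m (γ true)).length).map_perm
        (fun j => arr K (outV (outE n m (γ true) j)) (inV (inE n m (γ false) (finCongr hN.symm (σ' (σ.symm j)))))) σ
      have h3 : (fun j => arr K (outV (outE n m (γ true) j)) (inV (inE n m (γ false)
          (finCongr hN.symm (σ' (σ.symm j)))))) ∘ σ = fun j => Pi.single (e j) (1 : K) := by
        funext j
        rw [comp_apply, symm_apply_apply, ← (hc j).1, ← (hc j).2, arr_edge]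
      rw [h3] at h2
      rw [graph, map_ofFn]
      refine Eq.trans ?_ ((ιMulti_apply _).symm.trans h2).symm
      rw [netGraph, portProd, AlternatingMap.domDomCongr_apply, Units.smul_def, ← Int.cast_smul_eq_zsmul K]
      congr 2
      funext j
      simp
    · rw [if_neg hc]
      exact sum_eq_zero fun g _ => by rw [if_neg fun h => hc (forall_and.1 h.1), zero_smul]
  simp only [netCoeff, sum_smul]
  rw [sum_comm]
  rw [sum_congr rfl fun σ _ => sum_comm]
  rw [sum_congr rfl fun σ _ => sum_congr rfl fun σ' _ => h1 σ σ']
  have h4 (A : Prop) : ∀ _ : Decidable A, (∑ σ' : Equiv.Perm (Fin (outList n m (γ true)).length),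
      if A ∧ ∀ j, endpt false (e j) = halfV n m γ hN false (σ' j) then graph K (ofFn e) else 0) =
      if A then (matchings (fun j => endpt false (e j)) (halfV n m γ hN false) : K) • graph K (ofFn e) else 0 := by
    intro _
    split_ifs with hA
    · simp only [hA, true_and]
      rw [← sum_filter, sum_const, ← card_subtype, ← Nat.cast_smul_eq_nsmul K]
      rfl
    · simp [hA]
  rw [sum_congr rfl fun σ _ => h4 _ _, ← sum_filter, sum_const, ← card_subtype,
    ← Nat.cast_smul_eq_nsmul K, smul_smul, Fintype.prod_bool, cast_mul]
  rfl

variable {X : Type} {s : Finset X} {c : X → K}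

/-- The number of ways in which nets describe graphs is the same for all graphs that are not relations. -/
lemma sum_netCoeff_smul_cls [CharZero K] (e : Fin (outList n m (γ true)).length → Edge (Vert n m)) :
    ∑ g, netCoeff K hN e g • cls K n m (netGraph K g) =
      if HasValences γ (ofFn e) then ((∏ b, matchings (halfV n m γ hN b) (halfV n m γ hN b) : ℕ) : K) •
        cls K n m (graph K (ofFn e)) else 0 := by
  have h0 : ∑ g, netCoeff K hN e g • cls K n m (netGraph K g) = cls K n m (∑ g, netCoeff K hN e g • netGraph K g) := by
    simp only [map_sum, map_smul]
  rw [h0, sum_netCoeff_smul, LinearMap.map_smul]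
  split_ifs with h
  · by_cases h' : ∀ b v, card {j // endpt b (e j) = inr v} ≤ cap b
    · have h1 b : matchings (fun j => endpt b (e j)) (halfV n m γ hN b) =
          matchings (halfV n m γ hN b) (halfV n m γ hN b) := by
        refine matchings_eq (card_fibre_eq_of_le (fun i => ?_) fun v => ?_)
        · rw [card_halfV_inl, ← h b i, countP_ofFn]
        · rw [card_halfV_inr]; exact h' b v
      simp only [h1]
    · push Not at h'
      obtain ⟨b, v, hv⟩ := h'
      have h2 : graph K (ofFn e) ∈ relations K n m := graph_mem_relations (b := b) (v := v)
        (hv.trans_eq ((countP_ofFn (fun e => endpt b e = inr v) e).trans (card_congr (Equiv.refl _))).symm)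
      rw [show cls K n m (graph K (ofFn e)) = 0 from (mk_eq_zero _).2 h2, smul_zero, smul_zero]
  · rw [Nat.cast_eq_zero.2, zero_smul]
    by_contra h'
    refine h fun b i => ?_
    rw [countP_ofFn, ← card_halfV_inl hN b i]
    exact card_fibre_eq (prod_ne_zero_iff.1 h' b (mem_univ _)) _

variable [CharZero K]

include hN in
lemma sum_ofFn_mem_relations {e : X → Fin (outList n m (γ true)).length → Edge (Vert n m)}
    (h : ∀ (L : BasedLie K) (lc : (Σ i, Fin (γ false i)) → Fin L.dim) (rc : (Σ i, Fin (γ true i)) → Fin L.dim),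
      ∑ x ∈ s, c x • L.B (graph K (ofFn (e x)).reverse) (L.testArg lc rc) = 0) :
    ∑ x ∈ s, (if HasValences γ (ofFn (e x)) then c x • graph K (ofFn (e x)) else 0) ∈
      relations K n m := by
  classical
  have key := sum_smul_weight_eq_zero (fun g : OutP n m (γ true) ≃ InP n m (γ false) =>
    ∑ x ∈ s, c x * netCoeff K hN (e x) g) (fun g hg => sum_eq_zero fun x _ => by
      rw [netCoeff, sum_eq_zero fun σ _ => sum_eq_zero fun σ' _ => ?_, mul_zero]
      rw [if_neg]
      rintro ⟨h1, rfl⟩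
      refine hg fun v b hvb => ?_
      have h2 := h1 (σ.symm ((outE n m (γ true)).symm (inl (v, b))))
      rw [apply_symm_apply, apply_symm_apply] at h2
      refine (e x _).2 (h2.1.trans (Eq.trans ?_ h2.2.symm))
      simp only [trans_apply] at hvb
      rw [hvb]
      rfl) (fun L lc rc => by
      have := h L lc rc
      simp only [L.B_graph_testArg lc rc hN, smul_smul, ← sum_smul] at this
      have h1 := (smul_eq_zero.1 this).resolve_right one_ne_zero
      rw [← h1]
      simp only [sum_mul, mul_sum, mul_assoc]
      exact sum_comm) _ (isWeight_cls_netGraph K)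
  simp only [sum_smul, mul_smul] at key
  rw [sum_comm] at key
  simp only [← smul_sum, sum_netCoeff_smul_cls] at key
  set κ := ((∏ b, matchings (halfV n m γ hN b) (halfV n m γ hN b) : ℕ) : K) with hκ
  have hκ0 : κ ≠ 0 := Nat.cast_ne_zero.2 (prod_ne_zero_iff.2 fun b _ => matchings_self_ne_zero _)
  rw [← mk_eq_zero]
  refine (smul_eq_zero.1 (?_ : κ • cls K n m _ = 0)).resolve_left hκ0
  rw [← key, map_sum, smul_sum]
  refine sum_congr rfl fun x _ => ?_
  split_ifs
  · rw [map_smul, smul_comm]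
  · rw [map_zero, smul_zero, smul_zero]

lemma BasedLie.testArg_mem_bihom (L : BasedLie K) (lc : (Σ i, Fin (γ false i)) → Fin L.dim)
    (rc : (Σ i, Fin (γ true i)) → Fin L.dim) (i : Fin (n + 1)) :
    L.testArg lc rc i ∈ bihom K {((γ false i : ℤ), (γ true i : ℤ))} := by
  have h1 := list_prod_mem_bihom (fun a => xv K (lc ⟨i, a⟩)) _ fun a => xv_mem_bihom (lc ⟨i, a⟩)
  have h2 := list_prod_mem_bihom (fun b => pv K (rc ⟨i, b⟩)) _ fun b => pv_mem_bihom (rc ⟨i, b⟩)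
  have := mul_mem_bihom h1 h2
  rw [ofFn_eq_map, ofFn_eq_map] at this
  rw [sum_const, sum_const, Set.nsmul_singleton, Set.nsmul_singleton, singleton_add_singleton] at this
  rw [BasedLie.testArg]
  simpa using this

lemma BasedLie.biProj_B_testArg (L : BasedLie K) (lc : (Σ i, Fin (γ false i)) → Fin L.dim)
    (rc : (Σ i, Fin (γ true i)) → Fin L.dim) {r : ℕ} (hr : ∀ b, cap b * m + ∑ i, γ b i = r)
    (l : List (Edge (Vert n m))) : biProj K 0 0 (L.B (graph K l) (L.testArg lc rc)) =
      if l.length = r then L.B (graph K l) (L.testArg lc rc) else 0 := by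
  have h := L.B_mem_bihom l (L.testArg lc rc) _ (L.testArg_mem_bihom lc rc)
  rw [Set.finset_sum_singleton, singleton_add_singleton] at h
  have h1 := hr true
  have h0 := hr false
  simp only [cap, cond_true, cond_false] at h0 h1
  split_ifs with hl
  · refine biProj_of_mem (bihom_mono (le_of_eq ?_) h)
    congr 1
    simp only [ext_iff, fst_add, snd_add, Prod.fst_sum, Prod.snd_sum]
    constructor <;> push_cast [hl] <;> zify at h0 h1 <;> linarith
  · refine biProj_of_notMem (fun h2 => hl ?_) h
    have h3 := congrArg Prod.fst h2
    simp only [fst_add, Prod.fst_sum] at h3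
    zify at h0 ⊢
    push_cast at h3
    linarith

lemma sum_mem_relations_of_balanced {l : X → List (Edge (Vert n m))}
    (h : ∀ L : BasedLie K, L.B (∑ x ∈ s, c x • graph K (l x)) = 0) (r : ℕ)
    (hr : ∀ b, cap b * m + ∑ i, γ b i = r) :
    ∑ x ∈ s.filter (fun x => (l x).length = r ∧ HasValences γ (l x)), c x • graph K (l x) ∈ relations K n m := by
  classical
  have hlen : (outList n m (γ true)).length = r := length_outList.trans (hr true)
  have hN : (inList n m (γ false)).length = (outList n m (γ true)).length := by
    rw [hlen, length_inList, ← hr false, cap, cond_false, one_mul]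
  obtain ⟨u, hu0, hu⟩ := exists_prod_perm K (V := Vert n m)
    (List.reverse_perm (finRange (outList n m (γ true)).length)).symm
  have hrev (e : Fin (outList n m (γ true)).length → Edge (Vert n m)) :
      graph K (ofFn e) = u • graph K (ofFn e).reverse := by
    have := hu fun j => Pi.single (e j) 1
    rw [graph, graph, ofFn_eq_map, ← List.map_reverse, map_map, map_map]
    exact this
  have hex : ∀ x : {x // (l x).length = r}, ∃ e : Fin (outList n m (γ true)).length → Edge (Vert n m),
      (ofFn e).reverse = l x := by
    rintro ⟨x, hx⟩
    have h1 : (l x).reverse.length = (outList n m (γ true)).length := by rw [List.length_reverse, hx, hlen]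
    refine ⟨fun j => (l x).reverse.get (Fin.cast h1.symm j), ?_⟩
    rw [List.reverse_eq_iff]
    conv_rhs => rw [← List.ofFn_get (l x).reverse]
    exact List.ofFn_congr h1.symm _
  choose e he using hex
  have key := sum_ofFn_mem_relations hN (s := s.subtype fun x => (l x).length = r) (c := fun x => c x) (e := e)
    fun L lc rc => by
      have hB a : L.B a = L.Blin n m a := rfl
      have h1 := congrArg (fun F => biProj K 0 0 (F (L.testArg lc rc))) (h L)
      simp only [hB, map_sum, map_smul, MultilinearMap.sum_apply, MultilinearMap.smul_apply,
        MultilinearMap.zero_apply, map_zero] at h1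
      simp only [← hB, L.biProj_B_testArg lc rc hr, smul_ite, smul_zero] at h1
      rw [← sum_filter] at h1
      simp only [he]
      rw [← h1, Finset.sum_subtype_eq_sum_filter (f := fun x => c x • L.B (graph K (l x)) (L.testArg lc rc))]
  have h2 := smul_mem _ u⁻¹ key
  rw [smul_sum] at h2
  simp only [smul_ite, smul_zero] at h2
  have h3 (x : {x // (l x).length = r}) : (if HasValences γ (ofFn (e x)) then
      u⁻¹ • c x • graph K (ofFn (e x)) else 0) = if HasValences γ (l x) then c x • graph K (l x) else 0 := by
    have h4 : HasValences γ (ofFn (e x)) ↔ HasValences γ (l x) := by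
      rw [← he]
      simp only [HasValences, List.countP_reverse]
    simp only [h4]
    split_ifs
    · rw [hrev, he, smul_comm u⁻¹, inv_smul_smul₀ hu0]
    · rfl
  simp only [h3] at h2
  rw [Finset.sum_subtype_eq_sum_filter (f := fun x => if HasValences γ (l x) then c x • graph K (l x) else 0),
    ← sum_filter, Finset.filter_filter] at h2
  exact h2

end Balanced

end

section Contraction

variable (K) {V V' : Type} [Fintype V] [DecidableEq V] [Fintype V'] [DecidableEq V']

/-- The left derivative with respect to an edge. -/
def del (e : Edge V) : Gra K V →ₗ[K] Gra K V := CliffordAlgebra.contractLeft (proj e)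

lemma del_ι_mul (e : Edge V) (f : Edge V → K) (x : Gra K V) :
    del K e (ExteriorAlgebra.ι K f * x) = f e • x - ExteriorAlgebra.ι K f * del K e x :=
  contractLeft_ι_mul _ _ _

lemma del_arrow_mul (e e' : Edge V) (x : Gra K V) :
    del K e (arrow K e' * x) = (if e' = e then x else 0) - arrow K e' * del K e x := by
  rw [arrow, del_ι_mul]
  congr 1
  rcases eq_or_ne e' e with rfl | h
  · simp
  · simp [h, Ne.symm h]

lemma del_one (e : Edge V) : del K e 1 = 0 := CliffordAlgebra.contractLeft_one _ _

lemma del_pull {c : V' → Option V} {q : Edge V'} {e : Edge V} (h1 : c q.1.1 = some e.1.1)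
    (h2 : c q.1.2 = some e.1.2) (x : Gra K V) : del K q (pull K c x) = pull K c (del K e x) := by
  induction x using Gra.induction with
  | one => rw [map_one, del_one, del_one, map_zero]
  | add x y hx hy => simp only [map_add, hx, hy]
  | smul r x hx => simp only [map_smul, hx]
  | arrow_mul e' x hx =>
    have hf f : pullEdge K c f q = f e := by
      simp only [pullEdge, coe_mk, AddHom.coe_mk, h1, h2]
      exact dif_pos e.2
    have h3 : ∀ f, pull K c (ExteriorAlgebra.ι K f) = ExteriorAlgebra.ι K (pullEdge K c f) := fun f =>
      map_apply_ι _ _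
    rw [arrow, map_mul (pull K c), h3, del_ι_mul, del_ι_mul, hx, map_sub, map_smul, map_mul (pull K c), h3, hf]

lemma del_graph (e : Edge V) {l : List (Edge V)} (hl : l.Nodup) :
    ∃ (s : K) (l' : List (Edge V)), del K e (graph K l) = s • graph K l' ∧ (s = 0 ∨ l.Perm (e :: l')) := by
  induction l with
  | nil => exact ⟨0, [], by rw [graph_nil, del_one, zero_smul], Or.inl rfl⟩
  | cons e' l ih =>
    obtain ⟨s, l', hs, hs'⟩ := ih (nodup_cons.1 hl).2
    rw [graph_cons, del_arrow_mul, hs]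
    rcases eq_or_ne e' e with rfl | h
    · have h0 : s = 0 := hs'.resolve_right fun h => (nodup_cons.1 hl).1 (h.mem_iff.2 (by simp))
      exact ⟨1, l, by rw [h0, if_pos rfl, zero_smul, mul_zero, sub_zero, one_smul], Or.inr (List.Perm.refl _)⟩
    · refine ⟨-s, e' :: l', ?_, hs'.imp (fun h => by rw [h, neg_zero]) fun h => (h.cons e').trans (List.Perm.swap _ _ _)⟩
      rw [if_neg h, graph_cons, mul_smul_comm, zero_sub, neg_smul]

/-- The derivation that multiplies an edge `e` by `χ e`. -/
def weigh (χ : Edge V → K) : Module.End K (Gra K V) :=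
  ∑ e, χ e • (mulLeft K (arrow K e) * del K e)

lemma weigh_apply (χ : Edge V → K) (x : Gra K V) : weigh K χ x = ∑ e, χ e • (arrow K e * del K e x) := by
  simp [weigh, LinearMap.sum_apply]

lemma weigh_add (χ χ' : Edge V → K) : weigh K (χ + χ') = weigh K χ + weigh K χ' := by
  simp only [weigh, Pi.add_apply, add_smul, sum_add_distrib]

lemma weigh_ι_mul (χ f : Edge V → K) (x : Gra K V) : weigh K χ (ExteriorAlgebra.ι K f * x) =
    ExteriorAlgebra.ι K (χ * f) * x + ExteriorAlgebra.ι K f * weigh K χ x := by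
  have h1 : ExteriorAlgebra.ι K (χ * f) = ∑ e, (χ e * f e) • arrow K e := by
    conv_lhs => rw [pi_eq_sum_univ' (χ * f)]
    simp only [map_sum, map_smul, Pi.mul_apply]
    refine sum_congr rfl fun e _ => ?_
    rw [arrow]
  rw [weigh_apply, weigh_apply, h1, sum_mul, mul_sum, ← sum_add_distrib]
  refine sum_congr rfl fun e _ => ?_
  rw [del_ι_mul, mul_sub, ← mul_assoc, arrow, eq_neg_of_add_eq_zero_left (ι_add_mul_swap _ _), neg_mul, sub_neg_eq_add, smul_add, mul_smul_comm, smul_smul, smul_mul_assoc,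
    mul_smul_comm, mul_assoc]

lemma weigh_arrow_mul (χ : Edge V → K) (e : Edge V) (x : Gra K V) :
    weigh K χ (arrow K e * x) = χ e • (arrow K e * x) + arrow K e * weigh K χ x := by
  rw [arrow, weigh_ι_mul]
  congr 1
  rw [← smul_mul_assoc, ← map_smul]
  congr 2
  funext i
  by_cases h : i = e
  · subst h; simp
  · simp [h]

lemma weigh_one (χ : Edge V → K) : weigh K χ 1 = 0 := by simp [weigh_apply, del_one]

lemma weigh_graph (χ : Edge V → K) (l : List (Edge V)) : weigh K χ (graph K l) = (l.map χ).sum • graph K l := by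
  induction l with
  | nil => rw [graph_nil, weigh_one, map_nil, List.sum_nil, zero_smul]
  | cons e l ih => rw [graph_cons, weigh_arrow_mul, ih, map_cons, sum_cons, add_smul, mul_smul_comm]

lemma weigh_pull {c : V' → Option V} {χ : Edge V' → K} {χ' : Edge V → K}
    (h : ∀ q e, c q.1.1 = some e.1.1 → c q.1.2 = some e.1.2 → χ q = χ' e) (x : Gra K V) :
    weigh K χ (pull K c x) = pull K c (weigh K χ' x) := by
  have h0 f : χ * pullEdge K c f = pullEdge K c (χ' * f) := by
    funext q
    simp only [pullEdge, coe_mk, AddHom.coe_mk, Pi.mul_apply]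
    rcases h1 : c q.1.1 with _ | x
    · simp
    · rcases h2 : c q.1.2 with _ | y
      · simp
      · by_cases hxy : x = y
        · simp [hxy]
        · simp only [ne_eq, hxy, not_false_eq_true, dite_true]
          rw [h q ⟨(x, y), hxy⟩ h1 h2]
  induction x using Gra.induction with
  | one => rw [map_one, weigh_one, weigh_one, map_zero]
  | add x y hx hy => simp only [map_add, hx, hy]
  | smul r x hx => simp only [map_smul, hx]
  | arrow_mul e x hx =>
    have h3 : ∀ f, pull K c (ExteriorAlgebra.ι K f) = ExteriorAlgebra.ι K (pullEdge K c f) := fun f =>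
      map_apply_ι _ _
    rw [arrow, weigh_ι_mul, map_mul (pull K c), h3, weigh_ι_mul, hx, map_add, map_mul (pull K c), map_mul (pull K c),
      h3, h3, h0]

end Contraction

section Strip

variable (K) {n m : ℕ}

/-- The edge that starts (if `b`) or ends at `u`, with other endpoint `v`. -/
def mkEdge {V : Type} (b : Bool) {u v : V} (h : u ≠ v) : Edge V := bif b then ⟨(u, v), h⟩ else ⟨(v, u), h.symm⟩

lemma endpt_mkEdge {V : Type} (b : Bool) {u v : V} (h : u ≠ v) : endpt b (mkEdge b h) = u := by
  cases b <;> rfl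

lemma endpt_not_mkEdge {V : Type} (b : Bool) {u v : V} (h : u ≠ v) : endpt (!b) (mkEdge b h) = v := by
  cases b <;> rfl

lemma lifts_endpt {V V' : Type} {c : V' → Option V} {q : Edge V'} {e : Edge V} :
    (c q.1.1 = some e.1.1 ∧ c q.1.2 = some e.1.2) ↔ ∀ b, c (endpt b q) = some (endpt b e) := by
  simp [Bool.forall_bool, endpt, and_comm]

/-- The inclusion of the vertices, missing the last external one. -/
def incl (x : Vert n m) : Vert (n + 1) m := Sum.map Fin.castSucc id x

lemma incl_injective : Function.Injective (incl : Vert n m → Vert (n + 1) m) :=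
  Function.Injective.sumMap (Fin.castSucc_injective _) injective_id

lemma incl_ne (x : Vert n m) : incl x ≠ inl (Fin.last (n + 1)) := by
  rcases x with i | v
  · simp [incl, (Fin.castSucc_lt_last i).ne]
  · simp [incl]

/-- The edge between `x` and the last external vertex. -/
def leg (b : Bool) (x : Vert n m) : Edge (Vert (n + 1) m) := mkEdge b (incl_ne x)

/-- The characteristic function of the edges with a given endpoint. -/
def ends {V : Type} [DecidableEq V] (b : Bool) (x : V) (e : Edge V) : K := if endpt b e = x then 1 else 0

lemma sum_ends {V : Type} [DecidableEq V] (b : Bool) (x : V) (l : List (Edge V)) :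
    (l.map (ends K b x)).sum = l.countP (fun e => decide (endpt b e = x)) := by
  induction l with
  | nil => simp
  | cons e l ih =>
    rw [map_cons, sum_cons, countP_cons, ih, ends, add_comm]
    by_cases h : endpt b e = x <;> simp [h]

/-- Deletion of the last external vertex, together with all edges there. -/
abbrev forget : Gra K (Vert (n + 1) m) →ₐ[K] Gra K (Vert n m) := pull K fun x => some (incl x)

/-- Multiplication by the number of missing edges at `v`. -/
def missing (b : Bool) (v : Fin m) : Module.End K (Gra K (Vert n m)) :=
  (cap b : K) • 1 - weigh K (ends K b (inr v))

lemma missing_apply (b : Bool) (v : Fin m) (x : Gra K (Vert n m)) :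
    missing K b v x = (cap b : K) • x - weigh K (ends K b (inr v)) x := rfl

lemma missing_graph (b : Bool) (v : Fin m) (l : List (Edge (Vert n m))) : missing K b v (graph K l) =
    ((cap b : K) - l.countP (fun e => decide (endpt b e = inr v))) • graph K l := by
  rw [missing_apply, weigh_graph, sum_ends, sub_smul]

/-- Deletion of an edge at the last external vertex, with weights. -/
def strip (b : Bool) : Gra K (Vert (n + 1) m) →ₗ[K] Gra K (Vert n m) :=
  ∑ v : Fin m, missing K b v ∘ₗ (forget K).toLinearMap ∘ₗ del K (leg b (inr v))

lemma strip_apply (b : Bool) (x : Gra K (Vert (n + 1) m)) :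
    strip K b x = ∑ v : Fin m, missing K b v (forget K (del K (leg b (inr v)) x)) := by
  simp [strip, LinearMap.sum_apply]

lemma strip_graph_mem {b b' : Bool} {w : Fin m} {l : List (Edge (Vert (n + 1) m))}
    (h : cap b' < l.countP (fun e => decide (endpt b' e = inr w))) :
    strip K b (graph K l) ∈ relations K n m := by
  by_cases hl : l.Nodup
  swap
  · rw [graph_eq_zero K hl, map_zero]; exact zero_mem _
  rw [strip_apply]
  refine Submodule.sum_mem _ fun v _ => ?_
  obtain ⟨s, l₀, hs, hs'⟩ := del_graph K (leg b (inr v)) hl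
  rw [hs]
  rcases hs' with rfl | hmem
  · rw [zero_smul, map_zero, map_zero]; exact zero_mem _
  rw [map_smul, map_smul]
  refine smul_mem _ _ ?_
  refine map_mem_of_mem_span (missing K b v) ?_ (pull_graph_mem K _ _)
  rintro _ ⟨l', hl', rfl⟩
  · have hcount b' w' : l'.countP (fun e => decide (endpt b' e = inr w')) =
        l₀.countP (fun e => decide (endpt b' e = inr w')) := by
      clear hs hmem
      induction hl' with
      | nil => rfl
      | @cons q e l' l hq _ ih =>
        rw [countP_cons, countP_cons, ih]
        have h1 := (lifts_endpt (c := fun x : Vert n m => some (incl x))).1 hq b'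
        have h2 : endpt b' q = inr w' ↔ endpt b' e = inr w' := by
          rw [← Option.some.inj h1]
          rcases endpt b' q with i | i <;> simp [incl]
        simp only [h2]
    have hperm := hmem.countP_eq (fun e => decide (endpt b' e = inr w))
    rw [countP_cons, ← hcount] at hperm
    rw [missing_graph]
    by_cases hb : endpt b' (leg b (inr v) : Edge (Vert (n + 1) m)) = inr w
    · obtain rfl : b' = b := by
        by_contra hbb
        rw [Bool.eq_not.2 hbb, leg, endpt_not_mkEdge] at hb
        cases hb
      rw [leg, endpt_mkEdge] at hb
      obtain rfl : v = w := inr.inj hb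
      rcases Nat.lt_or_ge (cap b') (l'.countP fun e => decide (endpt b' e = inr v)) with h1 | h1
      · exact smul_mem _ _ (graph_mem_relations h1)
      · rw [leg, endpt_mkEdge] at hperm
        simp [incl] at hperm
        rw [show l'.countP (fun e => decide (endpt b' e = inr v)) = cap b' by omega, sub_self, zero_smul]
        exact zero_mem _
    · rw [decide_eq_false hb] at hperm
      exact smul_mem _ _ (graph_mem_relations (b := b') (v := w) (by simp at hperm; omega))

lemma strip_relabel (b : Bool) (σ : Equiv.Perm (Fin m)) (x : Gra K (Vert (n + 1) m)) :
    strip K b (pull K (relabel σ) x) = pull K (relabel σ) (strip K b x) := by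
  rw [strip_apply, strip_apply, map_sum]
  refine sum_equiv σ _ _ fun v => ?_
  rw [del_pull K (e := leg b (inr (σ v))) (by cases b <;> rfl) (by cases b <;> rfl), forget, pull_pull,
    missing_apply, missing_apply, map_sub, map_smul, ← weigh_pull (χ := ends K b (inr v)), pull_pull]
  · have h : ∀ x : Vert n m, (some (incl x)).bind (relabel σ) = (relabel σ x).bind fun x => some (incl x) := by
      rintro (i | i) <;> rfl
    rw [pull_congr K h]
  · intro q e h1 h2
    have h := lifts_endpt.1 ⟨h1, h2⟩ b
    rw [ends, ends, ← Option.some.inj h]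
    congr 1
    rcases endpt b q with i | i <;> simp

lemma forget_arrow {x y : Vert n m} (h : incl x ≠ incl y) (h' : x ≠ y) :
    forget K (arrow K ⟨(incl x, incl y), h⟩) = arrow K ⟨(x, y), h'⟩ := by
  rw [forget, pull_arrow_eq]
  simp only [Option.some.injEq, incl_injective.eq_iff, sum_ite_eq', mem_univ, if_true]
  exact ι_arr K h'

lemma strip_ihx_mem (b : Bool) {v w : Fin m} (h : (inr v : Vert (n + 1) m) ≠ inr w)
    (x : Gra K (Vert (n + 1) m)) :
    strip K b (arrow K ⟨(inr v, inr w), h⟩ * pull K (contract v w) x) ∈ relations K n m := by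
  have hvw : v ≠ w := fun h' => h (congrArg _ h')
  have h' : (inr v : Vert n m) ≠ inr w := fun h' => hvw (inr.inj h')
  set e' := arrow K (⟨(inr v, inr w), h'⟩ : Edge (Vert n m)) with he'
  have hforget (y : Gra K (Vert (n + 1) m)) : forget K (pull K (contract v w) y) = pull K (contract v w) (forget K y) := by
    rw [forget, pull_pull, pull_pull]
    refine pull_congr K (fun u => ?_) y
    rcases u with i | i
    · rfl
    · simp only [incl, contract, Option.bind_some, map_inr, id_eq, inr.injEq]
      split_ifs <;> rfl
  have hdel (u u' : Fin m) : contract v w (inr u : Vert (n + 1) m) = some (inr u') →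
      forget K (del K (leg b (inr u)) (arrow K ⟨(inr v, inr w), h⟩ * pull K (contract v w) x)) =
        -(e' * pull K (contract v w) (forget K (del K (leg b (inr u')) x))) := by
    intro hu
    have hne : (⟨(inr v, inr w), h⟩ : Edge (Vert (n + 1) m)) ≠ leg b (inr u) := by
      intro h2
      have := congrArg (endpt (!b)) h2
      rw [leg, endpt_not_mkEdge] at this
      cases b <;> cases this
    have hlast : contract v w (inl (Fin.last (n + 1)) : Vert (n + 1) m) = some (inl (Fin.last (n + 1))) := rfl
    rw [del_arrow_mul, if_neg hne, zero_sub, del_pull K (e := leg b (inr u')), map_neg, map_mul, hforget]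
    · congr 2
      exact forget_arrow K (x := inr v) (y := inr w) h h'
    · cases b
      · exact hlast
      · exact hu
    · cases b
      · exact hu
      · exact hlast
  have hends (u : Fin m) : u ≠ v → u ≠ w → ∀ y : Gra K (Vert n m),
      weigh K (ends K b (inr u)) (pull K (contract v w) y) =
        pull K (contract v w) (weigh K (ends K b (inr u)) y) := by
    intro h1 h2 y
    refine weigh_pull K (fun q e hq hq' => ?_) y
    have h3 := lifts_endpt.1 ⟨hq, hq'⟩ b
    rw [ends, ends, ← Option.some.inj h3]
    congr 1
    split_ifs with h4
    · rw [h4]; simp [Ne.symm h1, Ne.symm h2]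
    · rfl
  have hends' (y : Gra K (Vert n m)) : weigh K (ends K b (inr v)) (pull K (contract v w) y) +
      weigh K (ends K b (inr w)) (pull K (contract v w) y) =
        pull K (contract v w) (weigh K (ends K b (inr v)) y) := by
    rw [← LinearMap.add_apply, ← weigh_add]
    refine weigh_pull K (fun q e hq hq' => ?_) y
    have h3 := lifts_endpt.1 ⟨hq, hq'⟩ b
    rw [Pi.add_apply, ends, ends, ends, ← Option.some.inj h3]
    by_cases h4 : endpt b q = inr w
    · rw [h4]; simp [hvw.symm]
    · simp [h4]
  rw [strip_apply, ← Finset.add_sum_erase _ _ (mem_univ v),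
    ← Finset.add_sum_erase _ _ (mem_erase.2 ⟨hvw.symm, mem_univ w⟩), ← add_assoc]
  refine add_mem ?_ (Submodule.sum_mem _ fun u hu => ?_)
  · rw [hdel v v (by simp [contract, hvw]), hdel w v (by simp [contract]), map_neg, map_neg, ← neg_add]
    refine neg_mem ?_
    set y := forget K (del K (leg b (inr v)) x) with hy
    have h1 : missing K b v (e' * pull K (contract v w) y) + missing K b w (e' * pull K (contract v w) y) =
        e' * pull K (contract v w) ((2 * (cap b : K) - 1) • y - weigh K (ends K b (inr v)) y) := by
      have h2 : ends K b (inr v) ⟨(inr v, inr w), h'⟩ +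
          ends K b (inr w) ⟨(inr v, inr w), h'⟩ = 1 := by
        cases b <;> simp [ends, endpt, hvw, hvw.symm]
      rw [missing_apply, missing_apply, weigh_arrow_mul, weigh_arrow_mul, map_sub, map_smul, ← hends', mul_sub,
        mul_add, mul_smul_comm, sub_smul, ← h2]
      module
    rw [h1]
    exact arrow_mul_pull_mem K h' _
  · obtain ⟨h2, h1, -⟩ := by simpa only [mem_erase] using hu
    rw [hdel u u (by simp [contract, h2]), map_neg]
    refine neg_mem ?_
    have h3 : ends K b (inr u) (⟨(inr v, inr w), h'⟩ : Edge (Vert n m)) = 0 := by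
      cases b <;> simp [ends, endpt, h1.symm, h2.symm]
    rw [missing_apply, weigh_arrow_mul, h3, zero_smul, zero_add, hends u h1 h2, ← mul_smul_comm, ← map_smul,
      ← mul_sub, ← map_sub]
    exact arrow_mul_pull_mem K h' _

end Strip

section StripRelations

variable (K) {n m : ℕ}

lemma mul_mem_of_graph {V : Type} [Fintype V] [DecidableEq V] [CharZero K] (P : Submodule K (Gra K V)) {t : Gra K V}
    (h : ∀ l l', graph K l * t * graph K l' ∈ P) (x y : Gra K V) : x * t * y ∈ P :=
  map₂_mem_of_mem_span (LinearMap.mul K _ ∘ₗ LinearMap.mulRight K t)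
    (by rintro _ ⟨l, rfl⟩ _ ⟨l', rfl⟩; exact h l l') (mem_span_graph x) (mem_span_graph y)

variable [CharZero K]

lemma strip_mem (b : Bool) {x : Gra K (Vert (n + 1) m)} (hx : x ∈ relations K (n + 1) m) :
    strip K b x ∈ relations K n m := by
  refine map_mem_of_mem_span (strip K b) ?_ hx
  rintro _ (⟨v, e, e', x, y, h, h'⟩ | ⟨v, e, e', e'', x, y, h, h', h''⟩ | ⟨σ, x⟩ | ⟨v, w, h, x⟩)
  · rw [mul_assoc x]
    refine mul_mem_of_graph K ((relations K n m).comap (strip K b)) (fun l l' => ?_) x y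
    rw [mul_assoc, mul_assoc, ← graph_cons, ← graph_cons, ← graph_append]
    refine strip_graph_mem K (b' := false) (w := v) ?_
    simp [List.countP_append, countP_cons, endpt, h, h', cap]
    omega
  · rw [mul_assoc x, mul_assoc x]
    refine mul_mem_of_graph K ((relations K n m).comap (strip K b)) (fun l l' => ?_) x y
    simp only [mul_assoc, ← graph_cons, ← graph_append]
    refine strip_graph_mem K (b' := true) (w := v) ?_
    simp [List.countP_append, countP_cons, endpt, h, h', h'', cap]
    omega
  · rw [map_sub, strip_relabel]
    exact subset_span (Relator.symm σ _)
  · have : pull K (contract v w) x * arrow K ⟨(inr v, inr w), h⟩ =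
        arrow K ⟨(inr v, inr w), h⟩ * pull K (contract v w) (twist K 1 x) := by
      rw [arrow_mul, twist_pull]
      congr 2
      induction x using Gra.induction with
      | one => simp
      | add x y hx hy => simp only [map_add, ← hx, ← hy]
      | smul r x hx => simp only [map_smul, ← hx]
      | arrow_mul e x hx => simp [twist_arrow, ← hx]
    rw [this]
    exact strip_ihx_mem K b h _

variable {K}

/-- The edge with the same endpoints. -/
def liftE (e : Edge (Vert n m)) : Edge (Vert (n + 1) m) := ⟨(incl e.1.1, incl e.1.2), incl_injective.ne e.2⟩

lemma endpt_liftE (b : Bool) (e : Edge (Vert n m)) : endpt b (liftE e) = incl (endpt b e) := by cases b <;> rfl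

lemma forget_graph (l : List (Edge (Vert n m))) : forget K (graph K (l.map liftE)) = graph K l := by
  induction l with
  | nil => rw [map_nil, graph_nil, graph_nil, map_one]
  | cons e l ih =>
    rw [map_cons, graph_cons, graph_cons, map_mul, ih, liftE, forget_arrow K _ e.2]

lemma leg_ne_liftE (b : Bool) (x : Vert n m) (e : Edge (Vert n m)) : leg b x ≠ liftE e := fun h => by
  have := congrArg (endpt (!b)) h
  rw [leg, endpt_not_mkEdge, endpt_liftE] at this
  exact incl_ne _ this.symm

lemma del_leg_graph (b : Bool) (x : Vert n m) (l : List (Edge (Vert n m))) :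
    del K (leg b x) (graph K (l.map liftE)) = 0 := by
  induction l with
  | nil => rw [map_nil, graph_nil, del_one]
  | cons e l ih =>
    rw [map_cons, graph_cons, del_arrow_mul, if_neg (leg_ne_liftE b x e).symm, ih, mul_zero, sub_zero]

lemma leg_injective (b : Bool) : Function.Injective (leg b : Vert n m → Edge (Vert (n + 1) m)) := fun x y h => by
  have := congrArg (endpt b) h
  rw [leg, leg, endpt_mkEdge, endpt_mkEdge] at this
  exact incl_injective this

lemma strip_leg_inl (b : Bool) (i : Fin (n + 1)) (l : List (Edge (Vert n m))) :
    strip K b (graph K (leg b (inl i) :: l.map liftE)) = 0 := by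
  rw [strip_apply]
  refine sum_eq_zero fun v _ => ?_
  rw [graph_cons, del_arrow_mul, if_neg ((leg_injective b).ne (by simp)), del_leg_graph, mul_zero, sub_zero, map_zero,
    map_zero]

lemma strip_leg_inr (b : Bool) (v : Fin m) (l : List (Edge (Vert n m))) :
    strip K b (graph K (leg b (inr v) :: l.map liftE)) =
      ((cap b : K) - l.countP (fun e => decide (endpt b e = inr v))) • graph K l := by
  rw [strip_apply, Fintype.sum_eq_single v fun w hw => by
      rw [graph_cons, del_arrow_mul, if_neg ((leg_injective b).ne (by simpa using hw.symm)),
        del_leg_graph, mul_zero, sub_zero, map_zero, map_zero],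
    graph_cons, del_arrow_mul, if_pos rfl, del_leg_graph, mul_zero, sub_zero, forget_graph,
    missing_graph]

end StripRelations

section Attach

variable [CharZero K] {n m : ℕ}

lemma sum_vert {X : Type*} [AddCommMonoid X] (f : Vert (n + 1) m → X) :
    ∑ x, f x = ∑ x : Vert n m, f (incl x) + f (inl (Fin.last (n + 1))) := by
  rw [sum_sum_type, sum_sum_type, Fin.sum_univ_castSucc]
  simp only [incl, map_inl, map_inr, id_eq]
  abel

/-- The graph with two external vertices and one edge. -/
def stick (b : Bool) : Edge (Vert 1 0) := mkEdge b (u := inl 0) (v := inl 1) (by simp)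

lemma compose_stick (b : Bool) (hN : 1 + n = n + 1) (hM : 0 + m = m) (l : List (Edge (Vert n m))) :
    compose K hN hM 0 (arrow K (stick b)) (graph K l) = ∑ x : Vert n m, graph K (leg b x :: l.map liftE) := by
  have hc : ∀ x : Vert n m, collapse hN hM 0 (incl x) = some (inl 0) := by
    rintro (i | v)
    · have := i.2
      simp [collapse, incl]
      omega
    · simp [collapse, incl]
  have hc' : collapse hN hM 0 (inl (Fin.last (n + 1))) = some (inl 1) := by
    simp [collapse]
  have h1 : pull K (collapse hN hM 0) (arrow K (stick b)) = ∑ x : Vert n m, arrow K (leg b x) := by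
    rw [pull_arrow_eq]
    cases b
    all_goals
      simp only [stick, mkEdge, cond_true, cond_false, sum_vert, hc, hc', Option.some.injEq, if_true, reduceCtorEq,
        inl.injEq, zero_ne_one, one_ne_zero, if_false, sum_const_zero, zero_add, add_zero]
      exact sum_congr rfl fun x _ => ι_arr K _
  have h2 : pull K (restrict hN hM 0) (graph K l) = graph K (l.map liftE) := by
    induction l with
    | nil => rw [map_nil, graph_nil, graph_nil, map_one]
    | cons e l ih =>
      have h3 (x : Vert (n + 1) m) (y : Vert n m) : restrict hN hM 0 x = some y ↔ x = incl y := by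
        rw [restrict_eq_some_iff]
        have : embV hN hM 0 y = incl y := by
          rcases y with i | v <;> simp only [embV, incl, map_inl, map_inr] <;> congr 1 <;> ext <;> simp
        rw [this]
      rw [map_cons, graph_cons, graph_cons, map_mul, ih, pull_arrow_eq]
      simp only [h3, sum_ite_eq', mem_univ, if_true]
      rw [ι_arr K (incl_injective.ne e.2)]
      rfl
  change pull K (collapse hN hM 0) (arrow K (stick b)) * pull K (restrict hN hM 0) (graph K l) = _
  rw [h1, h2, sum_mul]
  rfl

lemma BasedLie.B_compose_zero (L : BasedLie K) {n₁ n₂ m₁ m₂ N M : ℕ} (hN : n₁ + n₂ = N) (hM : m₁ + m₂ = M)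
    (a : Gra K (Vert n₁ m₁)) {b : Gra K (Vert n₂ m₂)} (hb : L.B b = 0) : L.B (compose K hN hM 0 a b) = 0 := by
  ext f
  have key := LinearMap.eqOn_span (f := evalₗ f ∘ₗ L.Blin N M ∘ₗ compose K hN hM 0 a)
    (g := (L.B a).toLinearMap (fun i => f ⟨i.1 + n₂, by omega⟩) 0 ∘ₗ
      evalₗ (fun k => f ⟨0 + k.1, by omega⟩) ∘ₗ L.Blin n₂ m₂) ?_ (mem_span_graph b)
  · exact key.trans ((congrArg (fun g => (L.B a).toLinearMap _ 0 (evalₗ _ g)) hb).trans (map_zero _))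
  rintro _ ⟨l, rfl⟩
  have htw : twist K 1 (graph K l) = (-1 : K) ^ l.length • graph K l := by rw [twist_graph, one_mul]
  refine (L.B_compose hN hM 0 a htw _).trans (congrArg (L.B a) (funext fun i => ?_))
  rw [BasedLie.compArg, dif_neg (show ¬ i.1 < (0 : Fin (n₁ + 1)).1 from Nat.not_lt_zero _)]
  rcases eq_or_ne i 0 with rfl | hi
  · rw [update_self]; rfl
  · rw [update_of_ne hi, if_neg fun h => hi (Fin.ext h)]

lemma sum_countP (b : Bool) (l : List (Edge (Vert n m))) :
    ∑ i, l.countP (fun e => decide (endpt b e = inl i)) + ∑ v, l.countP (fun e => decide (endpt b e = inr v)) =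
      l.length := by
  induction l with
  | nil => simp
  | cons e l ih =>
    simp only [countP_cons, sum_add_distrib, length_cons, decide_eq_true_eq]
    have h : (∑ i, if endpt b e = inl i then 1 else 0) + (∑ v, if endpt b e = inr v then 1 else 0) = 1 := by
      rcases endpt b e with i | v <;> simp
    omega

lemma hasValences_leg {γ : Bool → Fin (n + 1) → ℕ} (b : Bool) (v : Fin m) (l : List (Edge (Vert n m))) :
    HasValences (fun b' => Fin.snoc (γ b') (if b' = b then 0 else 1) : Bool → Fin (n + 1 + 1) → ℕ)
      (leg b (inr v) :: l.map liftE) ↔ HasValences γ l := by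
  have h1 b' (i : Fin (n + 1)) : (leg b (inr v) :: l.map liftE).countP
      (fun e => decide (endpt b' e = inl i.castSucc)) = l.countP (fun e => decide (endpt b' e = inl i)) := by
    have h2 : endpt b' (leg b (inr v)) ≠ (inl i.castSucc : Vert (n + 1) m) := by
      rcases eq_or_ne b' b with rfl | hb
      · rw [leg, endpt_mkEdge]; simp [incl]
      · rw [Bool.eq_not.2 hb, leg, endpt_not_mkEdge]; simp [(Fin.castSucc_lt_last i).ne']
    rw [countP_cons, List.countP_map, decide_eq_false h2]
    simp only [Bool.false_eq_true, if_false, add_zero]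
    refine List.countP_congr fun e _ => ?_
    have h3 : (inl i.castSucc : Vert (n + 1) m) = incl (inl i) := rfl
    simp only [comp_apply, endpt_liftE, h3, incl_injective.eq_iff]
  have h2 b' : (leg b (inr v) :: l.map liftE).countP
      (fun e => decide (endpt b' e = (inl (Fin.last (n + 1)) : Vert (n + 1) m))) = if b' = b then 0 else 1 := by
    rw [countP_cons, List.countP_map, List.countP_eq_zero.2 fun e _ => by
      simpa [endpt_liftE] using incl_ne (endpt b' e), zero_add]
    rcases eq_or_ne b' b with rfl | hb
    · rw [leg, endpt_mkEdge, if_pos rfl, if_neg (by simpa using incl_ne (inr v : Vert n m))]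
    · rw [Bool.eq_not.2 hb, leg, endpt_not_mkEdge]; simp
  simp only [HasValences, Fin.forall_fin_succ', h1, h2, Fin.snoc_castSucc, Fin.snoc_last, and_true]

lemma sum_filter_mem_relations (k : ℕ) : ∀ (n m : ℕ) (γ : Bool → Fin (n + 1) → ℕ) (r : ℕ),
    ∑ b, (((cap b * m : ℕ) : ℤ) + ∑ i, (γ b i : ℤ) - r).toNat = k →
    ∀ {X : Type} (s : Finset X) (c : X → K) (l : X → List (Edge (Vert n m))),
    (∀ L : BasedLie K, L.B (∑ x ∈ s, c x • graph K (l x)) = 0) →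
    ∑ x ∈ s.filter (fun x => (l x).length = r ∧ HasValences γ (l x)), c x • graph K (l x) ∈ relations K n m := by
  induction k with
  | zero =>
    intro n m γ r hk X s c l h
    by_cases hr : ∀ b, cap b * m + ∑ i, γ b i = r
    · exact sum_mem_relations_of_balanced h r hr
    · push Not at hr
      obtain ⟨b, hb⟩ := hr
      have h0 := (Finset.sum_eq_zero_iff.1 hk) b (mem_univ _)
      refine Submodule.sum_mem _ fun x hx => smul_mem _ _ ?_
      obtain ⟨-, h1, h2⟩ := mem_filter.1 hx
      have h3 := sum_countP b (l x)
      rw [sum_congr rfl fun i _ => h2 b i, h1] at h3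
      by_contra hmem
      have h4 : ∑ v, (l x).countP (fun e => decide (endpt b e = inr v)) ≤ ∑ v : Fin m, cap b :=
        Finset.sum_le_sum fun v _ => not_lt.1 fun h => hmem (graph_mem_relations h)
      rw [sum_const, card_univ, card_fin, smul_eq_mul, mul_comm] at h4
      rw [Int.toNat_eq_zero] at h0
      zify at h3 h4 hb
      push_cast at h0
      exact hb (by linarith)
  | succ k ih =>
    intro n m γ r hk X s c l h
    obtain ⟨b, -, hb⟩ := Finset.exists_ne_zero_of_sum_ne_zero (hk.trans_ne k.succ_ne_zero)
    set γ' : Bool → Fin (n + 1 + 1) → ℕ := fun b' => Fin.snoc (γ b') (if b' = b then 0 else 1) with hγ'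
    have hk' : ∑ b', (((cap b' * m : ℕ) : ℤ) + ∑ i, (γ' b' i : ℤ) - (r + 1 : ℕ)).toNat = k := by
      have h1 b' : ((cap b' * m : ℕ) : ℤ) + ∑ i, (γ' b' i : ℤ) - (r + 1 : ℕ) =
          ((cap b' * m : ℕ) : ℤ) + ∑ i, (γ b' i : ℤ) - r - if b' = b then 1 else 0 := by
        simp only [hγ', Fin.sum_univ_castSucc, Fin.snoc_castSucc, Fin.snoc_last]
        split_ifs <;> push_cast <;> ring
      simp only [h1]
      obtain ⟨F, hF⟩ : ∃ F : Bool → ℤ, ∀ b', ((cap b' * m : ℕ) : ℤ) + ∑ i, (γ b' i : ℤ) - r = F b' :=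
        ⟨_, fun _ => rfl⟩
      simp only [hF] at hk hb ⊢
      rw [Fintype.sum_bool] at hk ⊢
      cases b <;> simp only [if_true, Bool.true_eq_false, Bool.false_eq_true, if_false] <;> omega
    have hB (L : BasedLie K) : L.B (∑ x ∈ s ×ˢ (univ : Finset (Vert n m)),
        c x.1 • graph K (leg b x.2 :: (l x.1).map liftE)) = 0 := by
      have := L.B_compose_zero (add_comm 1 n) (zero_add m) (arrow K (stick b)) (h L)
      simp only [map_sum, map_smul, compose_stick] at this
      rw [Finset.sum_product]
      simpa only [smul_sum] using this
    have key := strip_mem K b (ih (n + 1) m γ' (r + 1) hk' _ _ _ hB)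
    rw [sum_filter, Finset.sum_product, map_sum] at key
    simp only [map_sum, map_add, apply_ite (strip K b), map_smul, map_zero, sum_sum_type, strip_leg_inl, smul_zero,
      ite_self, sum_const_zero, zero_add, strip_leg_inr, hγ', hasValences_leg, length_cons,
      length_map, Nat.add_right_cancel_iff] at key
    have hne : ((cap b * m + ∑ i, γ b i : ℕ) : K) - r ≠ 0 := by
      rw [sub_ne_zero, Ne, Nat.cast_inj]
      intro h0
      apply hb
      rw [← h0]
      push_cast
      simp
    refine (Submodule.smul_mem_iff _ hne).1 ?_
    rw [sum_filter, smul_sum]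
    refine (congrArg (· ∈ relations K n m) (sum_congr rfl fun x _ => ?_)).mp key
    by_cases hx : (l x).length = r ∧ HasValences γ (l x)
    · simp only [if_pos hx]
      rw [← smul_sum, ← sum_smul, smul_comm]
      congr 2
      have h3 := sum_countP b (l x)
      rw [sum_congr rfl fun i _ => hx.2 b i, hx.1] at h3
      rw [sum_sub_distrib, sum_const, card_univ, card_fin, nsmul_eq_mul, ← h3]
      push_cast
      ring
    · simp only [if_neg hx, sum_const_zero, smul_zero]

/-- Only relations are represented by zero for all Lie algebras. -/
lemma mem_relations_of_forall_B_eq_zero {a : Gra K (Vert n m)} (h : ∀ L : BasedLie K, L.B a = 0) :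
    a ∈ relations K n m := by
  obtain ⟨c, rfl⟩ := Finsupp.mem_span_range_iff_exists_finsupp.1 (mem_span_graph a)
  rw [Finsupp.sum, ← Finset.sum_fiberwise_of_maps_to (g := fun l : List (Edge (Vert n m)) => (l.length,
    fun b i => l.countP (fun e => decide (endpt b e = inl i)))) fun l hl => Finset.mem_image_of_mem _ hl]
  refine Submodule.sum_mem _ fun d _ => ?_
  have := sum_filter_mem_relations _ n m d.2 d.1 rfl c.support c id h
  have h2 : c.support.filter (fun l => (l.length, fun b i => l.countP (fun e => decide (endpt b e = inl i))) = d) =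
      c.support.filter fun l => (id l).length = d.1 ∧ HasValences d.2 (id l) :=
    Finset.filter_congr fun l _ => by simp only [ext_iff, funext_iff]; rfl
  rw [h2]
  exact this

end Attach

open Filter in
lemma eventually_sum_diag {X : Type*} [AddCommMonoid X] (c : ℕ → ℕ → X) (T₀ : ℕ)
    (h : ∀ i j, T₀ ≤ i ∨ T₀ ≤ j → c i j = 0) :
    ∀ᶠ T in atTop, ∑ M ∈ range T, ∑ i ∈ range (M + 1), c i (M - i) =
      ∑ i ∈ range T₀, ∑ j ∈ range T₀, c i j := by
  filter_upwards [eventually_ge_atTop (2 * T₀)] with T hT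
  rw [Finset.sum_range_diag_flip T c, ← sum_subset (range_mono (show T₀ ≤ T by omega)) fun i _ hi =>
    sum_eq_zero fun j _ => h _ _ (Or.inl (by simpa using hi))]
  refine sum_congr rfl fun i hi => (sum_subset (range_mono ?_) fun j _ hj =>
    h _ _ (Or.inr (by simpa using hj))).symm
  grind

lemma sum_flip' {X : Type*} [AddCommMonoid X] (N : ℕ) (G : ℕ → ℕ → X) :
    ∑ s ∈ range (N + 1), G (N - s) s = ∑ n ∈ range (N + 1), G n (N - n) := by
  refine Finset.sum_nbij' (fun s => N - s) (fun s => N - s) ?_ ?_ ?_ ?_ ?_ <;> grind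

lemma prod_ite_lt_eq {X : Type*} [CommMonoid X] {n r : ℕ} (hr : r ≤ n) (α : ℕ → X) (β : X) :
    ∏ i : Fin (n + 1), (if i.1 < r then α i.1 else if i.1 = r then β else 1) =
      (∏ i ∈ range r, α i) * β := by
  rw [← prod_range fun i => if i < r then α i else if i = r then β else 1,
    ← Finset.prod_subset (range_mono (show r + 1 ≤ n + 1 by omega)) (by grind),
    Finset.prod_range_succ, prod_congr rfl fun i hi => if_pos (mem_range.1 hi)]
  simp

section Sign

variable (K)

/-- The sign `(-1) ^ z` in a field. -/
def sgn (z : ℤ) : K := ((z.negOnePow : ℤˣ) : ℤ)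

lemma sgn_add (z w : ℤ) : sgn K (z + w) = sgn K z * sgn K w := by
  simp [sgn, Int.negOnePow_add]

lemma sgn_natCast (n : ℕ) : sgn K n = (-1 : K) ^ n := by
  simp only [sgn, Int.negOnePow_def]
  simp

lemma sgn_congr {z w : ℤ} (h : Even (z - w)) : sgn K z = sgn K w := by
  rw [sgn, sgn, (Int.negOnePow_eq_iff z w).2 h]

lemma negOnePow_smul {A : Type*} [AddCommGroup A] [Module K A] (z : ℤ) (a : A) :
    ((z.negOnePow : ℤˣ) : ℤ) • a = sgn K z • a := (Int.cast_smul_eq_zsmul K _ a).symm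

lemma sgn_sum {X : Type*} (s : Finset X) (k : X → ℤ) : sgn K (∑ i ∈ s, k i) = ∏ i ∈ s, sgn K (k i) := by
  classical
  induction s using Finset.induction_on with
  | empty => simp [sgn]
  | insert i s hi ih => rw [Finset.sum_insert hi, Finset.prod_insert hi, sgn_add, ih]

end Sign

lemma preLieEnd_eq {A : Type u} [AddCommGroup A] [Module K A] (q : ℤ)
    (f g : EndFam K A) (N : ℕ) (a : ℕ → A) (k : ℕ → ℤ) :
    preLieEnd q f g N a k = ∑ n ∈ range (N + 1), ∑ r ∈ range (n + 1),
      sgn K ((q - (N - n : ℕ)) * n + r * (N - n : ℕ) +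
        (q - (N - n : ℕ)) * ∑ i ∈ range r, k i) •
      evalSeq (f n) (plug r (N - n + 1) (evalSeq (g (N - n)) fun i => a (r + i)) a) := by
  rw [← sum_flip' N fun n s => ∑ r ∈ range (n + 1),
      sgn K ((q - s) * n + r * s + (q - s) * ∑ i ∈ range r, k i) •
      evalSeq (f n) (plug r (s + 1) (evalSeq (g s) fun i => a (r + i)) a)]
  refine sum_congr rfl fun s _ => sum_congr rfl fun r _ => ?_
  rw [partialComp, negOnePow_smul K, negOnePow_smul K, smul_smul, ← sgn_add]
  congr 1
  exact sgn_congr K ⟨-(q - s) * ((N - s : ℕ) : ℤ) + s, by ring⟩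

section Compose

variable [CharZero K] (L : BasedLie K)

lemma BasedLie.BQ_compSign {n₁ n₂ m₁ m₂ N M : ℕ} (hN : n₁ + n₂ = N) (hM : m₁ + m₂ = M)
    (j : Fin (n₁ + 1)) (k : ℕ) {p : ℕ} {q : ℤ} (hp : Even ((p : ℤ) - (q - n₂))) (x : QGra K n₁ m₁)
    {y : QGra K n₂ m₂} (hy : y ∈ dgraphsDeg K q n₂ m₂) (f : Fin (N + 1) → L.A) :
    L.BQ N M (compSign K hN hM j k x y) f =
      (-1 : K) ^ (k * p) • L.BQ n₁ m₁ x (L.compArg hN j p (L.BQ n₂ m₂ y) f) := by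
  obtain ⟨b, rfl, hb⟩ := exists_twist_eq hp hy
  obtain ⟨a, rfl⟩ := mkQ_surjective _ x
  rw [← compQ_apply, ← compQ_cls K hN hM j k a b |>.symm, L.BQ_cls, hb, map_smul, L.B_smul,
    MultilinearMap.smul_apply, L.B_compose hN hM j a (by simpa using hb 1)]
  rfl

lemma BasedLie.compArg_eq_update {n₁ n₂ N : ℕ} (hN : n₁ + n₂ = N) (j : Fin (n₁ + 1)) (p : ℕ)
    (b : MultilinearMap K (fun _ : Fin (n₂ + 1) => L.A) L.A) (f : Fin (N + 1) → L.A) :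
    L.compArg hN j p b f = update (L.compArg hN j p 0 f) j
      (b fun k => f ⟨j.1 + k.1, by have := j.2; have := k.2; omega⟩) := by
  funext i
  by_cases hi : i = j
  · subst hi; simp [BasedLie.compArg]
  · simp [BasedLie.compArg, hi, ← Fin.ext_iff]

open Filter in
lemma BasedLie.eventually_BB_comp {n₁ n₂ N : ℕ} (hN : n₁ + n₂ = N) (j : Fin (n₁ + 1)) (p : ℕ)
    (x y : Conv K) (f : Fin (N + 1) → L.A) :
    ∀ᶠ T in atTop, ∑ M ∈ range T, ∑ i ∈ range (M + 1),
        L.BQ n₁ i (x n₁ i) (L.compArg hN j p (L.BQ n₂ (M - i) (y n₂ (M - i))) f) =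
      BB x L n₁ (L.compArg hN j p (BB y L n₂) f) := by
  let g : Fin (n₂ + 1) → L.A := fun k => f ⟨j.1 + k.1, by have := j.2; have := k.2; omega⟩
  obtain ⟨T₁, h₁⟩ := L.exists_bound g
  obtain ⟨T₂, h₂⟩ := L.exists_bound (L.compArg hN j p (BB y L n₂) f)
  choose T₃ h₃ using fun m : ℕ => L.exists_bound (L.compArg hN j p (L.BQ n₂ m (y n₂ m)) f)
  let T₀ := T₁ + T₂ + ∑ m ∈ range T₁, T₃ m
  have hz m : T₁ ≤ m → ∀ i, L.BQ n₁ i (x n₁ i) (L.compArg hN j p (L.BQ n₂ m (y n₂ m)) f) = 0 := by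
    intro hm i
    refine MultilinearMap.map_coord_zero _ j ?_
    rw [L.compArg_eq_update, update_self]
    exact h₁ m hm _
  refine (eventually_sum_diag (fun i m => L.BQ n₁ i (x n₁ i)
    (L.compArg hN j p (L.BQ n₂ m (y n₂ m)) f)) T₀ ?_).mono ?_
  · rintro i m (hi | hm)
    · rcases lt_or_ge m T₁ with hm | hm
      · refine h₃ m i (le_trans ?_ hi) _
        have := Finset.single_le_sum (f := T₃) (fun _ _ => Nat.zero_le _) (mem_range.2 hm)
        omega
      · exact hz m hm i
    · exact hz m (by omega) i
  · intro T hT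
    rw [hT, BB_apply L x (M := T₀) fun m hm => h₂ m (by omega)]
    refine sum_congr rfl fun i _ => ?_
    have e1 : BB y L n₂ g = ∑ m ∈ range T₀, L.BQ n₂ m (y n₂ m) g :=
      BB_apply L y fun m hm => h₁ m (by omega)
    rw [L.compArg_eq_update hN j p (BB y L n₂), e1, MultilinearMap.map_update_sum]
    exact sum_congr rfl fun m _ => by rw [L.compArg_eq_update]

open Filter in
lemma BasedLie.BB_preLie (x : Conv K) {y : Conv K} {q : ℤ} (hy : IsConvDegree K q y) (p : ℕ → ℕ)
    (hp : ∀ s : ℕ, Even ((p s : ℤ) - (q - s))) (N : ℕ) (f : Fin (N + 1) → L.A) :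
    BB (preLie K x y) L N f = ∑ n₁ : Fin (N + 1), ∑ j : Fin (n₁.1 + 1),
      (-1 : K) ^ (j.1 * (N - n₁.1) + n₁.1 * p (N - n₁.1)) • BB x L n₁.1
        (L.compArg (add_sub_of_le (le_of_lt_succ n₁.2)) j (p (N - n₁.1))
          (BB y L (N - n₁.1)) f) := by
  obtain ⟨M₀, hM₀⟩ := L.exists_bound f
  have hev : ∀ᶠ T in atTop, ∀ (n₁ : Fin (N + 1)) (j : Fin (n₁.1 + 1)),
      ∑ M ∈ range T, ∑ i ∈ range (M + 1), L.BQ n₁ i (x n₁ i)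
        (L.compArg (add_sub_of_le (le_of_lt_succ n₁.2)) j (p (N - n₁.1))
          (L.BQ (N - n₁.1) (M - i) (y (N - n₁.1) (M - i))) f) =
      BB x L n₁ (L.compArg (add_sub_of_le (le_of_lt_succ n₁.2)) j (p (N - n₁.1))
        (BB y L (N - n₁.1)) f) :=
    eventually_all.2 fun n₁ => eventually_all.2 fun j => L.eventually_BB_comp _ j _ x y f
  obtain ⟨T, hT, hT'⟩ := (hev.and (eventually_ge_atTop M₀)).exists
  rw [BB_apply L _ (M := T) fun m hm => hM₀ m (by omega)]
  have h1 M : L.BQ N M (preLie K x y N M) f = ∑ n₁ : Fin (N + 1), ∑ j : Fin (n₁.1 + 1),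
      (-1 : K) ^ (j.1 * (N - n₁.1) + n₁.1 * p (N - n₁.1)) • ∑ i ∈ range (M + 1),
        L.BQ n₁ i (x n₁ i)
          (L.compArg (add_sub_of_le (le_of_lt_succ n₁.2)) j (p (N - n₁.1))
            (L.BQ (N - n₁.1) (M - i) (y (N - n₁.1) (M - i))) f) := by
    simp only [preLie, map_sum, MultilinearMap.sum_apply]
    refine sum_congr rfl fun n₁ _ => ?_
    rw [sum_comm]
    refine sum_congr rfl fun j _ => ?_
    rw [sum_range, smul_sum]
    refine sum_congr rfl fun m₁ _ => ?_
    rw [map_smul, MultilinearMap.smul_apply, L.BQ_compSign _ _ _ _ (hp (N - n₁.1)) _ (hy _ _),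
      smul_smul, ← pow_add]
  simp only [h1]
  rw [sum_comm]
  refine sum_congr rfl fun n₁ _ => sum_comm.trans (sum_congr rfl fun j _ => ?_)
  rw [← smul_sum, hT]

lemma BasedLie.par_pow_of_mem_gr {k : ℤ} {a : L.A} (ha : a ∈ L.gr k) (p : ℕ) :
    par[K]^p a = sgn K (p * k) • a := by
  refine (par_pow_smul (k := k.natAbs) ?_ p).trans ?_
  · rw [L.gr_eq] at ha
    rcases lt_or_ge k 0 with hk | hk
    · rw [bihom_eq_bot fun p hp => Or.inr (Or.inl (by rw [mem_setOf_eq] at hp; omega)), mem_bot] at ha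
      simp [ha]
    · exact par_of_mem_bihom (by rwa [Int.natAbs_of_nonneg hk])
  · rw [← sgn_natCast, sgn_congr K (w := p * k)]
    simp [Int.even_sub, Int.even_mul, even_abs]

/-- `B` respects pre-Lie products. -/
lemma BasedLie.evalSeq_BB_preLie (x : Conv K) {y : Conv K} {q : ℤ} (hy : IsConvDegree K q y) (N : ℕ)
    (a : ℕ → L.A) (k : ℕ → ℤ) (ha : ∀ i, a i ∈ L.gr (k i)) :
    evalSeq (BB (preLie K x y) L N) a = preLieEnd q (BB x L) (BB y L) N a k := by
  have hp : ∀ s : ℕ, Even (((q.natAbs + s : ℕ) : ℤ) - (q - s)) := by grind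
  rw [evalSeq, L.BB_preLie x hy _ hp, preLieEnd_eq, sum_range]
  refine sum_congr rfl fun n _ => ?_
  rw [sum_range]
  refine sum_congr rfl fun r _ => ?_
  have e : L.compArg (add_sub_of_le (le_of_lt_succ n.2)) r (q.natAbs + (N - n.1))
      (BB y L (N - n.1)) (fun i => a i) = fun i : Fin (n.1 + 1) =>
      (if i.1 < r.1 then sgn K (((q.natAbs + (N - n.1) : ℕ) : ℤ) * k i) else
        if i.1 = r.1 then 1 else 1) • plug r (N - n.1 + 1) (evalSeq (BB y L (N - n.1)) fun i => a (r + i)) a i := by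
    funext i
    rw [BasedLie.compArg, plug]
    split_ifs with h1 h2
    · rw [L.par_pow_of_mem_gr (ha i)]
    · rw [one_smul]; rfl
    · rw [one_smul]; rfl
  rw [e, map_smul_univ, prod_ite_lt_eq (le_of_lt_succ r.2)
      (fun i => sgn K (((q.natAbs + (N - n.1) : ℕ) : ℤ) * k i)) 1, smul_smul, mul_one,
    ← sgn_sum, ← mul_sum, ← sgn_natCast, ← sgn_add]
  congr 1
  refine sgn_congr K ?_
  obtain ⟨t, ht⟩ := hp (N - n.1)
  rw [sub_eq_iff_eq_add] at ht
  rw [Nat.cast_add, cast_mul, cast_mul, ht]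
  exact ⟨t * n + t * ∑ i ∈ range r, k i, by ring⟩

lemma BasedLie.par_act {V : Type} [Fintype V] [DecidableEq V] (a : Gra K V) (G : L.Slots V) :
    par K (L.act V a G) = L.act V (twist K 1 a) (par K G) := by
  induction a using Gra.induction generalizing G with
  | one => simp
  | add a b ha hb => rw [map_add, LinearMap.add_apply, map_add, ha, hb, map_add, map_add]; rfl
  | smul r a ha => rw [map_smul, LinearMap.smul_apply, map_smul, ha, map_smul, map_smul]; rfl
  | arrow_mul e a ha =>
    rw [L.act_mul_apply, map_mul (twist K 1), L.act_mul_apply, ← ha, twist_arrow, pow_one, map_smul,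
      LinearMap.smul_apply, L.act_arrow, L.tau_apply, L.tau_apply, map_sum, smul_sum]
    refine sum_congr rfl fun l _ => ?_
    rw [dx_par, dp_par, smul_smul, neg_one_mul, neg_neg, one_smul]

lemma BasedLie.B_par {n m p : ℕ} {b : Gra K (Vert n m)} (hb : twist K 1 b = (-1 : K) ^ p • b)
    (f : Fin (n + 1) → L.A) : L.B b (fun i => par K (f i)) = (-1 : K) ^ p • par K (L.B b f) := by
  have h : par K (L.pis (ints n m) * L.exts m f) = L.pis (ints n m) * L.exts m fun i => par K (f i) := by
    rw [map_mul, L.par_pis, BasedLie.exts, BasedLie.exts, map_list_prod, map_ofFn]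
    congr 3
    funext i
    exact L.par_slot _ _
  have h2 := L.par_act b (L.pis (ints n m) * L.exts m f)
  rw [hb, map_smul, LinearMap.smul_apply, h] at h2
  rw [L.B_apply, L.B_apply, L.merge_eq, par_gmap, h2, map_smul, smul_smul, ← pow_add, ← two_mul, pow_mul,
    neg_one_sq, one_pow, one_smul]

lemma BasedLie.BB_par {n p : ℕ} {q : ℤ} {y : Conv K} (hy : IsConvDegree K q y)
    (hp : Even ((p : ℤ) - (q - n))) (f : Fin (n + 1) → L.A) (t : ℕ) :
    BB y L n (fun i => par[K]^t (f i)) =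
      (-1 : K) ^ (p * t) • par[K]^t (BB y L n f) := by
  induction t with
  | zero => rw [Nat.mul_zero, pow_zero (-1 : K), one_smul]; rfl
  | succ t ih =>
    have key (g : Fin (n + 1) → L.A) :
        BB y L n (fun i => par K (g i)) = (-1 : K) ^ p • par K (BB y L n g) := by
      obtain ⟨M₁, h₁⟩ := L.exists_bound g
      obtain ⟨M₂, h₂⟩ := L.exists_bound fun i => par K (g i)
      rw [BB_apply L y (M := M₁ + M₂) fun m hm => h₁ m (by omega),
        BB_apply L y (M := M₁ + M₂) fun m hm => h₂ m (by omega), map_sum, smul_sum]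
      refine sum_congr rfl fun m _ => ?_
      obtain ⟨b, hb, hb'⟩ := exists_twist_eq hp (hy n m)
      rw [← hb, L.BQ_cls]
      exact L.B_par (by rw [hb', one_mul]) g
    simp only [par_pow_apply]
    rw [key, ih, map_smul, smul_smul, ← pow_add, Nat.mul_succ, add_comm]

end Compose

section Lists

variable {A : Type u} [AddCommMonoid A] [Module K A]

/-- `∑ H (p l₁) l₂` over all decompositions `l = l₁ ++ l₂` with nonempty `l₁`. -/
def star : (List A → A) → (A → List A → A) → List A → A
  | _, _, [] => 0
  | p, H, b :: l => H (p [b]) l + star (fun v => p (b :: v)) H l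

/-- Inserting `x` into `h` in all ways; `S` is applied to the arguments before `x`. -/
def ins (S : A → A) : (List A → A) → (List A → A) → List A → A
  | _, _, [] => 0
  | h, x, b :: l => star x (fun c v => h (c :: v)) (b :: l) + ins S (fun v => h (S b :: v)) x l

lemma star_eq_sum (p : List A → A) (H : A → List A → A) (l : List A) :
    star p H l = ∑ i : Fin l.length, H (p (l.take (i + 1))) (l.drop (i + 1)) := by
  induction l generalizing p with
  | nil => simp [star]
  | cons b l ih =>
    rw [star, ih]
    exact (sum_univ_succ fun i : Fin (l.length + 1) =>
      H (p ((b :: l).take (i + 1))) ((b :: l).drop (i + 1))).symm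

lemma star_congr {p p' : List A → A} {H H' : A → List A → A} {l : List A}
    (hp : ∀ v, v ≠ [] → p v = p' v) (hH : ∀ c v, v.length < l.length → H c v = H' c v) :
    star p H l = star p' H' l := by
  induction l generalizing p p' with
  | nil => rfl
  | cons b l ih =>
    rw [star, star, hp [b] (by simp), hH _ l (by simp),
      ih (fun v _ => hp _ (by simp)) fun c v hv => hH c v (by simp; omega)]

lemma star_add_left {H : A → List A → A} (hH : ∀ c d v, H (c + d) v = H c v + H d v)
    (p p' : List A → A) (l : List A) :
    star (fun v => p v + p' v) H l = star p H l + star p' H l := by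
  induction l generalizing p p' with
  | nil => simp [star]
  | cons b l ih => simp only [star, hH, ih]; abel

lemma star_add_right (p : List A → A) (H H' : A → List A → A) (l : List A) :
    star p (fun c v => H c v + H' c v) l = star p H l + star p H' l := by
  induction l generalizing p with
  | nil => simp [star]
  | cons b l ih => simp only [star, ih]; abel

lemma star_smul_right (r : K) (p : List A → A) (H : A → List A → A) (l : List A) :
    star p (fun c v => r • H c v) l = r • star p H l := by
  induction l generalizing p with
  | nil => simp [star]
  | cons b l ih => simp only [star, ih, smul_add]

lemma star_map (f : A → A) (p : List A → A) (H : A → List A → A) (l : List A) :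
    star (fun v => f (p v)) H l = star p (fun c => H (f c)) l := by
  induction l generalizing p with
  | nil => rfl
  | cons b l ih => simp only [star, ih]

lemma star_star {H : A → List A → A} (hH : ∀ c d v, H (c + d) v = H c v + H d v)
    (x : List A → A) (G : A → List A → A) (l : List A) :
    star (star x G) H l = star x (fun c v => H (G c []) v + star (G c) H v) l := by
  induction l generalizing x with
  | nil => rfl
  | cons b l ih =>
    simp only [star, add_zero]
    rw [star_add_left hH, ih, add_assoc]

lemma ins_add_left (S : A → A) (h h' x : List A → A) (l : List A) :
    ins S (fun v => h v + h' v) x l = ins S h x l + ins S h' x l := by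
  induction l generalizing h h' with
  | nil => simp [ins]
  | cons b l ih => simp only [ins, ih, star_add_right]; abel

lemma ins_smul_left (S : A → A) (r : K) (h x : List A → A) (l : List A) :
    ins S (fun v => r • h v) x l = r • ins S h x l := by
  induction l generalizing h with
  | nil => simp [ins]
  | cons b l ih => simp only [ins, ih, star_smul_right, smul_add]

lemma ins_congr {S : A → A} {h h' x : List A → A} (hh : ∀ v, v ≠ [] → h v = h' v) (l : List A) :
    ins S h x l = ins S h' x l := by
  rcases l with _ | ⟨b, l⟩
  · rfl
  · rw [ins, ins, star_congr (fun v _ => rfl) fun c v _ => hh (c :: v) (by simp)]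
    congr 2
    funext v
    exact hh _ (by simp)

lemma ins_star {H : A → List A → A} (hH : ∀ c d v, H (c + d) v = H c v + H d v) (S : A → A)
    (p x : List A → A) (l : List A) :
    ins S (star p H) x l = star (ins S p x) H l +
      star (fun v => p (v.map S)) (fun c => ins S (H c) x) l := by
  induction l generalizing p with
  | nil => simp [ins, star]
  | cons b l ih =>
    have h1 : star (ins S p x) H (b :: l) = star (star x fun c v => p (c :: v)) H (b :: l) +
        star (ins S (fun v => p (S b :: v)) x) H l := by
      rw [star, star]
      simp only [ins, add_zero]
      rw [star_add_left hH, add_assoc]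
    rw [h1, ins, star_star hH]
    have h2 : ins S (fun v => star p H (S b :: v)) x l = ins S (H (p [S b])) x l +
        (star (ins S (fun v => p (S b :: v)) x) H l +
          star (fun v => p (S b :: v.map S)) (fun c => ins S (H c) x) l) := by
      rw [← ih, ← ins_add_left]
      rfl
    have h3 : star (fun v => p (v.map S)) (fun c => ins S (H c) x) (b :: l) = ins S (H (p [S b])) x l +
        star (fun v => p (S b :: v.map S)) (fun c => ins S (H c) x) l := rfl
    have h4 : star x (fun c v => star p H (c :: v)) (b :: l) =
        star x (fun c v => H (p [c]) v + star (fun v => p (c :: v)) H v) (b :: l) := rfl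
    rw [h2, h3, h4]
    abel

variable (K) in
/-- Linearity in every argument. -/
structure IsMultilin (h : List A → A) : Prop where
  add : ∀ u c d v, h (u ++ (c + d) :: v) = h (u ++ c :: v) + h (u ++ d :: v)
  smul : ∀ u (r : K) c v, h (u ++ r • c :: v) = r • h (u ++ c :: v)

lemma IsMultilin.tail {h : List A → A} (hh : IsMultilin K h) (b : A) :
    IsMultilin K fun v => h (b :: v) :=
  ⟨fun u => hh.add (b :: u), fun u => hh.smul (b :: u)⟩

/-- The pre-Lie identity. -/
lemma ins_ins {h : List A → A} (hh : IsMultilin K h) {Q : A → A} {x : List A → A}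
    (hx : ∀ v, x (v.map Q) = Q (x v)) (a : List A → A) (l : List A) :
    ins id (ins Q h a) x l + ins Q h (ins Q x a) l = ins Q (ins id h x) a l + ins Q h (ins id a x) l := by
  induction l generalizing h with
  | nil => simp [ins]
  | cons b l ih =>
    have hH c d v : h ((c + d) :: v) = h (c :: v) + h (d :: v) := hh.add [] c d v
    have e1 := ins_star (H := fun c v => h (c :: v)) hH id a x (b :: l)
    have e2 := ins_star (H := fun c v => h (c :: v)) hH Q x a (b :: l)
    have e3 : ins id (ins Q h a) x (b :: l) = ins id (star a fun c v => h (c :: v)) x (b :: l) +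
        star x (fun c => ins Q (fun v => h (Q c :: v)) a) (b :: l) +
        ins id (ins Q (fun v => h (Q b :: v)) a) x l := by
      rw [ins, ins]
      have := ins_add_left id (fun v => star a (fun c v => h (c :: v)) (b :: v))
        (ins Q (fun v => h (Q b :: v)) a) x l
      have h2 := star_add_right x (fun c v => star a (fun c v => h (c :: v)) (c :: v))
        (fun c v => ins Q (fun v => h (Q c :: v)) a v) (b :: l)
      simp only [ins, id] at this h2 ⊢
      rw [this, h2]
      abel
    have e4 : ins Q (ins id h x) a (b :: l) = ins Q (star x fun c v => h (c :: v)) a (b :: l) +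
        star a (fun c => ins id (fun v => h (c :: v)) x) (b :: l) +
        ins Q (ins id (fun v => h (Q b :: v)) x) a l := by
      rw [ins, ins]
      have := ins_add_left Q (fun v => star x (fun c v => h (c :: v)) (Q b :: v))
        (ins id (fun v => h (Q b :: v)) x) a l
      have h2 := star_add_right a (fun c v => star x (fun c v => h (c :: v)) (c :: v))
        (fun c v => ins id (fun v => h (c :: v)) x v) (b :: l)
      simp only [ins, id] at this h2 ⊢
      rw [this, h2]
      abel
    have e5 : star (fun v => x (v.map Q)) (fun c => ins Q (fun v => h (c :: v)) a) (b :: l) =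
        star x (fun c => ins Q (fun v => h (Q c :: v)) a) (b :: l) := by
      simp only [hx]
      rw [star_map Q x fun c => ins Q (fun v => h (c :: v)) a]
    have e6 y : ins Q h y (b :: l) = star y (fun c v => h (c :: v)) (b :: l) +
      ins Q (fun v => h (Q b :: v)) y l := by rw [ins]
    rw [e5] at e2
    simp only [List.map_id] at e1
    rw [e3, e4, e1, e2, e6, e6]
    have := ih (hh.tail (Q b))
    calc _ = (star (ins id a x) (fun c v => h (c :: v)) (b :: l) +
          star a (fun c => ins id (fun v => h (c :: v)) x) (b :: l) +
          star x (fun c => ins Q (fun v => h (Q c :: v)) a) (b :: l) +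
          star (ins Q x a) (fun c v => h (c :: v)) (b :: l)) +
          (ins id (ins Q (fun v => h (Q b :: v)) a) x l + ins Q (fun v => h (Q b :: v)) (ins Q x a) l) := by
            abel
      _ = _ := by rw [this]; abel

/-- The composition `∑ h (f l₁, f l₂, …)` over all decompositions of a list into nonempty ones. -/
def cmp (h f : List A → A) (l : List A) : A :=
  if l = [] then h [] else
    ∑ i : Fin l.length, cmp (fun v => h (f (l.take (i + 1)) :: v)) f (l.drop (i + 1))
termination_by l.length
decreasing_by
  have := i.2
  simp only [length_drop]
  omega

lemma cmp_nil (h f : List A → A) : cmp h f [] = h [] := by rw [cmp, if_pos rfl]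

lemma cmp_of_ne_nil (h f : List A → A) {l : List A} (hl : l ≠ []) :
    cmp h f l = star f (fun c => cmp (fun v => h (c :: v)) f) l := by
  rw [cmp, if_neg hl, star_eq_sum]

lemma cmp_congr {h h' : List A → A} (hh : ∀ v, v ≠ [] → h v = h' v) (f : List A → A) {l : List A}
    (hl : l ≠ []) : cmp h f l = cmp h' f l := by
  rw [cmp_of_ne_nil _ _ hl, cmp_of_ne_nil _ _ hl]
  congr 1
  funext c
  congr 1
  funext v
  exact hh _ (by simp)

lemma cmp_add (h h' f : List A → A) (l : List A) :
    cmp (fun v => h v + h' v) f l = cmp h f l + cmp h' f l := by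
  induction hn : l.length using Nat.strong_induction_on generalizing l h h' with
  | _ n ih =>
    by_cases hl : l = []
    · subst hl; simp only [cmp_nil]
    · rw [cmp_of_ne_nil _ _ hl, cmp_of_ne_nil _ _ hl, cmp_of_ne_nil _ _ hl, ← star_add_right]
      exact star_congr (fun _ _ => rfl) fun c v hv => ih _ (hn ▸ hv) _ _ v rfl

lemma cmp_star {H : A → List A → A} (hH : ∀ c d v, H (c + d) v = H c v + H d v)
    (p g : List A → A) (l : List A) :
    cmp (star p H) g l = star (cmp p g) (fun c => cmp (H c) g) l := by
  induction hn : l.length using Nat.strong_induction_on generalizing l p with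
  | _ n ih =>
    by_cases hl : l = []
    · subst hl; rw [cmp_nil]; rfl
    · have hH' c d v : cmp (H (c + d)) g v = cmp (H c) g v + cmp (H d) g v := by
        rw [← cmp_add]; congr 1; funext w; exact hH c d w
      have e1 : star (cmp p g) (fun c => cmp (H c) g) l =
          star (star g fun c => cmp (fun v => p (c :: v)) g) (fun c => cmp (H c) g) l :=
        star_congr (fun v hv => cmp_of_ne_nil _ _ hv) fun _ _ _ => rfl
      rw [e1, star_star hH', cmp_of_ne_nil _ _ hl]
      refine star_congr (fun _ _ => rfl) fun c v hv => ?_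
      rw [cmp_nil, ← ih _ (hn ▸ hv) _ v rfl, ← cmp_add]
      rfl

lemma cmp_add_head {h : List A → A} (hh : IsMultilin K h) (f : List A → A) (c d : A) (v : List A) :
    cmp (fun v => h ((c + d) :: v)) f v = cmp (fun v => h (c :: v)) f v + cmp (fun v => h (d :: v)) f v := by
  rw [← cmp_add]
  congr 1
  funext w
  exact hh.add [] c d w

lemma cmp_assoc {h : List A → A} (hh : IsMultilin K h) (f g : List A → A) (l : List A) :
    cmp (cmp h f) g l = cmp h (cmp f g) l := by
  induction hn : l.length using Nat.strong_induction_on generalizing l h with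
  | _ n ih =>
    by_cases hl : l = []
    · subst hl; simp only [cmp_nil]
    · rw [cmp_congr (fun v hv => cmp_of_ne_nil h f hv) g hl, cmp_star (cmp_add_head hh f),
        cmp_of_ne_nil _ _ hl]
      exact star_congr (fun _ _ => rfl) fun c v hv => ih _ (hn ▸ hv) (hh.tail c) v rfl

end Lists

section GroupLike

variable [CharZero K] {A : Type u} [AddCommMonoid A] [Module K A]

variable (x : List A → A)

/-- Repeated insertion of `x`. -/
def insPow (k : ℕ) (h : List A → A) : List A → A := (fun g => ins id g x)^[k] h

lemma insPow_zero (h : List A → A) : insPow x 0 h = h := rfl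

lemma insPow_succ (k : ℕ) (h : List A → A) : insPow x (k + 1) h = ins id (insPow x k h) x := by
  rw [insPow, Function.iterate_succ_apply']; rfl

lemma insPow_add (k : ℕ) (h h' : List A → A) (l : List A) :
    insPow x k (fun v => h v + h' v) l = insPow x k h l + insPow x k h' l := by
  induction k generalizing l with
  | zero => rfl
  | succ k ih => rw [insPow_succ, funext ih, ins_add_left, insPow_succ, insPow_succ]

lemma insPow_smul (k : ℕ) (r : K) (h : List A → A) (l : List A) :
    insPow x k (fun v => r • h v) l = r • insPow x k h l := by
  induction k generalizing l with
  | zero => rfl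
  | succ k ih => rw [insPow_succ, funext ih, ins_smul_left, insPow_succ]

lemma insPow_congr (k : ℕ) {h h' : List A → A} (hh : ∀ v, v ≠ [] → h v = h' v) {l : List A}
    (hl : l ≠ []) : insPow x k h l = insPow x k h' l := by
  induction k generalizing l with
  | zero => exact hh l hl
  | succ k ih => rw [insPow_succ, insPow_succ, ins_congr fun v hv => ih hv]

lemma insPow_add_head {h : List A → A} (hh : IsMultilin K h) (k : ℕ) (c d : A) (v : List A) :
    insPow x k (fun v => h ((c + d) :: v)) v =
      insPow x k (fun v => h (c :: v)) v + insPow x k (fun v => h (d :: v)) v := by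
  rw [← insPow_add]
  congr 1
  funext w
  exact hh.add [] c d w

lemma star_zero_right (p : List A → A) (l : List A) : star p (fun _ _ => 0) l = 0 := by
  induction l generalizing p with
  | nil => rfl
  | cons b l ih => rw [star, ih, add_zero]

lemma ins_zero_left (S : A → A) (l : List A) : ins S (fun _ => 0) x l = 0 := by
  induction l with
  | nil => rfl
  | cons b l ih => rw [ins, ih, star_zero_right, add_zero]

lemma ins_sum_left {ι : Type*} (s : Finset ι) (S : A → A) (h : ι → List A → A) (l : List A) :
    ins S (fun v => ∑ i ∈ s, h i v) x l = ∑ i ∈ s, ins S (h i) x l := by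
  classical
  induction s using Finset.induction_on with
  | empty => simp only [Finset.sum_empty, ins_zero_left]
  | insert i s hi ih => simp only [Finset.sum_insert hi, ins_add_left, ih]

lemma ins_nsmul_left (S : A → A) (n : ℕ) (h : List A → A) (l : List A) :
    ins S (fun v => n • h v) x l = n • ins S h x l := by
  induction n with
  | zero => simp only [zero_nsmul, ins_zero_left]
  | succ n ih => simp only [succ_nsmul, ins_add_left, ih]

lemma insPow_star {h : List A → A} (hh : IsMultilin K h) (k : ℕ) (p : List A → A) (l : List A) :
    insPow x k (star p fun c v => h (c :: v)) l = ∑ ij ∈ antidiagonal k,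
      k.choose ij.1 • star (insPow x ij.1 p) (fun c => insPow x ij.2 fun v => h (c :: v)) l := by
  induction k generalizing l with
  | zero => simp [insPow_zero]
  | succ k ih =>
    rw [insPow_succ, funext ih, ins_sum_left,
      Finset.sum_antidiagonal_choose_succ_nsmul fun i j =>
        star (insPow x i p) (fun c => insPow x j fun v => h (c :: v)) l, ← sum_add_distrib]
    refine sum_congr rfl fun ij hij => ?_
    rw [ins_nsmul_left, ins_star (insPow_add_head x hh _), smul_add, add_comm]
    simp only [List.map_id, ← insPow_succ]
    congr 2
    rw [Nat.choose_symm_of_eq_add (mem_antidiagonal.1 hij).symm]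

end GroupLike

lemma inv_factorial_mul_choose (K : Type u) [Field K] [CharZero K] (i j : ℕ) :
    ((i + j).factorial : K)⁻¹ * ((i + j).choose i : K) = (i.factorial : K)⁻¹ * (j.factorial : K)⁻¹ := by
  have h7 : ((i + j).factorial : K) ≠ 0 := by exact_mod_cast (Nat.factorial_pos _).ne'
  have h8 : (i.factorial : K) ≠ 0 := by exact_mod_cast (Nat.factorial_pos _).ne'
  have h9 : (j.factorial : K) ≠ 0 := by exact_mod_cast (Nat.factorial_pos _).ne'
  have : ((i + j).choose i : K) * i.factorial * j.factorial = (i + j).factorial := by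
    rw [Nat.choose_symm_add]; exact_mod_cast Nat.add_choose_mul_factorial_mul_factorial i j
  field_simp
  linear_combination this

section Filtered

variable [CharZero K] {A : Type u} [AddCommMonoid A] [Module K A]

/-- An increasing exhaustive filtration that is zero in negative degrees. -/
structure IsFiltration (F : ℤ → Submodule K A) : Prop where
  mono : Monotone F
  neg : ∀ D < 0, F D = ⊥
  exhaustive : ∀ a, ∃ D, a ∈ F D

/-- The induced filtration on lists. -/
def InF (F : ℤ → Submodule K A) : List A → ℤ → Prop
  | [], d => 0 ≤ d
  | a :: l, d => ∃ D, a ∈ F D ∧ InF F l (d - D)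

/-- Functions on lists that change the filtration degree by at most `w`. -/
def IsShift (F : ℤ → Submodule K A) (w : ℤ) (h : List A → A) : Prop :=
  ∀ l d, InF F l d → h l ∈ F (d + w)

variable {F : ℤ → Submodule K A} (hF : IsFiltration F)

include hF in
lemma IsFiltration.exists_InF (l : List A) : ∃ d, InF F l d := by
  induction l with
  | nil => exact ⟨0, le_refl _⟩
  | cons a l ih =>
    obtain ⟨d, hd⟩ := ih
    obtain ⟨D, hD⟩ := hF.exhaustive a
    exact ⟨d + D, D, hD, by rwa [add_sub_cancel_right]⟩

lemma IsShift.tail {w : ℤ} {h : List A → A} (hh : IsShift F w h) {b : A} {D : ℤ} (hb : b ∈ F D) :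
    IsShift F (w + D) fun v => h (b :: v) := by
  intro l d hl
  have := hh (b :: l) (d + D) ⟨D, hb, by rwa [add_sub_cancel_right]⟩
  rwa [add_assoc, add_comm D, ] at this

lemma IsShift.star {w w' : ℤ} {p : List A → A} (hp : IsShift F w p) {H : A → List A → A}
    (hH : ∀ D, ∀ c ∈ F D, IsShift F (w' + D) (H c)) : IsShift F (w + w') (star p H) := by
  intro l
  induction l generalizing p w with
  | nil => intro d _; exact zero_mem _
  | cons b l ih =>
    rintro d ⟨D, hb, hl⟩
    have h1 := hH (D + w) (p [b]) (hp [b] D ⟨D, hb, by simp [InF]⟩) l _ hl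
    have h2 := ih (hp.tail hb) _ hl
    rw [show d - D + (w' + (D + w)) = d + (w + w') by ring] at h1
    rw [show d - D + (w + D + w') = d + (w + w') by ring] at h2
    exact add_mem h1 h2

lemma IsShift.ins {w w' : ℤ} {h x : List A → A} (hh : IsShift F w h) (hx : IsShift F w' x) :
    IsShift F (w + w') (ins id h x) := by
  intro l
  induction l generalizing h w with
  | nil => intro d _; exact zero_mem _
  | cons b l ih =>
    intro d hl
    have h1 := (hx.star (H := fun c v => h (c :: v)) (w' := w) fun D c hc => hh.tail hc) _ _ hl
    obtain ⟨D, hb, hl⟩ := hl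
    have h2 := ih (hh.tail hb) _ hl
    rw [add_comm w'] at h1
    rw [show d - D + (w + D + w') = d + (w + w') by ring] at h2
    exact add_mem h1 h2

lemma IsShift.insPow {w : ℤ} {h x : List A → A} (hh : IsShift F w h) (hx : IsShift F (-1) x) (k : ℕ) :
    IsShift F (w - k) (insPow x k h) := by
  induction k with
  | zero => simpa [insPow_zero] using hh
  | succ k ih =>
    rw [insPow_succ]
    have := ih.ins hx
    rwa [show w - (k : ℤ) + -1 = w - ((k + 1 : ℕ) : ℤ) by push_cast; ring] at this

/-- The list function of the identity map. -/
def unitFn : List A → A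
  | [a] => a
  | _ => 0

include hF in
lemma IsFiltration.isShift_unitFn : IsShift F 0 unitFn := by
  rintro (_ | ⟨a, _ | ⟨b, l⟩⟩) d hl
  · exact zero_mem _
  · obtain ⟨D, ha, hD⟩ := hl
    rw [InF] at hD
    exact hF.mono (by omega) ha
  · exact zero_mem _

lemma star_unitFn (H : A → List A → A) (b : A) (l : List A) : star unitFn H (b :: l) = H b l +
    star (fun _ => 0) H l := by
  rw [star]
  congr 1
  exact star_congr (fun v hv => by obtain ⟨c, v, rfl⟩ := List.exists_cons_of_ne_nil hv; rfl)
    fun _ _ _ => rfl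

lemma star_zero_left {H : A → List A → A} (hH : ∀ v, H 0 v = 0) (l : List A) :
    star (fun _ => 0) H l = 0 := by
  induction l with
  | nil => rfl
  | cons b l ih => rw [star, hH, ih, add_zero]

lemma IsMultilin.zero {h : List A → A} (hh : IsMultilin K h) (v : List A) : h (0 :: v) = 0 := by
  have := hh.smul [] 0 0 v
  simpa using this

lemma IsMultilin.eq_star {h : List A → A} (hh : IsMultilin K h) {l : List A} (hl : l ≠ []) :
    h l = star unitFn (fun c v => h (c :: v)) l := by
  obtain ⟨b, l, rfl⟩ := List.exists_cons_of_ne_nil hl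
  rw [star_unitFn, star_zero_left hh.zero, add_zero]

variable (K) in
/-- The exponential of the insertion of `x`. -/
def expIns (x h : List A → A) (l : List A) : A :=
  ∑ᶠ k : ℕ, (k.factorial : K)⁻¹ • insPow x k h l

include hF in
lemma IsFiltration.expIns_eq {x h : List A → A} (hx : IsShift F (-1) x) {w : ℤ} (hh : IsShift F w h)
    {l : List A} {d : ℤ} (hl : InF F l d) {T : ℕ} (hT : d + w < T) :
    expIns K x h l = ∑ k ∈ range T, (k.factorial : K)⁻¹ • insPow x k h l := by
  refine finsum_eq_sum_of_support_subset _ fun k hk => ?_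
  rw [Finset.coe_range, Set.mem_Iio]
  by_contra hk'
  refine hk ?_
  have := hh.insPow hx k l d hl
  rw [hF.neg _ (by push Not at hk'; have : (T : ℤ) ≤ k := by exact_mod_cast hk'
                   omega), Submodule.mem_bot] at this
  simp only [this, smul_zero]

open Filter in
include hF in
lemma IsFiltration.eventually_expIns {x h : List A → A} (hx : IsShift F (-1) x) {w : ℤ}
    (hh : IsShift F w h) (l : List A) : ∀ᶠ T in atTop,
      expIns K x h l = ∑ k ∈ range T, (k.factorial : K)⁻¹ • insPow x k h l := by
  obtain ⟨d, hd⟩ := hF.exists_InF l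
  filter_upwards [eventually_gt_atTop (d + w).toNat] with T hT
  exact hF.expIns_eq hx hh hd (by omega)

open Filter in
include hF in
/-- The exponential of an insertion is a composition. -/
lemma IsFiltration.expIns_eq_cmp {x h : List A → A} (hx : IsShift F (-1) x) {w : ℤ}
    (hh : IsShift F w h) (hm : IsMultilin K h) (l : List A) :
    expIns K x h l = cmp h (expIns K x unitFn) l := by
  induction hn : l.length using Nat.strong_induction_on generalizing l h w with
  | _ n ih =>
  by_cases hl : l = []
  · subst hl
    rw [cmp_nil, expIns, finsum_eq_single _ 0]
    · simp [insPow_zero]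
    · intro k hk
      obtain ⟨k, rfl⟩ := Nat.exists_eq_succ_of_ne_zero hk
      rw [insPow_succ, ins, smul_zero]
  · let f := expIns K x unitFn
    obtain ⟨d, hd⟩ := hF.exists_InF l
    have hw i : ∃ w, IsShift F w fun v => h (f (l.take (i + 1)) :: v) := by
      obtain ⟨D, hD⟩ := hF.exhaustive (f (l.take (i + 1)))
      exact ⟨_, hh.tail hD⟩
    have ev1 : ∀ᶠ T in atTop, ∀ i : Fin l.length, f (l.take (i + 1)) =
        ∑ k ∈ range T, (k.factorial : K)⁻¹ • insPow x k unitFn (l.take (i + 1)) :=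
      eventually_all.2 fun i => hF.eventually_expIns hx hF.isShift_unitFn _
    have ev2 : ∀ᶠ T in atTop, ∀ i : Fin l.length,
        expIns K x (fun v => h (f (l.take (i + 1)) :: v)) (l.drop (i + 1)) =
        ∑ k ∈ range T, (k.factorial : K)⁻¹ •
          insPow x k (fun v => h (f (l.take (i + 1)) :: v)) (l.drop (i + 1)) :=
      eventually_all.2 fun i => hF.eventually_expIns hx (hw i).choose_spec _
    obtain ⟨T₀, ⟨h1, h2⟩, h3⟩ := ((ev1.and ev2).and (eventually_gt_atTop (d + w).toNat)).exists
    let c : ℕ → ℕ → A := fun i j => ((i.factorial : K)⁻¹ * (j.factorial : K)⁻¹) •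
      star (insPow x i unitFn) (fun c => insPow x j fun v => h (c :: v)) l
    have hc i j : T₀ ≤ i ∨ T₀ ≤ j → c i j = 0 := by
      intro hij
      have := (hF.isShift_unitFn.insPow hx i).star (w' := w - j)
        (H := fun c => insPow x j fun v => h (c :: v)) (fun D c hc => by
          have := (hh.tail hc).insPow hx j
          rwa [show w + D - (j : ℤ) = w - j + D by ring] at this) l d hd
      rw [hF.neg _ (by omega), Submodule.mem_bot] at this
      simp only [c, this, smul_zero]
    obtain ⟨T, h4, h5⟩ := ((hF.eventually_expIns (K := K) hx hh l).and
      (eventually_sum_diag c T₀ hc)).exists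
    have h6 k : (k.factorial : K)⁻¹ • insPow x k h l = ∑ i ∈ range (k + 1), c i (k - i) := by
      rw [insPow_congr x k (fun v hv => hm.eq_star hv) hl, insPow_star x hm,
        ← Finset.Nat.sum_antidiagonal_eq_sum_range_succ c k, smul_sum]
      refine sum_congr rfl fun ij hij => ?_
      rw [mem_antidiagonal] at hij
      rw [← Nat.cast_smul_eq_nsmul K, smul_smul]
      congr 1
      rw [← hij, inv_factorial_mul_choose]
    rw [h4, sum_congr rfl fun k _ => h6 k, h5, cmp_of_ne_nil _ _ hl, star_eq_sum]
    have hlin : ∀ (j : ℕ) (v : List A), ∃ φ : A →ₗ[K] A, ∀ c, φ c = insPow x j (fun v => h (c :: v)) v :=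
      fun j v => ⟨{ toFun := fun c => insPow x j (fun v => h (c :: v)) v
                    map_add' := fun c d => insPow_add_head x hm j c d v
                    map_smul' := fun r c => by
                      rw [RingHom.id_apply, ← insPow_smul]
                      congr 1
                      funext w
                      exact hm.smul [] r c w }, fun _ => rfl⟩
    have h10 (t : Fin l.length) : cmp (fun v => h (f (l.take (t + 1)) :: v)) f (l.drop (t + 1)) =
        ∑ i ∈ range T₀, ∑ j ∈ range T₀, ((i.factorial : K)⁻¹ * (j.factorial : K)⁻¹) •
          insPow x j (fun v => h (insPow x i unitFn (l.take (t + 1)) :: v)) (l.drop (t + 1)) := by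
      rw [← ih _ (by have := t.2; simp only [← hn, length_drop]; omega) (hw t).choose_spec
        (hm.tail _) _ rfl, h2 t, sum_comm]
      refine sum_congr rfl fun j _ => ?_
      obtain ⟨φ, hφ⟩ := hlin j (l.drop (t + 1))
      simp only [← hφ]
      rw [h1 t, map_sum, smul_sum]
      refine sum_congr rfl fun i _ => ?_
      rw [map_smul, smul_smul, mul_comm]
    rw [sum_congr rfl fun t _ => h10 t]
    symm
    rw [sum_comm]
    refine sum_congr rfl fun i _ => ?_
    rw [sum_comm]
    refine sum_congr rfl fun j _ => ?_
    simp only [c, star_eq_sum, smul_sum]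

end Filtered

lemma getD_append_cons {X : Type*} (d : X) (u : List X) (c : X) (v : List X) (i : ℕ) :
    (u ++ c :: v).getD i d =
      if i < u.length then u.getD i d else if i = u.length then c else v.getD (i - u.length - 1) d := by
  split_ifs with h1 h2
  · rw [List.getD_append _ _ _ _ h1]
  · subst h2; rw [List.getD_append_right _ _ _ _ le_rfl]; simp
  · rw [List.getD_append_right _ _ _ _ (by omega)]
    obtain ⟨j, hj⟩ : ∃ j, i - u.length = j + 1 := ⟨i - u.length - 1, by omega⟩
    rw [hj, List.getD_cons_succ]; rfl

lemma ins_eq_sum {A : Type*} [AddCommMonoid A] (S : A → A) (h x : List A → A) (l : List A) :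
    ins S h x l = ∑ r ∈ range l.length, ∑ s ∈ range (l.length - r),
      h ((l.take r).map S ++ x ((l.drop r).take (s + 1)) :: l.drop (r + s + 1)) := by
  induction l generalizing h with
  | nil => rfl
  | cons b l ih =>
    rw [ins, ih, length_cons, sum_range_succ', add_comm]
    congr 1
    · refine sum_congr rfl fun r _ => ?_
      rw [Nat.add_sub_add_right]
      refine sum_congr rfl fun s _ => ?_
      rw [show r + 1 + s + 1 = r + s + 1 + 1 by omega]
      rfl
    · rw [star_eq_sum, Nat.sub_zero, sum_range]
      refine sum_congr rfl fun i _ => ?_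
      simp

lemma sum_triangle {X : Type*} [AddCommMonoid X] (N : ℕ) (G : ℕ → ℕ → X) :
    ∑ r ∈ range (N + 1), ∑ s ∈ range (N + 1 - r), G r s =
      ∑ n ∈ range (N + 1), ∑ r ∈ range (n + 1), G r (N - n) := by
  rw [← sum_flip' N fun n s => ∑ r ∈ range (n + 1), G r s]
  refine Finset.sum_comm' fun r s => ?_
  simp only [mem_range]
  omega

section Tilde

variable [CharZero K] (L : BasedLie K)

/-- A family of multilinear maps as a function on lists, with signs that absorb the Koszul rule. -/
def BasedLie.tl (F : EndFam K L.A) : List L.A → L.A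
  | [] => 0
  | a :: l => F l.length fun i => par[K]^(l.length - i.1) ((a :: l).getD i.1 0)

lemma BasedLie.tl_eq (F : EndFam K L.A) {l : List L.A} {n : ℕ} (h : l.length = n + 1) :
    L.tl F l = F n fun i => par[K]^(n - i.1) (l.getD i.1 0) := by
  rcases l with _ | ⟨a, l⟩
  · simp at h
  · obtain rfl : l.length = n := by simpa using h
    rfl

lemma BasedLie.tl_append (F : EndFam K L.A) (u v : List L.A) (c : L.A) :
    L.tl F (u ++ c :: v) = F (u.length + v.length) (update
      (fun i => par[K]^(u.length + v.length - i.1) ((u ++ 0 :: v).getD i.1 0))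
        ⟨u.length, by omega⟩ (par[K]^v.length c)) := by
  rw [L.tl_eq F (n := u.length + v.length) (by simp; omega)]
  congr 1
  funext i
  by_cases hi : i = ⟨u.length, by omega⟩
  · subst hi
    rw [update_self, getD_append_cons]
    simp
  · rw [update_of_ne hi, getD_append_cons, getD_append_cons]
    have : i.1 ≠ u.length := fun h => hi (Fin.ext h)
    rw [if_neg this, if_neg this]

lemma BasedLie.isMultilin_tl (F : EndFam K L.A) : IsMultilin K (L.tl F) where
  add u c d v := by
    rw [L.tl_append, L.tl_append, L.tl_append, map_add]
    exact map_update_add _ _ _ _ _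
  smul u r c v := by
    rw [L.tl_append, L.tl_append, map_smul]
    exact map_update_smul _ _ _ _ _

lemma BasedLie.isFiltration : IsFiltration (K := K) (A := L.A) fun D => bihom K (xle D) where
  mono _ _ h := bihom_xle_mono h
  neg _ h := bihom_xle_eq_bot h
  exhaustive a := by
    obtain ⟨D, hD⟩ := exists_mem_xle a
    exact ⟨D, hD⟩

lemma InF.exists_degrees {A : Type u} [AddCommMonoid A] [Module K A] {F : ℤ → Submodule K A}
    {l : List A} {d : ℤ} (h : InF F l d) :
    ∃ D : Fin l.length → ℤ, (∀ i, l.getD i.1 0 ∈ F (D i)) ∧ ∑ i, D i ≤ d := by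
  induction l generalizing d with
  | nil => exact ⟨fun _ => 0, fun i => i.elim0, by simpa [InF] using h⟩
  | cons a l ih =>
    obtain ⟨D₀, ha, hl⟩ := h
    obtain ⟨D, hD, hs⟩ := ih hl
    refine ⟨Fin.cons D₀ D, Fin.cases ha hD, ?_⟩
    refine (le_of_eq (sum_univ_succ _)).trans ?_
    simp only [Fin.cons_zero, Fin.cons_succ]
    omega

lemma BasedLie.isShift_tl_BB {q w : ℤ} {y : Conv K} (hy : IsConvDegree K q y)
    (hw : ∀ n m : ℕ, y n m = 0 ∨ q - n - m ≤ w) :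
    IsShift (K := K) (fun D => bihom K (xle D)) w (L.tl (BB y L)) := by
  intro l d hl
  rcases l with _ | ⟨a, l⟩
  · exact zero_mem _
  · obtain ⟨D, hD, hs⟩ := hl.exists_degrees
    rw [L.tl_eq (BB y L) (n := l.length) rfl]
    set f : Fin (l.length + 1) → L.A :=
      fun i => par[K]^(l.length - i.1) ((a :: l).getD i.1 0) with hf
    obtain ⟨M, hM⟩ := L.exists_bound f
    rw [BB_apply L y hM]
    refine Submodule.sum_mem _ fun m _ => ?_
    have hfD : ∀ i : Fin (l.length + 1), f i ∈ bihom K (xle (D i)) :=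
      fun i => par_pow_mem_bihom _ (hD i)
    rcases hw l.length m with h0 | hw
    · rw [h0, map_zero]; exact zero_mem _
    refine bihom_le_xle ?_ (L.BQ_mem_bihom (hy l.length m) f _ hfD)
    rintro _ ⟨_, rfl, p, hp, rfl⟩ -
    have := (sum_xle (fun i => D i) hp).1
    have h3 : ∑ i : Fin (l.length + 1), D i ≤ d := hs
    simp only [fst_add]
    omega

/-- `B` turns pre-Lie products into insertions. -/
lemma BasedLie.tl_BB_preLie (x : Conv K) {y : Conv K} {q : ℕ} (hy : IsConvDegree K q y)
    (l : List L.A) : L.tl (BB (preLie K x y) L) l =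
      ins (fun a => (-1 : K) ^ q • par[K]^q a) (L.tl (BB x L)) (L.tl (BB y L)) l := by
  rcases hl : l with _ | ⟨b, l'⟩
  · rfl
  rw [← hl]
  obtain ⟨N, hN⟩ : ∃ N, l.length = N + 1 := ⟨l'.length, by rw [hl]; rfl⟩
  clear hl
  have hp (s : ℕ) : Even (((q + s : ℕ) : ℤ) - (q - s)) := ⟨s, by push_cast; ring⟩
  rw [L.tl_eq _ hN, L.BB_preLie x hy (fun s => q + s) hp, ins_eq_sum, hN, sum_triangle, sum_range]
  refine sum_congr rfl fun n _ => ?_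
  rw [sum_range]
  refine sum_congr rfl fun r _ => ?_
  have hn := n.2
  have hr := r.2
  set s := N - n.1 with hs
  have h1 : ((l.take r.1).map fun a => (-1 : K) ^ q • par[K]^q a).length = r.1 := by
    simp; omega
  have h2 : ((l.drop r.1).take (s + 1)).length = s + 1 := by simp; omega
  rw [L.tl_eq (BB x L) (n := n.1) (by
    rw [List.length_append, h1, length_cons, length_drop]; omega)]
  have e : L.compArg (add_sub_of_le (le_of_lt_succ n.2)) r (q + (N - n.1)) (BB y L (N - n.1))
        (fun i => par[K]^(N - i.1) (l.getD i.1 0)) =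
      fun i : Fin (n.1 + 1) => (if i.1 < r.1 then (-1 : K) ^ q else if i.1 = r.1 then
          (-1 : K) ^ ((q + s) * (n.1 - r.1)) else 1) •
        par[K]^(n.1 - i.1)
          ((((l.take r.1).map fun a => (-1 : K) ^ q • par[K]^q a) ++
            L.tl (BB y L) ((l.drop r.1).take (s + 1)) :: l.drop (r.1 + s + 1)).getD i.1 0) := by
    funext i
    have hi := i.2
    rw [BasedLie.compArg, getD_append_cons, h1]
    split_ifs with h3 h4
    · have : ((l.take r.1).map fun a => (-1 : K) ^ q • par[K]^q a).getD i.1 0 =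
          (-1 : K) ^ q • par[K]^q (l.getD i.1 0) := by
        rw [getD_eq_getElem _ _ (by rw [h1]; exact h3), getD_eq_getElem _ _ (by omega)]
        simp
      rw [this, map_smul, smul_smul, ← pow_add, ← two_mul, pow_mul, neg_one_sq, one_pow, one_smul,
        ← AlgHom.mul_apply, ← AlgHom.mul_apply, ← pow_add, ← pow_add]
      exact congrArg (fun φ : L.A →ₐ[K] L.A => φ (l.getD i.1 0)) (par_pow_congr ⟨q + N - i.1, by simp only; omega⟩)
    · have h6 : (fun k : Fin (s + 1) => par[K]^(N - (r.1 + k.1))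
          (l.getD (r.1 + k.1) 0)) = fun k : Fin (s + 1) => par[K]^(n.1 - r.1)
            (par[K]^(s - k.1) (((l.drop r.1).take (s + 1)).getD k.1 0)) := by
        funext k
        have hk := k.2
        have h7 : l.getD (r.1 + k.1) 0 = ((l.drop r.1).take (s + 1)).getD k.1 0 := by
          rw [getD_eq_getElem _ _ (by omega), getD_eq_getElem _ _ (by omega),
            List.getElem_take, List.getElem_drop]
        rw [← AlgHom.mul_apply, ← pow_add, h7]
        exact congrArg (fun φ : L.A →ₐ[K] L.A => φ _) (par_pow_congr ⟨N - (r.1 + k.1), by omega⟩)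
      rw [h4, L.tl_eq (BB y L) h2]
      exact (congrArg (BB y L s) h6).trans (L.BB_par hy (hp s) _ _)
    · rw [one_smul]
      have : l.getD (i.1 + s) 0 = (l.drop (r.1 + s + 1)).getD (i.1 - r.1 - 1) 0 := by
        rw [getD_eq_getElem _ _ (by omega), getD_eq_getElem _ _ (by simp; omega),
          List.getElem_drop]
        congr 1
        omega
      rw [← this]
      exact congrArg (fun φ : L.A →ₐ[K] L.A => φ (l.getD (i.1 + s) 0))
        (par_pow_congr ⟨n.1 - i.1, by simp only; omega⟩)
  rw [e, map_smul_univ, prod_ite_lt_eq (le_of_lt_succ r.2) (fun _ => (-1 : K) ^ q),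
    smul_smul, Finset.prod_const, Finset.card_range, ← pow_mul, ← pow_add, ← pow_add]
  have h5 : Even (r.1 * s + n.1 * (q + s) + (q * r.1 + (q + s) * (n.1 - r.1))) := by
    obtain ⟨t, ht⟩ : ∃ t, n.1 - r.1 = t := ⟨_, rfl⟩
    have ht' : n.1 = r.1 + t := by omega
    rw [ht, show r.1 * s + n.1 * (q + s) = r.1 * s + (r.1 + t) * (q + s) by rw [← ht']]
    exact ⟨r.1 * s + (q + s) * t + r.1 * q, by ring⟩
  rw [h5.neg_one_pow, one_smul]

lemma BasedLie.tl_map_range (F : EndFam K L.A) (N : ℕ) (a : ℕ → L.A) (k : ℕ → ℤ)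
    (ha : ∀ i, a i ∈ L.gr (k i)) : L.tl F ((List.range (N + 1)).map a) =
      sgn K (∑ i ∈ range (N + 1), ((N : ℤ) - i) * k i) • evalSeq (F N) a := by
  rw [L.tl_eq F (n := N) (by simp)]
  have : (fun i : Fin (N + 1) => par[K]^(N - i.1)
      (((List.range (N + 1)).map a).getD i.1 0)) =
      fun i : Fin (N + 1) => sgn K (((N : ℤ) - i.1) * k i.1) • a i := by
    funext (i : Fin (N + 1))
    rw [getD_eq_getElem _ _ (by simp; omega), List.getElem_map, List.getElem_range,
      L.par_pow_of_mem_gr (ha i), cast_sub (le_of_lt_succ i.2)]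
  rw [this, map_smul_univ, sgn_sum, prod_range]
  rfl

end Tilde

/-- The values of `f` on the blocks of a list. -/
def onBlocks {A : Type*} (f : List A → A) : List A → List ℕ → List A
  | _, [] => []
  | l, b :: bs => f (l.take b) :: onBlocks f (l.drop b) bs

lemma sum_composition_succ {X : Type*} [AddCommMonoid X] (n : ℕ) (g : List ℕ → X) :
    ∑ c : Composition (n + 1), g c.blocks =
      ∑ i : Fin (n + 1), ∑ c : Composition (n - i), g ((i.1 + 1) :: c.blocks) := by
  rw [← Fintype.sum_sigma' fun (i : Fin (n + 1)) (c : Composition (n - i)) => g ((i.1 + 1) :: c.blocks)]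
  symm
  refine Fintype.sum_bijective (fun p : Σ i : Fin (n + 1), Composition (n - i) =>
    (⟨(p.1.1 + 1) :: p.2.blocks, by
      intro i hi
      rcases mem_cons.1 hi with rfl | hi
      · omega
      · exact p.2.blocks_pos hi, by
      have := p.1.2
      rw [sum_cons, p.2.blocks_sum]; omega⟩ : Composition (n + 1))) ?_ _ _ fun _ => rfl
  constructor
  · rintro ⟨i, c⟩ ⟨i', c'⟩ h
    have h1 := congrArg Composition.blocks h
    simp only [List.cons.injEq, add_left_inj] at h1
    obtain rfl : i = i' := Fin.ext h1.1
    obtain rfl : c = c' := Composition.ext h1.2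
    rfl
  · intro c
    rcases hc : c.blocks with _ | ⟨b, bs⟩
    · have := c.blocks_sum
      rw [hc] at this
      simp at this
    · have hs := c.blocks_sum
      have hb : 0 < b := c.blocks_pos (by rw [hc]; exact List.mem_cons_self)
      rw [hc, sum_cons] at hs
      refine ⟨⟨⟨b - 1, by omega⟩, ⟨bs, fun hi => c.blocks_pos (by rw [hc]; exact List.mem_cons_of_mem _ hi),
        by simp only; omega⟩⟩, Composition.ext (Eq.trans ?_ hc.symm)⟩
      simp only [Nat.sub_add_cancel hb]

lemma cmp_eq_sum {A : Type*} [AddCommMonoid A] (h f : List A → A) (l : List A) (n : ℕ)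
    (hl : l.length = n) : cmp h f l = ∑ c : Composition n, h (onBlocks f l c.blocks) := by
  induction n using Nat.strong_induction_on generalizing h l with
  | _ n ih =>
  rcases n with _ | n
  · obtain rfl := List.length_eq_zero_iff.1 hl
    have : ∀ c : Composition 0, c.blocks = [] := by
      intro c
      rcases hc : c.blocks with _ | ⟨b, bs⟩
      · rfl
      · have hs := c.blocks_sum
        have hb : 0 < b := c.blocks_pos (by rw [hc]; exact List.mem_cons_self)
        rw [hc, sum_cons] at hs
        omega
    rw [cmp_nil, Fintype.sum_eq_single (Composition.ones 0)
      fun c hc => absurd (Composition.ext ((this c).trans (this _).symm)) hc, this]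
    rfl
  · have hne : l ≠ [] := by rintro rfl; simp at hl
    rw [cmp, if_neg hne, sum_composition_succ n fun bs => h (onBlocks f l bs)]
    refine sum_equiv (finCongr hl) _ _ fun i => ?_
    have := i.2
    rw [ih (n - i.1) (by omega) _ _ (by rw [length_drop]; omega)]
    rfl

lemma onBlocks_map_range {A : Type*} (f : List A → A) (bs : List ℕ) (n : ℕ) (hn : bs.sum = n) (a : ℕ → A) :
    onBlocks f ((List.range n).map a) bs = (List.range bs.length).map fun j =>
      f ((List.range (bs.getD j 0)).map fun i => a ((bs.take j).sum + i)) := by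
  induction bs generalizing n a with
  | nil => rfl
  | cons b bs ih =>
    rw [sum_cons] at hn
    have h1 : ((List.range n).map a).take b = (List.range b).map a := by
      rw [← List.map_take, List.take_range, min_eq_left (by omega)]
    have h2 : ((List.range n).map a).drop b = (List.range bs.sum).map fun i => a (b + i) := by
      obtain rfl := hn
      rw [List.range_add, List.map_append, List.drop_left' (by simp), map_map]
      rfl
    rw [onBlocks, h1, h2, ih _ rfl, length_cons, List.range_succ_eq_map, map_cons, map_map]
    refine congrArg₂ _ ?_ ?_
    · simp
    · refine map_congr_left fun j _ => ?_
      simp [add_assoc]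

lemma sum_blocks_sub (bs : List ℕ) :
    ∑ j ∈ range bs.length, (1 - (bs.getD j 0 : ℤ)) = bs.length - bs.sum := by
  induction bs with
  | nil => simp
  | cons b bs ih =>
    rw [length_cons, sum_range_succ']
    simp only [List.getD_cons_succ, List.getD_cons_zero, ih, sum_cons]
    push_cast
    ring

lemma sum_blocks_sign (bs : List ℕ) (k : ℕ → ℤ) :
    ∑ j ∈ range bs.length, (((bs.length : ℤ) - 1 - j) *
        ∑ i ∈ range (bs.getD j 0), k ((bs.take j).sum + i) +
      ∑ i ∈ range (bs.getD j 0), ((bs.getD j 0 : ℤ) - 1 - i) * k ((bs.take j).sum + i)) =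
    ∑ i ∈ range bs.sum, ((bs.sum : ℤ) - 1 - i) * k i +
      ∑ j ∈ range bs.length, (1 - (bs.getD j 0 : ℤ)) * ∑ i ∈ range (bs.take j).sum, k i := by
  induction bs generalizing k with
  | nil => simp
  | cons b bs ih =>
    have ih := ih fun i => k (b + i)
    rw [length_cons, sum_range_succ', sum_range_succ' _ bs.length]
    simp only [List.getD_cons_succ, List.getD_cons_zero, List.take_succ_cons, sum_cons,
      List.take_zero, List.sum_nil, Finset.range_zero, Finset.sum_empty, mul_zero, add_zero, zero_add,
      Finset.sum_range_add, mul_add, sum_add_distrib, ← sum_mul, sum_blocks_sub] at ih ⊢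
    have h1 (j : ℕ) : ((bs.length + 1 : ℕ) : ℤ) - 1 - (j + 1 : ℕ) = bs.length - 1 - j := by
      push_cast; ring
    have h2 (j : ℕ) : ((b + bs.sum : ℕ) : ℤ) - 1 - (b + j : ℕ) = bs.sum - 1 - j := by
      push_cast; ring
    simp only [h1, h2, add_assoc] at ih ⊢
    have h3 : ∑ i ∈ range b, (((b + bs.sum : ℕ) : ℤ) - 1 - i) * k i =
        ∑ i ∈ range b, ((b : ℤ) - 1 - i) * k i + bs.sum * ∑ i ∈ range b, k i := by
      rw [mul_sum, ← sum_add_distrib]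
      exact sum_congr rfl fun i _ => by push_cast; ring
    rw [h3]
    simp only [Nat.cast_add, Nat.cast_one, Nat.cast_zero]
    linear_combination ih

section Morphism

variable [CharZero K] (L : BasedLie K)

lemma BasedLie.tl_map_range' (F : EndFam K L.A) (n : ℕ) (hn : 0 < n) (a : ℕ → L.A) (k : ℕ → ℤ)
    (ha : ∀ i, a i ∈ L.gr (k i)) : L.tl F ((List.range n).map a) =
      sgn K (∑ i ∈ range n, ((n : ℤ) - 1 - i) * k i) • evalSeq (F (n - 1)) a := by
  obtain ⟨m, rfl⟩ : ∃ m, n = m + 1 := ⟨n - 1, by omega⟩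
  rw [L.tl_map_range F m a k ha]
  simp

lemma evalSeq_smul {A : Type u} [AddCommGroup A] [Module K A] {n : ℕ}
    (f : MultilinearMap K (fun _ : Fin (n + 1) => A) A) (c : ℕ → K) (a : ℕ → A) :
    evalSeq f (fun j => c j • a j) = (∏ j ∈ range (n + 1), c j) • evalSeq f a := by
  rw [prod_range]
  exact f.map_smul_univ (fun j => c j) fun j => a j

lemma evalSeq_congr {A : Type u} [AddCommGroup A] [Module K A] {n : ℕ}
    (f : MultilinearMap K (fun _ : Fin (n + 1) => A) A) {a b : ℕ → A} (h : ∀ i < n + 1, a i = b i) :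
    evalSeq f a = evalSeq f b := congrArg f (funext fun i => h i i.2)

/-- The right hand side of the relations of an `A∞`-morphism. -/
lemma BasedLie.cmp_tl {ν f : EndFam K L.A} (hf : ∀ n, HasDegree L.gr (f n) (1 - ((n : ℤ) + 1))) (N : ℕ)
    (a : ℕ → L.A) (k : ℕ → ℤ) (ha : ∀ i, a i ∈ L.gr (k i)) :
    cmp (L.tl ν) (L.tl f) ((List.range (N + 1)).map a) =
      sgn K (∑ i ∈ range (N + 1), ((N : ℤ) - i) * k i) • ∑ c : Composition (N + 1),
      ((-1 : ℤ) ^ (∑ j ∈ range c.length, (c.length - 1 - j) * (blk c j - 1)) *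
        (((∑ j ∈ range c.length,
          (1 - (blk c j : ℤ)) * ∑ i ∈ range (c.sizeUpTo j), k i).negOnePow : ℤˣ) : ℤ)) •
        evalSeq (ν (c.length - 1))
          fun j => evalSeq (f (blk c j - 1)) fun i => a (c.sizeUpTo j + i) := by
  rw [cmp_eq_sum _ _ _ (N + 1) (by simp), smul_sum]
  refine sum_congr rfl fun c _ => ?_
  have hpos : ∀ j < c.length, 0 < c.blocks.getD j 0 := fun j hj => by
    rw [getD_eq_getElem _ _ hj]
    exact c.blocks_pos (List.getElem_mem _)
  have hlen : 0 < c.length := c.length_pos_of_pos (Nat.succ_pos N)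
  rw [onBlocks_map_range _ _ _ c.blocks_sum]
  set κ : ℕ → ℤ := fun j => ∑ i ∈ range (c.blocks.getD j 0), k ((c.blocks.take j).sum + i) with hκ
  set ρ : ℕ → ℤ := fun j => ∑ i ∈ range (c.blocks.getD j 0),
    ((c.blocks.getD j 0 : ℤ) - 1 - i) * k ((c.blocks.take j).sum + i) with hρ
  set b : ℕ → L.A := fun j => evalSeq (f (blk c j - 1)) fun i => a (c.sizeUpTo j + i) with hb
  have h1 : ((List.range c.blocks.length).map fun j => L.tl f ((List.range (c.blocks.getD j 0)).map
      fun i => a ((c.blocks.take j).sum + i))) =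
      (List.range c.length).map fun j => if j < c.length then sgn K (ρ j) • b j else 0 := by
    refine map_congr_left fun j hj => ?_
    have hj' : j < c.length := List.mem_range.1 hj
    rw [if_pos hj', L.tl_map_range' f _ (hpos j hj') _ _ fun i => ha _]
    rfl
  have h2 j : (if j < c.length then sgn K (ρ j) • b j else 0) ∈
      L.gr (1 - (c.blocks.getD j 0 : ℤ) + κ j) := by
    split_ifs with hj
    · have := hf (blk c j - 1) (fun i => a (c.sizeUpTo j + i)) (fun i => k (c.sizeUpTo j + i)) fun i => ha _
      refine smul_mem _ _ ?_
      refine Eq.mp (congrArg (fun z => b j ∈ L.gr z) ?_) this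
      have hp := hpos j hj
      have h3 : c.blocks.getD j 0 = blk c j - 1 + 1 := by rw [blk]; omega
      have h4 : κ j = ∑ i : Fin (blk c j - 1 + 1), k (c.sizeUpTo j + i) := by
        rw [← h3, ← sum_range fun i => k (c.sizeUpTo j + i)]
        rfl
      rw [← h4]
      have h5 : (c.blocks.getD j 0 : ℤ) = (blk c j - 1 : ℕ) + 1 := by exact_mod_cast h3
      rw [h5]
      ring
    · exact zero_mem _
  rw [h1, L.tl_map_range' ν _ hlen _ _ h2]
  have h3 : evalSeq (ν (c.length - 1)) (fun j => if j < c.length then sgn K (ρ j) • b j else 0) =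
      sgn K (∑ j ∈ range c.length, ρ j) • evalSeq (ν (c.length - 1)) b := by
    rw [evalSeq_congr (b := fun j => sgn K (ρ j) • b j) _ fun j hj => if_pos (by omega), evalSeq_smul,
      sgn_sum, Nat.sub_add_cancel hlen]
  rw [h3, smul_smul, ← sgn_add]
  have h4 (n : ℕ) (z : ℤ) (y : L.A) : (((-1 : ℤ) ^ n * ((z.negOnePow : ℤˣ) : ℤ)) : ℤ) • y =
      sgn K (n + z) • y := by
    rw [← negOnePow_smul K (n + z) y, Int.negOnePow_add, Int.negOnePow_def (n : ℤ), zpow_natCast]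
    simp
  rw [h4, smul_smul, ← sgn_add]
  congr 1
  refine sgn_congr K ?_
  have h5 := sum_blocks_sign c.blocks k
  rw [sum_add_distrib] at h5
  have h6 : ((∑ j ∈ range c.length, (c.length - 1 - j) * (blk c j - 1) : ℕ) : ℤ) =
      -∑ j ∈ range c.length, ((c.length : ℤ) - 1 - j) * (1 - (c.blocks.getD j 0 : ℤ)) := by
    rw [Nat.cast_sum, ← sum_neg_distrib]
    refine sum_congr rfl fun j hj => ?_
    have hj := mem_range.1 hj
    have hp := hpos j hj
    rw [cast_mul, cast_sub (by omega), cast_sub (by omega), cast_sub (by rw [blk]; omega), blk]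
    push_cast
    ring
  have h7 : ∑ j ∈ range c.length, ((c.length : ℤ) - 1 - j) * (1 - (c.blocks.getD j 0 : ℤ) + κ j) =
      ∑ j ∈ range c.length, ((c.length : ℤ) - 1 - j) * (1 - (c.blocks.getD j 0 : ℤ)) +
      ∑ j ∈ range c.length, ((c.length : ℤ) - 1 - j) * κ j := by
    simp only [mul_add, sum_add_distrib]
  have h8 : ∑ i ∈ range c.blocks.sum, ((c.blocks.sum : ℤ) - 1 - i) * k i =
      ∑ i ∈ range (N + 1), ((N : ℤ) - i) * k i := by
    rw [c.blocks_sum]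
    exact sum_congr rfl fun i _ => by push_cast; ring
  rw [h8] at h5
  rw [h6, h7]
  refine ⟨∑ j ∈ range c.length, ((c.length : ℤ) - 1 - j) * (1 - (c.blocks.getD j 0 : ℤ)), ?_⟩
  have h9 : ∑ j ∈ range c.length, ((c.length : ℤ) - 1 - j) * κ j + ∑ j ∈ range c.length, ρ j =
    ∑ i ∈ range (N + 1), ((N : ℤ) - i) * k i + ∑ j ∈ range c.length,
      (1 - (blk c j : ℤ)) * ∑ i ∈ range (c.sizeUpTo j), k i := h5
  linear_combination h9

lemma sum_partialComp (f μ : EndFam K L.A) (N : ℕ) (a : ℕ → L.A) (k : ℕ → ℤ) :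
    ∑ s' ∈ range (N + 1), ∑ r ∈ range (N - s' + 1),
      (-1 : ℤ) ^ (r + (s' + 1) * (N - s' - r)) •
        partialComp (f (N - s')) (μ s') (2 - ((s' : ℤ) + 1)) r a k = preLieEnd 1 f μ N a k := by
  refine sum_congr rfl fun s hs => sum_congr rfl fun r hr => ?_
  rw [mem_range] at hs hr
  rw [show (2 - ((s : ℤ) + 1)) = 1 - s by ring]
  congr 1
  have : ((-1 : ℤ) ^ (r + (s + 1) * (N - s - r)) : ℤ) =
      ((((r + (s + 1) * (N - s - r) : ℕ) : ℤ).negOnePow : ℤˣ) : ℤ) := by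
    rw [Int.negOnePow_def, zpow_natCast]; simp
  rw [this]
  congr 1
  refine (Int.negOnePow_eq_iff _ _).2 ?_
  rw [Nat.cast_add, cast_mul, cast_sub (by omega), cast_sub (by omega)]
  push_cast [cast_sub (show s ≤ N by omega)]
  exact ⟨(N : ℤ) - s - r * s - s , by ring⟩

end Morphism

section

open scoped Pointwise

lemma multilinear_eq_zero {R ι M N : Type*} [CommSemiring R] [Fintype ι]
    [AddCommMonoid M] [AddCommMonoid N] [Module R M] [Module R N] {s : Set M} (hs : span R s = ⊤)
    {g : MultilinearMap R (fun _ : ι => M) N} (hg : ∀ f, (∀ i, f i ∈ s) → g f = 0) : g = 0 := by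
  classical
  suffices h : ∀ (t : Finset ι) (f : ι → M), (∀ i ∉ t, f i ∈ s) → g f = 0 from
    MultilinearMap.ext fun f => h univ f fun i hi => absurd (mem_univ i) hi
  intro t
  induction t using Finset.induction_on with
  | empty => exact fun f hf => hg f fun i => hf i (Finset.notMem_empty i)
  | insert i t _ ih =>
    intro f hf
    rw [← Function.update_eq_self i f]
    refine LinearMap.eqOn_span (f := g.toLinearMap f i) (g := 0) (fun c hc => ih _ fun j hj => ?_)
      (hs ▸ mem_top)
    by_cases hij : j = i
    · subst hij; rwa [update_self]
    · rw [update_of_ne hij]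
      exact hf j (by simp [hij, hj])

lemma span_bihomogeneous (K : Type u) [Field K] (ι : Type) [Fintype ι] [DecidableEq ι] : span K
    {a : SuperPoly K ι | ∃ p : ℕ × ℕ, a ∈ bihom K {((p.1 : ℤ), (p.2 : ℤ))}} = ⊤ := by
  rw [eq_top_iff, ← iSup_bihom]
  exact iSup_le fun p a ha => subset_span ⟨p, ha⟩

lemma eq_zero_of_biProj {ι : Type} [Fintype ι] [DecidableEq ι] {a : SuperPoly K ι}
    (h : ∀ i j, biProj K i j a = 0) : a = 0 := by
  obtain ⟨g, hg, rfl⟩ := (Submodule.mem_iSup_iff_exists_finsupp _ a).1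
    (iSup_bihom (K := K) (ι := ι) ▸ mem_top : a ∈ ⨆ p : ℕ × ℕ, bihom K {((p.1 : ℤ), (p.2 : ℤ))})
  refine sum_eq_zero fun p hp => ?_
  rw [← biProj_of_mem (hg p), ← h p.1 p.2, Finsupp.sum, map_sum]
  refine Eq.symm (sum_eq_single (f := fun q : ℕ × ℕ => biProj K p.1 p.2 (g q)) p (fun q _ hq => biProj_of_notMem ?_ (hg q)) fun hp' => absurd hp hp')
  rw [Set.mem_singleton_iff, Prod.mk.injEq, Nat.cast_inj, Nat.cast_inj, ← ext_iff]
  exact Ne.symm hq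

section Separation

variable [CharZero K] (L : BasedLie K) {n m : ℕ}

lemma sum_mem_singleton {X : Type*} [AddCommMonoid X] {ι : Type*} [Fintype ι] (p : ι → X) {x : X}
    (h : x ∈ ∑ i, ({p i} : Set X)) : x = ∑ i, p i := by
  rwa [Set.finsetSum_singleton, Set.mem_singleton_iff] at h

lemma BasedLie.BQ_mem_bihom_sub (y : QGra K n m) (f : Fin (n + 1) → L.A) (p : Fin (n + 1) → ℤ × ℤ)
    (h : ∀ i, f i ∈ bihom K {p i}) :
    L.BQ n m y f ∈ bihom K {r | r.2 - r.1 = m + (∑ i, p i).2 - (∑ i, p i).1} := by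
  obtain ⟨a, rfl⟩ := mk_surjective _ y
  refine map_mem_of_mem_span (evalₗ f ∘ₗ L.Blin n m) ?_ (mem_span_graph a)
  rintro _ ⟨l, rfl⟩
  refine bihom_mono ?_ (L.B_mem_bihom l f _ h)
  rintro _ ⟨_, rfl, r, hr, rfl⟩
  rw [sum_mem_singleton p hr]
  simp only [mem_setOf_eq, snd_add, fst_add]
  ring

/-- Bidegrees separate the numbers of internal vertices. -/
lemma BasedLie.biProj_BQ_eq_zero (x : Conv K) (f : Fin (n + 1) → L.A) (p : Fin (n + 1) → ℤ × ℤ)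
    (h : ∀ i, f i ∈ bihom K {p i}) {i j : ℕ} (h0 : biProj K i j (BB x L n f) = 0) (m : ℕ) :
    biProj K i j (L.BQ n m (x n m) f) = 0 := by
  by_cases hij : (j : ℤ) - i = m + (∑ i, p i).2 - (∑ i, p i).1
  · obtain ⟨M, hM⟩ := L.exists_bound f
    rw [BB_apply L x (M := M + m + 1) fun k hk => hM k (by omega), map_sum, sum_eq_single_of_mem m
      (mem_range.2 (by omega)) fun k _ hk =>
        biProj_of_notMem (fun hk' => hk ?_) (L.BQ_mem_bihom_sub _ f p h)] at h0
    · exact h0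
    · rw [mem_setOf_eq] at hk'
      omega
  · exact biProj_of_notMem hij (L.BQ_mem_bihom_sub _ f p h)

/-- Classes of graphs are determined by the multilinear maps that they represent. -/
lemma eq_zero_of_biProj_BQ {z : QGra K n m} (h : ∀ (L : BasedLie K) (f : Fin (n + 1) → L.A)
    (p : Fin (n + 1) → ℤ × ℤ), (∀ i, f i ∈ bihom K {p i}) → ∀ i j, biProj K i j (L.BQ n m z f) = 0) :
    z = 0 := by
  obtain ⟨a, rfl⟩ := mk_surjective _ z
  refine (mk_eq_zero _).2 (mem_relations_of_forall_B_eq_zero fun L =>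
    multilinear_eq_zero (span_bihomogeneous K _) fun f hf => ?_)
  choose p hp using hf
  exact eq_zero_of_biProj (h L f (fun i => ((p i).1, (p i).2)) hp)

/-- A family of homogeneous elements, extended by zero. -/
lemma BasedLie.exists_seq (f : Fin (n + 1) → L.A) (p : Fin (n + 1) → ℤ × ℤ) (h : ∀ i, f i ∈ bihom K {p i}) :
    ∃ (a : ℕ → L.A) (k : ℕ → ℤ), (∀ i, a i ∈ L.gr (k i)) ∧ (fun i : Fin (n + 1) => a i) = f ∧
      ∀ i : Fin (n + 1), k i = (p i).2 := by
  refine ⟨fun i => if h : i < n + 1 then f ⟨i, h⟩ else 0, fun i => if h : i < n + 1 then (p ⟨i, h⟩).2 else 0,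
    fun i => ?_, funext fun i => dif_pos i.2, fun i => dif_pos i.2⟩
  dsimp only
  split_ifs with hi
  · rw [L.gr_eq]
    exact bihom_mono (by rintro _ rfl; rfl) (h ⟨i, hi⟩)
  · exact zero_mem _

lemma eq_zero_of_evalSeq {z : Conv K} (h : ∀ (L : BasedLie K) (N : ℕ) (a : ℕ → L.A) (k : ℕ → ℤ),
    (∀ i, a i ∈ L.gr (k i)) → evalSeq (BB z L N) a = 0) : z = 0 := by
  funext n m
  refine eq_zero_of_biProj_BQ fun L f p hf i j => L.biProj_BQ_eq_zero z f p hf ?_ m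
  obtain ⟨a, k, ha, rfl, -⟩ := L.exists_seq f p hf
  rw [show BB z L n (fun i => a i) = 0 from h L n a k ha, map_zero]

lemma BasedLie.hasDegree_BB {q : ℤ} {x : Conv K} (hx : IsConvDegree K q x) (n : ℕ) :
    HasDegree L.gr (BB x L n) (q - n) := by
  intro f k hf
  obtain ⟨M, hM⟩ := L.exists_bound f
  rw [BB_apply L x hM]
  refine Submodule.sum_mem _ fun m _ => ?_
  rw [L.gr_eq]
  refine bihom_mono ?_ (L.BQ_mem_bihom (hx n m) f (fun i => {p | p.2 = k i}) fun i => L.gr_eq _ ▸ hf i)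
  rintro _ ⟨_, rfl, r, hr, rfl⟩
  obtain ⟨g, hg, rfl⟩ := (Set.mem_fintype_sum _ _).1 hr
  simp only [mem_setOf_eq, snd_add, Prod.snd_sum] at hg ⊢
  rw [sum_congr rfl fun i _ => hg i, add_comm]

lemma isConvDegree_of_hasDegree {q : ℤ} {x : Conv K} (hx : IsConvElement K x)
    (h : ∀ (L : BasedLie K) (n : ℕ), HasDegree L.gr (BB x L n) (q - n)) : IsConvDegree K q x := by
  intro n m
  have hxm := hx n m
  rw [dgraphs_eq, iSup_split_single _ q] at hxm
  obtain ⟨y, hy, w, hw, hyw⟩ := Submodule.mem_sup.1 hxm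
  suffices hw0 : w = 0 by rw [← hyw, hw0, add_zero]; exact hy
  refine eq_zero_of_biProj_BQ fun L f p hf i j => ?_
  by_cases hj : (j : ℤ) = q - n + (∑ i, p i).2
  · let φ : QGra K n m →ₗ[K] L.A :=
      { toFun := fun z => biProj K i j (L.BQ n m z f)
        map_add' := fun z z' => by rw [map_add, MultilinearMap.add_apply, map_add]
        map_smul' := fun r z => by rw [map_smul, MultilinearMap.smul_apply, map_smul]; rfl }
    suffices hle : (⨆ q', ⨆ _ : q' ≠ q, dgraphsDeg K q' n m) ≤ LinearMap.ker φ from mem_ker.1 (hle hw)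
    refine iSup₂_le fun q' hq' z hz => mem_ker.2
      (biProj_of_notMem ?_ (L.BQ_mem_bihom hz f (fun i => {p i}) hf))
    rintro ⟨_, rfl, r, hr, hr'⟩
    rw [sum_mem_singleton p hr] at hr'
    have := congrArg snd hr'
    simp only [snd_add] at this
    omega
  · have h1 : biProj K i j (BB x L n f) = 0 := by
      obtain ⟨a, k, ha, rfl, hk⟩ := L.exists_seq f p hf
      have := h L n _ _ fun i : Fin (n + 1) => ha i
      rw [L.gr_eq] at this
      refine biProj_of_notMem (fun h' => hj ?_) this
      rw [mem_setOf_eq, sum_congr rfl fun i _ => hk i] at h'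
      rw [Prod.snd_sum, add_comm]
      exact h'
    have h2 := L.biProj_BQ_eq_zero x f p hf h1 m
    rw [← hyw, map_add, MultilinearMap.add_apply, map_add, biProj_of_notMem ?_
      (L.BQ_mem_bihom hy f (fun i => {p i}) hf), zero_add] at h2
    · exact h2
    · rintro ⟨_, rfl, r, hr, hr'⟩
      rw [sum_mem_singleton p hr] at hr'
      exact hj (congrArg snd hr').symm

end Separation

end

section Order

variable (K)

/-- The families that vanish where the number of external and internal vertices is at most `d`. -/
def ordGe (d : ℕ) : Submodule K (Conv K) where
  carrier := {z | ∀ n m, n + m < d → z n m = 0}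
  zero_mem' _ _ _ := rfl
  add_mem' hx hy n m h := by rw [Pi.add_apply, Pi.add_apply, hx n m h, hy n m h, add_zero]
  smul_mem' r x hx n m h := by rw [Pi.smul_apply, Pi.smul_apply, hx n m h, smul_zero]

variable {K}

lemma ordGe_anti {d d' : ℕ} (h : d ≤ d') : ordGe K d' ≤ ordGe K d := fun _ hz n m hnm =>
  hz n m (hnm.trans_le h)

lemma mem_ordGe_zero (z : Conv K) : z ∈ ordGe K 0 := fun _ _ h => absurd h (Nat.not_lt_zero _)

lemma eq_zero_of_mem_ordGe {z : Conv K} (h : ∀ d, z ∈ ordGe K d) : z = 0 := by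
  funext n m
  exact h (n + m + 1) n m (Nat.lt_succ_self _)

lemma preLie_mem_ordGe {x y : Conv K} {d e : ℕ} (hx : x ∈ ordGe K d) (hy : y ∈ ordGe K e) :
    preLie K x y ∈ ordGe K (d + e) := by
  intro N M h
  refine sum_eq_zero fun n _ => sum_eq_zero fun m _ => sum_eq_zero fun j _ => ?_
  rw [← compQ_apply]
  by_cases h1 : n.1 + m.1 < d
  · rw [hx _ _ h1, map_zero, LinearMap.zero_apply, smul_zero]
  · have := n.2
    have := m.2
    rw [hy (N - n.1) (M - m.1) (by omega), map_zero, smul_zero]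

/-- `z = ∑ₖ fₖ / k!`. -/
def HasExp (f : ℕ → Conv K) (z : Conv K) : Prop :=
  ∀ T, z - ∑ k ∈ range T, (k.factorial : K)⁻¹ • f k ∈ ordGe K T

/-- The sum of `fₖ / k!`. -/
def expSum (f : ℕ → Conv K) : Conv K := fun n m =>
  ∑ k ∈ range (n + m + 1), (k.factorial : K)⁻¹ • f k n m

lemma hasExp_expSum {f : ℕ → Conv K} (hf : ∀ k, f k ∈ ordGe K k) : HasExp f (expSum f) := by
  intro T n m h
  simp only [Pi.sub_apply, Finset.sum_apply, Pi.smul_apply]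
  rw [sub_eq_zero]
  refine sum_subset (Finset.range_subset_range.2 h) fun k _ hk => ?_
  rw [hf k n m (by rw [mem_range] at hk; omega), smul_zero]

lemma HasExp.unique {f : ℕ → Conv K} {z z' : Conv K} (h : HasExp f z) (h' : HasExp f z') : z = z' := by
  rw [← sub_eq_zero]
  refine eq_zero_of_mem_ordGe fun d => ?_
  have := sub_mem (h d) (h' d)
  rwa [sub_sub_sub_cancel_right] at this

lemma HasExp.map {f : ℕ → Conv K} {z : Conv K} (h : HasExp f z) (B : Module.End K (Conv K))
    (hB : ∀ d, ∀ z ∈ ordGe K d, B z ∈ ordGe K d) : HasExp (fun k => B (f k)) (B z) := by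
  intro T
  have := hB T _ (h T)
  simpa only [map_sub, map_sum, map_smul] using this

/-- Operators that raise the order. -/
def Raises (B : Module.End K (Conv K)) : Prop := ∀ d, ∀ z ∈ ordGe K d, B z ∈ ordGe K (d + 1)

lemma Raises.pow {B : Module.End K (Conv K)} (hB : Raises B) (k : ℕ) {d : ℕ} {z : Conv K} (hz : z ∈ ordGe K d) :
    (B ^ k) z ∈ ordGe K (d + k) := by
  induction k with
  | zero => exact hz
  | succ k ih => rw [pow_succ', Module.End.mul_apply]; exact hB _ _ ih

/-- The exponential of an operator that raises the order. -/
def expOp (B : Module.End K (Conv K)) (z : Conv K) : Conv K := expSum fun k => (B ^ k) z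

lemma Raises.hasExp {B : Module.End K (Conv K)} (hB : Raises B) (z : Conv K) :
    HasExp (fun k => (B ^ k) z) (expOp B z) :=
  hasExp_expSum fun k => by simpa using hB.pow k (mem_ordGe_zero z)

lemma Raises.hasExp_expOp [CharZero K] {B : Module.End K (Conv K)} (hB : Raises B) {c : ℕ → ℕ → Conv K}
    (hc : ∀ i j, c i j ∈ ordGe K (i + j)) (hBc : ∀ i j, c (i + 1) j = B (c i j)) {y : Conv K}
    (hy : HasExp (c 0) y) : HasExp (fun k => ∑ ij ∈ antidiagonal k,
      k.choose ij.1 • c ij.1 ij.2) (expOp B y) := by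
  intro T
  have h0 i j : (B ^ i) (c 0 j) = c i j := by
    induction i with
    | zero => rfl
    | succ i ih => rw [pow_succ', Module.End.mul_apply, ih, hBc]
  have h1 : ∑ i ∈ range T, (i.factorial : K)⁻¹ • ((B ^ i) y -
      ∑ j ∈ range T, (j.factorial : K)⁻¹ • c i j) ∈ ordGe K T := by
    refine Submodule.sum_mem _ fun i _ => smul_mem _ _ ?_
    have := ordGe_anti (Nat.le_add_right T i) (hB.pow i (hy T))
    simpa only [map_sub, map_sum, map_smul, h0] using this
  have h2 : ∑ i ∈ range T, (∑ j ∈ range T, ((i.factorial : K)⁻¹ * (j.factorial : K)⁻¹) • c i j -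
      ∑ j ∈ range (T - i), ((i.factorial : K)⁻¹ * (j.factorial : K)⁻¹) • c i j) ∈ ordGe K T := by
    refine Submodule.sum_mem _ fun i _ => ?_
    rw [Finset.sum_range_sub_sum_range (Nat.sub_le T i)]
    refine Submodule.sum_mem _ fun j hj => smul_mem _ _ (ordGe_anti ?_ (hc i j))
    have := (mem_filter.1 hj).2
    omega
  have h3 := add_mem (add_mem (hB.hasExp y T) h1) h2
  rw [sum_sub_distrib, ← Finset.sum_range_diag_flip T
    fun i j => ((i.factorial : K)⁻¹ * (j.factorial : K)⁻¹) • c i j] at h3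
  simp only [smul_sub, sum_sub_distrib, smul_sum, smul_smul] at h3
  rw [sub_add_sub_cancel, sub_add_sub_cancel] at h3
  convert h3 using 3 with k
  rw [smul_sum, ← Finset.Nat.sum_antidiagonal_eq_sum_range_succ
    fun i j => ((i.factorial : K)⁻¹ * (j.factorial : K)⁻¹) • c i j]
  refine sum_congr rfl fun ij hij => ?_
  rw [mem_antidiagonal] at hij
  rw [← Nat.cast_smul_eq_nsmul K, smul_smul, ← hij, inv_factorial_mul_choose]

lemma hasExp_zero (z : Conv K) : HasExp (fun k => ((0 : Module.End K (Conv K)) ^ k) z) z := by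
  rintro (_ | T)
  · exact mem_ordGe_zero _
  · have h k : ((0 : Module.End K (Conv K)) ^ (k + 1)) z = 0 := by
      rw [zero_pow k.succ_ne_zero, LinearMap.zero_apply]
    rw [sum_range_succ']
    simp [h]

lemma Raises.neg {B : Module.End K (Conv K)} (hB : Raises B) : Raises (-B) := fun d z hz =>
  neg_mem (hB d z hz)

lemma Raises.expOp_neg_expOp [CharZero K] {B : Module.End K (Conv K)} (hB : Raises B) (z : Conv K) :
    expOp (-B) (expOp B z) = z := by
  have h := hB.neg.hasExp_expOp (c := fun i j => ((-B) ^ i) ((B ^ j) z))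
    (fun i j => by
      have := hB.neg.pow i (hB.pow j (mem_ordGe_zero z))
      rwa [zero_add, add_comm] at this)
    (fun i j => by rw [pow_succ', Module.End.mul_apply]) (hB.hasExp z)
  refine h.unique ?_
  convert hasExp_zero z with k
  rw [← neg_add_cancel B, (show Commute (-B) B from LinearMap.ext fun w => (map_neg B (B w)).symm).add_pow',
    LinearMap.sum_apply]
  rfl

lemma Raises.expOp_injective [CharZero K] {B : Module.End K (Conv K)} (hB : Raises B) :
    Function.Injective (expOp B) := Function.LeftInverse.injective hB.expOp_neg_expOp

lemma expOp_smul (B : Module.End K (Conv K)) (r : K) (z : Conv K) : expOp B (r • z) = r • expOp B z := by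
  funext n m
  simp only [expOp, expSum, map_smul, Pi.smul_apply, smul_sum, smul_comm r]

lemma expOp_mem_degree {B : Module.End K (Conv K)} {q : ℤ} (hB : ∀ z, IsConvDegree K q z →
    IsConvDegree K q (B z)) {z : Conv K} (hz : IsConvDegree K q z) : IsConvDegree K q (expOp B z) := by
  have : ∀ k, IsConvDegree K q ((B ^ k) z) := fun k => by
    induction k with
    | zero => exact hz
    | succ k ih => rw [pow_succ', Module.End.mul_apply]; exact hB _ ih
  intro n m
  unfold expOp expSum
  exact Submodule.sum_mem _ fun k _ => smul_mem _ _ (this k n m)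

variable (K) in
/-- The product with `x` from the right. -/
def mulR (x : Conv K) : Module.End K (Conv K) := preLieL.flip x

variable (K) in
/-- The adjoint operator. -/
def adL (x : Conv K) : Module.End K (Conv K) := preLieL x - preLieL.flip x

lemma mulR_apply (x z : Conv K) : mulR K x z = preLie K z x := rfl

lemma adL_apply (x z : Conv K) : adL K x z = ad K x z := rfl

lemma expAd_eq (x y : Conv K) : expAd K x y = expOp (adL K x) y := by
  funext n m
  refine sum_congr rfl fun k _ => ?_
  simp only [Module.End.pow_apply]
  rfl

lemma IsPronilpotent.mem_ordGe {x : Conv K} (hx : IsPronilpotent K x) : x ∈ ordGe K 1 := by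
  intro n m h
  obtain ⟨rfl, rfl⟩ : n = 0 ∧ m = 0 := by omega
  exact hx.2

lemma raises_mulR {x : Conv K} (hx : IsPronilpotent K x) : Raises (mulR K x) := fun _ _ hz =>
  preLie_mem_ordGe hz hx.mem_ordGe

lemma raises_adL {x : Conv K} (hx : IsPronilpotent K x) : Raises (adL K x) := fun d _ hz =>
  sub_mem (add_comm 1 d ▸ preLie_mem_ordGe hx.mem_ordGe hz) (preLie_mem_ordGe hz hx.mem_ordGe)

lemma IsConvDegree.mulR {q : ℤ} {x z : Conv K} (hz : IsConvDegree K q z) (hx : IsConvDegree K 0 x) :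
    IsConvDegree K q (mulR K x z) := by
  have := hz.preLie hx
  rwa [add_zero] at this

lemma IsConvDegree.adL {q : ℤ} {x z : Conv K} (hz : IsConvDegree K q z) (hx : IsConvDegree K 0 x) :
    IsConvDegree K q (adL K x z) := fun n m =>
  Submodule.sub_mem _ (by have := hx.preLie hz n m; rwa [zero_add] at this) (hz.mulR hx n m)

end Order

section Values

variable [CharZero K] (L : BasedLie K)

lemma sgn_ne_zero (K : Type u) [Field K] (z : ℤ) : sgn K z ≠ 0 := fun h => by
  have h3 := sgn_add K z z
  rw [h, zero_mul, ← two_mul, sgn_congr K (w := 0) ⟨z, by ring⟩] at h3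
  simp [sgn] at h3

lemma BB_add (x y : Conv K) (n : ℕ) : BB (x + y) L n = BB x L n + BB y L n := by
  ext f
  obtain ⟨M, hM⟩ := L.exists_bound f
  rw [MultilinearMap.add_apply, BB_apply L _ hM, BB_apply L _ hM, BB_apply L _ hM, ← sum_add_distrib]
  exact sum_congr rfl fun m _ => by rw [Pi.add_apply, Pi.add_apply, map_add, MultilinearMap.add_apply]

lemma BB_eq_smul {x y : Conv K} {n : ℕ} {r : K} (h : ∀ m, x n m = r • y n m) :
    BB x L n = r • BB y L n := by
  ext f
  obtain ⟨M, hM⟩ := L.exists_bound f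
  rw [MultilinearMap.smul_apply, BB_apply L _ hM, BB_apply L _ hM, smul_sum]
  exact sum_congr rfl fun m _ => by rw [h, map_smul, MultilinearMap.smul_apply]

/-- The values of the maps represented by families of classes of graphs on a list. -/
def BasedLie.ev (l : List L.A) : Conv K →ₗ[K] L.A where
  toFun x := L.tl (BB x L) l
  map_add' x y := by
    rcases l with _ | ⟨a, l⟩
    · exact (add_zero _).symm
    · rw [BasedLie.tl, BB_add]; rfl
  map_smul' r x := by
    rcases l with _ | ⟨a, l⟩
    · exact (smul_zero _).symm
    · rw [BasedLie.tl, BB_eq_smul L (r := r) (y := x) fun _ => rfl]; rfl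

lemma BasedLie.ev_apply (l : List L.A) (x : Conv K) : L.ev l x = L.tl (BB x L) l := rfl

/-- The values determine a family. -/
lemma conv_ext {x y : Conv K} (h : ∀ (L : BasedLie K) (N : ℕ) (a : ℕ → L.A) (k : ℕ → ℤ),
    (∀ i, a i ∈ L.gr (k i)) → L.ev ((List.range (N + 1)).map a) x = L.ev ((List.range (N + 1)).map a) y) :
    x = y := by
  rw [← sub_eq_zero]
  refine eq_zero_of_evalSeq fun L N a k ha => ?_
  have h1 := h L N a k ha
  rw [← sub_eq_zero, ← map_sub, L.ev_apply, L.tl_map_range _ N a k ha] at h1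
  exact (smul_eq_zero.1 h1).resolve_left (sgn_ne_zero K _)

lemma BasedLie.eventually_ev (l : List L.A) :
    ∀ᶠ T in Filter.atTop, ∀ z ∈ ordGe K T, L.ev l z = 0 := by
  rcases l with _ | ⟨a, l⟩
  · exact Filter.Eventually.of_forall fun _ _ _ => rfl
  · obtain ⟨M, hM⟩ := L.exists_bound
      fun i : Fin (l.length + 1) => par[K]^(l.length - i.1) ((a :: l).getD i.1 0)
    filter_upwards [Filter.eventually_ge_atTop (l.length + M)] with T hT z hz
    refine (BB_apply L z hM).trans (sum_eq_zero fun m hm => ?_)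
    rw [hz _ _ (by rw [mem_range] at hm; omega), map_zero]
    rfl

lemma BasedLie.ev_preLie (x : Conv K) {y : Conv K} {q : ℕ} (hy : IsConvDegree K q y) (l : List L.A) :
    L.ev l (preLie K x y) = ins (fun a => (-1 : K) ^ q • par[K]^q a)
      (fun l => L.ev l x) (fun l => L.ev l y) l := L.tl_BB_preLie x hy l

lemma BasedLie.ev_preLie_zero (x : Conv K) {y : Conv K} (hy : IsConvDegree K 0 y) (l : List L.A) :
    L.ev l (preLie K x y) = ins id (fun l => L.ev l x) (fun l => L.ev l y) l := by
  rw [L.ev_preLie x (q := 0) hy]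
  congr 1
  funext a
  rw [pow_zero, one_smul, pow_zero]
  rfl

lemma BasedLie.ev_map {x : Conv K} (hx : IsConvDegree K 0 x) (q : ℕ) (l : List L.A) :
    L.ev (l.map fun a => (-1 : K) ^ q • par[K]^q a) x =
      (-1 : K) ^ q • par[K]^q (L.ev l x) := by
  rcases l with _ | ⟨b, l'⟩
  · exact (by simp : (0 : L.A) = (-1 : K) ^ q • par[K]^q 0)
  obtain ⟨n, l, hl⟩ : ∃ n, ∃ l : List L.A, b :: l' = l ∧ l.length = n + 1 := ⟨_, _, rfl, rfl⟩
  rw [hl.1, L.ev_apply, L.ev_apply, L.tl_eq _ hl.2, L.tl_eq (n := n) _ (by rw [length_map, hl.2])]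
  have h1 : (fun i : Fin (n + 1) => par[K]^(n - i.1)
      ((l.map fun a => (-1 : K) ^ q • par[K]^q a).getD i.1 0)) =
      fun i => (-1 : K) ^ q • par[K]^q
        (par[K]^(n - i.1) (l.getD i.1 0)) := by
    funext i
    rw [getD_eq_getElem _ _ (by simp; omega), List.getElem_map, getD_eq_getElem _ _ (by omega),
      map_smul, ← AlgHom.mul_apply, ← AlgHom.mul_apply, ← pow_add, ← pow_add, add_comm]
  rw [h1, map_smul_univ, L.BB_par hx (p := n) ⟨n, by ring⟩, smul_smul, Finset.prod_const,
    card_univ, card_fin, ← pow_mul, ← pow_add]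
  congr 1
  rw [show q * (n + 1) + n * q = q + 2 * (n * q) by ring, pow_add, pow_mul, neg_one_sq, one_pow, mul_one]

/-- The pre-Lie identity. -/
lemma preLie_preLie {x a : Conv K} {q : ℕ} (hx : IsConvDegree K 0 x) (ha : IsConvDegree K q a) (z : Conv K) :
    preLie K (preLie K z a) x + preLie K z (preLie K x a) =
      preLie K (preLie K z x) a + preLie K z (preLie K a x) := by
  refine conv_ext fun L N b k _ => ?_
  have h1 : IsConvDegree K q (preLie K x a) := by have := hx.preLie ha; rwa [zero_add] at this
  have h2 : IsConvDegree K q (preLie K a x) := by have := ha.preLie hx; rwa [add_zero] at this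
  simp only [map_add, L.ev_preLie_zero _ hx, L.ev_preLie _ h1, L.ev_preLie _ h2, L.ev_preLie _ ha]
  exact ins_ins (L.isMultilin_tl _) (fun v => L.ev_map hx q v) _ _

lemma mulR_pow_preLie {x : Conv K} {q : ℕ} (hx : IsConvDegree K 0 x) (z : Conv K) (k : ℕ) {a : Conv K}
    (ha : IsConvDegree K q a) : preLie K ((mulR K x ^ k) z) a =
      ∑ ij ∈ antidiagonal k,
        k.choose ij.1 • (mulR K x ^ ij.1) (preLie K z ((adL K x ^ ij.2) a)) := by
  induction k generalizing a with
  | zero => simp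
  | succ k ih =>
    have h : preLie K ((mulR K x ^ (k + 1)) z) a =
        mulR K x (preLie K ((mulR K x ^ k) z) a) + preLie K ((mulR K x ^ k) z) (adL K x a) := by
      rw [pow_succ', Module.End.mul_apply, mulR_apply, mulR_apply, eq_sub_of_add_eq (preLie_preLie hx ha _).symm,
        adL_apply, ad, ← preLieL_apply _ (preLie K x a - preLie K a x), map_sub, preLieL_apply, preLieL_apply]
      abel
    rw [h, ih ha, ih (ha.adL hx), Finset.sum_antidiagonal_choose_succ_nsmul fun i j =>
      (mulR K x ^ i) (preLie K z ((adL K x ^ j) a)), map_sum, ← sum_add_distrib,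
      ← sum_add_distrib]
    refine sum_congr rfl fun ij hij => ?_
    rw [map_nsmul, pow_succ (adL K x), Module.End.mul_apply, pow_succ', Module.End.mul_apply, add_comm,
      Nat.choose_symm_of_eq_add (mem_antidiagonal.1 hij).symm]

/-- `exp(R_x) z ⋆ a = exp(R_x) (z ⋆ exp(ad x) a)`. -/
lemma preLie_expOp {x a : Conv K} {q : ℕ} (hx : IsPronilpotent K x) (ha : IsConvDegree K q a) (z : Conv K) :
    preLie K (expOp (mulR K x) z) a = expOp (mulR K x) (preLie K z (expOp (adL K x) a)) := by
  have h1 := ((raises_mulR hx).hasExp z).map (mulR K a) fun d w hw =>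
    preLie_mem_ordGe (e := 0) hw (mem_ordGe_zero a)
  have h2 := (raises_mulR hx).hasExp_expOp (c := fun i j => (mulR K x ^ i) (preLie K z ((adL K x ^ j) a)))
    (fun i j => by
      have := (raises_mulR hx).pow i (preLie_mem_ordGe (mem_ordGe_zero z)
        ((raises_adL hx).pow j (mem_ordGe_zero a)))
      rwa [zero_add, zero_add, add_comm] at this)
    (fun i j => by rw [pow_succ', Module.End.mul_apply])
    (((raises_adL hx).hasExp a).map (preLieL z) fun d w hw => by
      have := preLie_mem_ordGe (mem_ordGe_zero z) hw
      rwa [zero_add] at this)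
  refine h1.unique ?_
  rw [← preLieL_apply z]
  convert h2 using 2 with k
  exact mulR_pow_preLie hx.1 z k ha

variable (K) in
/-- The operadic unit. -/
def opUnit : Conv K := fun n m => if n = 0 ∧ m = 0 then cls K n m 1 else 0

lemma opUnit_apply {n m : ℕ} (h : ¬ (n = 0 ∧ m = 0)) : opUnit K n m = 0 := if_neg h

lemma isConvDegree_opUnit : IsConvDegree K 0 (opUnit K) := by
  intro n m
  by_cases h : n = 0 ∧ m = 0
  · obtain ⟨rfl, rfl⟩ := h
    exact subset_span ⟨[], ⟨List.nodup_nil, by simp, by simp, by simp, fun v => v.elim0⟩, by simp,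
      rfl⟩
  · rw [opUnit_apply h]; exact zero_mem _

lemma BasedLie.ev_opUnit (l : List L.A) : L.ev l (opUnit K) = unitFn l := by
  rcases l with _ | ⟨a, _ | ⟨b, l⟩⟩
  · rfl
  · obtain ⟨M, hM⟩ := L.exists_bound (n := 0)
      fun i => par[K]^(0 - i.1) ([a].getD i.1 0)
    refine (BB_apply L _ (M := M + 1) fun m hm => hM m (by omega)).trans ?_
    rw [sum_eq_single_of_mem 0 (by simp) fun m _ hm => by
      rw [opUnit_apply (by simp [hm]), map_zero]; rfl]
    refine (L.B_apply 1 _).trans ?_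
    rw [map_one, Module.End.one_apply]
    simp only [ints, Finset.univ_eq_empty, Finset.map_empty, L.pis_empty, one_mul, BasedLie.exts]
    simp [L.merge_slot, unitFn]
  · obtain ⟨M, hM⟩ := L.exists_bound fun i : Fin ((b :: l).length + 1) =>
      par[K]^((b :: l).length - i.1) ((a :: b :: l).getD i.1 0)
    refine (BB_apply L _ hM).trans (sum_eq_zero fun m _ => ?_)
    rw [opUnit_apply (by simp), map_zero]
    rfl

lemma opUnit_preLie {a : Conv K} {q : ℕ} (ha : IsConvDegree K q a) : preLie K (opUnit K) a = a := by
  refine conv_ext fun L N b k _ => ?_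
  rw [L.ev_preLie _ ha, ins_eq_sum]
  simp only [L.ev_opUnit]
  obtain ⟨l, hl, hN⟩ : ∃ l : List L.A, (List.range (N + 1)).map b = l ∧ l.length = N + 1 := ⟨_, rfl, by simp⟩
  rw [hl, hN]
  have h0 : ∀ l : List L.A, l.length ≠ 1 → unitFn l = 0 := by
    rintro (_ | ⟨a, _ | ⟨b, l⟩⟩) h
    · rfl
    · exact absurd rfl h
    · rfl
  rw [sum_eq_single_of_mem 0 (by simp), sum_eq_single_of_mem N (by simp)]
  · rw [List.take_zero, map_nil, List.nil_append, List.drop_zero, List.take_of_length_le hN.le,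
      List.drop_of_length_le (by omega)]
    rfl
  · intro s hs hs'
    rw [mem_range] at hs
    refine h0 _ ?_
    simp only [List.length_append, length_cons, length_drop, length_map, List.length_take]
    omega
  · intro r hr hr'
    rw [mem_range] at hr
    refine sum_eq_zero fun s hs => h0 _ ?_
    simp only [List.length_append, length_cons, length_drop, length_map, List.length_take]
    omega

/-- Exponentials become compositions. -/
lemma BasedLie.ev_expOp {x z : Conv K} {q : ℤ} (hx : IsPronilpotent K x) (hz : IsConvDegree K q z)
    (l : List L.A) : L.ev l (expOp (mulR K x) z) =
      cmp (fun l => L.ev l z) (fun l => L.ev l (expOp (mulR K x) (opUnit K))) l := by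
  have hxs : IsShift (K := K) (fun D => bihom K (xle D)) (-1) fun l => L.ev l x :=
    L.isShift_tl_BB hx.1 fun n m => by
      by_cases h : n = 0 ∧ m = 0
      · obtain ⟨rfl, rfl⟩ := h
        exact Or.inl hx.2
      · exact Or.inr (by omega)
  have hexp : ∀ {q : ℤ} {z : Conv K}, IsConvDegree K q z → ∀ l : List L.A,
      L.ev l (expOp (mulR K x) z) = expIns K (fun l => L.ev l x) (fun l => L.ev l z) l := by
    intro q z hz l
    have hk : ∀ (k : ℕ) (l : List L.A), L.ev l ((mulR K x ^ k) z) =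
        insPow (fun l => L.ev l x) k (fun l => L.ev l z) l := fun k => by
      induction k with
      | zero => exact fun _ => rfl
      | succ k ih =>
        intro l
        rw [pow_succ', Module.End.mul_apply, mulR_apply, L.ev_preLie_zero _ hx.1, funext ih, insPow_succ]
    obtain ⟨T, h1, h2⟩ := ((L.eventually_ev l).and (L.isFiltration.eventually_expIns hxs
      (L.isShift_tl_BB hz (w := q) fun n m => Or.inr (by omega)) l)).exists
    have h3 := h1 _ ((raises_mulR hx).hasExp z T)
    rw [map_sub, sub_eq_zero, map_sum] at h3
    rw [h3]
    refine Eq.trans (sum_congr rfl fun k _ => ?_) h2.symm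
    rw [map_smul, hk]
    rfl
  refine ((hexp hz l).trans (L.isFiltration.expIns_eq_cmp hxs
    (L.isShift_tl_BB hz (w := q) fun n m => Or.inr (by omega)) (L.isMultilin_tl _) l)).trans ?_
  congr 1
  funext v
  rw [hexp isConvDegree_opUnit, funext L.ev_opUnit]

end Values

section Logarithm

variable [CharZero K]

variable (K) in
/-- The group-like element `exp(R_x) u`. -/
def grp (x : Conv K) : Conv K := expOp (mulR K x) (opUnit K)

lemma grp_mem_degree {x : Conv K} (hx : IsPronilpotent K x) : IsConvDegree K 0 (grp K x) :=
  expOp_mem_degree (fun _ hz => hz.mulR hx.1) isConvDegree_opUnit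

lemma grp_sub_grp {x y : Conv K} (hx : IsPronilpotent K x) (hy : IsPronilpotent K y) {d : ℕ}
    (h : x - y ∈ ordGe K (d + 1)) : grp K x - grp K y - (x - y) ∈ ordGe K (d + 2) := by
  set D : ℕ → Conv K := fun k => (mulR K x ^ k) (opUnit K) - (mulR K y ^ k) (opUnit K) with hD
  have hs k : D (k + 1) = mulR K x (D k) + preLie K ((mulR K y ^ k) (opUnit K)) (x - y) := by
    rw [hD]
    simp only [pow_succ', Module.End.mul_apply, map_sub, mulR_apply]
    rw [← preLieL_apply _ (x - y), map_sub, preLieL_apply, preLieL_apply]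
    abel
  have h0 : D 0 = 0 := sub_self _
  have h1 : D 1 = x - y := by
    rw [hs, h0, map_zero, zero_add, pow_zero, Module.End.one_apply]
    exact opUnit_preLie (q := 0) fun n m => Submodule.sub_mem _ (hx.1 n m) (hy.1 n m)
  have h2 k : D (k + 1) ∈ ordGe K (d + 1) ∧ D (k + 2) ∈ ordGe K (d + 2) := by
    induction k with
    | zero =>
      refine ⟨h1 ▸ h, ?_⟩
      rw [hs, h1]
      refine add_mem (raises_mulR hx _ _ h) (ordGe_anti (by omega)
        (preLie_mem_ordGe ((raises_mulR hy).pow 1 (mem_ordGe_zero _)) h))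
    | succ k ih =>
      refine ⟨ordGe_anti (by omega) ih.2, ?_⟩
      rw [hs]
      exact add_mem (ordGe_anti (by omega) (raises_mulR hx _ _ ih.2)) (ordGe_anti (by omega)
        (preLie_mem_ordGe ((raises_mulR hy).pow (k + 2) (mem_ordGe_zero _)) h))
  have h3 : ∑ k ∈ range (d + 2), (k.factorial : K)⁻¹ • D k - (x - y) ∈ ordGe K (d + 2) := by
    rw [sum_range_succ', sum_range_succ', h0, h1]
    simp only [smul_zero, add_zero, zero_add, Nat.factorial_one, Nat.cast_one, inv_one, one_smul,
      add_sub_cancel_right]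
    exact Submodule.sum_mem _ fun k _ => smul_mem _ _ (h2 k).2
  have h4 := add_mem (sub_mem ((raises_mulR hx).hasExp (opUnit K) (d + 2))
    ((raises_mulR hy).hasExp (opUnit K) (d + 2))) h3
  simp only [hD, smul_sub, sum_sub_distrib] at h4
  convert h4 using 1
  rw [grp, grp]
  abel

/-- Successive approximations of the logarithm. -/
def logSeq (φ : Conv K) : ℕ → Conv K
  | 0 => 0
  | d + 1 => logSeq φ d + (φ - grp K (logSeq φ d))

/-- Every element of degree zero with leading term `u` is an exponential. -/
lemma exists_grp_eq {φ : Conv K} (hφ : IsConvDegree K 0 φ) (h0 : φ 0 0 = opUnit K 0 0) :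
    ∃ x, IsPronilpotent K x ∧ grp K x = φ := by
  have h d : IsPronilpotent K (logSeq φ d) ∧ φ - grp K (logSeq φ d) ∈ ordGe K (d + 1) := by
    induction d with
    | zero =>
      have hp : IsPronilpotent K (0 : Conv K) := ⟨fun n m => zero_mem _, rfl⟩
      refine ⟨hp, ?_⟩
      have h1 := (raises_mulR hp).hasExp (opUnit K) 1
      rw [Finset.sum_range_one, Nat.factorial_zero, Nat.cast_one, inv_one, one_smul] at h1
      have h2 : φ - opUnit K ∈ ordGe K 1 := fun n m hnm => by
        obtain ⟨rfl, rfl⟩ : n = 0 ∧ m = 0 := by omega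
        rw [Pi.sub_apply, Pi.sub_apply, h0, sub_self]
      have h3 : grp K 0 - opUnit K ∈ ordGe K 1 := h1
      have := sub_mem h2 h3
      rwa [sub_sub_sub_cancel_right] at this
    | succ d ih =>
      have hp : IsPronilpotent K (logSeq φ (d + 1)) :=
        ⟨fun n m => add_mem (ih.1.1 n m) (sub_mem (hφ n m) (grp_mem_degree ih.1 n m)), by
          rw [logSeq, Pi.add_apply, Pi.add_apply, ih.1.2, ih.2 0 0 (by omega), add_zero]⟩
      refine ⟨hp, ?_⟩
      have hd : logSeq φ (d + 1) - logSeq φ d = φ - grp K (logSeq φ d) := add_sub_cancel_left _ _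
      have := neg_mem (grp_sub_grp hp ih.1 (d := d) (hd ▸ ih.2))
      rw [hd] at this
      convert this using 1
      abel
  have h1 n m d : n + m ≤ d → logSeq φ d n m = logSeq φ (n + m) n m := by
    intro hd
    induction d, hd using Nat.le_induction with
    | base => rfl
    | succ d hd ih => rw [logSeq, Pi.add_apply, Pi.add_apply, (h d).2 n m (by omega), add_zero, ih]
  have hp : IsPronilpotent K fun n m => logSeq φ (n + m) n m :=
    ⟨fun n m => (h (n + m)).1.1 n m, (h 0).1.2⟩
  refine ⟨_, hp, (sub_eq_zero.1 (eq_zero_of_mem_ordGe fun d => ordGe_anti d.le_succ ?_)).symm⟩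
  have h2 : (fun n m => logSeq φ (n + m) n m) - logSeq φ d ∈ ordGe K (d + 1) := fun n m hnm =>
    sub_eq_zero.2 (h1 n m d (by omega)).symm
  have := sub_mem (h d).2 (add_mem (ordGe_anti (Nat.le_succ _) (grp_sub_grp hp (h d).1 h2)) h2)
  rwa [sub_add_cancel, sub_sub_sub_cancel_right] at this

end Logarithm

section GaugeGroup

/-- The action of scalars. -/
def scal (c : K) : Module.End K (Conv K) where
  toFun z n m := c ^ n • z n m
  map_add' _ _ := funext fun _ => funext fun _ => smul_add _ _ _
  map_smul' _ _ := funext fun _ => funext fun _ => smul_comm (_ : K) (_ : K) _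

lemma scal_apply (c : K) (z : Conv K) (n m : ℕ) : scal c z n m = c ^ n • z n m := rfl

lemma scal_scal (c d : K) (z : Conv K) : scal c (scal d z) = scal (c * d) z := by
  funext n m
  rw [scal_apply, scal_apply, scal_apply, smul_smul, mul_pow]

lemma scal_one (z : Conv K) : scal 1 z = z := by
  funext n m
  rw [scal_apply, one_pow, one_smul]

lemma scal_mem_degree (c : K) {q : ℤ} {z : Conv K} (hz : IsConvDegree K q z) :
    IsConvDegree K q (scal c z) := fun n m => smul_mem _ _ (hz n m)

lemma IsPronilpotent.scal (c : K) {x : Conv K} (hx : IsPronilpotent K x) : IsPronilpotent K (scal c x) :=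
  ⟨scal_mem_degree c hx.1, by rw [scal_apply, hx.2, smul_zero]⟩

lemma IsPronilpotent.neg {x : Conv K} (hx : IsPronilpotent K x) : IsPronilpotent K (-x) :=
  ⟨fun n m => neg_mem (hx.1 n m), by rw [Pi.neg_apply, Pi.neg_apply, hx.2, neg_zero]⟩

lemma scal_preLie (c : K) (x y : Conv K) : scal c (preLie K x y) = preLie K (scal c x) (scal c y) := by
  funext N M
  rw [scal_apply]
  simp only [preLie, smul_sum, ← compQ_apply, scal_apply, map_smul, LinearMap.smul_apply]
  refine sum_congr rfl fun n _ => sum_congr rfl fun m _ => sum_congr rfl fun j _ => ?_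
  rw [smul_comm, smul_smul (c ^ _) (c ^ _), ← pow_add, Nat.sub_add_cancel (le_of_lt_succ n.2)]

lemma expOp_scal (c : K) (x a : Conv K) :
    expOp (adL K (scal c x)) (scal c a) = scal c (expOp (adL K x) a) := by
  have h k : (adL K (scal c x) ^ k) (scal c a) = scal c ((adL K x ^ k) a) := by
    induction k with
    | zero => rfl
    | succ k ih =>
      simp only [pow_succ', Module.End.mul_apply, ih, adL_apply, ad, map_sub, scal_preLie]
  funext n m
  simp only [expOp, expSum, h, scal_apply, smul_sum, smul_comm (c ^ n)]

variable [CharZero K]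

lemma expOp_expOp_mulR {x y z : Conv K} (hx : IsPronilpotent K x) (hy : IsPronilpotent K y)
    (hz : IsPronilpotent K z) (h : grp K z = expOp (mulR K x) (grp K y)) {w : Conv K} {q : ℤ}
    (hw : IsConvDegree K q w) : expOp (mulR K x) (expOp (mulR K y) w) = expOp (mulR K z) w := by
  refine conv_ext fun L N a k _ => ?_
  rw [L.ev_expOp hx (expOp_mem_degree (fun _ hz => hz.mulR hy.1) hw), funext (L.ev_expOp hy hw),
    L.ev_expOp hz hw]
  refine (cmp_assoc (L.isMultilin_tl _) _ _ _).trans ?_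
  congr 1
  funext v
  exact ((congrArg (L.ev v) h).trans (L.ev_expOp hx (grp_mem_degree hy) v)).symm

lemma exists_expOp_adL {x y : Conv K} (hx : IsPronilpotent K x) (hy : IsPronilpotent K y) :
    ∃ z, IsPronilpotent K z ∧ ∀ {a : Conv K} {q : ℕ}, IsConvDegree K q a →
      expOp (adL K y) (expOp (adL K x) a) = expOp (adL K z) a := by
  obtain ⟨z, hz, h⟩ := exists_grp_eq (φ := expOp (mulR K x) (grp K y))
    (expOp_mem_degree (fun _ hz => hz.mulR hx.1) (grp_mem_degree hy)) (by simp [expOp, expSum, grp])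
  refine ⟨z, hz, fun {a q} ha => (raises_mulR hz).expOp_injective ?_⟩
  have hxa : IsConvDegree K q (expOp (adL K x) a) := expOp_mem_degree (fun _ hz => hz.adL hx.1) ha
  have hya := expOp_mem_degree (fun _ hz => hz.adL hy.1) hxa
  rw [← expOp_expOp_mulR hx hy hz h hya, ← opUnit_preLie hya, ← preLie_expOp hy hxa, ← preLie_expOp hx ha]
  change preLie K (expOp (mulR K x) (grp K y)) a = _
  rw [← h, grp, preLie_expOp hz ha, opUnit_preLie (expOp_mem_degree (fun _ h => h.adL hz.1) ha)]

/-- Gauge equivalence for a group of scalars. -/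
def GaugeBy (S : Subgroup Kˣ) (a b : MC K) : Prop :=
  ∃ c ∈ S, ∃ x, IsPronilpotent K x ∧ b.1 = scal ((c⁻¹ : Kˣ) : K) (expOp (adL K x) a.1)

lemma equivalence_gaugeBy (S : Subgroup Kˣ) : Equivalence (GaugeBy S) where
  refl a := by
    refine ⟨1, one_mem S, 0, ⟨fun n m => zero_mem _, rfl⟩, ?_⟩
    have h : adL K (0 : Conv K) = 0 := LinearMap.ext fun z => by
      change preLieL 0 z - preLieL z 0 = 0
      rw [map_zero, map_zero, LinearMap.zero_apply, sub_zero]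
    rw [inv_one, Units.val_one, scal_one, h]
    exact (hasExp_zero a.1).unique (Raises.hasExp (fun d z _ => zero_mem _) a.1)
  symm := by
    rintro a b ⟨c, hc, x, hx, h⟩
    refine ⟨c⁻¹, inv_mem hc, -scal ((c⁻¹ : Kˣ) : K) x, (hx.scal _).neg, ?_⟩
    have hn (x : Conv K) : adL K (-x) = -adL K x := LinearMap.ext fun z => by
      change preLieL (-x) z - preLieL z (-x) = -(preLieL x z - preLieL z x)
      rw [map_neg, map_neg, LinearMap.neg_apply]
      abel
    rw [h, ← map_neg, expOp_scal, hn, (raises_adL hx).expOp_neg_expOp, scal_scal, inv_inv, Units.mul_inv,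
      scal_one]
  trans := by
    rintro a b d ⟨c, hc, x, hx, h⟩ ⟨c', hc', y, hy, h'⟩
    obtain ⟨z, hz, hxy⟩ := exists_expOp_adL hx (hy.scal (c : K))
    refine ⟨c * c', mul_mem hc hc', z, hz, ?_⟩
    have h1 := expOp_scal ((c⁻¹ : Kˣ) : K) (scal (c : K) y) (expOp (adL K x) a.1)
    rw [scal_scal, Units.inv_mul, scal_one] at h1
    rw [h', h, ← hxy (q := 1) a.2.1, mul_inv, mul_comm, Units.val_mul, ← scal_scal, ← h1]

lemma gauge_iff (a b : MC K) : Gauge K a b ↔ GaugeBy ⊤ a b := by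
  refine exists_congr fun c => ?_
  simp only [Subgroup.mem_top, true_and, expAd_eq, funext_iff, scal_apply]

lemma unipotentGauge_iff (a b : MC K) : UnipotentGauge K a b ↔ GaugeBy ⊥ a b := by
  simp [UnipotentGauge, GaugeBy, Subgroup.mem_bot, expAd_eq, scal_one]

end GaugeGroup

section

open scoped Pointwise

section Isomorphisms

variable [CharZero K]

lemma cmp_smul_right {A : Type u} [AddCommMonoid A] [Module K A] {h : List A → A} (hh : IsMultilin K h)
    (f : List A → A) (c : K) (l : List A) :
    cmp h (fun v => c • f v) l = cmp (fun v => c ^ v.length • h v) f l := by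
  induction hn : l.length using Nat.strong_induction_on generalizing l h with
  | _ n ih =>
    by_cases hl : l = []
    · subst hl; rw [cmp_nil, cmp_nil, List.length_nil, pow_zero, one_smul]
    · rw [cmp, if_neg hl, cmp, if_neg hl]
      refine sum_congr rfl fun i _ => ?_
      have h1 : (fun v => h (c • f (l.take (i + 1)) :: v)) = fun v => c • h (f (l.take (i + 1)) :: v) :=
        funext fun v => hh.smul [] c _ v
      have h2 : IsMultilin K fun v => c • h (f (l.take (i + 1)) :: v) :=
        ⟨fun u a b v => by rw [(hh.tail _).add, smul_add], fun u r a v => by rw [(hh.tail _).smul, smul_comm]⟩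
      rw [h1, ih _ (by have := i.2; rw [length_drop]; omega) h2 _ rfl]
      congr 1
      funext v
      rw [smul_smul, length_cons, pow_succ]

lemma BasedLie.ev_singleton (L : BasedLie K) (a : L.A) (x : Conv K) : L.ev [a] x = BB x L 0 fun _ => a := by
  rw [L.ev_apply, L.tl_eq (n := 0) _ rfl]
  congr 1
  funext i
  obtain rfl : i = 0 := Fin.fin_one_eq_zero i
  rfl

lemma BasedLie.ev_scal (L : BasedLie K) (c : K) (b : Conv K) (l : List L.A) :
    L.ev l (c • scal c b) = c ^ l.length • L.ev l b := by
  rcases l with _ | ⟨a, l⟩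
  · exact (smul_zero _).symm
  · rw [map_smul, L.ev_apply, BasedLie.tl, BB_eq_smul L (fun m => scal_apply c b l.length m),
      MultilinearMap.smul_apply, smul_smul, length_cons, pow_succ']
    rfl

lemma morphism_iff {a φ : Conv K} (ha : IsConvDegree K 1 a) (hφ : IsConvDegree K 0 φ) (b : Conv K)
    (L : BasedLie K) : IsAInfinityMorphism L.gr (BB a L) (BB b L) (BB φ L) ↔
      ∀ (N : ℕ) (s : ℕ → L.A) (k : ℕ → ℤ), (∀ i, s i ∈ L.gr (k i)) →
        L.ev ((List.range (N + 1)).map s) (preLie K φ a) =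
          cmp (fun l => L.ev l b) (fun l => L.ev l φ) ((List.range (N + 1)).map s) := by
  have hd n : HasDegree L.gr (BB φ L n) (1 - ((n : ℤ) + 1)) := by
    have := L.hasDegree_BB hφ n
    rwa [show (0 : ℤ) - n = 1 - (n + 1) by ring] at this
  refine ⟨fun h N s k hs => ?_, fun h => ⟨hd, fun N s k hs => ?_⟩⟩
  · refine Eq.trans ?_ (L.cmp_tl hd N s k hs).symm
    rw [L.ev_apply, L.tl_map_range _ N s k hs, L.evalSeq_BB_preLie φ ha N s k hs, ← sum_partialComp,
      h.relation N s k hs]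
  · have h1 := (h N s k hs).trans (L.cmp_tl hd N s k hs)
    rw [L.ev_apply, L.tl_map_range _ N s k hs, L.evalSeq_BB_preLie φ ha N s k hs, ← sum_partialComp] at h1
    exact smul_right_injective L.A (sgn_ne_zero K _) h1

lemma morphism_grp_iff {a b x : Conv K} (ha : IsConvDegree K 1 a) (hb : IsConvDegree K 1 b)
    (hx : IsPronilpotent K x) (c : K) :
    (∀ L : BasedLie K, IsAInfinityMorphism L.gr (BB a L) (BB b L) (BB (c • grp K x) L)) ↔
      c • scal c b = c • expOp (adL K x) a := by
  have hφ : IsConvDegree K 0 (c • grp K x) := fun n m => smul_mem _ c (grp_mem_degree hx n m)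
  have hsb : IsConvDegree K 1 (c • scal c b) := fun n m => smul_mem _ c (scal_mem_degree c hb n m)
  have h1 : preLie K (c • grp K x) a = expOp (mulR K x) (c • expOp (adL K x) a) := by
    rw [← preLieL_apply, map_smul, LinearMap.smul_apply, preLieL_apply, grp, preLie_expOp (q := 1) hx ha,
      opUnit_preLie (q := 1) (expOp_mem_degree (fun _ hz => hz.adL hx.1) ha), expOp_smul]
  have h2 (L : BasedLie K) (l : List L.A) : cmp (fun l => L.ev l b) (fun l => L.ev l (c • grp K x)) l =
      L.ev l (expOp (mulR K x) (c • scal c b)) := by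
    rw [L.ev_expOp hx hsb, funext (L.ev_scal c b)]
    simp only [map_smul]
    exact cmp_smul_right (L.isMultilin_tl _) _ c l
  refine ⟨fun h => (raises_mulR hx).expOp_injective (conv_ext fun L N s k hs => ?_), fun h L => ?_⟩
  · rw [← h2, ← h1]
    exact ((morphism_iff ha hφ b L).1 (h L) N s k hs).symm
  · refine (morphism_iff ha hφ b L).2 fun N s k hs => ?_
    rw [h1, h2, h]

lemma BasedLie.grp_one (L : BasedLie K) {φ : Conv K} (hφ : IsConvDegree K 0 φ) {c : K}
    (h : φ 0 0 = c • opUnit K 0 0) : BB φ L 0 (fun _ => 1) = c • (1 : L.A) := by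
  obtain ⟨M, hM⟩ := L.exists_bound (n := 0) fun _ => (1 : L.A)
  have h1 := L.ev_opUnit [1]
  rw [L.ev_singleton, BB_apply L _ (M := M + 1) fun m hm => hM m (by omega), sum_eq_single_of_mem 0
    (by simp) fun m _ hm => by rw [opUnit_apply (by simp [hm]), map_zero]; rfl] at h1
  rw [BB_apply L _ (M := M + 1) fun m hm => hM m (by omega), sum_eq_single_of_mem 0 (by simp), h,
    map_smul, MultilinearMap.smul_apply, h1]
  · rfl
  · intro m _ hm
    have := L.BQ_mem_bihom (hφ 0 m) (fun _ => 1) (fun _ => {0}) fun _ => one_mem_bihom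
    rw [Fin.sum_univ_one] at this
    rw [bihom_eq_bot ?_, mem_bot] at this
    · exact this
    · rintro _ ⟨_, rfl, _, rfl, rfl⟩
      left
      simp only [fst_add, Prod.fst_zero]
      omega

lemma exists_smul_opUnit {φ : Conv K} (hφ : IsConvDegree K 0 φ) : ∃ c : K, φ 0 0 = c • opUnit K 0 0 := by
  refine (Submodule.mem_span_singleton.1 (span_mono ?_ (hφ 0 0))).imp fun _ => Eq.symm
  rintro _ ⟨l, -, -, rfl⟩
  obtain rfl : l = [] := List.eq_nil_iff_forall_not_mem.2 fun e _ => e.2 (by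
    rcases e with ⟨⟨i | i, j | j⟩, h⟩
    · exact congrArg inl (Subsingleton.elim (α := Fin 1) i j)
    all_goals first | exact i.elim0 | exact j.elim0)
  rfl

lemma BasedLie.leftInverse_grp (L : BasedLie K) {x : Conv K} (hx : IsPronilpotent K x) :
    Function.LeftInverse (fun a : L.A => BB (grp K (-x)) L 0 fun _ => a)
      (fun a : L.A => BB (grp K x) L 0 fun _ => a) := by
  intro a
  have h : expOp (mulR K x) (grp K (-x)) = opUnit K := by
    have h1 : mulR K (-x) = -mulR K x := LinearMap.ext fun z => map_neg (preLieL z) x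
    have h2 := (raises_mulR hx).neg.expOp_neg_expOp (opUnit K)
    rw [← h1, show -mulR K (-x) = mulR K x by rw [h1]; exact LinearMap.ext fun z => neg_neg _] at h2
    exact h2
  have h1 := L.ev_expOp hx (grp_mem_degree hx.neg) [a]
  rw [h, L.ev_opUnit, cmp_of_ne_nil _ _ (List.cons_ne_nil _ _), star, star, cmp_nil] at h1
  dsimp only
  rw [← L.ev_singleton, ← L.ev_singleton]
  exact (h1.trans (add_zero _)).symm

lemma BasedLie.bijective_grp (L : BasedLie K) {x : Conv K} (hx : IsPronilpotent K x) :
    Function.Bijective fun a : L.A => BB (grp K x) L 0 fun _ => a := by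
  refine Function.bijective_iff_has_inverse.2 ⟨_, L.leftInverse_grp hx, ?_⟩
  have := L.leftInverse_grp hx.neg
  rwa [neg_neg] at this

lemma IsConvDegree.isUniversal {q : ℤ} {x : Conv K} (hx : IsConvDegree K q x) : IsUniversal (BB x) :=
  ⟨x, hx.isConvElement, realizes_BB x⟩

/-- The universal `A∞`-structure of a Maurer–Cartan element. -/
def MC.toUAInfinity (a : MC K) : UAInfinity K :=
  ⟨BB a.1, a.2.1.isUniversal, fun L => ⟨fun n => by
    have := L.hasDegree_BB a.2.1 n
    rwa [show (1 : ℤ) - n = 2 - (n + 1) by ring] at this, fun N s k hs => by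
    rw [sum_partialComp, ← L.evalSeq_BB_preLie a.1 a.2.1 N s k hs, a.2.2,
      BB_eq_smul L (x := 0) (y := 0) (r := 0) fun _ => (smul_zero _).symm, zero_smul]
    rfl⟩⟩

lemma MC.toUAInfinity_bijective : Function.Bijective (MC.toUAInfinity (K := K)) := by
  refine ⟨fun a b h => Subtype.ext (conv_ext fun L N s k _ => ?_), fun F => ?_⟩
  · have := congrArg val h
    rw [L.ev_apply, L.ev_apply, show BB a.1 = BB b.1 from this]
  · obtain ⟨F, ⟨x, hx, hF⟩, h⟩ := F
    obtain rfl := hF.eq_BB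
    have hd : IsConvDegree K 1 x := isConvDegree_of_hasDegree hx fun L n => by
      have := (h L).degree n
      rwa [show (2 : ℤ) - (n + 1) = 1 - n by ring] at this
    refine ⟨⟨x, hd, eq_zero_of_evalSeq fun L N s k hs => ?_⟩, rfl⟩
    rw [L.evalSeq_BB_preLie x hd N s k hs, ← sum_partialComp, (h L).relation N s k hs]

lemma GaugeBy.exists_isUIso {S : Subgroup Kˣ} {a b : MC K} (h : GaugeBy S a b) :
    ∃ f, IsUIso a.toUAInfinity b.toUAInfinity f ∧
      ∃ c ∈ S, ∀ L : BasedLie K, f L 0 (fun _ => 1) = ((c : Kˣ) : K) • (1 : L.A) := by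
  obtain ⟨c, hc, x, hx, h⟩ := h
  have hφ : IsConvDegree K 0 ((c : K) • grp K x) := fun n m => smul_mem _ _ (grp_mem_degree hx n m)
  have h0 : ((c : K) • grp K x) 0 0 = (c : K) • opUnit K 0 0 := by simp [grp, expOp, expSum]
  refine ⟨BB ((c : K) • grp K x), ⟨hφ.isUniversal, (morphism_grp_iff a.2.1 b.2.1 hx c).2 ?_, fun L => ?_⟩,
    c, hc, fun L => L.grp_one hφ h0⟩
  · rw [h, scal_scal, Units.mul_inv, scal_one]
  · simp only [BB_eq_smul L (x := (c : K) • grp K x) (y := grp K x) (r := (c : K)) fun _ => rfl]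
    exact (MulAction.bijective c).comp (L.bijective_grp hx)

lemma IsUIso.exists_gauge {a b : MC K} {f : UFam K} (h : IsUIso a.toUAInfinity b.toUAInfinity f) :
    ∃ c : Kˣ, (∀ L : BasedLie K, f L 0 (fun _ => 1) = (c : K) • (1 : L.A)) ∧
      ∃ x, IsPronilpotent K x ∧ b.1 = scal ((c⁻¹ : Kˣ) : K) (expOp (adL K x) a.1) := by
  obtain ⟨φ, hφ, hf⟩ := h.universal
  obtain rfl := hf.eq_BB
  have hd : IsConvDegree K 0 φ := isConvDegree_of_hasDegree hφ fun L n => by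
    have := (h.morphism L).degree n
    rwa [show (1 : ℤ) - (n + 1) = 0 - n by ring] at this
  obtain ⟨c, hc⟩ := exists_smul_opUnit hd
  have hc0 : c ≠ 0 := by
    rintro rfl
    have h1 := (unitLie K Empty Empty).grp_one hd hc
    rw [zero_smul, ← (BB φ (unitLie K Empty Empty) 0).map_coord_zero (m := fun _ => 0) 0 rfl] at h1
    exact one_ne_zero ((h.bijective (unitLie K Empty Empty)).1 h1)
  obtain ⟨x, hx, hxφ⟩ := exists_grp_eq (φ := c⁻¹ • φ) (fun n m => smul_mem _ _ (hd n m))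
    (by rw [Pi.smul_apply, Pi.smul_apply, hc, inv_smul_smul₀ hc0])
  refine ⟨Units.mk0 c hc0, fun L => L.grp_one hd hc, x, hx, ?_⟩
  obtain rfl : φ = c • grp K x := by rw [hxφ, smul_inv_smul₀ hc0]
  have h1 := smul_right_injective (Conv K) hc0 ((morphism_grp_iff a.2.1 b.2.1 hx c).1 h.morphism)
  rw [← h1, scal_scal, Units.val_inv_eq_inv_val, Units.val_mk0, inv_mul_cancel₀ hc0, scal_one]

lemma gauge_iff_uIsomorphic (a b : MC K) : Gauge K a b ↔ UIsomorphic a.toUAInfinity b.toUAInfinity := by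
  rw [gauge_iff]
  refine ⟨fun h => h.exists_isUIso.imp fun _ => And.left, fun ⟨f, hf⟩ => ?_⟩
  obtain ⟨c, -, x, hx⟩ := hf.exists_gauge
  exact ⟨c, trivial, x, hx⟩

lemma unipotentGauge_iff_uIsomorphic (a b : MC K) :
    UnipotentGauge K a b ↔ UnipotentUIsomorphic a.toUAInfinity b.toUAInfinity := by
  rw [unipotentGauge_iff]
  constructor
  · intro h
    obtain ⟨f, hf, c, hc, h1⟩ := h.exists_isUIso
    refine ⟨f, hf, fun L => (h1 L).trans ?_⟩
    rw [Subgroup.mem_bot.1 hc, Units.val_one, one_smul]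
  · rintro ⟨f, hf, h1⟩
    obtain ⟨c, hc, x, hx⟩ := hf.exists_gauge
    refine ⟨c, Subgroup.mem_bot.2 (Units.ext ?_), x, hx⟩
    have h2 := (hc (unitLie K Empty Empty)).symm.trans (h1 (unitLie K Empty Empty))
    exact smul_left_injective K (one_ne_zero (α := (unitLie K Empty Empty).A)) (h2.trans (one_smul K _).symm)

lemma equivalence_of_surjective {X Y : Type*} {r : X → X → Prop} {s : Y → Y → Prop} (hr : Equivalence r)
    {F : X → Y} (hF : Function.Surjective F) (h : ∀ a b, r a b ↔ s (F a) (F b)) : Equivalence s where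
  refl y := by obtain ⟨a, rfl⟩ := hF y; exact (h a a).1 (hr.refl a)
  symm {y z} hyz := by
    obtain ⟨a, rfl⟩ := hF y
    obtain ⟨b, rfl⟩ := hF z
    exact (h b a).1 (hr.symm ((h a b).2 hyz))
  trans {x y z} hxy hyz := by
    obtain ⟨a, rfl⟩ := hF x
    obtain ⟨b, rfl⟩ := hF y
    obtain ⟨c, rfl⟩ := hF z
    exact (h a c).1 (hr.trans ((h a b).2 hxy) ((h b c).2 hyz))

end Isomorphisms

end

end DGraphs

end

theorem mainTheorem6 (K : Type u) [Field K] [CharZero K] :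
    -- `B` vanishes on the relations, so it is defined on classes of graphs
    (∀ (L : DGraphs.BasedLie K) (n m : ℕ), ∀ a ∈ DGraphs.relations K n m, L.B a = 0) ∧
    -- admissible graphs are closed under the pre-Lie product
    (∀ x y : DGraphs.Conv K, DGraphs.IsConvElement K x → DGraphs.IsConvElement K y →
      DGraphs.IsConvElement K (DGraphs.preLie K x y)) ∧
    -- `BB` is composition with `B`
    ∃ BB : DGraphs.Conv K → DGraphs.UFam K,
      (∀ x : DGraphs.Conv K, DGraphs.IsConvElement K x → DGraphs.Realizes x (BB x)) ∧
      -- which respects the pre-Lie products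
      (∀ (x y : DGraphs.Conv K) (q : ℤ), DGraphs.IsConvElement K x → DGraphs.IsConvDegree K q y →
        ∀ (L : DGraphs.BasedLie K) (N : ℕ) (a : ℕ → L.A) (k : ℕ → ℤ), (∀ i, a i ∈ L.gr (k i)) →
          DGraphs.evalSeq (BB (DGraphs.preLie K x y) L N) a =
            DGraphs.preLieEnd q (BB x L) (BB y L) N a k) ∧
      -- maps Maurer–Cartan elements to universal `A∞`-structures
      ∃ Φ : DGraphs.MC K → DGraphs.UAInfinity K,
        (∀ α : DGraphs.MC K, (Φ α).1 = BB α.1) ∧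
        -- and induces the bijection of equivalence classes
        Equivalence (DGraphs.Gauge K) ∧
        Equivalence (DGraphs.UIsomorphic (K := K)) ∧
        (∃ e : Quot (DGraphs.Gauge K) ≃ Quot (DGraphs.UIsomorphic (K := K)),
          ∀ α : DGraphs.MC K, e (Quot.mk _ α) = Quot.mk _ (Φ α)) ∧
        -- also for the pro-unipotent group and isomorphisms with `f₁(1) = 1`
        Equivalence (DGraphs.UnipotentGauge K) ∧
        Equivalence (DGraphs.UnipotentUIsomorphic (K := K)) ∧
        (∃ e : Quot (DGraphs.UnipotentGauge K) ≃ Quot (DGraphs.UnipotentUIsomorphic (K := K)),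
          ∀ α : DGraphs.MC K, e (Quot.mk _ α) = Quot.mk _ (Φ α)) := by
  have h₁ := DGraphs.equivalence_gaugeBy (K := K) ⊤
  have h₂ := DGraphs.equivalence_gaugeBy (K := K) ⊥
  rw [show DGraphs.GaugeBy (K := K) ⊤ = DGraphs.Gauge K from
    funext₂ fun a b => propext (DGraphs.gauge_iff a b).symm] at h₁
  rw [show DGraphs.GaugeBy (K := K) ⊥ = DGraphs.UnipotentGauge K from
    funext₂ fun a b => propext (DGraphs.unipotentGauge_iff a b).symm] at h₂
  have hF := DGraphs.MC.toUAInfinity_bijective (K := K)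
  exact ⟨fun L n m a ha => L.B_eq_zero_of_mem ha, fun x y hx hy => hx.preLie hy, DGraphs.BB,
    fun x _ => DGraphs.realizes_BB x, fun x y q _ hy L N a k ha => L.evalSeq_BB_preLie x hy N a k ha,
    DGraphs.MC.toUAInfinity, fun _ => rfl,
    h₁, DGraphs.equivalence_of_surjective h₁ hF.2 DGraphs.gauge_iff_uIsomorphic,
    ⟨Quot.congr (Equiv.ofBijective _ hF) DGraphs.gauge_iff_uIsomorphic, fun _ => rfl⟩,
    h₂, DGraphs.equivalence_of_surjective h₂ hF.2 DGraphs.unipotentGauge_iff_uIsomorphic,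
    ⟨Quot.congr (Equiv.ofBijective _ hF) DGraphs.unipotentGauge_iff_uIsomorphic, fun _ => rfl⟩⟩
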